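/- Let $D\subset\mathbb R^3$ be a bounded open set with smooth boundary, $T\in(0,\infty]$, $D_T=(0,T)\times D$, $$H=\{u\in L^2(D)^3:\ \operatorname{div}u=0,\ u\cdot n|_{\partial D}=0\},\qquad V=\{u\in H^1_0(D)^3:\ \operatorname{div}u=0\},$$ with $|u|=\|u\|_{L^2}$ on $H$ and $\|u\|=\|\nabla u\|_{L^2}$ on $V$. Let $f\in L^2(0,T;H)$, let $g$ be a locally integrable vector field on $D_T$, and let $u_0$ be an initial velocity. *Linear problem.* For a force $f_1$ and an initial value $z_0$, a solution $(z,Q)$ of the linear Stokes problem with data $(f_1,g,z_0)$ is a pair such that $z$ is weakly continuous in time with values in $H$, $z(0)=z_0$, $z\in L^\infty(0,S;H)\cap L^2(0,S;V)\cap L^\infty(0,S;L^4(D))$ for every finite $S\le T$, $Q\in L^{5/3}_{\rm loc}(D_T)$, and $$\partial_t z+\nabla Q=\Delta z+f_1+\partial_t g$$ in the sense of distributions on $D_T$. *Suitable weak solutions.* Let $(z,Q)$ be such a solution and put $h=f-f_1$. A pair $(u,P)$ is a suitable weak solution relative to $(z,Q)$ if $v=u-z$ and $\pi=P-Q$ satisfy: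 1. $v$ is weakly continuous in time with values in $H$, and $v(0)=u_0-z_0$; 2. $v\in L^\infty(0,T;H)\cap L^2(0,T;V)$ and $\pi\in L^{5/3}_{\rm loc}(D_T)$; 3. $\partial_t v+((v+z)\cdot\nabla)(v+z)+\nabla\pi=\Delta v+h$ in the sense of distributions on $D_T$; 4. for all finite $t\le T$ and almost all $s\in(0,t)$, $$|v(t)|^2+2\int_s^t\|v\|^2dr\le|v(s)|^2+2\int_s^t\!\!\int_D z\cdot((v+z)\cdot\nabla)v\,dx\,dr+2\int_s^t\!\!\int_D h\cdot v\,dx\,dr;$$ 5. for all $\phi\in C_c^\infty(D_T)$ with $\phi\ge0$, $$2\iint|\nabla v|^2\phi\le\iint|v|^2(\partial_t\phi+\Delta\phi)+2\iint\pi\,(v\cdot\nabla\phi)+\iint(|v|^2+2v\cdot z)\,((v+z)\cdot\nabla\phi)+2\iint\phi\,z\cdot((v+z)\cdot\nabla)v+2\iint\phi\,h\cdot v.$$ For $f_1=f$, $z_0=0$ (the linear problem carries the whole force) one has $h=0$ and $v(0)=u_0$. **Theorem.** Being a suitable weak solution does not depend on the solution of the linear problem that is used: (a) If $(z,Q)$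 and $(z_1,Q_1)$ both solve the linear problem with data $(f,g,0)$, then a pair $(u,P)$ is a suitable weak solution relative to $(z,Q)$ if and only if it is one relative to $(z_1,Q_1)$. (b) More generally, the same equivalence holds if $(z,Q)$ solves the linear problem with data $(f_a,g,z_a)$ and $(z_1,Q_1)$ the one with data $(f_b,g,z_b)$, where $f_a,f_b\in L^2(0,T;H)$ and $z_a,z_b$ are arbitrary initial values. (c) If $g\equiv0$ and $(z,Q)$ solves the linear problem with data $(f,0,0)$, then $(u,P)$ is a suitable weak solution relative to $(z,Q)$ if and only if it is a suitable weak solution of the Navier–Stokes equations with force $f$ in the sense of Caffarelli–Kohn–Nirenberg that satisfies the classical energy inequality: $u$ is weakly continuous in time with values in $H$, $u(0)=u_0$, $u\in L^\infty(0,T;H)\cap L^2(0,T;V)$, $P\in L^{5/3}_{\rm loc}(D_T)$, $\partial_tu+(u\cdot\nabla)u+\nabla P=\Delta u+f$ in the sense of distributions, $$2\iint|\nabla u|^2\phi\le\iint|u|^2(\partial_t\phi+\Delta\phi)+\iint(|u|^2+2P)\,(u\cdot\nabla\phi)+2\iint(u\cdot f)\,\phi\qquad(\phi\in C_c^\infty(D_T),\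 \phi\ge0),$$ and $|u(t)|^2+2\int_s^t\|u\|^2dr\le|u(s)|^2+2\int_s^t\int_D f\cdot u\,dx\,dr$ for all finite $t\le T$ and almost all $s\in(0,t)$. The equivalence remains true if the two global energy inequalities (condition 4 and the last inequality) are dropped on both sides. -/

import Mathlib

open MeasureTheory Set Filter Topology
open scoped ContDiff ENNReal NNReal

namespace SuitableNS

/-- Euclidean three-space. -/
abbrev E3 : Type := EuclideanSpace ℝ (Fin 3)

/-! ### Domains and space-time cylinders -/

/-- A bounded open set of `ℝ³` with smooth boundary, given by a smooth defining function. -/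
structure IsSmoothBoundedDomain (D : Set E3) : Prop where
  bounded : Bornology.IsBounded D
  smooth : ∃ ρ : E3 → ℝ, ContDiff ℝ ∞ ρ ∧ D = {x | ρ x < 0} ∧
    ∀ x, ρ x = 0 → fderiv ℝ ρ x ≠ 0

/-- The open time interval `(0,T)`, where `T = ⊤` is allowed. -/
def openTimes (T : EReal) : Set ℝ := {t | 0 < t ∧ (t : EReal) < T}

/-- The time interval `[0,T]`, which is `[0,∞)` for `T = ⊤`. -/
def closedTimes (T : EReal) : Set ℝ := {t | 0 ≤ t ∧ (t : EReal) ≤ T}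

/-- The cylinder `D_T = (0,T) × D`. -/
def spaceTime (D : Set E3) (T : EReal) : Set (ℝ × E3) := openTimes T ×ˢ D

/-! ### Derivatives of test functions -/

/-- The `i`-th standard unit vector. -/
noncomputable def basisVec (i : Fin 3) : E3 := EuclideanSpace.single i 1

section Derivatives

variable {F : Type*} [NormedAddCommGroup F] [NormedSpace ℝ F]

/-- `∂_t φ`. -/
noncomputable def timeDeriv (φ : ℝ × E3 → F) (p : ℝ × E3) : F := fderiv ℝ φ p (1, 0)

/-- `(b · ∇) φ`, the derivative of `φ` in the spatial direction `b`. -/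
noncomputable def spaceDeriv (φ : ℝ × E3 → F) (b : E3) (p : ℝ × E3) : F := fderiv ℝ φ p (0, b)

/-- The spatial Laplacian `Δφ`. -/
noncomputable def laplace (φ : ℝ × E3 → F) (p : ℝ × E3) : F :=
  ∑ i, spaceDeriv (spaceDeriv φ (basisVec i)) (basisVec i) p

/-- `φ ∈ C_c^∞(U)`. -/
structure IsTestFunction {X : Type*} [NormedAddCommGroup X] [NormedSpace ℝ X]
    (U : Set X) (φ : X → F) : Prop where
  smooth : ContDiff ℝ ∞ φ
  compact : HasCompactSupport φ
  support : tsupport φ ⊆ U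

end Derivatives

/-- The spatial divergence of a vector field on space-time. -/
noncomputable def divergence (Ψ : ℝ × E3 → E3) (p : ℝ × E3) : ℝ :=
  ∑ i, (spaceDeriv Ψ (basisVec i) p) i

/-! ### The spaces `H` and `V`

The gradient of a vector field is the family `G` of its partial derivatives, `G i = ∂_i v`. -/

/-- `(b · ∇) v`, where `G i = ∂_i v`. -/
noncomputable def advect (b : E3) (G : Fin 3 → E3) : E3 := ∑ i, b i • G i

/-- `|∇v|²`, where `G i = ∂_i v`. -/
noncomputable def gradSq (G : Fin 3 → E3) : ℝ := ∑ i, ‖G i‖ ^ 2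

/-- `v ∈ H`: a square-integrable field with `div v = 0` in `D` and `v · n = 0` on `∂D`. Both
conditions together are expressed, weakly, by orthogonality to the gradients of all functions that
are smooth up to the boundary. -/
structure MemH (D : Set E3) (v : E3 → E3) : Prop where
  memLp : MemLp v 2 (volume.restrict D)
  weak : ∀ φ : E3 → ℝ, IsTestFunction univ φ → ∫ x in D, fderiv ℝ φ x (v x) = 0

/-- `v ∈ H¹₀(D)³` with (weak) partial derivatives `∂_i v = G i`: the pair `(v, G)` is a limit in
`L²(D)` of pairs `(φ, ∇φ)` with `φ ∈ C_c^∞(D)³`. -/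
structure IsH10 (D : Set E3) (v : E3 → E3) (G : Fin 3 → E3 → E3) : Prop where
  memLp : MemLp v 2 (volume.restrict D)
  memLp_grad : ∀ i, MemLp (G i) 2 (volume.restrict D)
  approx : ∃ φ : ℕ → E3 → E3, (∀ n, IsTestFunction D (φ n)) ∧
    Tendsto (fun n => eLpNorm (φ n - v) 2 (volume.restrict D)) atTop (𝓝 0) ∧
    ∀ i, Tendsto (fun n => eLpNorm (fun x => fderiv ℝ (φ n) x (basisVec i) - G i x) 2
      (volume.restrict D)) atTop (𝓝 0)

/-- `v ∈ V`, with gradient `G`: `v ∈ H¹₀(D)³` and `div v = 0`. -/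
structure MemV (D : Set E3) (v : E3 → E3) (G : Fin 3 → E3 → E3) : Prop where
  h10 : IsH10 D v G
  div_free : ∀ᵐ x ∂(volume.restrict D), ∑ i, (G i x) i = 0

/-! ### Spaces of functions of time and space -/

/-- The function `t ↦ v(t) ∈ H` is weakly continuous on `[0,T]` (on `[0,∞)` if `T = ⊤`). -/
structure WeaklyContinuous (D : Set E3) (T : EReal) (v : ℝ × E3 → E3) : Prop where
  memH : ∀ t ∈ closedTimes T, MemH D (fun x => v (t, x))
  cont : ∀ ψ : E3 → E3, MemH D ψ →
    ContinuousOn (fun t : ℝ => ∫ x in D, inner ℝ (v (t, x)) (ψ x)) (closedTimes T)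

/-- `v ∈ L^∞(0,T;H) ∩ L²(0,T;V)`, with spatial gradient `G`. -/
structure InEnergyClass (D : Set E3) (T : EReal) (v : ℝ × E3 → E3)
    (G : Fin 3 → ℝ × E3 → E3) : Prop where
  meas : AEStronglyMeasurable v (volume.restrict (spaceTime D T))
  bound : ∃ C : ℝ≥0, ∀ᵐ t ∂(volume.restrict (openTimes T)),
    MemH D (fun x => v (t, x)) ∧ eLpNorm (fun x => v (t, x)) 2 (volume.restrict D) ≤ C
  grad_memLp : ∀ i, MemLp (G i) 2 (volume.restrict (spaceTime D T))
  memV : ∀ᵐ t ∂(volume.restrict (openTimes T)),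
    MemV D (fun x => v (t, x)) (fun i x => G i (t, x))

/-- `f ∈ L²(0,T;H)`. -/
structure InL2H (D : Set E3) (T : EReal) (f : ℝ × E3 → E3) : Prop where
  memLp : MemLp f 2 (volume.restrict (spaceTime D T))
  memH : ∀ᵐ t ∂(volume.restrict (openTimes T)), MemH D (fun x => f (t, x))

/-- `z ∈ L^∞(0,T;L⁴(D))`; joint measurability is part of `InEnergyClass`. -/
def InLinftyL4 (D : Set E3) (T : EReal) (z : ℝ × E3 → E3) : Prop :=
  ∃ C : ℝ≥0, ∀ᵐ t ∂(volume.restrict (openTimes T)),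
    eLpNorm (fun x => z (t, x)) 4 (volume.restrict D) ≤ C

/-- `q ∈ L^{5/3}_loc(D_T)`. -/
def InL53loc (D : Set E3) (T : EReal) (q : ℝ × E3 → ℝ) : Prop :=
  ∀ K : Set (ℝ × E3), IsCompact K → K ⊆ spaceTime D T → MemLp q (5 / 3) (volume.restrict K)

/-! ### The linear problem -/

/-- `(z,Q)` solves the linear Stokes problem
`∂_t z + ∇Q = Δz + f + ∂_t g`, `div z = 0` in `D_T`, `z = 0` on `∂D`, `z(0) = z₀`.

The equation holds in the sense of distributions (`∂_t g` is a distributional derivative); `z` is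
weakly continuous in `H` and lies in `L^∞(H) ∩ L²(V) ∩ L^∞(L⁴)` on every bounded time interval
`(0,S)`, `S ≤ T`. -/
structure IsStokesSolution (D : Set E3) (T : EReal) (f g : ℝ × E3 → E3) (z₀ : E3 → E3)
    (z : ℝ × E3 → E3) (Q : ℝ × E3 → ℝ) : Prop where
  weakCont : WeaklyContinuous D T z
  initial : ∀ᵐ x ∂(volume.restrict D), z (0, x) = z₀ x
  energy : ∃ G : Fin 3 → ℝ × E3 → E3, ∀ S : ℝ, 0 < S → (S : EReal) ≤ T →
    InEnergyClass D S z G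
  bound4 : ∀ S : ℝ, 0 < S → (S : EReal) ≤ T → InLinftyL4 D S z
  pressure : InL53loc D T Q
  equation : ∀ Ψ : ℝ × E3 → E3, IsTestFunction (spaceTime D T) Ψ →
    -(∫ p in spaceTime D T, inner ℝ (z p) (timeDeriv Ψ p))
        - ∫ p in spaceTime D T, Q p * divergence Ψ p
      = (∫ p in spaceTime D T, inner ℝ (z p) (laplace Ψ p))
        + (∫ p in spaceTime D T, inner ℝ (f p) (Ψ p))
        - ∫ p in spaceTime D T, inner ℝ (g p) (timeDeriv Ψ p)

/-! ### Suitable weak solutions relative to a solution of the linear problem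

Throughout, `h` is the part of the smooth force that is not already in the linear problem, so `h = 0`
if the linear problem is driven by the full force, and `v₀` is the initial value of `v`. -/

/-- `(v,π)` is a weak solution of
`∂_t v + ((v+z)·∇)(v+z) + ∇π = Δv + h`, `div v = 0`, `v = 0` on `∂D`, `v(0) = v₀`,
with `v` weakly continuous, `v ∈ L^∞(0,T;H) ∩ L²(0,T;V)` with gradient `G`, `π ∈ L^{5/3}_loc(D_T)`.
-/
structure IsModifiedWeakSolution (D : Set E3) (T : EReal) (h : ℝ × E3 → E3) (v₀ : E3 → E3)
    (z v : ℝ × E3 → E3) (G : Fin 3 → ℝ × E3 → E3) (π : ℝ × E3 → ℝ) : Prop where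
  weakCont : WeaklyContinuous D T v
  initial : ∀ᵐ x ∂(volume.restrict D), v (0, x) = v₀ x
  energy : InEnergyClass D T v G
  pressure : InL53loc D T π
  equation : ∀ Ψ : ℝ × E3 → E3, IsTestFunction (spaceTime D T) Ψ →
    -(∫ p in spaceTime D T, inner ℝ (v p) (timeDeriv Ψ p))
        - (∫ p in spaceTime D T, inner ℝ (v p + z p) (spaceDeriv Ψ (v p + z p) p))
        - ∫ p in spaceTime D T, π p * divergence Ψ p
      = (∫ p in spaceTime D T, inner ℝ (v p) (laplace Ψ p))
        + ∫ p in spaceTime D T, inner ℝ (h p) (Ψ p)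

/-- The energy inequality for `v`: for all `t ≤ T` and almost all `s < t`,
`|v(t)|² + 2 ∫_s^t ‖v‖² ≤ |v(s)|² + 2 ∫_s^t ∫_D z·((v+z)·∇)v + 2 ∫_s^t ∫_D h·v`. -/
def EnergyInequality (D : Set E3) (T : EReal) (h z v : ℝ × E3 → E3)
    (G : Fin 3 → ℝ × E3 → E3) : Prop :=
  ∀ t ∈ closedTimes T, ∀ᵐ s ∂(volume.restrict (Ioo 0 t)),
    (∫ x in D, ‖v (t, x)‖ ^ 2) + 2 * (∫ p in Ioo s t ×ˢ D, gradSq (fun i => G i p))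
      ≤ (∫ x in D, ‖v (s, x)‖ ^ 2)
        + 2 * (∫ p in Ioo s t ×ˢ D, inner ℝ (z p) (advect (v p + z p) (fun i => G i p)))
        + 2 * ∫ p in Ioo s t ×ˢ D, inner ℝ (h p) (v p)

/-- The local energy inequality for `(v,π)`. -/
def LocalEnergyInequality (D : Set E3) (T : EReal) (h z v : ℝ × E3 → E3)
    (G : Fin 3 → ℝ × E3 → E3) (π : ℝ × E3 → ℝ) : Prop :=
  ∀ φ : ℝ × E3 → ℝ, IsTestFunction (spaceTime D T) φ → (∀ p, 0 ≤ φ p) →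
    2 * (∫ p in spaceTime D T, gradSq (fun i => G i p) * φ p)
      ≤ (∫ p in spaceTime D T, ‖v p‖ ^ 2 * (timeDeriv φ p + laplace φ p))
        + 2 * (∫ p in spaceTime D T, π p * spaceDeriv φ (v p) p)
        + (∫ p in spaceTime D T,
            (‖v p‖ ^ 2 + 2 * inner ℝ (v p) (z p)) * spaceDeriv φ (v p + z p) p)
        + 2 * (∫ p in spaceTime D T,
            φ p * inner ℝ (z p) (advect (v p + z p) (fun i => G i p)))
        + 2 * ∫ p in spaceTime D T, φ p * inner ℝ (h p) (v p)

/-- `(u,P)` is a suitable weak solution relative to `(z,Q)`, where `v = u - z` and `π = P - Q`. -/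
def IsSuitable (D : Set E3) (T : EReal) (h : ℝ × E3 → E3) (v₀ : E3 → E3)
    (z : ℝ × E3 → E3) (Q : ℝ × E3 → ℝ) (u : ℝ × E3 → E3) (P : ℝ × E3 → ℝ) : Prop :=
  ∃ G : Fin 3 → ℝ × E3 → E3,
    IsModifiedWeakSolution D T h v₀ z (u - z) G (P - Q) ∧
    EnergyInequality D T h z (u - z) G ∧
    LocalEnergyInequality D T h z (u - z) G (P - Q)

/-- The same notion without the global energy inequality. -/
def IsLocallySuitable (D : Set E3) (T : EReal) (h : ℝ × E3 → E3) (v₀ : E3 → E3)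
    (z : ℝ × E3 → E3) (Q : ℝ × E3 → ℝ) (u : ℝ × E3 → E3) (P : ℝ × E3 → ℝ) : Prop :=
  ∃ G : Fin 3 → ℝ × E3 → E3,
    IsModifiedWeakSolution D T h v₀ z (u - z) G (P - Q) ∧
    LocalEnergyInequality D T h z (u - z) G (P - Q)

/-! ### The notion of Caffarelli, Kohn and Nirenberg -/

/-- `(u,P)` is a suitable weak solution in the sense of Caffarelli, Kohn and Nirenberg of the
initial-boundary value problem
`∂_t u + (u·∇)u + ∇P = Δu + f`, `div u = 0`, `u = 0` on `∂D`, `u(0) = u₀`;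
`G` is the spatial gradient of `u`. -/
structure IsCKNSuitable (D : Set E3) (T : EReal) (f : ℝ × E3 → E3) (u₀ : E3 → E3)
    (u : ℝ × E3 → E3) (G : Fin 3 → ℝ × E3 → E3) (P : ℝ × E3 → ℝ) : Prop where
  weakCont : WeaklyContinuous D T u
  initial : ∀ᵐ x ∂(volume.restrict D), u (0, x) = u₀ x
  energy : InEnergyClass D T u G
  pressure : InL53loc D T P
  equation : ∀ Ψ : ℝ × E3 → E3, IsTestFunction (spaceTime D T) Ψ →
    -(∫ p in spaceTime D T, inner ℝ (u p) (timeDeriv Ψ p))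
        - (∫ p in spaceTime D T, inner ℝ (u p) (spaceDeriv Ψ (u p) p))
        - ∫ p in spaceTime D T, P p * divergence Ψ p
      = (∫ p in spaceTime D T, inner ℝ (u p) (laplace Ψ p))
        + ∫ p in spaceTime D T, inner ℝ (f p) (Ψ p)
  localEnergy : ∀ φ : ℝ × E3 → ℝ, IsTestFunction (spaceTime D T) φ → (∀ p, 0 ≤ φ p) →
    2 * (∫ p in spaceTime D T, gradSq (fun i => G i p) * φ p)
      ≤ (∫ p in spaceTime D T, ‖u p‖ ^ 2 * (timeDeriv φ p + laplace φ p))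
        + (∫ p in spaceTime D T, (‖u p‖ ^ 2 + 2 * P p) * spaceDeriv φ (u p) p)
        + 2 * ∫ p in spaceTime D T, inner ℝ (u p) (f p) * φ p

/-- The classical (Leray) energy inequality: for all `t ≤ T` and almost all `s < t`,
`|u(t)|² + 2 ∫_s^t ‖u‖² ≤ |u(s)|² + 2 ∫_s^t ∫_D f·u`. -/
def LerayEnergyInequality (D : Set E3) (T : EReal) (f u : ℝ × E3 → E3)
    (G : Fin 3 → ℝ × E3 → E3) : Prop :=
  ∀ t ∈ closedTimes T, ∀ᵐ s ∂(volume.restrict (Ioo 0 t)),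
    (∫ x in D, ‖u (t, x)‖ ^ 2) + 2 * (∫ p in Ioo s t ×ˢ D, gradSq (fun i => G i p))
      ≤ (∫ x in D, ‖u (s, x)‖ ^ 2) + 2 * ∫ p in Ioo s t ×ˢ D, inner ℝ (f p) (u p)

end SuitableNS

open SuitableNS

/-! Put w = z - z₁, q = Q - Q₁ and k = fa - fb. The singular force cancels in the difference, so (w,
q) solves the linear problem with the square-integrable force k (`IsStokesSolution.sub`). Passing
from z to z₁ replaces v by v + w, π by π + q, h by h + k and z by z - w, while the advecting
velocity u = v + z stays the same. The equation for v + w is therefore the sum of two equations, and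
only the two energy inequalities need an argument.

Expand |v + w|² = |v|² + 2 v·w + |w|². Nothing better than an inequality is known for |v|², but the
mixed term and |w|² satisfy exact balance laws, with a weight φ and between any two positive times
(`IsBalanced.pairing`). When these are inserted, the energy expressions for v and for v + w differ
only by total transport terms φ ((u·∇)c·d + c·(u·∇)d) + (u·∇φ) c·d, and by the same terms with a
constant field in place of u and ∂ᵢφ in place of φ. All of them integrate to zero
(`integral_transport`). So the two energy expressions are equal (`IsBalanced.energy_change`). A
cutoff φ gives the local inequality and φ = 1 the global one, and both pass from one linear solution
to the other.

The product rule for ∫ φ v·w is the main work, since neither factor can simply be inserted into the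
equation of the other. It rests on three points.

Pressure: it is only locally integrable, and for φ = 1 it must not appear at all. The equations are
therefore tested with φψ, where ψ is solenoidal with compact support in D, so that the pressure
meets only ψ·∇φ. Such fields are dense in V (`exists_solenoidal_approx`). They arise by
mollification along a vector field pointing into D, with a first-order correction that keeps the
divergence zero. This gives the rate of change of ∫ φ v·ψ for each fixed ψ in V
(`IsBalanced.balance`).

Time: the function g(t, r) = ∫ φ(r) v(t)·w(r) is absolutely continuous in each variable for almost
every value of the other. Integration over a thin strip beside the diagonal, followed by
differentiation in its width, gives the increment of g(t, t) as the integral of the sum of the two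
partial derivatives (`IsCross.sub_eq`).

Convection: (u·∇)u·w is integrable, and continuous under small time shifts of w, because u lies in
L²(L⁴) by the Sobolev inequality, ∇u in L² and w in L^∞(L⁴) (`isCross_of_memL2L4`).

For T = ∞ the linear solutions are controlled only on bounded intervals, but w has a regular force,
and the Poincaré inequality gives a bound up to infinity (`exists_energy_le`). For g = 0 the zero
field solves the linear problem without force, and suitability relative to it is the notion of
Caffarelli, Kohn and Nirenberg (`isSuitable_zero_iff`). -/

namespace SuitableNS

/-! ### Coordinates and elementary facts about test functions -/

section Basis

variable {F : Type*} [NormedAddCommGroup F] [NormedSpace ℝ F]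

lemma apply_eq_sum_basisVec (A : E3 →L[ℝ] F) (x : E3) : A x = ∑ i, x i • A (basisVec i) := by
  conv_lhs => rw [← (EuclideanSpace.basisFun (Fin 3) ℝ).sum_repr x]
  simp [basisVec]

lemma norm_basisVec (i : Fin 3) : ‖basisVec i‖ = 1 := by simp [basisVec]

lemma opNorm_le_sum_basisVec (A : E3 →L[ℝ] F) : ‖A‖ ≤ ∑ i, ‖A (basisVec i)‖ := by
  refine A.opNorm_le_bound (by positivity) fun x => ?_
  rw [apply_eq_sum_basisVec A x, Finset.sum_mul]
  refine (norm_sum_le _ _).trans (Finset.sum_le_sum fun i _ => ?_)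
  rw [norm_smul, mul_comm]
  gcongr
  exact PiLp.norm_apply_le x i

end Basis

lemma IsSmoothBoundedDomain.isOpen {D : Set E3} (hD : IsSmoothBoundedDomain D) : IsOpen D := by
  obtain ⟨ρ, h1, rfl, -⟩ := hD.smooth
  exact isOpen_lt h1.continuous continuous_const

lemma IsSmoothBoundedDomain.isFiniteMeasure {D : Set E3} (hD : IsSmoothBoundedDomain D) :
    IsFiniteMeasure (volume.restrict D) :=
  ⟨by simpa using hD.bounded.measure_lt_top⟩

section TestFunctions

variable {X : Type*} [NormedAddCommGroup X] [NormedSpace ℝ X]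
  {F : Type*} [NormedAddCommGroup F] [NormedSpace ℝ F] {U : Set X} {φ ψ : X → F}

lemma IsTestFunction.mono {U' : Set X} (h : IsTestFunction U φ) (hU : U ⊆ U') :
    IsTestFunction U' φ := ⟨h.smooth, h.compact, h.support.trans hU⟩

lemma IsTestFunction.sub (h : IsTestFunction U φ) (h' : IsTestFunction U ψ) :
    IsTestFunction U (φ - ψ) :=
  ⟨h.smooth.sub h'.smooth, h.compact.sub h'.compact,
    (tsupport_sub φ ψ).trans (union_subset h.support h'.support)⟩

lemma IsTestFunction.support_subset (h : IsTestFunction U φ) : Function.support φ ⊆ U :=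
  (subset_tsupport φ).trans h.support

lemma IsTestFunction.smul_left {χ : X → ℝ} (hχ : ContDiff ℝ ∞ χ) (h : IsTestFunction U φ) :
    IsTestFunction U (fun x => χ x • φ x) :=
  ⟨hχ.smul h.smooth, h.compact.smul_left, (tsupport_smul_subset_right χ φ).trans h.support⟩

lemma IsTestFunction.fderiv_apply (h : IsTestFunction U φ) (b : X) :
    IsTestFunction U (fun x => fderiv ℝ φ x b) :=
  ⟨(h.smooth.fderiv_right (by simp)).clm_apply contDiff_const, h.compact.fderiv_apply ℝ b,
    (tsupport_fderiv_apply_subset ℝ b).trans h.support⟩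

end TestFunctions

/-! ### Sobolev embedding of H¹₀ -/

variable {D : Set E3}

lemma IsTestFunction.memLp {F : Type*} [NormedAddCommGroup F] [NormedSpace ℝ F]
    {φ : E3 → F} {U : Set E3} (h : IsTestFunction U φ) (p : ℝ≥0∞) :
    MemLp φ p (volume.restrict D) :=
  (h.smooth.continuous.memLp_of_hasCompactSupport h.compact).restrict D

lemma IsTestFunction.hasFDerivAt {X F : Type*} [NormedAddCommGroup X] [NormedSpace ℝ X]
    [NormedAddCommGroup F] [NormedSpace ℝ F]
    {φ : X → F} {U : Set X} (h : IsTestFunction U φ) (x : X) : HasFDerivAt φ (fderiv ℝ φ x) x :=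
  (h.smooth.differentiable (by simp) x).hasFDerivAt

/-- The Gagliardo–Nirenberg–Sobolev inequality in dimension three: 1/6 = 1/2 - 1/3 is the critical
exponent, and boundedness of the domain admits every smaller q. The operator norm of the derivative
is replaced by the partial derivatives that occur in `IsH10`. -/
lemma exists_sobolev_test (hD : Bornology.IsBounded D) (q : ℝ≥0) (hq : (1 : ℝ) / 6 ≤ (q : ℝ)⁻¹) :
    ∃ C : ℝ≥0, ∀ φ : E3 → E3, IsTestFunction D φ →
      eLpNorm φ q (volume.restrict D) ≤
        C * ∑ i, eLpNorm (fun x => fderiv ℝ φ x (basisVec i)) 2 (volume.restrict D) := by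
  refine ⟨eLpNormLESNormFDerivOfLeConst E3 volume D 2 q, fun φ hφ => ?_⟩
  have h := eLpNorm_le_eLpNorm_fderiv_of_le (volume : Measure E3) (F := E3) (u := φ) (s := D)
    (p := 2) (q := q) (hφ.smooth.of_le (by simp)) hφ.support_subset
    (by norm_num) (by simp; norm_num) (by simp; norm_num at hq ⊢; linarith) hD
  rw [eLpNorm_restrict_eq_of_support_subset hφ.support_subset]
  refine h.trans ?_
  gcongr
  have hs : Function.support (fderiv ℝ φ) ⊆ D :=
    (support_fderiv_subset ℝ).trans hφ.support
  rw [← eLpNorm_restrict_eq_of_support_subset hs]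
  calc eLpNorm (fderiv ℝ φ) ((2 : ℝ≥0) : ℝ≥0∞) (volume.restrict D)
      ≤ eLpNorm (∑ i, fun x => ‖fderiv ℝ φ x (basisVec i)‖) 2 (volume.restrict D) :=
        eLpNorm_mono_real fun x => by simpa using opNorm_le_sum_basisVec (fderiv ℝ φ x)
    _ ≤ ∑ i, eLpNorm (fun x => ‖fderiv ℝ φ x (basisVec i)‖) 2 (volume.restrict D) :=
        eLpNorm_sum_le (fun i _ => ((hφ.fderiv_apply (basisVec i)).memLp 2).1.norm) (by norm_num)
    _ = _ := by simp

/-- Elements of `H¹₀(D)` lie in `L^q(D)` for `q ≤ 6`, and the approximating test functions converge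
there too. -/
lemma exists_sobolev (hD : Bornology.IsBounded D) (q : ℝ≥0)
    (hq : (1 : ℝ) / 6 ≤ (q : ℝ)⁻¹) :
    ∃ C : ℝ≥0, ∀ (v : E3 → E3) (G : Fin 3 → E3 → E3), IsH10 D v G →
      eLpNorm v q (volume.restrict D) ≤ C * ∑ i, eLpNorm (G i) 2 (volume.restrict D) ∧
      ∀ φ : ℕ → E3 → E3, (∀ n, IsTestFunction D (φ n)) →
        Tendsto (fun n => eLpNorm (φ n - v) 2 (volume.restrict D)) atTop (𝓝 0) →
        (∀ i, Tendsto (fun n => eLpNorm (fun x => fderiv ℝ (φ n) x (basisVec i) - G i x) 2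
          (volume.restrict D)) atTop (𝓝 0)) →
        Tendsto (fun n => eLpNorm (φ n - v) q (volume.restrict D)) atTop (𝓝 0) := by
  obtain ⟨C, hC⟩ := exists_sobolev_test hD q hq
  -- An almost everywhere convergent subsequence and Fatou carry the inequality from φₙ - ψ to v -
  -- ψ, without prior knowledge that v lies in L^q. The choice ψ = 0 gives the bound on v, and ψ =
  -- φₙ the convergence in L^q.
  have key : ∀ (v : E3 → E3) (G : Fin 3 → E3 → E3), IsH10 D v G → ∀ φ : ℕ → E3 → E3,
      (∀ n, IsTestFunction D (φ n)) →
      Tendsto (fun n => eLpNorm (φ n - v) 2 (volume.restrict D)) atTop (𝓝 0) →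
      (∀ i, Tendsto (fun n => eLpNorm (fun x => fderiv ℝ (φ n) x (basisVec i) - G i x) 2
          (volume.restrict D)) atTop (𝓝 0)) → ∀ ψ : E3 → E3, IsTestFunction D ψ →
      eLpNorm (v - ψ) q (volume.restrict D) ≤
        C * ∑ i, eLpNorm (fun x => fderiv ℝ ψ x (basisVec i) - G i x) 2 (volume.restrict D) := by
    intro v G hv φ hφ hφv hφG ψ hψ
    obtain ⟨ns, hns, hae⟩ := (tendstoInMeasure_of_tendsto_eLpNorm (by norm_num)
      (fun n => ((hφ n).memLp 2).1) hv.memLp.1 hφv).exists_seq_tendsto_ae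
    have h1 : eLpNorm (v - ψ) q (volume.restrict D) ≤
        liminf (fun k => eLpNorm (φ (ns k) - ψ) q (volume.restrict D)) atTop := by
      refine Lp.eLpNorm_lim_le_liminf_eLpNorm
        (fun k => (((hφ (ns k)).sub hψ).memLp q).1) _ ?_
      filter_upwards [hae] with x hx using hx.sub_const _
    refine h1.trans ?_
    set a : ℕ → Fin 3 → ℝ≥0∞ := fun n i =>
      eLpNorm (fun x => fderiv ℝ (φ n) x (basisVec i) - G i x) 2 (volume.restrict D)
    set b : Fin 3 → ℝ≥0∞ := fun i =>
      eLpNorm (fun x => fderiv ℝ ψ x (basisVec i) - G i x) 2 (volume.restrict D)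
    have h2 : ∀ k, eLpNorm (φ (ns k) - ψ) q (volume.restrict D) ≤
        C * ∑ i, (a (ns k) i + b i) := by
      intro k
      refine (hC _ ((hφ (ns k)).sub hψ)).trans ?_
      gcongr with i
      have : (fun x => fderiv ℝ (φ (ns k) - ψ) x (basisVec i)) =
          (fun x => fderiv ℝ (φ (ns k)) x (basisVec i) - G i x) -
            (fun x => fderiv ℝ ψ x (basisVec i) - G i x) := by
        ext1 x
        rw [fderiv_sub ((hφ (ns k)).hasFDerivAt x).differentiableAt (hψ.hasFDerivAt x).differentiableAt]
        simp
      rw [this]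
      exact eLpNorm_sub_le ((((hφ (ns k)).fderiv_apply _).memLp 2).1.sub (hv.memLp_grad i).1)
        (((hψ.fderiv_apply _).memLp 2).1.sub (hv.memLp_grad i).1) (by norm_num)
    refine (liminf_le_liminf (Eventually.of_forall h2)).trans (le_of_eq ?_)
    refine Tendsto.liminf_eq ?_
    have h3 : Tendsto (fun k => C * ∑ i, (a (ns k) i + b i)) atTop
        (𝓝 (C * ∑ i, (0 + b i))) := by
      refine ENNReal.Tendsto.const_mul (tendsto_finsetSum _ fun i _ => ?_) (by simp)
      exact ((hφG i).comp hns.tendsto_atTop).add tendsto_const_nhds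
    simpa using h3
  refine ⟨C, fun v G hv => ⟨?_, fun φ hφ hφv hφG => ?_⟩⟩
  · obtain ⟨φ, hφ, hφv, hφG⟩ := hv.approx
    have h0 : IsTestFunction D (0 : E3 → E3) :=
      ⟨contDiff_const, HasCompactSupport.zero, by simp [tsupport]⟩
    have := key v G hv φ hφ hφv hφG 0 h0
    simpa [eLpNorm_neg, ← Pi.neg_def] using this
  · have h3 : Tendsto (fun n => C * ∑ i,
        eLpNorm (fun x => fderiv ℝ (φ n) x (basisVec i) - G i x) 2 (volume.restrict D)) atTop
        (𝓝 (C * ∑ _i : Fin 3, 0)) :=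
      ENNReal.Tendsto.const_mul (tendsto_finsetSum _ fun i _ => hφG i) (by simp)
    refine tendsto_of_tendsto_of_tendsto_of_le_of_le tendsto_const_nhds (by simpa using h3)
      (fun _ => zero_le) fun n => ?_
    simp only
    rw [eLpNorm_sub_comm]
    exact key v G hv φ hφ hφv hφG _ (hφ n)

/-- A sequence of test functions converging to `v` in `H¹₀(D)`. -/
structure H10Approx (D : Set E3) (v : E3 → E3) (G : Fin 3 → E3 → E3) (φ : ℕ → E3 → E3) : Prop where
  test : ∀ n, IsTestFunction D (φ n)
  tendsto : Tendsto (fun n => eLpNorm (φ n - v) 2 (volume.restrict D)) atTop (𝓝 0)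
  tendsto_grad : ∀ i, Tendsto (fun n => eLpNorm (fun x => fderiv ℝ (φ n) x (basisVec i) - G i x) 2
    (volume.restrict D)) atTop (𝓝 0)

lemma IsH10.exists_approx {v : E3 → E3} {G : Fin 3 → E3 → E3} (hv : IsH10 D v G) :
    ∃ φ, H10Approx D v G φ := by
  obtain ⟨φ, h1, h2, h3⟩ := hv.approx
  exact ⟨φ, h1, h2, h3⟩

lemma IsH10.memLp_four (hD : Bornology.IsBounded D) {v : E3 → E3} {G : Fin 3 → E3 → E3}
    (hv : IsH10 D v G) : MemLp v 4 (volume.restrict D) := by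
  obtain ⟨C, hC⟩ := exists_sobolev hD 4 (by norm_num)
  refine ⟨hv.memLp.1, ((hC v G hv).1).trans_lt ?_⟩
  refine ENNReal.mul_lt_top (by simp) (ENNReal.sum_lt_top.2 fun i _ => (hv.memLp_grad i).2)

lemma H10Approx.tendsto_four (hD : Bornology.IsBounded D) {v : E3 → E3} {G : Fin 3 → E3 → E3}
    (hv : IsH10 D v G) {φ : ℕ → E3 → E3} (h : H10Approx D v G φ) :
    Tendsto (fun n => eLpNorm (φ n - v) 4 (volume.restrict D)) atTop (𝓝 0) := by
  obtain ⟨C, hC⟩ := exists_sobolev hD 4 (by norm_num)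
  simpa using (hC v G hv).2 φ h.test h.tendsto h.tendsto_grad

end SuitableNS

namespace SuitableNS

/-! ### Continuity of pairings, and integration by parts along solenoidal fields -/

section Convergence

variable {α : Type*} {m : MeasurableSpace α} {μ : Measure α}
  {F : Type*} [NormedAddCommGroup F] [InnerProductSpace ℝ F]

lemma eLpNorm_inner_le {p q : ℝ≥0∞} [p.HolderTriple q 1] {f g : α → F}
    (hf : AEStronglyMeasurable f μ) (hg : AEStronglyMeasurable g μ) :
    eLpNorm (fun x => inner ℝ (f x) (g x)) 1 μ ≤ eLpNorm f p μ * eLpNorm g q μ := by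
  simpa using eLpNorm_le_eLpNorm_mul_eLpNorm_of_nnnorm hf hg (fun a b => inner ℝ a b) 1
    (Eventually.of_forall fun x => by simpa using nnnorm_inner_le_nnnorm (𝕜 := ℝ) (f x) (g x))
    (p := p) (q := q) (r := 1)

lemma integrable_inner_of_memLp {p q : ℝ≥0∞} [p.HolderTriple q 1] {f g : α → F}
    (hf : MemLp f p μ) (hg : MemLp g q μ) : Integrable (fun x => inner ℝ (f x) (g x)) μ := by
  rw [← memLp_one_iff_integrable]
  exact ⟨hf.1.inner hg.1, (eLpNorm_inner_le hf.1 hg.1).trans_lt (ENNReal.mul_lt_top hf.2 hg.2)⟩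

/-- The pairing of `L^p` and `L^q` is continuous. -/
lemma tendsto_integral_inner {p q : ℝ≥0∞} (hq : 1 ≤ q) [p.HolderTriple q 1]
    {f : ℕ → α → F} {g : ℕ → α → F} {f₀ g₀ : α → F} (hf : ∀ n, MemLp (f n) p μ)
    (hg : ∀ n, MemLp (g n) q μ) (hf₀ : MemLp f₀ p μ) (hg₀ : MemLp g₀ q μ)
    (hff : Tendsto (fun n => eLpNorm (f n - f₀) p μ) atTop (𝓝 0))
    (hgg : Tendsto (fun n => eLpNorm (g n - g₀) q μ) atTop (𝓝 0)) :
    Tendsto (fun n => ∫ x, inner ℝ (f n x) (g n x) ∂μ) atTop (𝓝 (∫ x, inner ℝ (f₀ x) (g₀ x) ∂μ)) := by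
  refine tendsto_integral_of_L1' _ (integrable_inner_of_memLp hf₀ hg₀).1
    (Eventually.of_forall fun n => integrable_inner_of_memLp (hf n) (hg n)) ?_
  have hb : ∀ n, eLpNorm ((fun x => inner ℝ (f n x) (g n x)) - fun x => inner ℝ (f₀ x) (g₀ x)) 1 μ ≤
      eLpNorm (f n - f₀) p μ * (eLpNorm (g n - g₀) q μ + eLpNorm g₀ q μ) +
        eLpNorm f₀ p μ * eLpNorm (g n - g₀) q μ := by
    intro n
    have h1 : ((fun x => inner ℝ (f n x) (g n x)) - fun x => inner ℝ (f₀ x) (g₀ x)) =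
        (fun x => inner ℝ ((f n - f₀) x) (g n x)) + fun x => inner ℝ (f₀ x) ((g n - g₀) x) := by
      ext x
      simp [inner_sub_left, inner_sub_right]
    rw [h1]
    refine (eLpNorm_add_le (((hf n).1.sub hf₀.1).inner (hg n).1) (hf₀.1.inner ((hg n).1.sub hg₀.1))
      le_rfl).trans ?_
    refine add_le_add ((eLpNorm_inner_le (p := p) (q := q) ((hf n).1.sub hf₀.1) (hg n).1).trans ?_)
      (eLpNorm_inner_le hf₀.1 ((hg n).1.sub hg₀.1))
    gcongr
    have := eLpNorm_add_le ((hg n).1.sub hg₀.1) hg₀.1 hq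
    simpa using this
  have hlim : Tendsto (fun n => eLpNorm (f n - f₀) p μ * (eLpNorm (g n - g₀) q μ + eLpNorm g₀ q μ) +
        eLpNorm f₀ p μ * eLpNorm (g n - g₀) q μ) atTop (𝓝 (0 * (0 + eLpNorm g₀ q μ) +
        eLpNorm f₀ p μ * 0)) := by
    refine Tendsto.add (ENNReal.Tendsto.mul hff ?_ (hgg.add tendsto_const_nhds) ?_)
      (ENNReal.Tendsto.const_mul hgg (Or.inr hf₀.2.ne))
    · right; simpa using hg₀.2.ne
    · right; simp
  exact tendsto_of_tendsto_of_tendsto_of_le_of_le tendsto_const_nhds (by simpa using hlim)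
    (fun _ => zero_le) hb

lemma integral_sum_add {ι : Type*} [Fintype ι] {f g : ι → α → ℝ} (hf : ∀ i, Integrable (f i) μ)
    (hg : ∀ i, Integrable (g i) μ) :
    ∫ x, ∑ i, (f i x + g i x) ∂μ = ∑ i, (∫ x, f i x ∂μ + ∫ x, g i x ∂μ) := by
  rw [integral_finsetSum _ fun i _ => (hf i).fun_add (hg i)]
  exact Finset.sum_congr rfl fun i _ => integral_add (hf i) (hg i)

end Convergence

variable {D : Set E3}

lemma exists_bound_of_continuous {X F : Type*} [PseudoMetricSpace X] [ProperSpace X]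
    [SeminormedAddCommGroup F] {D : Set X} (hD : Bornology.IsBounded D) {χ : X → F}
    (hχ : Continuous χ) : ∃ C : ℝ, 0 ≤ C ∧ ∀ x ∈ D, ‖χ x‖ ≤ C := by
  obtain ⟨C, hC⟩ := hD.isCompact_closure.exists_bound_of_continuousOn hχ.continuousOn
  exact ⟨max C 0, le_max_right _ _, fun x hx => (hC x (subset_closure hx)).trans (le_max_left _ _)⟩

lemma memLp_continuous_smul {F : Type*} [NormedAddCommGroup F] [NormedSpace ℝ F]
    (hD : IsSmoothBoundedDomain D) {χ : E3 → ℝ} (hχ : Continuous χ) {f : E3 → F} {p : ℝ≥0∞}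
    (hf : MemLp f p (volume.restrict D)) : MemLp (fun x => χ x • f x) p (volume.restrict D) := by
  obtain ⟨C, -, hC⟩ := exists_bound_of_continuous hD.bounded hχ
  refine hf.of_le_mul (c := C) (hχ.aestronglyMeasurable.smul hf.1) ?_
  filter_upwards [ae_restrict_mem hD.isOpen.measurableSet] with x hx
  rw [norm_smul]
  gcongr
  exact hC x hx

lemma memLp_apply {U : E3 → E3} {p : ℝ≥0∞} {μ : Measure E3} (hU : MemLp U p μ) (i : Fin 3) :
    MemLp (fun x => U x i) p μ :=
  hU.of_le ((by fun_prop : Continuous fun y : E3 => y i).comp_aestronglyMeasurable hU.1)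
    (Eventually.of_forall fun x => PiLp.norm_apply_le (U x) i)

lemma memLp_continuous_fderiv_apply (hD : IsSmoothBoundedDomain D) {χ : E3 → ℝ}
    (hχ : ContDiff ℝ ∞ χ) {U : E3 → E3} {p : ℝ≥0∞}
    (hU : MemLp U p (volume.restrict D)) :
    MemLp (fun x => fderiv ℝ χ x (U x)) p (volume.restrict D) := by
  have : (fun x => fderiv ℝ χ x (U x)) =
      fun x => ∑ i, fderiv ℝ χ x (basisVec i) • U x i := by
    ext x
    rw [apply_eq_sum_basisVec]
    simp [mul_comm]
  rw [this]
  refine memLp_finsetSum _ fun i _ => memLp_continuous_smul hD ?_ (memLp_apply hU i)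
  exact (hχ.continuous_fderiv (by simp)).clm_apply continuous_const

/-- Hölder with 1/4 + 1/4 = 1/2. In the transport identity an L⁴ weight times an L⁴ field is paired
with a gradient in L², so convergence of this product in L² is what is needed. -/
lemma tendsto_eLpNorm_smul {φ : ℕ → E3 → E3} {c : E3 → E3} {β : E3 → ℝ}
    {μ : Measure E3} (hφ : ∀ n, MemLp (φ n) 4 μ) (hc : MemLp c 4 μ) (hβ : MemLp β 4 μ)
    (h : Tendsto (fun n => eLpNorm (φ n - c) 4 μ) atTop (𝓝 0)) :
    Tendsto (fun n => eLpNorm ((fun x => β x • φ n x) - fun x => β x • c x) 2 μ) atTop (𝓝 0) := by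
  have h4 : ENNReal.HolderTriple 4 4 2 := ⟨by
    rw [← ENNReal.toReal_eq_toReal_iff' (by simp) (by simp), ENNReal.toReal_add (by simp) (by simp)]
    norm_num⟩
  have hlim : Tendsto (fun n => eLpNorm β 4 μ * eLpNorm (φ n - c) 4 μ) atTop (𝓝 (eLpNorm β 4 μ * 0)) :=
    ENNReal.Tendsto.const_mul h (Or.inr hβ.2.ne)
  refine tendsto_of_tendsto_of_tendsto_of_le_of_le tendsto_const_nhds (by simpa using hlim)
    (fun _ => zero_le) fun n => ?_
  have : ((fun x => β x • φ n x) - fun x => β x • c x) = β • (φ n - c) := by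
    ext x; simp [smul_sub]
  simp only [this]
  exact eLpNorm_smul_le_mul_eLpNorm ((hφ n).1.sub hc.1) hβ.1

lemma memLp_two_smul {c : E3 → E3} {β : E3 → ℝ}
    {μ : Measure E3} (hc : MemLp c 4 μ) (hβ : MemLp β 4 μ) : MemLp (fun x => β x • c x) 2 μ := by
  have h4 : ENNReal.HolderTriple 4 4 2 := ⟨by
    rw [← ENNReal.toReal_eq_toReal_iff' (by simp) (by simp), ENNReal.toReal_add (by simp) (by simp)]
    norm_num⟩
  exact hc.smul hβ

/-- Integration by parts for `∫ χ (U · ∇)(a · c)` with a field `U` without divergence. -/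
lemma integral_advect_add_advect (hD : IsSmoothBoundedDomain D) {U : E3 → E3}
    (hU : MemLp U 4 (volume.restrict D))
    (hdiv : ∀ φ : E3 → ℝ, IsTestFunction D φ → ∫ x in D, fderiv ℝ φ x (U x) = 0)
    {a c : E3 → E3} {A C : Fin 3 → E3 → E3} (ha : IsH10 D a A) (hc : IsH10 D c C)
    {χ : E3 → ℝ} (hχ : ContDiff ℝ ∞ χ) :
    ∫ x in D, χ x * (inner ℝ (advect (U x) fun i => A i x) (c x) +
        inner ℝ (a x) (advect (U x) fun i => C i x)) =
      -∫ x in D, fderiv ℝ χ x (U x) * inner ℝ (a x) (c x) := by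
  obtain ⟨φ, hφ⟩ := ha.exists_approx
  obtain ⟨ψ, hψ⟩ := hc.exists_approx
  have ha4 := ha.memLp_four hD.bounded
  have hc4 := hc.memLp_four hD.bounded
  set β : Fin 3 → E3 → ℝ := fun i x => χ x • U x i
  have hβ : ∀ i, MemLp (β i) 4 (volume.restrict D) := fun i =>
    memLp_continuous_smul hD hχ.continuous (memLp_apply hU i)
  set γ : E3 → ℝ := fun x => fderiv ℝ χ x (U x)
  have hγ : MemLp γ 4 (volume.restrict D) := memLp_continuous_fderiv_apply hD hχ hU
  -- The weight is moved onto the factor without derivative. Every summand then pairs an L² gradient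
  -- with a product of two L⁴ functions, and both factors converge along the approximating test
  -- fields.
  have expand : ∀ (a c : E3 → E3) (A C : Fin 3 → E3 → E3) (x : E3),
      χ x * (inner ℝ (advect (U x) fun i => A i x) (c x) +
        inner ℝ (a x) (advect (U x) fun i => C i x)) =
      ∑ i, (inner ℝ (A i x) (β i x • c x) + inner ℝ (β i x • a x) (C i x)) := by
    intro a c A C x
    simp only [advect, sum_inner, inner_sum, ← Finset.sum_add_distrib, Finset.mul_sum,
      inner_smul_left, inner_smul_right, β]
    refine Finset.sum_congr rfl fun i _ => ?_
    simp
    ring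
  have expand' : ∀ (a c : E3 → E3) (x : E3),
      fderiv ℝ χ x (U x) * inner ℝ (a x) (c x) = inner ℝ (a x) (γ x • c x) := by
    intro a c x
    rw [inner_smul_right]
  simp_rw [expand, expand']
  rw [integral_sum_add (fun i => integrable_inner_of_memLp (ha.memLp_grad i)
      (memLp_two_smul hc4 (hβ i))) (fun i => integrable_inner_of_memLp
      (memLp_two_smul ha4 (hβ i)) (hc.memLp_grad i))]
  have t1 : ∀ n, MemLp (φ n) 4 (volume.restrict D) := fun n => (hφ.test n).memLp 4
  have t2 : ∀ n, MemLp (ψ n) 4 (volume.restrict D) := fun n => (hψ.test n).memLp 4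
  have lim1 := tendsto_finsetSum (Finset.univ : Finset (Fin 3)) fun i _ =>
    (tendsto_integral_inner (p := 2) (q := 2) (by norm_num)
      (fun n => ((hφ.test n).fderiv_apply (basisVec i)).memLp 2)
      (fun n => memLp_two_smul (t2 n) (hβ i)) (ha.memLp_grad i) (memLp_two_smul hc4 (hβ i))
      (hφ.tendsto_grad i) (tendsto_eLpNorm_smul t2 hc4 (hβ i) (hψ.tendsto_four hD.bounded hc))).add
    (tendsto_integral_inner (p := 2) (q := 2) (by norm_num)
      (fun n => memLp_two_smul (t1 n) (hβ i))
      (fun n => ((hψ.test n).fderiv_apply (basisVec i)).memLp 2)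
      (memLp_two_smul ha4 (hβ i)) (hc.memLp_grad i)
      (tendsto_eLpNorm_smul t1 ha4 (hβ i) (hφ.tendsto_four hD.bounded ha)) (hψ.tendsto_grad i))
  have lim2 := (tendsto_integral_inner (p := 2) (q := 2) (by norm_num)
      (fun n => (hφ.test n).memLp 2)
      (fun n => memLp_two_smul (t2 n) hγ) ha.memLp (memLp_two_smul hc4 hγ)
      hφ.tendsto (tendsto_eLpNorm_smul t2 hc4 hγ (hψ.tendsto_four hD.bounded hc))).neg
  refine tendsto_nhds_unique lim1 (lim2.congr fun n => ?_)
  have i1 := fun i => (integrable_inner_of_memLp (p := 2) (q := 2)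
    (((hφ.test n).fderiv_apply (basisVec i)).memLp 2) (memLp_two_smul (t2 n) (hβ i)))
  have i2 := fun i => (integrable_inner_of_memLp (p := 2) (q := 2)
    (memLp_two_smul (t1 n) (hβ i)) (((hψ.test n).fderiv_apply (basisVec i)).memLp 2))
  have i3 := integrable_inner_of_memLp (p := 2) (q := 2)
    ((hφ.test n).memLp 2) (memLp_two_smul (t2 n) hγ)
  rw [← integral_sum_add i1 i2, neg_eq_iff_add_eq_zero,
    ← integral_add i3 (integrable_finsetSum _ fun i _ => (i1 i).fun_add (i2 i))]
  -- For test fields the identity is the vanishing divergence of U tested with the scalar χ φₙ·ψₙ,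
  -- whose derivative along U splits by the product rule.
  have htest : IsTestFunction D (fun x => χ x * inner ℝ (φ n x) (ψ n x)) := by
    refine ⟨hχ.mul ((hφ.test n).smooth.inner ℝ (hψ.test n).smooth),
      (hφ.test n).compact.mono' ?_, (closure_minimal ?_ isClosed_closure).trans (hφ.test n).support⟩
    all_goals
      refine Function.support_subset_iff.2 fun x hx => subset_tsupport _ ?_
      intro h
      apply hx
      simp [h]
  rw [← hdiv _ htest]
  refine integral_congr_ae (Eventually.of_forall fun x => ?_)
  have d1 := ((hφ.test n).hasFDerivAt x).inner ℝ ((hψ.test n).hasFDerivAt x)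
  have d2 := ((hχ.differentiable (by simp) x).hasFDerivAt).fun_mul d1
  simp only
  rw [d2.fderiv, ← expand (φ n) (ψ n) (fun i x => fderiv ℝ (φ n) x (basisVec i))
    (fun i x => fderiv ℝ (ψ n) x (basisVec i)), inner_smul_right]
  simp only [advect, ← apply_eq_sum_basisVec]
  simp [fderivInnerCLM_apply, γ]
  ring

/-- A constant field has no divergence. -/
lemma integral_fderiv_test {φ : E3 → ℝ} (hφ : IsTestFunction D φ) (b : E3) :
    ∫ x in D, fderiv ℝ φ x b = 0 := by
  rw [setIntegral_eq_integral_of_forall_compl_eq_zero]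
  · have h1 : Integrable (fun x => fderiv ℝ φ x b) := by
      have := (hφ.fderiv_apply b).memLp (D := univ) 1
      rwa [Measure.restrict_univ, memLp_one_iff_integrable] at this
    have h2 : Integrable φ := by
      have := hφ.memLp (D := univ) 1
      rwa [Measure.restrict_univ, memLp_one_iff_integrable] at this
    have := integral_mul_fderiv_eq_neg_fderiv_mul_of_integrable (μ := volume)
      (f := fun _ : E3 => (1 : ℝ)) (g := φ) (v := b) (by simp) (by simpa using h1)
      (by simpa using h2) (fun _ _ => by fun_prop) (fun x _ => (hφ.hasFDerivAt x).differentiableAt)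
    simpa using this
  · intro x hx
    exact Function.notMem_support.1 fun h =>
      hx ((hφ.fderiv_apply b).support_subset h)

/-- The `H¹₀` function given by a test function. -/
lemma IsTestFunction.isH10 {ψ : E3 → E3} (hψ : IsTestFunction D ψ) :
    IsH10 D ψ (fun i x => fderiv ℝ ψ x (basisVec i)) :=
  ⟨hψ.memLp 2, fun i => (hψ.fderiv_apply _).memLp 2, fun _ => ψ, fun _ => hψ, by simp, by simp⟩

end SuitableNS

namespace SuitableNS

/-! ### Smoothing along a vector field -/

/-- Averages of `g` with a kernel at scale `s` whose centre is moved by `s X`. -/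
noncomputable def smear (X : E3 → E3) (ζ : E3 → ℝ) (s : ℝ) (g : E3 → E3) (x : E3) : E3 :=
  ∫ y, (s⁻¹ ^ 3 * ζ (s⁻¹ • (x - y) - X y)) • g y

section Smear

variable {X : E3 → E3} {ζ : E3 → ℝ} {B r M : ℝ}

/-- The moved kernel still lives at distance O(s) from x, because the centre moves by at most sB.
The point w at which the field is evaluated is arbitrary, so the bound also covers a kernel with
frozen centre. -/
lemma norm_sub_le_of_kernel_ne_zero (hXB : ∀ x, ‖X x‖ ≤ B) (hζr : ∀ z, ζ z ≠ 0 → ‖z‖ ≤ r) {s : ℝ}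
    (hs : 0 < s) {x y w : E3} (h : ζ (s⁻¹ • (x - y) - X w) ≠ 0) : ‖x - y‖ ≤ s * (r + B) := by
  have h1 := hζr _ h
  have h2 : ‖s⁻¹ • (x - y)‖ ≤ r + B := by
    calc ‖s⁻¹ • (x - y)‖ = ‖(s⁻¹ • (x - y) - X w) + X w‖ := by simp
      _ ≤ _ := (norm_add_le _ _).trans (add_le_add h1 (hXB w))
  rw [norm_smul, norm_inv, Real.norm_of_nonneg hs.le, inv_mul_le_iff₀ hs] at h2
  exact h2

lemma integrable_smear (hX : Continuous X) (hXB : ∀ x, ‖X x‖ ≤ B) (hζ : Continuous ζ)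
    (hζr : ∀ z, ζ z ≠ 0 → ‖z‖ ≤ r) (hM : ∀ z, |ζ z| ≤ M) {s : ℝ} (hs : 0 < s) {g : E3 → E3}
    (hg : MemLp g 2) (x : E3) :
    Integrable (fun y => (s⁻¹ ^ 3 * ζ (s⁻¹ • (x - y) - X y)) • g y) := by
  have hloc : IntegrableOn g (Metric.closedBall x (s * (r + B))) :=
    hg.locallyIntegrable (by norm_num) |>.integrableOn_isCompact (isCompact_closedBall _ _)
  have hmeas : AEStronglyMeasurable (fun y => (s⁻¹ ^ 3 * ζ (s⁻¹ • (x - y) - X y)) • g y) volume :=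
    (by fun_prop : Continuous fun y => s⁻¹ ^ 3 * ζ (s⁻¹ • (x - y) - X y)).aestronglyMeasurable.smul hg.1
  have h2 : IntegrableOn (fun y => (s⁻¹ ^ 3 * ζ (s⁻¹ • (x - y) - X y)) • g y)
      (Metric.closedBall x (s * (r + B))) := by
    refine (hloc.norm.const_mul (s⁻¹ ^ 3 * M)).mono' hmeas.restrict (Eventually.of_forall fun y => ?_)
    rw [norm_smul, norm_mul, Real.norm_of_nonneg (by positivity)]
    gcongr
    exact hM _
  refine (integrableOn_iff_integrable_of_support_subset fun y hy => ?_).1 h2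
  have : ζ (s⁻¹ • (x - y) - X y) ≠ 0 := fun h => hy (by simp [h])
  rw [mem_closedBall_iff_norm, norm_sub_rev]
  exact norm_sub_le_of_kernel_ne_zero hXB hζr hs this

lemma aestronglyMeasurable_smear (hX : Continuous X) (hζ : Continuous ζ) (s : ℝ) {g : E3 → E3}
    (hg : MemLp g 2) : AEStronglyMeasurable (smear X ζ s g) volume := by
  have : AEStronglyMeasurable (fun p : E3 × E3 =>
      (s⁻¹ ^ 3 * ζ (s⁻¹ • (p.1 - p.2) - X p.2)) • g p.2) (volume.prod volume) :=
    (by fun_prop : Continuous fun p : E3 × E3 =>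
      s⁻¹ ^ 3 * ζ (s⁻¹ • (p.1 - p.2) - X p.2)).aestronglyMeasurable.smul hg.1.comp_snd
  exact this.integral_prod_right'

/-- The averages are bounded on `L²`, uniformly in the scale. -/
lemma exists_eLpNorm_smear_le (hXB : ∀ x, ‖X x‖ ≤ B)
    (hζr : ∀ z, ζ z ≠ 0 → ‖z‖ ≤ r) (hM : ∀ z, |ζ z| ≤ M) (hrB : 0 ≤ r + B) :
    ∃ K : ℝ≥0, ∀ s : ℝ, 0 < s → ∀ g : E3 → E3, MemLp g 2 →
      eLpNorm (smear X ζ s g) 2 volume ≤ K * eLpNorm g 2 volume := by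
  set L := r + B
  have hM0 : 0 ≤ M := (abs_nonneg _).trans (hM 0)
  -- V is the volume of a ball of radius L, which is s⁻³ times the volume of a ball of radius sL at
  -- every scale. The kernel is at most M s⁻³ and vanishes off such a ball, so Cauchy–Schwarz on the
  -- ball and Tonelli bound the operator norm by MV.
  set V : ℝ≥0∞ := ENNReal.ofReal (L ^ 3) * volume (Metric.ball (0 : E3) 1)
  have hV : V ≠ ⊤ := ENNReal.mul_ne_top (by simp) measure_ball_lt_top.ne
  refine ⟨(ENNReal.ofReal M * V).toNNReal, fun s hs g hg => ?_⟩
  rw [ENNReal.coe_toNNReal (ENNReal.mul_ne_top (by simp) hV)]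
  set c : ℝ≥0∞ := ENNReal.ofReal (s⁻¹ ^ 3)
  have hvol : ∀ x : E3, c * volume (Metric.closedBall x (s * L)) = V := by
    intro x
    rw [Measure.addHaar_closedBall _ _ (by positivity)]
    simp only [finrank_euclideanSpace, Fintype.card_fin, c, V]
    rw [← mul_assoc, ← ENNReal.ofReal_mul (by positivity)]
    congr 2
    field_simp
  have hpt : ∀ x, ‖smear X ζ s g x‖ₑ ^ 2 ≤
      ENNReal.ofReal M ^ 2 * V * (c * ∫⁻ y in Metric.closedBall x (s * L), ‖g y‖ₑ ^ 2) := by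
    intro x
    have h1 : ‖smear X ζ s g x‖ₑ ≤
        ENNReal.ofReal M * c * ∫⁻ y in Metric.closedBall x (s * L), ‖g y‖ₑ := by
      refine (enorm_integral_le_lintegral_enorm _).trans ?_
      rw [← lintegral_const_mul' _ _ (ENNReal.mul_ne_top (by simp) (by simp [c])),
        ← lintegral_indicator Metric.isClosed_closedBall.measurableSet]
      refine lintegral_mono fun y => ?_
      by_cases hy : ζ (s⁻¹ • (x - y) - X y) = 0
      · simp [hy]
      · have hmem : y ∈ Metric.closedBall x (s * L) := by
          rw [mem_closedBall_iff_norm, norm_sub_rev]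
          exact norm_sub_le_of_kernel_ne_zero hXB hζr hs hy
        rw [indicator_of_mem hmem, enorm_smul, ← ENNReal.ofReal_mul hM0]
        gcongr
        rw [← ofReal_norm]
        refine ENNReal.ofReal_le_ofReal ?_
        rw [norm_mul, Real.norm_of_nonneg (by positivity), mul_comm]
        gcongr
        exact hM _
    have h2 : (∫⁻ y in Metric.closedBall x (s * L), ‖g y‖ₑ) ^ 2 ≤
        volume (Metric.closedBall x (s * L)) * ∫⁻ y in Metric.closedBall x (s * L), ‖g y‖ₑ ^ 2 := by
      have := eLpNorm_le_eLpNorm_mul_rpow_measure_univ (p := 1) (q := 2) (by norm_num)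
        (hg.1.restrict (s := Metric.closedBall x (s * L)))
      rw [eLpNorm_one_eq_lintegral_enorm] at this
      refine (pow_le_pow_left₀ zero_le this 2).trans (le_of_eq ?_)
      rw [mul_pow, eLpNorm_eq_lintegral_rpow_enorm_toReal (by norm_num) (by norm_num), ← ENNReal.rpow_natCast, ← ENNReal.rpow_mul,
        ← ENNReal.rpow_natCast, ← ENNReal.rpow_mul]
      norm_num
      rw [mul_comm]
    calc ‖smear X ζ s g x‖ₑ ^ 2 ≤ (ENNReal.ofReal M * c * ∫⁻ y in Metric.closedBall x (s * L), ‖g y‖ₑ) ^ 2 := by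
          gcongr
      _ = ENNReal.ofReal M ^ 2 * c ^ 2 * (∫⁻ y in Metric.closedBall x (s * L), ‖g y‖ₑ) ^ 2 := by ring
      _ ≤ ENNReal.ofReal M ^ 2 * c ^ 2 * (volume (Metric.closedBall x (s * L)) *
            ∫⁻ y in Metric.closedBall x (s * L), ‖g y‖ₑ ^ 2) := by gcongr
      _ = ENNReal.ofReal M ^ 2 * (c * volume (Metric.closedBall x (s * L))) *
            (c * ∫⁻ y in Metric.closedBall x (s * L), ‖g y‖ₑ ^ 2) := by ring
      _ = _ := by rw [hvol x]
  have hg2 : AEMeasurable (fun y => ‖g y‖ₑ ^ 2) volume := (hg.1.enorm).pow_const 2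
  have hfub : ∫⁻ x, c * ∫⁻ y in Metric.closedBall x (s * L), ‖g y‖ₑ ^ 2 = V * ∫⁻ y, ‖g y‖ₑ ^ 2 := by
    have e1 : ∀ x, ∫⁻ y in Metric.closedBall x (s * L), ‖g y‖ₑ ^ 2 =
        ∫⁻ y, indicator {p : E3 × E3 | dist p.1 p.2 ≤ s * L} (fun p => ‖g p.2‖ₑ ^ 2) (x, y) := by
      intro x
      rw [← lintegral_indicator Metric.isClosed_closedBall.measurableSet]
      refine lintegral_congr fun y => ?_
      simp only [indicator, Metric.mem_closedBall, mem_ofPred_eq, dist_comm]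
    have hmeasS : MeasurableSet {p : E3 × E3 | dist p.1 p.2 ≤ s * L} :=
      (isClosed_le (by fun_prop) continuous_const).measurableSet
    rw [lintegral_const_mul' _ _ (by simp [c])]
    simp_rw [e1]
    rw [lintegral_lintegral_swap]
    · rw [← lintegral_const_mul' _ _ (by simp [c]), ← lintegral_const_mul' _ _ hV]
      refine lintegral_congr fun y => ?_
      have : (fun x => indicator {p : E3 × E3 | dist p.1 p.2 ≤ s * L} (fun p => ‖g p.2‖ₑ ^ 2) (x, y)) =
          indicator (Metric.closedBall y (s * L)) fun _ => ‖g y‖ₑ ^ 2 := by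
        ext x
        simp only [indicator, Metric.mem_closedBall, mem_ofPred_eq]
      rw [this, lintegral_indicator_const Metric.isClosed_closedBall.measurableSet, ← hvol y]
      ring
    · exact (hg2.comp_quasiMeasurePreserving Measure.quasiMeasurePreserving_snd).indicator hmeasS
  have hsq : ∫⁻ x, ‖smear X ζ s g x‖ₑ ^ 2 ≤ (ENNReal.ofReal M * V) ^ 2 * ∫⁻ y, ‖g y‖ₑ ^ 2 := by
    refine (lintegral_mono hpt).trans ?_
    rw [lintegral_const_mul' _ _ (ENNReal.mul_ne_top (by simp) hV), hfub]
    exact le_of_eq (by ring)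
  rw [eLpNorm_eq_lintegral_rpow_enorm_toReal (by norm_num) (by norm_num), eLpNorm_eq_lintegral_rpow_enorm_toReal (by norm_num) (by norm_num)]
  have := ENNReal.rpow_le_rpow hsq (z := 1 / 2) (by norm_num)
  rw [ENNReal.mul_rpow_of_nonneg _ _ (by norm_num), ← ENNReal.rpow_natCast, ← ENNReal.rpow_mul] at this
  simpa using this

/-- With the centre frozen the kernel is a translate and dilate of ζ, and s⁻³ is the Jacobian. With
the centre depending on y this would fail, which is why the convergence proof compares with the
frozen kernel. -/
lemma integral_kernel {s : ℝ} (hs : 0 < s) (x w : E3) :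
    ∫ y, s⁻¹ ^ 3 * ζ (s⁻¹ • (x - y) - w) = ∫ z, ζ z := by
  rw [integral_sub_left_eq_self (fun y => s⁻¹ ^ 3 * ζ (s⁻¹ • y - w)) volume x,
    integral_const_mul, Measure.integral_comp_smul volume (fun y => ζ (y - w)),
    integral_sub_right_eq_self]
  simp only [finrank_euclideanSpace, Fintype.card_fin, smul_eq_mul]
  rw [abs_of_pos (by positivity)]
  field_simp

/-- On continuous functions with compact support the averages converge. -/
lemma tendsto_smear_of_continuous (hX : Continuous X) (hXB : ∀ x, ‖X x‖ ≤ B) (hζ : Continuous ζ)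
    (hζr : ∀ z, ζ z ≠ 0 → ‖z‖ ≤ r) (hM : ∀ z, |ζ z| ≤ M) (hrB : 0 ≤ r + B) {g : E3 → E3}
    (hg : Continuous g) (hgc : HasCompactSupport g) :
    Tendsto (fun s => eLpNorm (smear X ζ s g - (∫ z, ζ z) • g) 2 volume) (𝓝[>] 0) (𝓝 0) := by
  set L := r + B
  set V : ℝ := (L ^ 3) * (volume (Metric.ball (0 : E3) 1)).toReal
  have hV0 : 0 ≤ V := by positivity
  have hgL : MemLp g 2 := hg.memLp_of_hasCompactSupport hgc
  obtain ⟨R, hR⟩ := hgc.isCompact.isBounded.subset_closedBall (0 : E3)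
  have hg0 : ∀ y, g y ≠ 0 → ‖y‖ ≤ R := fun y hy => by
    simpa using hR (subset_tsupport g hy)
  -- Both the centre X y and the value g y are to be replaced by their values at x. Uniform
  -- continuity in the pair makes this cost at most ε as soon as sL < δ, for all x at once.
  have huc : UniformContinuous fun p : E3 × E3 => ζ (p.1 - X p.2) • g p.2 := by
    refine Continuous.uniformContinuous_of_tendsto_cocompact (x := 0) (by fun_prop) ?_
    refine (HasCompactSupport.intro (K := Metric.closedBall 0 L ×ˢ Metric.closedBall 0 R)
      ((isCompact_closedBall _ _).prod (isCompact_closedBall _ _)) ?_).is_zero_at_infty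
    rintro ⟨z, y⟩ hzy
    by_contra h
    apply hzy
    have h1 : ζ (z - X y) ≠ 0 := fun h' => h (by simp [h'])
    have h2 : g y ≠ 0 := fun h' => h (by simp [h'])
    refine ⟨?_, by simpa using hg0 y h2⟩
    simp only [mem_closedBall_zero_iff]
    calc ‖z‖ = ‖(z - X y) + X y‖ := by simp
      _ ≤ r + B := (norm_add_le _ _).trans (add_le_add (hζr _ h1) (hXB y))
  -- For s ≤ 1 the error is supported in one fixed ball, so uniform convergence implies convergence
  -- in L².
  have hgint : ∀ s : ℝ, 0 < s → ∀ x, ‖smear X ζ s g x - (∫ z, ζ z) • g x‖ₑ ≠ 0 → s ≤ 1 →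
      ‖x‖ ≤ R + L := by
    intro s hs x hx hs1
    by_contra hxR
    apply hx
    have h1 : g x = 0 := by
      by_contra h
      have := hg0 x h
      linarith
    have h2 : smear X ζ s g x = 0 := by
      unfold smear
      refine integral_eq_zero_of_ae (Eventually.of_forall fun y => ?_)
      by_contra h
      have h3 : ζ (s⁻¹ • (x - y) - X y) ≠ 0 := fun h' => h (by simp [h'])
      have h4 : g y ≠ 0 := fun h' => h (by simp [h'])
      have h5 := norm_sub_le_of_kernel_ne_zero hXB hζr hs h3
      have h6 := hg0 y h4
      have h7 : s * L ≤ L := mul_le_of_le_one_left hrB hs1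
      have : ‖x‖ ≤ ‖x - y‖ + ‖y‖ := by simpa using norm_add_le (x - y) y
      linarith
    simp [h1, h2]
  set W : ℝ≥0∞ := volume (Metric.closedBall (0 : E3) (R + L)) ^ ((1 : ℝ) / 2)
  have hW : W ≠ ⊤ := by
    refine ENNReal.rpow_ne_top_of_nonneg (by norm_num) measure_closedBall_lt_top.ne
  have main : ∀ ε > 0, ∀ᶠ s in 𝓝[>] (0 : ℝ), ∀ x,
      ‖smear X ζ s g x - (∫ z, ζ z) • g x‖ ≤ ε * V := by
    intro ε hε
    obtain ⟨δ, hδ, hδ'⟩ := Metric.uniformContinuous_iff.1 huc ε hε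
    have h0 : ∀ᶠ s in 𝓝[>] (0 : ℝ), s * L < δ := by
      have : Tendsto (fun s : ℝ => s * L) (𝓝 0) (𝓝 (0 * L)) := tendsto_id.mul_const L
      exact (this.mono_left nhdsWithin_le_nhds).eventually_lt_const (by simpa using hδ)
    filter_upwards [h0, self_mem_nhdsWithin] with s hsδ hs x
    have hs : 0 < s := hs
    have hi1 := integrable_smear hX hXB hζ hζr hM hs hgL x
    have hi2 : Integrable (fun y => (s⁻¹ ^ 3 * ζ (s⁻¹ • (x - y) - X x)) • g x) := by
      refine Integrable.smul_const ?_ (g x)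
      refine Continuous.integrable_of_hasCompactSupport (by fun_prop) ?_
      refine HasCompactSupport.intro (isCompact_closedBall x (s * L)) fun y hy => ?_
      by_contra h
      apply hy
      rw [mem_closedBall_iff_norm, norm_sub_rev]
      exact norm_sub_le_of_kernel_ne_zero hXB hζr hs (w := x) fun h' => h (by simp [h'])
    have e1 : (∫ z, ζ z) • g x = ∫ y, (s⁻¹ ^ 3 * ζ (s⁻¹ • (x - y) - X x)) • g x := by
      rw [integral_smul_const, integral_kernel hs]
    rw [e1, smear, ← integral_sub hi1 hi2]
    have e2 : ∫ y, ((s⁻¹ ^ 3 * ζ (s⁻¹ • (x - y) - X y)) • g y -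
        (s⁻¹ ^ 3 * ζ (s⁻¹ • (x - y) - X x)) • g x) =
        ∫ y in Metric.closedBall x (s * L), ((s⁻¹ ^ 3 * ζ (s⁻¹ • (x - y) - X y)) • g y -
        (s⁻¹ ^ 3 * ζ (s⁻¹ • (x - y) - X x)) • g x) := by
      symm
      refine setIntegral_eq_integral_of_forall_compl_eq_zero fun y hy => ?_
      have hz : ∀ w, ζ (s⁻¹ • (x - y) - X w) = 0 := fun w => by
        by_contra h
        apply hy
        rw [mem_closedBall_iff_norm, norm_sub_rev]
        exact norm_sub_le_of_kernel_ne_zero hXB hζr hs h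
      simp [hz]
    rw [e2]
    refine (norm_setIntegral_le_of_norm_le_const (C := s⁻¹ ^ 3 * ε) measure_closedBall_lt_top
      fun y hy => ?_).trans (le_of_eq ?_)
    · have := hδ' (a := (s⁻¹ • (x - y), y)) (b := (s⁻¹ • (x - y), x)) (by
        rw [Prod.dist_eq]
        simpa [hδ] using (Metric.mem_closedBall.1 hy).trans_lt hsδ)
      rw [mul_smul, mul_smul, ← smul_sub, norm_smul, Real.norm_of_nonneg (by positivity)]
      gcongr
      rw [dist_eq_norm] at this
      exact this.le
    · rw [measureReal_def, Measure.addHaar_closedBall _ _ (by positivity), ENNReal.toReal_mul,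
        ENNReal.toReal_ofReal (by positivity)]
      simp only [finrank_euclideanSpace, Fintype.card_fin, V]
      field_simp
  rw [ENNReal.tendsto_nhds_zero]
  intro ε hε
  by_cases hεt : ε = ⊤
  · simp [hεt]
  obtain ⟨ε', hε', hlt⟩ : ∃ ε' : ℝ, 0 < ε' ∧ ENNReal.ofReal (ε' * V) * W ≤ ε := by
    have hc : Tendsto (fun e : ℝ => ENNReal.ofReal (e * V) * W) (𝓝[>] 0) (𝓝 (ENNReal.ofReal (0 * V) * W)) := by
      refine ENNReal.Tendsto.mul_const ?_ (Or.inr hW)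
      exact ENNReal.tendsto_ofReal ((tendsto_id.mono_left nhdsWithin_le_nhds).mul_const V)
    have hc' : Tendsto (fun e : ℝ => ENNReal.ofReal (e * V) * W) (𝓝[>] 0) (𝓝 0) := by simpa using hc
    have h1 := (ENNReal.tendsto_nhds_zero.1 hc') ε hε
    obtain ⟨e, he1, he2⟩ := (h1.and self_mem_nhdsWithin).exists
    exact ⟨e, he2, he1⟩
  have hle1 : ∀ᶠ s in 𝓝[>] (0 : ℝ), s ≤ 1 :=
    nhdsWithin_le_nhds (Iic_mem_nhds one_pos)
  filter_upwards [main ε' hε', self_mem_nhdsWithin, hle1] with s hs hs0 hs1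
  have hsupp : Function.support (smear X ζ s g - (∫ z, ζ z) • g) ⊆ Metric.closedBall 0 (R + L) := by
    intro x hx
    rw [mem_closedBall_zero_iff]
    exact hgint s hs0 x (by simpa using hx) hs1
  rw [← eLpNorm_restrict_eq_of_support_subset hsupp]
  refine (eLpNorm_le_of_ae_bound (C := ε' * V) (Eventually.of_forall fun x => ?_)).trans ?_
  · simpa using hs x
  · rw [mul_comm]
    simpa [W] using hlt

/-- The averages converge in `L²`. -/
lemma tendsto_smear (hX : Continuous X) (hXB : ∀ x, ‖X x‖ ≤ B) (hζ : Continuous ζ)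
    (hζr : ∀ z, ζ z ≠ 0 → ‖z‖ ≤ r) (hM : ∀ z, |ζ z| ≤ M) (hrB : 0 ≤ r + B) {g : E3 → E3}
    (hg : MemLp g 2) :
    Tendsto (fun s => eLpNorm (smear X ζ s g - (∫ z, ζ z) • g) 2 volume) (𝓝[>] 0) (𝓝 0) := by
  obtain ⟨K, hK⟩ := exists_eLpNorm_smear_le hXB hζr hM hrB
  set I := ∫ z, ζ z
  rw [ENNReal.tendsto_nhds_zero]
  intro ε hε
  -- If g is replaced by k, the error changes by at most (K + |I|) times the L² distance of g and k.
  -- The added 1 only makes A nonzero, so that one can divide by it.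
  set A : ℝ≥0∞ := K + ‖I‖ₑ + 1
  have hA : A ≠ ⊤ := by simp [A]
  have hA0 : A ≠ 0 := by simp [A]
  obtain ⟨k, hk1, hk2, hk3, hk4⟩ := hg.exists_hasCompactSupport_eLpNorm_sub_le (by norm_num)
    (ε := ε / 2 / A) (by simp [hA, hε.ne'])
  filter_upwards [(ENNReal.tendsto_nhds_zero.1
    (tendsto_smear_of_continuous hX hXB hζ hζr hM hrB hk3 hk1)) (ε / 2) (by simpa using hε.ne'),
    self_mem_nhdsWithin] with s hs hs0
  have hs0 : 0 < s := hs0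
  have hsub : smear X ζ s g - I • g = smear X ζ s (g - k) + ((smear X ζ s k - I • k) - I • (g - k)) := by
    ext1 x
    have : smear X ζ s (g - k) x = smear X ζ s g x - smear X ζ s k x := by
      simp only [smear, Pi.sub_apply]
      simp only [smul_sub (_ : ℝ) (g _)]
      exact integral_sub (integrable_smear hX hXB hζ hζr hM hs0 hg x)
        (integrable_smear hX hXB hζ hζr hM hs0 hk4 x)
    simp only [Pi.sub_apply, Pi.add_apply, Pi.smul_apply, this, smul_sub]
    abel
  have m1 := aestronglyMeasurable_smear hX hζ s (hg.sub hk4)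
  have m2 := aestronglyMeasurable_smear hX hζ s hk4
  rw [hsub]
  calc eLpNorm (smear X ζ s (g - k) + ((smear X ζ s k - I • k) - I • (g - k))) 2 volume
      ≤ eLpNorm (smear X ζ s (g - k)) 2 volume + (eLpNorm (smear X ζ s k - I • k) 2 volume +
          eLpNorm (I • (g - k)) 2 volume) := by
        refine (eLpNorm_add_le m1 ((m2.sub (hk4.1.const_smul I)).sub
          ((hg.1.sub hk4.1).const_smul I)) (by norm_num)).trans ?_
        gcongr
        exact eLpNorm_sub_le (m2.sub (hk4.1.const_smul I)) ((hg.1.sub hk4.1).const_smul I) (by norm_num)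
    _ ≤ K * eLpNorm (g - k) 2 volume + (ε / 2 + ‖I‖ₑ * eLpNorm (g - k) 2 volume) := by
        gcongr
        · exact hK s hs0 _ (hg.sub hk4)
        · exact (eLpNorm_const_smul _ _ _ _).le
    _ = (K + ‖I‖ₑ) * eLpNorm (g - k) 2 volume + ε / 2 := by ring
    _ ≤ A * (ε / 2 / A) + ε / 2 := by
        gcongr
        simp [A]
    _ = ε := by
        rw [ENNReal.mul_div_cancel hA0 hA, ENNReal.add_halves]

end Smear

end SuitableNS

namespace SuitableNS

/-! ### Smoothness of averages -/

section Kernel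

variable {E : Type} [NormedAddCommGroup E] [NormedSpace ℝ E] [MeasurableSpace E] [BorelSpace E]
  [SecondCountableTopology E] {Φ : E → E} {g : E → ℝ} {μ : Measure E} {F : Type}
  [NormedAddCommGroup F] [NormedSpace ℝ F]

/-- The derivative is an integral of the same form, with kernel l • fderiv ζ, so it can be iterated.
This is why the kernel is vector-valued and why E and F live in the same universe: the next target
space is E →L[ℝ] F. -/
lemma hasFDerivAt_integral_kernel (hΦ : Continuous Φ) (hg : Integrable g μ) (l : ℝ)
    {ζ : E → F} (hζ : ContDiff ℝ ∞ ζ) (hc : HasCompactSupport ζ) (x : E) :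
    HasFDerivAt (fun x => ∫ y, g y • ζ (l • x - Φ y) ∂μ)
      (∫ y, g y • (l • fderiv ℝ ζ (l • x - Φ y)) ∂μ) x := by
  have hcζ := hζ.continuous
  have hcd : Continuous (fderiv ℝ ζ) := hζ.continuous_fderiv (n := ∞) (by simp)
  have hdc : HasCompactSupport (fderiv ℝ ζ) := hc.fderiv (𝕜 := ℝ)
  obtain ⟨M, hM⟩ := hc.exists_bound_of_continuous hcζ
  obtain ⟨M', hM'⟩ := hdc.exists_bound_of_continuous hcd
  have hmeas : ∀ x, AEStronglyMeasurable (fun y => g y • ζ (l • x - Φ y)) μ := fun x =>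
    hg.1.smul (by fun_prop : Continuous fun y => ζ (l • x - Φ y)).aestronglyMeasurable
  refine hasFDerivAt_integral_of_dominated_of_fderiv_le (𝕜 := ℝ)
    (F := fun x y => g y • ζ (l • x - Φ y))
    (F' := fun x y => g y • (l • fderiv ℝ ζ (l • x - Φ y)))
    (bound := fun y => ‖g y‖ * (|l| * M')) univ_mem (Eventually.of_forall hmeas) ?_ ?_ ?_ ?_ ?_
  · refine (hg.norm.mul_const M).mono' (hmeas x) (Eventually.of_forall fun y => ?_)
    rw [norm_smul]
    gcongr
    exact hM _
  · exact hg.1.smul (by fun_prop : Continuous fun y =>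
      l • fderiv ℝ ζ (l • x - Φ y)).aestronglyMeasurable
  · refine Eventually.of_forall fun y x _ => ?_
    rw [norm_smul, norm_smul, Real.norm_eq_abs l]
    gcongr
    exact hM' _
  · exact hg.norm.mul_const _
  · refine Eventually.of_forall fun y x _ => ?_
    have h1 : HasFDerivAt (fun x : E => l • x - Φ y) (l • ContinuousLinearMap.id ℝ E) x :=
      ((hasFDerivAt_id x).const_smul l).sub_const _
    have h2 := ((hζ.differentiable (by simp) (l • x - Φ y)).hasFDerivAt.comp x h1).const_smul (g y)
    refine h2.congr_fderiv ?_
    ext v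
    simp

lemma contDiff_integral_kernel (hΦ : Continuous Φ) (hg : Integrable g μ) (l : ℝ)
    {ζ : E → F} (hζ : ContDiff ℝ ∞ ζ) (hc : HasCompactSupport ζ) :
    ContDiff ℝ ∞ (fun x => ∫ y, g y • ζ (l • x - Φ y) ∂μ) := by
  refine contDiff_infty.2 fun n => ?_
  induction n generalizing F with
  | zero =>
    refine contDiff_zero.2 ?_
    -- The induction generalizes over the target space F, since each step replaces ζ by its
    -- derivative.
    exact continuous_iff_continuousAt.2 fun x =>
      (hasFDerivAt_integral_kernel hΦ hg l hζ hc x).continuousAt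
  | succ n ih =>
    have hder := fun x => hasFDerivAt_integral_kernel hΦ hg l hζ hc x
    push_cast
    refine contDiff_succ_iff_fderiv.2 ⟨fun x => (hder x).differentiableAt, by simp, ?_⟩
    have e : fderiv ℝ (fun x => ∫ y, g y • ζ (l • x - Φ y) ∂μ) =
        fun x => ∫ y, g y • (fun z => l • fderiv ℝ ζ z) (l • x - Φ y) ∂μ := by
      ext1 x
      rw [(hder x).fderiv]
    rw [e]
    exact ih ((hζ.fderiv_right (m := ∞) (by simp)).const_smul l) ((hc.fderiv (𝕜 := ℝ)).smul_left (f := fun _ => l))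

end Kernel

/-! ### A vector field pointing into the domain -/

/-- The field is -∇ρ, cut off far away from D. At the boundary ρ decreases along it at the rate
|∇ρ|² > 0, which by compactness leaves room for perturbations ζ of a fixed size c. In the interior a
short step does no harm. -/
lemma IsSmoothBoundedDomain.exists_inward {D : Set E3} (hD : IsSmoothBoundedDomain D) :
    ∃ X : E3 → E3, ContDiff ℝ ∞ X ∧ HasCompactSupport X ∧ ∃ c : ℝ, 0 < c ∧
      ∀ᶠ s in 𝓝[>] (0 : ℝ), ∀ y ∈ closure D, ∀ ζ : E3, ‖ζ‖ ≤ c → y + s • (X y + ζ) ∈ D := by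
  obtain ⟨ρ, hρ, hDρ, hreg⟩ := hD.smooth
  have hK : IsCompact (closure D) := hD.bounded.isCompact_closure
  obtain ⟨χ, hχs, hχc, hχ1⟩ : ∃ χ : E3 → ℝ, ContDiff ℝ ∞ χ ∧ HasCompactSupport χ ∧
      (∀ y ∈ closure D, χ y = 1) := by
    obtain ⟨R, hR⟩ := hD.bounded.closure.subset_closedBall (0 : E3)
    -- The maximum with 1 ensures a positive inner radius.
    let b : ContDiffBump (0 : E3) := ⟨max R 1, max R 1 + 1, by positivity, by linarith⟩
    exact ⟨b, b.contDiff, b.hasCompactSupport, fun y hy => b.one_of_mem_closedBall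
      (Metric.closedBall_subset_closedBall (le_max_left _ _) (hR hy))⟩
  set N : E3 → E3 := fun y => ∑ i, (fderiv ℝ ρ y (basisVec i)) • basisVec i
  have hN : ContDiff ℝ ∞ N := ContDiff.sum fun i _ =>
    ((hρ.fderiv_right (m := ∞) (by simp)).clm_apply contDiff_const).smul contDiff_const
  have hρN : ∀ y, fderiv ℝ ρ y (N y) = ∑ i, (fderiv ℝ ρ y (basisVec i)) ^ 2 := by
    intro y
    simp [N, sq]
  set X : E3 → E3 := fun y => -(χ y • N y)
  have hX : ContDiff ℝ ∞ X := (hχs.smul hN).neg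
  have hXc : HasCompactSupport X := by
    refine HasCompactSupport.neg ?_
    exact hχc.smul_right
  have hle : ∀ y ∈ closure D, ρ y ≤ 0 := by
    have : closure D ⊆ {y | ρ y ≤ 0} :=
      closure_minimal (by rw [hDρ]; exact fun y (hy : ρ y < 0) => hy.le)
        (isClosed_le hρ.continuous continuous_const)
    exact this
  have hneg : ∀ y ∈ closure D, ρ y = 0 → fderiv ℝ ρ y (X y) < 0 := by
    intro y hy hy0
    simp only [X, hχ1 y hy, one_smul, map_neg, hρN, neg_lt_zero]
    have hne := hreg y hy0
    obtain ⟨i, hi⟩ : ∃ i, fderiv ℝ ρ y (basisVec i) ≠ 0 := by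
      by_contra h
      push Not at h
      apply hne
      ext v
      rw [apply_eq_sum_basisVec]
      simp [h]
    exact Finset.sum_pos' (fun i _ => sq_nonneg _) ⟨i, Finset.mem_univ i, by positivity⟩
  have hcdρ : Continuous (fderiv ℝ ρ) := hρ.continuous_fderiv (by simp)
  have hcX : Continuous X := hX.continuous
  have hZ : IsCompact (closure D ∩ {y | ρ y = 0}) :=
    hK.inter_right (isClosed_eq hρ.continuous continuous_const)
  obtain ⟨c, hc0, hc⟩ : ∃ c : ℝ, 0 < c ∧ ∀ y ∈ closure D ∩ {y | ρ y = 0},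
      fderiv ℝ ρ y (X y) + c * ‖fderiv ℝ ρ y‖ < 0 := by
    have := hZ.eventually_forall_of_forall_eventually (x₀ := (0 : ℝ))
      (P := fun c y => fderiv ℝ ρ y (X y) + c * ‖fderiv ℝ ρ y‖ < 0) (by
        rintro y ⟨hy, hy0⟩
        have hcont : Continuous fun p : ℝ × E3 => fderiv ℝ ρ p.2 (X p.2) + p.1 * ‖fderiv ℝ ρ p.2‖ := by
          fun_prop
        exact (hcont.tendsto (0, y)).eventually_lt_const (by simpa using hneg y hy hy0))
    obtain ⟨c, h1, h2⟩ := ((this.filter_mono nhdsWithin_le_nhds).and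
      (self_mem_nhdsWithin : ∀ᶠ c in 𝓝[>] (0 : ℝ), c ∈ Ioi 0)).exists
    exact ⟨c, h2, h1⟩
  refine ⟨X, hX, hXc, c, hc0, ?_⟩
  have hKK : IsCompact (closure D ×ˢ Metric.closedBall (0 : E3) c) :=
    hK.prod (isCompact_closedBall _ _)
  -- Compactness of closure D times the ball of perturbations makes the admissible step size
  -- uniform. The conditions on s and on the base point are part of the predicate because a full
  -- neighbourhood also contains points outside closure D.
  have main := hKK.eventually_forall_of_forall_eventually (x₀ := (0 : ℝ))
      (P := fun s p => 0 < s → p.1 ∈ closure D → ρ (p.1 + s • (X p.1 + p.2)) < 0) (by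
    rintro ⟨y, ζ⟩ ⟨hy, hζ⟩
    simp only [mem_closedBall_zero_iff] at hζ hy
    rcases (hle y hy).lt_or_eq with hlt | heq
    · have hcont : Continuous fun q : ℝ × E3 × E3 => ρ (q.2.1 + q.1 • (X q.2.1 + q.2.2)) :=
        hρ.continuous.comp (by fun_prop)
      filter_upwards [(hcont.tendsto (0, y, ζ)).eventually_lt_const (u := 0) (by simpa using hlt)]
        with q hq _ _ using hq
    · have hcont : Continuous fun q : ℝ × E3 × E3 =>
          fderiv ℝ ρ (q.2.1 + q.1 • (X q.2.1 + q.2.2)) (X q.2.1 + q.2.2) :=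
        (hcdρ.comp (by fun_prop)).clm_apply (by fun_prop)
      have h0 : fderiv ℝ ρ y (X y + ζ) < 0 := by
        rw [map_add]
        have h1 := hc y ⟨hy, heq⟩
        have h2 := (le_abs_self _).trans ((fderiv ℝ ρ y).le_opNorm ζ)
        have h3 : ‖fderiv ℝ ρ y‖ * ‖ζ‖ ≤ c * ‖fderiv ℝ ρ y‖ := by
          rw [mul_comm]; gcongr
        linarith
      have hev := (hcont.tendsto (0, y, ζ)).eventually_lt_const (u := 0) (by simpa using h0)
      rw [nhds_prod_eq, eventually_prod_iff] at hev
      obtain ⟨pa, hpa, pb, hpb, hab⟩ := hev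
      obtain ⟨δ, hδ, hδ'⟩ := Metric.eventually_nhds_iff.1 hpa
      rw [nhds_prod_eq, eventually_prod_iff]
      refine ⟨fun s => dist s 0 < δ, Metric.ball_mem_nhds 0 hδ, pb, hpb, ?_⟩
      rintro s hs ⟨y', ζ'⟩ hyζ hs0 hy'
      simp only at hy' ⊢
      have hder : ∀ σ, HasDerivAt (fun σ : ℝ => ρ (y' + σ • (X y' + ζ')))
          (fderiv ℝ ρ (y' + σ • (X y' + ζ')) (X y' + ζ')) σ := by
        intro σ
        have h1 : HasDerivAt (fun σ : ℝ => y' + σ • (X y' + ζ')) (X y' + ζ') σ := by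
          simpa using ((hasDerivAt_id σ).smul_const (X y' + ζ')).const_add y'
        exact (hρ.differentiable (by simp) _).hasFDerivAt.comp_hasDerivAt σ h1
      -- Near a boundary point ρ has negative slope along the whole short segment. As ρ ≤ 0 at its
      -- start, the mean value theorem makes ρ strictly negative at its end.
      obtain ⟨σ, hσ, hslope⟩ := exists_hasDerivAt_eq_slope (fun σ : ℝ => ρ (y' + σ • (X y' + ζ'))) _
        hs0 (fun σ _ => (hder σ).continuousAt.continuousWithinAt) (fun σ _ => hder σ)
      have hneg' := hab (hδ' (y := σ) (by
        rw [Real.dist_eq, sub_zero] at hs ⊢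
        rw [abs_of_pos hσ.1]
        rw [abs_of_pos hs0] at hs
        linarith [hσ.2])) hyζ
      simp only at hneg'
      rw [hslope, div_neg_iff] at hneg'
      have := hle y' hy'
      simp only [zero_smul, add_zero, sub_zero] at hneg'
      rcases hneg' with h | h
      · linarith [h.2]
      · linarith [h.1])
  filter_upwards [main.filter_mono nhdsWithin_le_nhds, self_mem_nhdsWithin] with s hs hs0 y hy ζ hζ
  rw [hDρ]
  exact hs (y, ζ) ⟨hy, by simpa using hζ⟩ hs0 hy

end SuitableNS

/-! ### Density of compactly supported solenoidal fields -/

namespace SuitableNS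

variable {D : Set E3}

/-- The defining property of the weak gradient of an `H¹₀` function. -/
lemma IsH10.integral_smul_grad (hD : IsSmoothBoundedDomain D) {w : E3 → E3} {G : Fin 3 → E3 → E3}
    (hw : IsH10 D w G) {β : E3 → ℝ} (hβ : ContDiff ℝ ∞ β) (i : Fin 3) :
    ∫ x in D, β x • G i x = -∫ x in D, fderiv ℝ β x (basisVec i) • w x := by
  have := hD.isFiniteMeasure
  obtain ⟨φ, hφ⟩ := hw.exists_approx
  have hdβ : ContDiff ℝ ∞ fun x => fderiv ℝ β x (basisVec i) :=
    (hβ.fderiv_right (m := ∞) (by simp)).clm_apply contDiff_const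
  have m1 : ∀ c : E3, MemLp (fun x => β x • c) 2 (volume.restrict D) := fun c =>
    memLp_continuous_smul hD hβ.continuous (memLp_const c)
  have m2 : ∀ c : E3, MemLp (fun x => fderiv ℝ β x (basisVec i) • c) 2 (volume.restrict D) :=
    fun c => memLp_continuous_smul hD hdβ.continuous (memLp_const c)
  have i1 : Integrable (fun x => β x • G i x) (volume.restrict D) :=
    (memLp_continuous_smul hD hβ.continuous (hw.memLp_grad i)).integrable (by norm_num)
  have i2 : Integrable (fun x => fderiv ℝ β x (basisVec i) • w x) (volume.restrict D) :=
    (memLp_continuous_smul hD hdβ.continuous hw.memLp).integrable (by norm_num)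
  -- Pairing with a constant vector c reduces the vector identity to scalar ones. These pass to the
  -- limit from test fields, where they say that a derivative of a compactly supported function has
  -- integral zero.
  refine ext_inner_left ℝ fun c => ?_
  rw [inner_neg_right, ← integral_inner i1, ← integral_inner i2]
  have e1 : ∀ (b : ℝ) (y : E3), inner ℝ c (b • y) = inner ℝ (b • c) y := fun b y => by
    rw [inner_smul_left, inner_smul_right]; simp
  simp_rw [e1]
  have l1 := tendsto_integral_inner (p := 2) (q := 2) (by norm_num)
    (fun _ => m1 c) (fun n => ((hφ.test n).fderiv_apply (basisVec i)).memLp 2) (m1 c)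
    (hw.memLp_grad i) (by simp) (hφ.tendsto_grad i)
  have l2 := (tendsto_integral_inner (p := 2) (q := 2) (by norm_num)
    (fun _ => m2 c) (fun n => (hφ.test n).memLp 2) (m2 c) hw.memLp (by simp) hφ.tendsto).neg
  refine tendsto_nhds_unique l1 (l2.congr fun n => ?_)
  have j1 := integrable_inner_of_memLp (p := 2) (q := 2) (m1 c)
    (((hφ.test n).fderiv_apply (basisVec i)).memLp 2)
  have j2 := integrable_inner_of_memLp (p := 2) (q := 2) (m2 c) ((hφ.test n).memLp 2)
  rw [neg_eq_iff_add_eq_zero, ← integral_add j2 j1]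
  have htest : IsTestFunction D (fun x => β x * inner ℝ c (φ n x)) := by
    refine ⟨hβ.mul (contDiff_const.inner ℝ (hφ.test n).smooth),
      (hφ.test n).compact.mono' ?_, (closure_minimal ?_ isClosed_closure).trans (hφ.test n).support⟩
    all_goals
      refine Function.support_subset_iff.2 fun x hx => subset_tsupport _ ?_
      intro h
      apply hx
      simp [h]
  rw [← integral_fderiv_test htest (basisVec i)]
  refine integral_congr_ae (Eventually.of_forall fun x => ?_)
  have d1 := (hasFDerivAt_const c x).inner ℝ ((hφ.test n).hasFDerivAt x)
  have d2 := ((hβ.differentiable (by simp) x).hasFDerivAt).fun_mul d1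
  simp only
  rw [d2.fderiv]
  simp [fderivInnerCLM_apply, inner_smul_left]
  ring

section Derivative

variable {X : E3 → E3} {η : E3 → ℝ} {B r M : ℝ}

lemma smear_apply (hX : Continuous X) (hXB : ∀ x, ‖X x‖ ≤ B) (hζ : Continuous η)
    (hζr : ∀ z, η z ≠ 0 → ‖z‖ ≤ r) (hM : ∀ z, |η z| ≤ M) {s : ℝ} (hs : 0 < s) {g : E3 → E3}
    (hg : MemLp g 2) (x : E3) (i : Fin 3) :
    smear X η s g x i = ∫ y, (s⁻¹ ^ 3 * g y i) • η (s⁻¹ • x - (s⁻¹ • y + X y)) := by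
  have := (EuclideanSpace.proj (𝕜 := ℝ) i).integral_comp_comm
    (integrable_smear hX hXB hζ hζr hM hs hg x)
  simp only [smear]
  change (EuclideanSpace.proj (𝕜 := ℝ) i) (∫ y, (s⁻¹ ^ 3 * η (s⁻¹ • (x - y) - X y)) • g y) = _
  rw [← this]
  refine integral_congr_ae (Eventually.of_forall fun y => ?_)
  simp only [map_smul, smul_sub, sub_sub, smul_eq_mul]
  simp only [PiLp.proj_apply]
  ring

lemma contDiff_smear (hX : Continuous X) (hXB : ∀ x, ‖X x‖ ≤ B) (hη : ContDiff ℝ ∞ η)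
    (hηc : HasCompactSupport η)
    (hζr : ∀ z, η z ≠ 0 → ‖z‖ ≤ r) (hM : ∀ z, |η z| ≤ M) {s : ℝ} (hs : 0 < s) {g : E3 → E3}
    (hg : MemLp g 2) (hg1 : Integrable g) : ContDiff ℝ ∞ (smear X η s g) := by
  rw [contDiff_euclidean]
  intro i
  simp_rw [smear_apply hX hXB hη.continuous hζr hM hs hg]
  have : Integrable (fun y => g y i) := memLp_one_iff_integrable.1
    (memLp_apply (memLp_one_iff_integrable.2 hg1) i)
  exact contDiff_integral_kernel (by fun_prop) (this.const_mul _) _ hη hηc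

/-- The centre of the kernel depends on y and not on x, so differentiation in x only meets the
scaled argument and costs one factor s⁻¹. -/
lemma fderiv_smear (hX : Continuous X) (hXB : ∀ x, ‖X x‖ ≤ B) (hη : ContDiff ℝ ∞ η)
    (hηc : HasCompactSupport η) (hζr : ∀ z, η z ≠ 0 → ‖z‖ ≤ r) (hM : ∀ z, |η z| ≤ M) {M' : ℝ}
    (hM' : ∀ z, ‖fderiv ℝ η z‖ ≤ M')
    (hζr' : ∀ z, fderiv ℝ η z ≠ 0 → ‖z‖ ≤ r) {s : ℝ} (hs : 0 < s) {g : E3 → E3}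
    (hg : MemLp g 2) (hg1 : Integrable g) (x : E3) (j : Fin 3) :
    fderiv ℝ (smear X η s g) x (basisVec j) =
      s⁻¹ • smear X (fun z => fderiv ℝ η z (basisVec j)) s g x := by
  have hcd : Continuous (fderiv ℝ η) := hη.continuous_fderiv (by simp)
  have hdiff : DifferentiableAt ℝ (smear X η s g) x :=
    (contDiff_smear hX hXB hη hηc hζr hM hs hg hg1).differentiable (by simp) x
  ext i
  have h1 : (fderiv ℝ (smear X η s g) x (basisVec j)) i =
      fderiv ℝ (fun x => smear X η s g x i) x (basisVec j) := by
    have := ((EuclideanSpace.proj (𝕜 := ℝ) i).hasFDerivAt.comp x hdiff.hasFDerivAt).fderiv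
    exact (congrArg (fun A : E3 →L[ℝ] ℝ => A (basisVec j)) this).symm
  have hgi : Integrable (fun y => g y i) := memLp_one_iff_integrable.1
    (memLp_apply (memLp_one_iff_integrable.2 hg1) i)
  have hr0 : ∀ z, (fun z => fderiv ℝ η z (basisVec j)) z ≠ 0 → ‖z‖ ≤ r := fun z hz =>
    hζr' z fun h => hz (by simp [h])
  have hM0 : ∀ z, |fderiv ℝ η z (basisVec j)| ≤ M' := fun z =>
    ((fderiv ℝ η z).le_opNorm _).trans (by rw [norm_basisVec, mul_one]; exact hM' z)
  rw [h1]
  simp_rw [smear_apply hX hXB hη.continuous hζr hM hs hg]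
  rw [(hasFDerivAt_integral_kernel (by fun_prop) (hgi.const_mul _) _ hη hηc x).fderiv,
    ContinuousLinearMap.integral_apply]
  · rw [PiLp.smul_apply, smear_apply hX hXB (by fun_prop) hr0 hM0 hs hg, ← integral_smul]
    refine integral_congr_ae (Eventually.of_forall fun y => ?_)
    simp
    ring
  · refine ((hgi.const_mul (s⁻¹ ^ 3)).norm.mul_const (|s⁻¹| * M')).mono' ?_
      (Eventually.of_forall fun y => ?_)
    · exact (hgi.const_mul _).1.smul (by fun_prop : Continuous fun y =>
        s⁻¹ • fderiv ℝ η (s⁻¹ • x - (s⁻¹ • y + X y))).aestronglyMeasurable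
    · rw [norm_smul, norm_smul s⁻¹, Real.norm_eq_abs s⁻¹]
      gcongr
      exact hM' _

end Derivative

end SuitableNS

namespace SuitableNS

variable {D : Set E3}

lemma tendsto_eLpNorm_of_le_add {α : Type*} {m : MeasurableSpace α} {μ : Measure α} {ι : Type*}
    {l : Filter ι} {a b : ι → α → E3} (ha : ∀ᶠ s in l, AEStronglyMeasurable (a s) μ)
    (hb : ∀ᶠ s in l, AEStronglyMeasurable (b s) μ)
    (h1 : Tendsto (fun s => eLpNorm (a s) 2 μ) l (𝓝 0))
    (h2 : Tendsto (fun s => eLpNorm (b s) 2 μ) l (𝓝 0)) :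
    Tendsto (fun s => eLpNorm (a s + b s) 2 μ) l (𝓝 0) := by
  refine tendsto_of_tendsto_of_tendsto_of_le_of_le' tendsto_const_nhds
    (by simpa using h1.add h2) (Eventually.of_forall fun _ => zero_le) ?_
  filter_upwards [ha, hb] with s h3 h4 using eLpNorm_add_le h3 h4 (by norm_num)

lemma smear_add_smul {X : E3 → E3} {ζ : E3 → ℝ} {B r M : ℝ} (hX : Continuous X)
    (hXB : ∀ x, ‖X x‖ ≤ B) (hζ : Continuous ζ)
    (hζr : ∀ z, ζ z ≠ 0 → ‖z‖ ≤ r) (hM : ∀ z, |ζ z| ≤ M) {s : ℝ} (hs : 0 < s) {g h : E3 → E3}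
    (hg : MemLp g 2) (hh : MemLp h 2) (t : ℝ) (x : E3) :
    smear X ζ s (g + t • h) x = smear X ζ s g x + t • smear X ζ s h x := by
  have i1 := integrable_smear hX hXB hζ hζr hM hs hg x
  have i2 := (integrable_smear hX hXB hζ hζr hM hs hh x).fun_smul t
  simp only [smear]
  rw [← integral_smul, ← integral_add i1 i2]
  refine integral_congr_ae (Eventually.of_forall fun y => ?_)
  simp only [Pi.add_apply, Pi.smul_apply, smul_add]
  rw [smul_comm]

/-- Smooth solenoidal fields with compact support in `D` are dense in `V`. -/
theorem exists_solenoidal_approx (hD : IsSmoothBoundedDomain D) {w : E3 → E3}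
    {G : Fin 3 → E3 → E3} (hH : MemH D w) (hw : IsH10 D w G) :
    ∃ φ : ℕ → E3 → E3, H10Approx D w G φ ∧
      ∀ n x, ∑ i, (fderiv ℝ (φ n) x (basisVec i)) i = 0 := by
  have hfin := hD.isFiniteMeasure
  have hDm : MeasurableSet D := hD.isOpen.measurableSet
  obtain ⟨X, hX, hXc, c, hc0, hcs⟩ := hD.exists_inward
  -- the kernel
  let bump : ContDiffBump (0 : E3) := ⟨c / 2, c, by positivity, by linarith⟩
  set η : E3 → ℝ := bump.normed volume
  have hη : ContDiff ℝ ∞ η := bump.contDiff_normed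
  have hηc : HasCompactSupport η := bump.hasCompactSupport_normed
  have hη1 : ∫ z, η z = 1 := bump.integral_normed
  have hηsupp : tsupport η ⊆ Metric.closedBall 0 c := (bump.tsupport_normed_eq (μ := volume)).le
  have hηr : ∀ z, η z ≠ 0 → ‖z‖ ≤ c := fun z hz => by
    simpa using hηsupp (subset_tsupport η hz)
  have hηr' : ∀ z, fderiv ℝ η z ≠ 0 → ‖z‖ ≤ c := fun z hz => by
    simpa using hηsupp (support_fderiv_subset ℝ hz)
  have hcd : Continuous (fderiv ℝ η) := hη.continuous_fderiv (by simp)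
  have hdc : HasCompactSupport (fderiv ℝ η) := hηc.fderiv (𝕜 := ℝ)
  obtain ⟨M, hM⟩ := hηc.exists_bound_of_continuous hη.continuous
  obtain ⟨M', hM'⟩ := hdc.exists_bound_of_continuous hcd
  obtain ⟨B, hXB⟩ := hXc.exists_bound_of_continuous hX.continuous
  have hB0 : 0 ≤ B := (norm_nonneg _).trans (hXB 0)
  have hXcont := hX.continuous
  have hcB : 0 ≤ c + B := by positivity
  set dη : Fin 3 → E3 → ℝ := fun i z => fderiv ℝ η z (basisVec i)
  have hdη : ∀ i, Continuous (dη i) := fun i => by fun_prop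
  have hdηr : ∀ i z, dη i z ≠ 0 → ‖z‖ ≤ c := fun i z hz => hηr' z fun h => hz (by simp [dη, h])
  have hdηM : ∀ i z, |dη i z| ≤ M' := fun i z =>
    ((fderiv ℝ η z).le_opNorm _).trans (by rw [norm_basisVec, mul_one]; exact hM' z)
  have hdη0 : ∀ i, ∫ z, dη i z = 0 := fun i => by
    have : IsTestFunction univ η := ⟨hη, hηc, subset_univ _⟩
    simpa using integral_fderiv_test this (basisVec i)
  -- the fields
  have hind : ∀ {g : E3 → E3}, MemLp g 2 (volume.restrict D) → MemLp (D.indicator g) 2 volume :=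
    fun hg => (memLp_indicator_iff_restrict hDm).2 hg
  have hXd : Continuous (fderiv ℝ X) := hX.continuous_fderiv (by simp)
  obtain ⟨B', hXB'⟩ := (hXc.fderiv (𝕜 := ℝ)).exists_bound_of_continuous hXd
  have hDXw : MemLp (fun y => fderiv ℝ X y (w y)) 2 (volume.restrict D) := by
    refine hw.memLp.of_le_mul (c := B') (isBoundedBilinearMap_apply.continuous.comp_aestronglyMeasurable
      (hXd.aestronglyMeasurable.prodMk hw.memLp.1)) (Eventually.of_forall fun y => ?_)
    exact ((fderiv ℝ X y).le_opNorm _).trans (by gcongr; exact hXB' y)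
  have hXkw : ∀ k i, MemLp (fun y => (fderiv ℝ X y (basisVec i)) k • w y) 2 (volume.restrict D) :=
    fun k i => memLp_continuous_smul hD (by fun_prop) hw.memLp
  set w0 := D.indicator w
  set dw := D.indicator fun y => fderiv ℝ X y (w y)
  set G0 : Fin 3 → E3 → E3 := fun i => D.indicator (G i)
  set xw : Fin 3 → Fin 3 → E3 → E3 := fun k i =>
    D.indicator fun y => (fderiv ℝ X y (basisVec i)) k • w y
  have hw0 : MemLp w0 2 volume := hind hw.memLp
  have hdw : MemLp dw 2 volume := hind hDXw
  have hG0 : ∀ i, MemLp (G0 i) 2 volume := fun i => hind (hw.memLp_grad i)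
  have hxw : ∀ k i, MemLp (xw k i) 2 volume := fun k i => hind (hXkw k i)
  have hg : ∀ s : ℝ, MemLp (w0 + s • dw) 2 volume := fun s => hw0.add (hdw.const_smul s)
  have hg1 : ∀ s : ℝ, Integrable (w0 + s • dw) volume := by
    intro s
    refine Integrable.add ?_ (Integrable.smul s ?_)
    · exact (integrable_indicator_iff hDm).2 (hw.memLp.integrable (by norm_num))
    · exact (integrable_indicator_iff hDm).2 (hDXw.integrable (by norm_num))
  -- The map y ↦ y + s X(y) has derivative v ↦ v + s DX(y)v, and w is transported by it before
  -- averaging. The derivative of the kernel in x along w + s DX w is then -s times s⁻¹ times its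
  -- derivative in y along w, up to the normalisation of ∂η, and this keeps the average solenoidal.
  set S : ℝ → E3 → E3 := fun s => smear X η s (w0 + s • dw)
  have hSadd : ∀ s, 0 < s → S s = smear X η s w0 + s • smear X η s dw := by
    intro s hs
    ext1 x
    exact smear_add_smul hXcont hXB hη.continuous hηr hM hs hw0 hdw s x
  have hkernel : ∀ (s : ℝ) (x : E3), ContDiff ℝ ∞ (fun y => s⁻¹ ^ 3 * η (s⁻¹ • (x - y) - X y)) :=
    fun s x => contDiff_const.mul (hη.comp
      (((contDiff_const.sub contDiff_id).const_smul _).sub hX))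
  have hkd : ∀ (s : ℝ) (x y v : E3),
      fderiv ℝ (fun y => s⁻¹ ^ 3 * η (s⁻¹ • (x - y) - X y)) y v =
      -(s⁻¹ ^ 3 * fderiv ℝ η (s⁻¹ • (x - y) - X y) (s⁻¹ • v + fderiv ℝ X y v)) := by
    intro s x y v
    have d1 : HasFDerivAt (fun y : E3 => s⁻¹ • (x - y) - X y)
        (s⁻¹ • (-(ContinuousLinearMap.id ℝ E3)) - fderiv ℝ X y) y :=
      (((hasFDerivAt_id y).const_sub x).const_smul s⁻¹).sub
        (hX.differentiable (by simp) y).hasFDerivAt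
    have d2 := ((hη.differentiable (by simp) _).hasFDerivAt.comp y d1).const_mul (s⁻¹ ^ 3)
    have d3 : fderiv ℝ (fun y => s⁻¹ ^ 3 * η (s⁻¹ • (x - y) - X y)) y = _ := d2.fderiv
    rw [d3]
    have : (s⁻¹ • (-(ContinuousLinearMap.id ℝ E3)) - fderiv ℝ X y) v =
        -(s⁻¹ • v + fderiv ℝ X y v) := by
      simp
      abel
    simp only [_root_.smul_apply, ContinuousLinearMap.comp_apply, this, map_neg, smul_eq_mul]
    ring
  -- the derivative
  have hdS : ∀ s, 0 < s → ∀ x i, fderiv ℝ (S s) x (basisVec i) =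
      s⁻¹ • smear X (dη i) s w0 x + smear X (dη i) s dw x := by
    intro s hs x i
    simp only [S]
    rw [fderiv_smear hXcont hXB hη hηc hηr hM hM' hηr' hs (hg s) (hg1 s)]
    change s⁻¹ • smear X (dη i) s (w0 + s • dw) x = _
    rw [smear_add_smul hXcont hXB (hdη i) (hdηr i) (hdηM i) hs hw0 hdw, smul_add,
      inv_smul_smul₀ hs.ne']
  have hsmearD : ∀ (ζ : E3 → ℝ) (s : ℝ) (g : E3 → E3) (x : E3), smear X ζ s (D.indicator g) x =
      ∫ y in D, (s⁻¹ ^ 3 * ζ (s⁻¹ • (x - y) - X y)) • g y := by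
    intro ζ s g x
    rw [smear, ← integral_indicator hDm]
    refine integral_congr_ae (Eventually.of_forall fun y => ?_)
    by_cases hy : y ∈ D <;> simp [hy]
  -- The singular factor s⁻¹ disappears by integration by parts. The kernel's derivative in y along
  -- the i-th axis is made of -s⁻¹ ∂ᵢη and of terms with ∂ₖη times the derivative of Xₖ. The zero
  -- boundary values of w throw the derivative onto G i.
  have hparts : ∀ s, 0 < s → ∀ x i, s⁻¹ • smear X (dη i) s w0 x =
      smear X η s (G0 i) x - ∑ k, smear X (dη k) s (xw k i) x := by
    intro s hs x i
    have h1 := hw.integral_smul_grad hD (hkernel s x) i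
    have h2 : smear X η s (G0 i) x = ∫ y in D, (s⁻¹ ^ 3 * η (s⁻¹ • (x - y) - X y)) • G i y :=
      hsmearD _ _ _ _
    have i1 := (integrable_smear hXcont hXB (hdη i) (hdηr i) (hdηM i) hs hw0 x).restrict (s := D)
    have i2 := fun k =>
      (integrable_smear hXcont hXB (hdη k) (hdηr k) (hdηM k) hs (hxw k i) x).restrict (s := D)
    have h3 : ∀ (ζ : E3 → ℝ) (g : E3 → E3), smear X ζ s (D.indicator g) x =
        ∫ y in D, (s⁻¹ ^ 3 * ζ (s⁻¹ • (x - y) - X y)) • D.indicator g y := by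
      intro ζ g
      rw [hsmearD]
      exact setIntegral_congr_fun hDm fun y hy => by simp [hy]
    rw [eq_sub_iff_add_eq, h2, h1, ← integral_neg]
    simp only [w0, xw, h3]
    rw [← integral_smul, ← integral_finsetSum _ fun k _ => i2 k,
      ← integral_add (i1.fun_smul s⁻¹) (integrable_finsetSum _ fun k _ => i2 k)]
    refine setIntegral_congr_fun hDm fun y hy => ?_
    simp only [hkd, w0, xw, indicator_of_mem hy, map_add]
    rw [apply_eq_sum_basisVec (fderiv ℝ η _) (fderiv ℝ X y (basisVec i))]
    simp only [Fin.sum_univ_three, map_smul, smul_eq_mul, dη]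
    module
  -- convergence
  have hpos : ∀ᶠ s in 𝓝[>] (0 : ℝ), 0 < s := self_mem_nhdsWithin
  have conv := fun {g : E3 → E3} (hg : MemLp g 2 volume) =>
    tendsto_smear hXcont hXB hη.continuous hηr hM hcB hg
  have dconv := fun (i : Fin 3) {g : E3 → E3} (hg : MemLp g 2 volume) =>
    tendsto_smear hXcont hXB (hdη i) (hdηr i) (hdηM i) hcB hg
  simp only [hη1, one_smul] at conv
  -- The kernels ∂ₖη have mean zero, so all averages formed with them tend to zero.
  simp only [hdη0, zero_smul, sub_zero] at dconv
  have ms := fun (s : ℝ) {g : E3 → E3} (hg : MemLp g 2 volume) =>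
    aestronglyMeasurable_smear hXcont hη.continuous s hg
  have mds := fun (i : Fin 3) (s : ℝ) {g : E3 → E3} (hg : MemLp g 2 volume) =>
    aestronglyMeasurable_smear hXcont (hdη i) s hg
  have lim0 : Tendsto (fun s => eLpNorm (S s - w0) 2 volume) (𝓝[>] 0) (𝓝 0) := by
    -- The transport correction is of order s in L², by the bound on averages that is uniform in the
    -- scale.
    have hsd : Tendsto (fun s : ℝ => eLpNorm (s • smear X η s dw) 2 volume) (𝓝[>] 0) (𝓝 0) := by
      obtain ⟨K, hK⟩ := exists_eLpNorm_smear_le (X := X) hXB hηr hM hcB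
      have h0 : Tendsto (fun s : ℝ => ‖s‖ₑ * (K * eLpNorm dw 2 volume)) (𝓝[>] 0)
          (𝓝 (‖(0 : ℝ)‖ₑ * (K * eLpNorm dw 2 volume))) := by
        refine ENNReal.Tendsto.mul_const ?_ (Or.inr (ENNReal.mul_ne_top (by simp) hdw.2.ne))
        exact (continuous_enorm.tendsto 0).mono_left nhdsWithin_le_nhds
      refine tendsto_of_tendsto_of_tendsto_of_le_of_le' tendsto_const_nhds (by simpa using h0)
        (Eventually.of_forall fun _ => zero_le) ?_
      filter_upwards [hpos] with s hs
      refine (eLpNorm_const_smul _ _ _ _).le.trans ?_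
      gcongr
      exact hK s hs _ hdw
    refine (tendsto_eLpNorm_of_le_add (Eventually.of_forall fun s => (ms s hw0).sub hw0.1)
      (Eventually.of_forall fun s => (ms s hdw).const_smul s) (conv hw0) hsd).congr' ?_
    filter_upwards [hpos] with s hs
    rw [hSadd s hs]
    congr 1
    abel
  have lim1 : ∀ i, Tendsto (fun s => eLpNorm (fun x => fderiv ℝ (S s) x (basisVec i) - G0 i x) 2 volume)
      (𝓝[>] 0) (𝓝 0) := by
    intro i
    have hsum : Tendsto (fun s => eLpNorm (-∑ k, smear X (dη k) s (xw k i)) 2 volume)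
        (𝓝[>] 0) (𝓝 0) := by
      simp_rw [eLpNorm_neg]
      refine tendsto_of_tendsto_of_tendsto_of_le_of_le tendsto_const_nhds
        (by simpa using tendsto_finsetSum Finset.univ fun k _ => dconv k (hxw k i))
        (fun _ => zero_le) fun s => ?_
      exact eLpNorm_sum_le (fun k _ => mds k s (hxw k i)) (by norm_num)
    have msum : ∀ s, AEStronglyMeasurable (-∑ k, smear X (dη k) s (xw k i)) volume := fun s =>
      (Finset.aestronglyMeasurable_sum _ fun k _ => mds k s (hxw k i)).neg
    refine (tendsto_eLpNorm_of_le_add (Eventually.of_forall fun s =>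
      ((ms s (hG0 i)).sub (hG0 i).1).add (msum s)) (Eventually.of_forall fun s => mds i s hdw)
      (tendsto_eLpNorm_of_le_add (Eventually.of_forall fun s => (ms s (hG0 i)).sub (hG0 i).1)
        (Eventually.of_forall msum) (conv (hG0 i)) hsum) (dconv i hdw)).congr' ?_
    filter_upwards [hpos] with s hs
    congr 1
    ext1 x
    rw [hdS s hs, hparts s hs]
    simp only [Pi.add_apply, Pi.sub_apply, Pi.neg_apply, Finset.sum_apply]
    abel
  -- the divergence
  have hdivS : ∀ s, 0 < s → ∀ x, ∑ i, (fderiv ℝ (S s) x (basisVec i)) i = 0 := by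
    intro s hs x
    have htest : IsTestFunction univ (fun y => s⁻¹ ^ 3 * η (s⁻¹ • (x - y) - X y)) := by
      refine ⟨hkernel s x, ?_, subset_univ _⟩
      refine HasCompactSupport.intro (isCompact_closedBall x (s * (c + B))) fun y hy => ?_
      by_contra h
      apply hy
      rw [mem_closedBall_iff_norm, norm_sub_rev]
      exact norm_sub_le_of_kernel_ne_zero hXB hηr hs (w := y) fun h' => h (by simp [h'])
    have h0 := hH.weak _ htest
    have happ : ∀ i, (fderiv ℝ (S s) x (basisVec i)) i = s⁻¹ *
        ∫ y in D, (s⁻¹ ^ 3 * dη i (s⁻¹ • (x - y) - X y)) * ((w y) i + s * (fderiv ℝ X y (w y)) i) := by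
      intro i
      have hi := (integrable_smear hXcont hXB (hdη i) (hdηr i) (hdηM i) hs (hg s) x)
      have e : fderiv ℝ (S s) x (basisVec i) = s⁻¹ • smear X (dη i) s (w0 + s • dw) x :=
        fderiv_smear hXcont hXB hη hηc hηr hM hM' hηr' hs (hg s) (hg1 s) x i
      rw [e, PiLp.smul_apply, smul_eq_mul]
      congr 1
      have e2 : w0 + s • dw = D.indicator fun y => w y + s • fderiv ℝ X y (w y) := by
        ext1 y
        by_cases hy : y ∈ D <;> simp [w0, dw, hy]
      rw [e2] at hi ⊢
      have hi2 : IntegrableOn (fun y => (s⁻¹ ^ 3 * dη i (s⁻¹ • (x - y) - X y)) •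
          (w y + s • fderiv ℝ X y (w y))) D := by
        refine (integrableOn_congr_fun (fun y hy => ?_) hDm).1 hi.integrableOn
        simp [hy]
      rw [hsmearD]
      have := (EuclideanSpace.proj (𝕜 := ℝ) i).integral_comp_comm hi2
      change (EuclideanSpace.proj (𝕜 := ℝ) i) _ = _
      rw [← this]
      refine integral_congr_ae (Eventually.of_forall fun y => ?_)
      simp
      ring
    have hint : ∀ i, IntegrableOn (fun y => (s⁻¹ ^ 3 * dη i (s⁻¹ • (x - y) - X y)) *
        ((w y) i + s * (fderiv ℝ X y (w y)) i)) D := by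
      intro i
      refine memLp_one_iff_integrable.1 ?_
      have h2 : MemLp (fun y => (w y) i + s * (fderiv ℝ X y (w y)) i) 2 (volume.restrict D) :=
        (memLp_apply hw.memLp i).add ((memLp_apply hDXw i).const_mul s)
      exact (memLp_continuous_smul (χ := fun y => s⁻¹ ^ 3 * dη i (s⁻¹ • (x - y) - X y)) hD
        (by have := hdη i; fun_prop) h2).mono_exponent (by norm_num)
    simp_rw [happ]
    rw [← Finset.mul_sum, ← integral_finsetSum _ fun i _ => hint i]
    refine mul_eq_zero_of_right _ ?_
    -- The divergence is the integral of w against a gradient. The kernel, as a function of y, need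
    -- not vanish on the boundary of D, so both conditions in H enter here: zero divergence and zero
    -- normal component.
    have : ∀ y, ∑ i, (s⁻¹ ^ 3 * dη i (s⁻¹ • (x - y) - X y)) * ((w y) i + s * (fderiv ℝ X y (w y)) i) =
        -s * fderiv ℝ (fun y => s⁻¹ ^ 3 * η (s⁻¹ • (x - y) - X y)) y (w y) := by
      intro y
      rw [hkd, apply_eq_sum_basisVec (fderiv ℝ η _)]
      simp only [Fin.sum_univ_three, dη, PiLp.add_apply, PiLp.smul_apply, smul_eq_mul]
      field_simp
    simp_rw [this]
    rw [integral_const_mul, h0, mul_zero]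
  -- the support
  have hsuppS : ∀ s, 0 < s → (∀ y ∈ closure D, ∀ ζ : E3, ‖ζ‖ ≤ c → y + s • (X y + ζ) ∈ D) →
      IsTestFunction D (S s) := by
    intro s hs hsD
    -- The kernel is nonzero only if x = y + s (X y + ζ) with ‖ζ‖ ≤ c, so the average vanishes off
    -- the compact image K. The choice of X puts K inside D.
    set K : Set E3 := (fun p : E3 × E3 => p.1 + s • (X p.1 + p.2)) ''
      (closure D ×ˢ Metric.closedBall 0 c)
    have hK : IsCompact K := (hD.bounded.isCompact_closure.prod (isCompact_closedBall _ _)).image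
      (by fun_prop)
    have hKD : K ⊆ D := by
      rintro _ ⟨⟨y, ζ⟩, ⟨hy, hζ⟩, rfl⟩
      exact hsD y hy ζ (by simpa using hζ)
    have hz : ∀ x ∉ K, S s x = 0 := by
      intro x hx
      have e2 : w0 + s • dw = D.indicator fun y => w y + s • fderiv ℝ X y (w y) := by
        ext1 y
        by_cases hy : y ∈ D <;> simp [w0, dw, hy]
      simp only [S]
      rw [e2, hsmearD]
      refine (setIntegral_congr_fun hDm fun y hy => ?_).trans (integral_zero _ _)
      have : η (s⁻¹ • (x - y) - X y) = 0 := by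
        by_contra h
        refine hx ⟨(y, s⁻¹ • (x - y) - X y), ⟨subset_closure hy, by simpa using hηr _ h⟩, ?_⟩
        simp [smul_inv_smul₀ hs.ne']
      simp [this]
    have hsub : tsupport (S s) ⊆ K := closure_minimal (fun x hx => by
      by_contra h
      exact hx (hz x h)) hK.isClosed
    exact ⟨contDiff_smear hXcont hXB hη hηc hηr hM hs (hg s) (hg1 s),
      HasCompactSupport.intro hK hz, hsub.trans hKD⟩
  -- a sequence of scales
  obtain ⟨δ, hδ0, hδ⟩ := (mem_nhdsGT_iff_exists_Ioo_subset).1 hcs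
  have hδ0 : 0 < δ := hδ0
  -- The shift by 2 keeps even the first scale strictly below δ.
  set s : ℕ → ℝ := fun n => δ / (n + 2)
  have hs0 : ∀ n, 0 < s n := fun n => by positivity
  have hs1 : ∀ n, s n < δ := fun n => by
    simp only [s]
    rw [div_lt_iff₀ (by positivity)]
    nlinarith [(Nat.cast_nonneg n : (0 : ℝ) ≤ n)]
  have hslim : Tendsto s atTop (𝓝[>] 0) := by
    refine tendsto_nhdsWithin_iff.2 ⟨?_, Eventually.of_forall hs0⟩
    exact tendsto_const_nhds.div_atTop
      (tendsto_atTop_add_const_right _ _ tendsto_natCast_atTop_atTop)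
  refine ⟨fun n => S (s n), ⟨fun n => hsuppS _ (hs0 n) (hδ ⟨hs0 n, hs1 n⟩), ?_, fun i => ?_⟩,
    fun n => hdivS _ (hs0 n)⟩
  · refine tendsto_of_tendsto_of_tendsto_of_le_of_le tendsto_const_nhds (lim0.comp hslim)
      (fun _ => zero_le) fun n => ?_
    refine le_trans (le_of_eq ?_) (eLpNorm_restrict_le _ 2 volume D)
    refine eLpNorm_congr_ae ((ae_restrict_mem hDm).mono fun x hx => ?_)
    simp [w0, hx]
  · refine tendsto_of_tendsto_of_tendsto_of_le_of_le tendsto_const_nhds ((lim1 i).comp hslim)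
      (fun _ => zero_le) fun n => ?_
    refine le_trans (le_of_eq ?_) (eLpNorm_restrict_le _ 2 volume D)
    refine eLpNorm_congr_ae ((ae_restrict_mem hDm).mono fun x hx => ?_)
    simp [G0, hx]

end SuitableNS

namespace SuitableNS

variable {D : Set E3}

/-! ### The space `H` -/

/-- The gradient of a scalar function as a vector field. -/
noncomputable def gradVec (φ : E3 → ℝ) (x : E3) : E3 := ∑ i, fderiv ℝ φ x (basisVec i) • basisVec i

lemma inner_gradVec (φ : E3 → ℝ) (x y : E3) : inner ℝ (gradVec φ x) y = fderiv ℝ φ x y := by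
  rw [apply_eq_sum_basisVec (fderiv ℝ φ x) y]
  simp only [gradVec, sum_inner, inner_smul_left, smul_eq_mul]
  refine Finset.sum_congr rfl fun i _ => ?_
  rw [show (basisVec i : E3) = EuclideanSpace.single i (1:ℝ) from rfl,
    EuclideanSpace.inner_single_left]
  simp [mul_comm]

lemma memLp_gradVec {φ : E3 → ℝ} {U : Set E3} (hφ : IsTestFunction U φ) (p : ℝ≥0∞) :
    MemLp (gradVec φ) p (volume.restrict D) := by
  have : IsTestFunction univ (gradVec φ) := by
    refine ⟨ContDiff.sum fun i _ => ((hφ.smooth.fderiv_right (m := ∞) (by simp)).clm_apply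
      contDiff_const).smul contDiff_const, ?_, subset_univ _⟩
    refine (hφ.compact.fderiv (𝕜 := ℝ)).comp_left
      (g := fun A : E3 →L[ℝ] ℝ => ∑ i, A (basisVec i) • basisVec i) (by simp)
  exact this.memLp p

lemma MemH.add {v w : E3 → E3} (hv : MemH D v) (hw : MemH D w) : MemH D (v + w) := by
  refine ⟨hv.memLp.add hw.memLp, fun φ hφ => ?_⟩
  have h1 := hv.weak φ hφ
  have h2 := hw.weak φ hφ
  simp only [← inner_gradVec] at h1 h2 ⊢
  simp only [Pi.add_apply, inner_add_right]
  rw [integral_add (integrable_inner_of_memLp (memLp_gradVec hφ 2) hv.memLp)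
    (integrable_inner_of_memLp (memLp_gradVec hφ 2) hw.memLp), h1, h2, add_zero]

lemma MemH.neg {v : E3 → E3} (hv : MemH D v) : MemH D (-v) := by
  refine ⟨hv.memLp.neg, fun φ hφ => ?_⟩
  have h1 := hv.weak φ hφ
  simp only [Pi.neg_apply, map_neg, integral_neg, h1, neg_zero]

lemma memH_zero : MemH D 0 := ⟨MemLp.zero, fun φ _ => by simp⟩

/-- Pairings with elements of `H` only see the projection onto `H`. -/
lemma exists_memH_forall_integral_inner_eq {ψ : E3 → E3} (hψ : MemLp ψ 2 (volume.restrict D)) :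
    ∃ ψ' : E3 → E3, MemH D ψ' ∧ ∀ a : E3 → E3, MemH D a →
      ∫ x in D, inner ℝ (a x) (ψ x) = ∫ x in D, inner ℝ (a x) (ψ' x) := by
  set μ := volume.restrict D
  let grads : Set (Lp E3 2 μ) :=
    {f | ∃ (φ : E3 → ℝ) (hφ : IsTestFunction univ φ), f = (memLp_gradVec (D := D) hφ 2).toLp}
  -- H is realised in L² as the orthogonal complement of the gradients. It is closed, so the
  -- component of ψ in H exists, and the other component is invisible to H.
  obtain ⟨K, hKdef⟩ : ∃ K : Submodule ℝ (Lp E3 2 μ), K = (Submodule.span ℝ grads)ᗮ := ⟨_, rfl⟩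
  have hinner : ∀ {f g : E3 → E3} (hf : MemLp f 2 μ) (hg : MemLp g 2 μ),
      inner ℝ (hf.toLp f) (hg.toLp g) = ∫ x, inner ℝ (f x) (g x) ∂μ := by
    intro f g hf hg
    rw [L2.inner_def]
    refine integral_congr_ae ?_
    filter_upwards [hf.coeFn_toLp, hg.coeFn_toLp] with x h1 h2
    rw [h1, h2]
  have hK : ∀ {f : E3 → E3} (hf : MemLp f 2 μ), hf.toLp f ∈ K ↔ MemH D f := by
    intro f hf
    simp only [hKdef, Submodule.mem_orthogonal]
    constructor
    · intro h
      refine ⟨hf, fun φ hφ => ?_⟩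
      have := h _ (Submodule.subset_span ⟨φ, hφ, rfl⟩)
      rw [hinner] at this
      simpa only [inner_gradVec] using this
    · intro h u hu
      refine Submodule.span_induction (p := fun u _ => inner ℝ u (hf.toLp f) = (0 : ℝ)) ?_ (by simp)
        (fun x y _ _ hx hy => by rw [inner_add_left, hx, hy, add_zero])
        (fun a x _ hx => by rw [inner_smul_left, hx, mul_zero]) hu
      rintro _ ⟨φ, hφ, rfl⟩
      rw [hinner]
      simp only [inner_gradVec]
      exact h.weak φ hφ
  have : CompleteSpace K := by
    rw [hKdef]; exact (Submodule.isClosed_orthogonal _).completeSpace_coe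
  have : K.HasOrthogonalProjection := Submodule.HasOrthogonalProjection.ofCompleteSpace K
  obtain ⟨y, hy, z, hz, hyz⟩ := K.exists_add_mem_mem_orthogonal (hψ.toLp ψ)
  have hymem : MemLp y 2 μ := Lp.memLp y
  have hy' : hymem.toLp y = y := Lp.toLp_coeFn y hymem
  refine ⟨y, (hK hymem).1 (by rwa [hy']), fun a ha => ?_⟩
  rw [← hinner ha.memLp hψ, ← hinner ha.memLp hymem, hyz, hy', inner_add_right,
    (Submodule.mem_orthogonal _ _).1 hz _ ((hK ha.memLp).2 ha), add_zero]

/-- Since v(t) lies in H, an L² test field may be replaced by its projection onto H. This is needed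
for test fields multiplied by a cutoff, which are not solenoidal. -/
lemma WeaklyContinuous.continuousOn_memLp {T : EReal} {v : ℝ × E3 → E3}
    (hv : WeaklyContinuous D T v) {ψ : E3 → E3} (hψ : MemLp ψ 2 (volume.restrict D)) :
    ContinuousOn (fun t : ℝ => ∫ x in D, inner ℝ (v (t, x)) (ψ x)) (closedTimes T) := by
  obtain ⟨ψ', h1, h2⟩ := exists_memH_forall_integral_inner_eq hψ
  exact (hv.cont ψ' h1).congr fun t ht => h2 _ (hv.memH t ht)

lemma closedTimes_coe (S : ℝ) : closedTimes (S : EReal) = Icc 0 S := by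
  ext t; simp [closedTimes]

lemma openTimes_coe (S : ℝ) : openTimes (S : EReal) = Ioo 0 S := by
  ext t; simp [openTimes]

lemma spaceTime_coe (S : ℝ) : spaceTime D (S : EReal) = Ioo 0 S ×ˢ D := by
  rw [spaceTime, openTimes_coe]

lemma integral_inner_le_eLpNorm {α F : Type*} {m : MeasurableSpace α} {μ : Measure α}
    [NormedAddCommGroup F] [InnerProductSpace ℝ F] {p q : ℝ≥0∞} [p.HolderTriple q 1] {a b : α → F}
    (ha : MemLp a p μ) (hb : MemLp b q μ) :
    |∫ x, inner ℝ (a x) (b x) ∂μ| ≤ (eLpNorm a p μ).toReal * (eLpNorm b q μ).toReal := by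
  rw [← ENNReal.toReal_mul, ← Real.norm_eq_abs, ← toReal_enorm]
  refine ENNReal.toReal_mono (ENNReal.mul_ne_top ha.2.ne hb.2.ne) ?_
  refine (enorm_integral_le_lintegral_enorm _).trans ?_
  rw [← eLpNorm_one_eq_lintegral_enorm]
  exact eLpNorm_inner_le ha.1 hb.1

lemma integral_norm_sq_eq {α F : Type*} {m : MeasurableSpace α} {μ : Measure α}
    [NormedAddCommGroup F] {a : α → F}
    (ha : MemLp a 2 μ) : ∫ x, ‖a x‖ ^ 2 ∂μ = (eLpNorm a 2 μ).toReal ^ 2 := by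
  rw [ha.eLpNorm_eq_integral_rpow_norm (by norm_num) (by norm_num), ENNReal.toReal_ofReal (by positivity)]
  rw [← Real.rpow_natCast, ← Real.rpow_mul (by positivity)]
  simp

/-- The bound of a weakly continuous function holds at every time. -/
lemma WeaklyContinuous.forall_eLpNorm_le {S : ℝ} (hS : 0 < S) {v : ℝ × E3 → E3}
    (hv : WeaklyContinuous D S v) {C : ℝ≥0}
    (hC : ∀ᵐ t ∂(volume.restrict (openTimes S)),
      eLpNorm (fun x => v (t, x)) 2 (volume.restrict D) ≤ C) :
    ∀ t ∈ Icc 0 S, eLpNorm (fun x => v (t, x)) 2 (volume.restrict D) ≤ C := by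
  intro t ht
  rw [openTimes_coe, ae_restrict_iff' measurableSet_Ioo] at hC
  have hcl := (Measure.dense_of_ae hC).open_subset_closure_inter (isOpen_Ioo (a := (0 : ℝ)) (b := S))
  have hcl2 : t ∈ closure (Ioo 0 S ∩
      {t | t ∈ Ioo 0 S → eLpNorm (fun x => v (t, x)) 2 (volume.restrict D) ≤ C}) := by
    have := closure_mono hcl
    rw [closure_closure, closure_Ioo hS.ne] at this
    exact this ht
  have hvt : MemLp (fun x => v (t, x)) 2 (volume.restrict D) :=
    (hv.memH t (by rwa [closedTimes_coe])).memLp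
  have hcont := hv.continuousOn_memLp hvt
  rw [closedTimes_coe] at hcont
  set N := (eLpNorm (fun x => v (t, x)) 2 (volume.restrict D)).toReal
  -- Weak lower semicontinuity of the norm: v(s) is paired with the fixed field v(t), while s tends
  -- to t through the dense set of times where the bound holds. The outcome is N² ≤ CN.
  have key : ∫ x in D, inner ℝ (v (t, x)) (v (t, x)) ≤ C * N := by
    have h1 := (hcont t ht).mono (s := Ioo 0 S ∩
      {t | t ∈ Ioo 0 S → eLpNorm (fun x => v (t, x)) 2 (volume.restrict D) ≤ C})
      (inter_subset_left.trans Ioo_subset_Icc_self)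
    have h2 := (mem_closure_iff_nhdsWithin_neBot).1 hcl2
    refine le_of_tendsto h1.tendsto ?_
    filter_upwards [self_mem_nhdsWithin] with s hs
    have hvs : MemLp (fun x => v (s, x)) 2 (volume.restrict D) :=
      (hv.memH s (by rw [closedTimes_coe]; exact Ioo_subset_Icc_self hs.1)).memLp
    refine (le_abs_self _).trans ((integral_inner_le_eLpNorm (p := 2) (q := 2) hvs hvt).trans ?_)
    gcongr
    exact ENNReal.toReal_le_coe_of_le_coe (hs.2 hs.1)
  simp only [real_inner_self_eq_norm_sq] at key
  rw [integral_norm_sq_eq hvt] at key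
  have hN : N ≤ C := by
    rcases (ENNReal.toReal_nonneg : 0 ≤ N).eq_or_lt with h | h
    · exact h.symm.le.trans C.2
    · rw [sq] at key
      exact le_of_mul_le_mul_right key h
  rw [← ENNReal.ofReal_toReal hvt.2.ne]
  exact ENNReal.ofReal_le_of_le_toReal hN

/-- Weakly continuous functions of the energy class on a bounded time interval. -/
structure IsFlow (D : Set E3) (S : ℝ) (v : ℝ × E3 → E3) (G : Fin 3 → ℝ × E3 → E3) : Prop where
  memH : ∀ t ∈ Icc 0 S, MemH D (fun x => v (t, x))
  cont : ∀ ψ : E3 → E3, MemLp ψ 2 (volume.restrict D) →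
    ContinuousOn (fun t : ℝ => ∫ x in D, inner ℝ (v (t, x)) (ψ x)) (Icc 0 S)
  meas : AEStronglyMeasurable v ((volume.restrict (Ioo 0 S)).prod (volume.restrict D))
  bound : ∃ C : ℝ≥0, ∀ t ∈ Icc 0 S, eLpNorm (fun x => v (t, x)) 2 (volume.restrict D) ≤ C
  memLp_grad : ∀ i, MemLp (G i) 2 ((volume.restrict (Ioo 0 S)).prod (volume.restrict D))
  h10 : ∀ᵐ t ∂(volume.restrict (Ioo 0 S)), IsH10 D (fun x => v (t, x)) (fun i x => G i (t, x))

lemma volume_restrict_prod (I : Set ℝ) :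
    (volume : Measure (ℝ × E3)).restrict (I ×ˢ D) =
      (volume.restrict I).prod (volume.restrict D) := by
  rw [Measure.volume_eq_prod, Measure.prod_restrict]

lemma WeaklyContinuous.mono {T T' : EReal} (h : T' ≤ T) {v : ℝ × E3 → E3}
    (hv : WeaklyContinuous D T v) : WeaklyContinuous D T' v := by
  have : closedTimes T' ⊆ closedTimes T := fun t ht => ⟨ht.1, ht.2.trans h⟩
  exact ⟨fun t ht => hv.memH t (this ht), fun ψ hψ => (hv.cont ψ hψ).mono this⟩

lemma openTimes_mono {T T' : EReal} (h : T' ≤ T) : openTimes T' ⊆ openTimes T :=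
  fun _ ht => ⟨ht.1, ht.2.trans_le h⟩

lemma InEnergyClass.mono {T T' : EReal} (h : T' ≤ T) {v : ℝ × E3 → E3} {G : Fin 3 → ℝ × E3 → E3}
    (hv : InEnergyClass D T v G) : InEnergyClass D T' v G := by
  have h1 : openTimes T' ⊆ openTimes T := openTimes_mono h
  have h2 : spaceTime D T' ⊆ spaceTime D T := prod_mono h1 subset_rfl
  obtain ⟨C, hC⟩ := hv.bound
  exact ⟨hv.meas.mono_set h2, ⟨C, ae_restrict_of_ae_restrict_of_subset h1 hC⟩,
    fun i => (hv.grad_memLp i).mono_measure (Measure.restrict_mono h2 le_rfl),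
    ae_restrict_of_ae_restrict_of_subset h1 hv.memV⟩

/-- Weak continuity upgrades the L² bound from almost every time to every time. Values at individual
times are unavoidable later on, because the energy inequality concerns all end times t. -/
lemma InEnergyClass.isFlow {S : ℝ} (hS : 0 < S) {T : EReal} (hST : (S : EReal) ≤ T)
    {v : ℝ × E3 → E3} {G : Fin 3 → ℝ × E3 → E3} (hv : InEnergyClass D S v G)
    (hw : WeaklyContinuous D T v) : IsFlow D S v G := by
  have hw' := hw.mono hST
  obtain ⟨C, hC⟩ := hv.bound
  refine ⟨?_, ?_, ?_, ⟨C, hw'.forall_eLpNorm_le hS (hC.mono fun t h => h.2)⟩, ?_, ?_⟩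
  · simpa only [closedTimes_coe] using hw'.memH
  · intro ψ hψ
    simpa only [closedTimes_coe] using hw'.continuousOn_memLp hψ
  · simpa only [spaceTime_coe, volume_restrict_prod] using hv.meas
  · simpa only [spaceTime_coe, volume_restrict_prod] using hv.grad_memLp
  · have := hv.memV
    rw [openTimes_coe] at this
    exact this.mono fun t h => h.h10

end SuitableNS

namespace SuitableNS

/-! ### Mixed space-time norms -/

section MixedNorms

variable {α β F : Type*} {mα : MeasurableSpace α} {mβ : MeasurableSpace β} {μ : Measure α}
  {ν : Measure β} [SFinite μ] [SFinite ν] [NormedAddCommGroup F]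

lemma eLpNorm_rpow_toReal {p : ℝ≥0∞} (hp : p ≠ 0) (hp' : p ≠ ⊤) (f : α → F) :
    eLpNorm f p μ ^ p.toReal = ∫⁻ x, ‖f x‖ₑ ^ p.toReal ∂μ := by
  have : 0 < p.toReal := ENNReal.toReal_pos hp hp'
  rw [eLpNorm_eq_lintegral_rpow_enorm_toReal hp hp', ← ENNReal.rpow_mul, one_div,
    inv_mul_cancel₀ this.ne', ENNReal.rpow_one]

lemma lintegral_eLpNorm_rpow {p : ℝ≥0∞} (hp : p ≠ 0) (hp' : p ≠ ⊤) {f : α × β → F}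
    (hf : AEStronglyMeasurable f (μ.prod ν)) :
    ∫⁻ t, eLpNorm (fun x => f (t, x)) p ν ^ p.toReal ∂μ = eLpNorm f p (μ.prod ν) ^ p.toReal := by
  simp only [eLpNorm_rpow_toReal hp hp']
  rw [lintegral_prod _ (hf.enorm.pow_const _)]

lemma aemeasurable_eLpNorm_slice {p : ℝ≥0∞} (hp : p ≠ 0) (hp' : p ≠ ⊤) {f : α × β → F}
    (hf : AEStronglyMeasurable f (μ.prod ν)) :
    AEMeasurable (fun t => eLpNorm (fun x => f (t, x)) p ν) μ := by
  simp only [eLpNorm_eq_lintegral_rpow_enorm_toReal hp hp']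
  exact (hf.enorm.pow_const _).lintegral_prod_right'.pow_const _

lemma memLp_slice {p : ℝ≥0∞} (hp : p ≠ 0) (hp' : p ≠ ⊤) {f : α × β → F}
    (hf : MemLp f p (μ.prod ν)) : ∀ᵐ t ∂μ, MemLp (fun x => f (t, x)) p ν := by
  have h1 := lintegral_eLpNorm_rpow hp hp' hf.1
  have h2 : ∫⁻ t, eLpNorm (fun x => f (t, x)) p ν ^ p.toReal ∂μ ≠ ⊤ := by
    rw [h1]; exact ENNReal.rpow_ne_top_of_nonneg ENNReal.toReal_nonneg hf.2.ne
  filter_upwards [ae_lt_top' ((aemeasurable_eLpNorm_slice hp hp' hf.1).pow_const _) h2,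
    hf.1.prodMk_left] with t h3 h4
  refine ⟨h4, ?_⟩
  by_contra h
  rw [not_lt, top_le_iff] at h
  rw [h, ENNReal.top_rpow_of_pos (ENNReal.toReal_pos hp hp')] at h3
  exact h3.ne rfl

lemma memLp_of_lintegral {p : ℝ≥0∞} (hp : p ≠ 0) (hp' : p ≠ ⊤) {f : α × β → F}
    (hf : AEStronglyMeasurable f (μ.prod ν))
    (h : ∫⁻ t, eLpNorm (fun x => f (t, x)) p ν ^ p.toReal ∂μ ≠ ⊤) : MemLp f p (μ.prod ν) := by
  rw [lintegral_eLpNorm_rpow hp hp' hf] at h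
  refine ⟨hf, ?_⟩
  by_contra h'
  rw [not_lt, top_le_iff] at h'
  rw [h', ENNReal.top_rpow_of_pos (ENNReal.toReal_pos hp hp')] at h
  exact h rfl

/-- The space `L²(L⁴)`. -/
structure MemL2L4 (μ : Measure α) (ν : Measure β) (f : α × β → F) : Prop where
  meas : AEStronglyMeasurable f (μ.prod ν)
  lt_top : ∫⁻ t, eLpNorm (fun x => f (t, x)) 4 ν ^ 2 ∂μ < ⊤

lemma MemL2L4.ae_lt_top {f : α × β → F} (hf : MemL2L4 μ ν f) :
    ∀ᵐ t ∂μ, MemLp (fun x => f (t, x)) 4 ν := by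
  filter_upwards [ae_lt_top' ((aemeasurable_eLpNorm_slice (by simp) (by simp) hf.meas).pow_const 2)
    hf.lt_top.ne, hf.meas.prodMk_left] with t h1 h2
  exact ⟨h2, by simpa using h1⟩

lemma MemL2L4.add {f g : α × β → F} (hf : MemL2L4 μ ν f) (hg : MemL2L4 μ ν g) :
    MemL2L4 μ ν (f + g) := by
  refine ⟨hf.meas.add hg.meas, ?_⟩
  calc ∫⁻ t, eLpNorm (fun x => (f + g) (t, x)) 4 ν ^ 2 ∂μ
      ≤ ∫⁻ t, 2 * (eLpNorm (fun x => f (t, x)) 4 ν ^ 2 + eLpNorm (fun x => g (t, x)) 4 ν ^ 2) ∂μ := by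
        refine lintegral_mono_ae ?_
        filter_upwards [hf.meas.prodMk_left, hg.meas.prodMk_left] with t h1 h2
        have h3 : eLpNorm (fun x => (f + g) (t, x)) 4 ν ≤
          eLpNorm (fun x => f (t, x)) 4 ν + eLpNorm (fun x => g (t, x)) 4 ν :=
          eLpNorm_add_le h1 h2 (by norm_num)
        refine (pow_le_pow_left₀ zero_le h3 2).trans ?_
        have h4 := ENNReal.rpow_add_le_mul_rpow_add_rpow (eLpNorm (fun x => f (t, x)) 4 ν)
          (eLpNorm (fun x => g (t, x)) 4 ν) (p := 2) (by norm_num)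
        norm_num at h4
        exact_mod_cast h4
    _ < ⊤ := by
        have := (aemeasurable_eLpNorm_slice (p := 4) (by simp) (by simp) hf.meas).pow_const 2
        rw [lintegral_const_mul' _ _ (by simp), lintegral_add_left' this]
        exact ENNReal.mul_lt_top (by simp) (ENNReal.add_lt_top.2 ⟨hf.lt_top, hg.lt_top⟩)

lemma memL2L4_of_bound [IsFiniteMeasure μ] {f : α × β → F}
    (hf : AEStronglyMeasurable f (μ.prod ν)) {C : ℝ≥0}
    (h : ∀ᵐ t ∂μ, eLpNorm (fun x => f (t, x)) 4 ν ≤ C) : MemL2L4 μ ν f := by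
  refine ⟨hf, ?_⟩
  calc _ ≤ ∫⁻ _, (C : ℝ≥0∞) ^ 2 ∂μ := by
        refine lintegral_mono_ae ?_
        filter_upwards [h] with t ht
        gcongr
    _ < ⊤ := by
        rw [lintegral_const]
        exact ENNReal.mul_lt_top (by simp) (measure_lt_top _ _)

/-- `L^∞(L²) ∩ L²(L⁴) ⊆ L³`. -/
lemma MemL2L4.memLp_three {f : α × β → F} (hf : MemL2L4 μ ν f) {C : ℝ≥0}
    (h : ∀ᵐ t ∂μ, eLpNorm (fun x => f (t, x)) 2 ν ≤ C) : MemLp f 3 (μ.prod ν) := by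
  refine memLp_of_lintegral (by simp) (by simp) hf.meas (ne_of_lt ?_)
  -- At each time ∫ |f|³ ≤ ‖f‖₂ ‖|f|²‖₂ = ‖f‖₂ ‖f‖₄². The first factor is bounded and the second is
  -- integrable in time.
  calc ∫⁻ t, eLpNorm (fun x => f (t, x)) 3 ν ^ (3 : ℝ≥0∞).toReal ∂μ
      ≤ ∫⁻ t, C * eLpNorm (fun x => f (t, x)) 4 ν ^ 2 ∂μ := by
        refine lintegral_mono_ae ?_
        filter_upwards [h, hf.meas.prodMk_left] with t h1 h2
        rw [eLpNorm_rpow_toReal (by simp) (by simp)]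
        have h3 : eLpNorm (fun x => ‖f (t, x)‖ ^ 2) 2 ν = eLpNorm (fun x => f (t, x)) 4 ν ^ 2 := by
          have := eLpNorm_norm_rpow (μ := ν) (p := 2) (fun x => f (t, x)) (q := 2) (by norm_num)
          norm_num at this
          exact_mod_cast this
        have h4 : eLpNorm (fun x => ‖f (t, x)‖ * ‖f (t, x)‖ ^ 2) 1 ν ≤
            eLpNorm (fun x => ‖f (t, x)‖) 2 ν * eLpNorm (fun x => ‖f (t, x)‖ ^ 2) 2 ν := by
          have := eLpNorm_smul_le_mul_eLpNorm (p := 2) (q := 2) (r := 1) (μ := ν)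
            (f := fun x => ‖f (t, x)‖ ^ 2) (φ := fun x => ‖f (t, x)‖) (h2.norm.pow 2) h2.norm
          exact this
        rw [h3, eLpNorm_norm, eLpNorm_one_eq_lintegral_enorm] at h4
        calc _ = ∫⁻ x, ‖‖f (t, x)‖ * ‖f (t, x)‖ ^ 2‖ₑ ∂ν := by
              refine lintegral_congr fun x => ?_
              rw [enorm_mul, enorm_pow, enorm_norm, ENNReal.toReal_ofNat, ← pow_succ']
              norm_num
          _ ≤ _ := h4
          _ ≤ _ := by gcongr
    _ < ⊤ := by
        rw [lintegral_const_mul' _ _ (by simp)]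
        exact ENNReal.mul_lt_top (by simp) hf.lt_top

end MixedNorms

variable {D : Set E3} {S : ℝ} {v : ℝ × E3 → E3} {G : Fin 3 → ℝ × E3 → E3}

/-- The Sobolev inequality is applied at almost every time. The factor 3 is Cauchy–Schwarz for the
sum over the three partial derivatives. -/
lemma IsFlow.memL2L4 (hD : IsSmoothBoundedDomain D) (hv : IsFlow D S v G) :
    MemL2L4 (volume.restrict (Ioo 0 S)) (volume.restrict D) v := by
  refine ⟨hv.meas, ?_⟩
  obtain ⟨C, hC⟩ := exists_sobolev hD.bounded 4 (by norm_num)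
  calc ∫⁻ t in Ioo 0 S, eLpNorm (fun x => v (t, x)) 4 (volume.restrict D) ^ 2
      ≤ ∫⁻ t in Ioo 0 S, C ^ 2 * (3 * ∑ i, eLpNorm (fun x => G i (t, x)) 2 (volume.restrict D) ^ 2) := by
        refine lintegral_mono_ae ?_
        filter_upwards [hv.h10] with t ht
        refine (pow_le_pow_left₀ zero_le (hC _ _ ht).1 2).trans ?_
        rw [mul_pow]
        gcongr
        have h4 := ENNReal.inner_le_Lp_mul_Lq (ι := Fin 3) Finset.univ (fun _ => 1)
          (fun i => eLpNorm (fun x => G i (t, x)) 2 (volume.restrict D)) (p := 2) (q := 2)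
          (by constructor <;> norm_num)
        have h5 := pow_le_pow_left₀ zero_le h4 2
        rw [mul_pow, ← ENNReal.rpow_mul_natCast, ← ENNReal.rpow_mul_natCast] at h5
        norm_num at h5
        exact_mod_cast h5
    _ < ⊤ := by
        rw [lintegral_const_mul' _ _ (by simp), lintegral_const_mul' _ _ (by simp),
          lintegral_finsetSum' _ fun i _ => (aemeasurable_eLpNorm_slice (by simp) (by simp)
            (hv.memLp_grad i).1).pow_const 2]
        refine ENNReal.mul_lt_top (by simp) (ENNReal.mul_lt_top (by simp)
          (ENNReal.sum_lt_top.2 fun i _ => ?_))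
        have := lintegral_eLpNorm_rpow (p := 2) (by simp) (by simp) (hv.memLp_grad i).1
        norm_num at this
        rw [this]
        exact ENNReal.pow_lt_top (hv.memLp_grad i).2

lemma IsFlow.ae_bound (hv : IsFlow D S v G) : ∃ C : ℝ≥0, ∀ᵐ t ∂(volume.restrict (Ioo 0 S)),
    eLpNorm (fun x => v (t, x)) 2 (volume.restrict D) ≤ C := by
  obtain ⟨C, hC⟩ := hv.bound
  exact ⟨C, (ae_restrict_iff' measurableSet_Ioo).2 (ae_of_all _ fun t ht =>
    hC t (Ioo_subset_Icc_self ht))⟩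

lemma IsFlow.memLp_three (hD : IsSmoothBoundedDomain D) (hv : IsFlow D S v G) :
    MemLp v 3 ((volume.restrict (Ioo 0 S)).prod (volume.restrict D)) := by
  obtain ⟨C, hC⟩ := hv.ae_bound
  exact (hv.memL2L4 hD).memLp_three hC

lemma IsFlow.memLp_of_le_three (hD : IsSmoothBoundedDomain D) (hv : IsFlow D S v G) {p : ℝ≥0∞}
    (hp : p ≤ 3) : MemLp v p ((volume.restrict (Ioo 0 S)).prod (volume.restrict D)) :=
  have := hD.isFiniteMeasure
  (hv.memLp_three hD).mono_exponent hp

/-- Weak continuity with a weight that depends smoothly on time. -/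
lemma IsFlow.continuousOn_smul (hD : IsSmoothBoundedDomain D) (hv : IsFlow D S v G)
    {φ : ℝ × E3 → ℝ} (hφ : ContDiff ℝ ∞ φ) {ψ : E3 → E3} (hψ : MemLp ψ 2 (volume.restrict D)) :
    ContinuousOn (fun t => ∫ x in D, φ (t, x) * inner ℝ (v (t, x)) (ψ x)) (Icc 0 S) := by
  have := hD.isFiniteMeasure
  intro s hs
  have hφt : ∀ t, MemLp (fun x => φ (t, x) • ψ x) 2 (volume.restrict D) := fun t =>
    memLp_continuous_smul hD (hφ.continuous.comp (by fun_prop)) hψ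
  obtain ⟨R, hR⟩ := hD.bounded.subset_closedBall 0
  obtain ⟨M, hM0, hM⟩ := exists_bound_of_continuous (χ := fun p => fderiv ℝ φ p)
    ((Metric.isBounded_Icc 0 S).prod (Metric.isBounded_closedBall (x := (0 : E3)) (r := R)))
    (hφ.continuous_fderiv (by simp))
  obtain ⟨C, hC⟩ := hv.bound
  -- The weight is frozen at time s. The error is O(|t - s|) uniformly on D, and what remains is
  -- plain weak continuity with the test field φ(s)ψ.
  have hlip : ∀ t ∈ Icc 0 S, ∀ x ∈ D, |φ (t, x) - φ (s, x)| ≤ M * |t - s| := by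
    intro t ht x hx
    have := Convex.norm_image_sub_le_of_norm_fderiv_le (f := φ) (s := Icc 0 S ×ˢ Metric.closedBall 0 R)
      (fun p _ => (hφ.differentiable (by simp)) p) hM ((convex_Icc 0 S).prod (convex_closedBall _ _))
      (x := (s, x)) (y := (t, x)) ⟨hs, hR hx⟩ ⟨ht, hR hx⟩
    simpa [Prod.norm_def] using this
  have h1 := hv.cont _ (hφt s) s hs
  have h2 : Tendsto (fun t => ∫ x in D, inner ℝ (v (t, x)) ((φ (t, x) - φ (s, x)) • ψ x))
      (𝓝[Icc 0 S] s) (𝓝 0) := by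
    have h3 : Tendsto (fun t => C * (M * |t - s| * (eLpNorm ψ 2 (volume.restrict D)).toReal))
        (𝓝[Icc 0 S] s) (𝓝 0) := by
      have : Continuous fun t => C * (M * |t - s| * (eLpNorm ψ 2 (volume.restrict D)).toReal) := by
        fun_prop
      have := this.tendsto s
      simp only [sub_self, abs_zero, mul_zero, zero_mul] at this
      exact this.mono_left nhdsWithin_le_nhds
    refine squeeze_zero_norm' ?_ h3
    filter_upwards [self_mem_nhdsWithin] with t ht
    have hm : MemLp (fun x => (φ (t, x) - φ (s, x)) • ψ x) 2 (volume.restrict D) := by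
      simp only [sub_smul]; exact (hφt t).sub (hφt s)
    refine (integral_inner_le_eLpNorm (p := 2) (q := 2) (hv.memH t ht).memLp hm).trans ?_
    gcongr
    · exact ENNReal.toReal_le_coe_of_le_coe (hC t ht)
    · rw [← ENNReal.toReal_ofReal (r := M * |t - s|) (by positivity), ← ENNReal.toReal_mul]
      refine ENNReal.toReal_mono (ENNReal.mul_ne_top (by simp) hψ.2.ne) ?_
      refine eLpNorm_le_mul_eLpNorm_of_ae_le_mul ?_ 2
      filter_upwards [ae_restrict_mem hD.isOpen.measurableSet] with x hx
      rw [norm_smul]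
      gcongr
      exact hlip t ht x hx
  have h3 := h1.tendsto.add h2
  simp only [inner_smul_right, add_zero] at h3
  refine h3.congr' ?_
  filter_upwards [self_mem_nhdsWithin] with t ht
  rw [← integral_add]
  · refine integral_congr_ae (ae_of_all _ fun x => ?_)
    simp only
    ring
  · simpa only [inner_smul_right] using
      integrable_inner_of_memLp (p := 2) (q := 2) (hv.memH t ht).memLp (hφt s)
  · have hm : MemLp (fun x => (φ (t, x) - φ (s, x)) • ψ x) 2 (volume.restrict D) := by
      simp only [sub_smul]; exact (hφt t).sub (hφt s)
    simpa only [inner_smul_right] using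
      integrable_inner_of_memLp (p := 2) (q := 2) (hv.memH t ht).memLp hm

end SuitableNS

namespace SuitableNS

/-! ### Weak derivatives on an interval -/

section WeakDerivative

variable {a b : ℝ}

lemma intervalIntegral_eq_of_test {U : Set ℝ} {θ : ℝ → ℝ} (hθ : IsTestFunction U θ)
    (hU : U ⊆ Ioc a b) (k : ℝ → ℝ) : ∫ t in a..b, θ t * k t = ∫ t, θ t * k t := by
  refine intervalIntegral.integral_eq_integral_of_support_subset fun t ht => hU ?_
  exact hθ.support_subset (left_ne_zero_of_mul ht)

/-- The primitive from a vanishes to the left of the support of η, and to the right of it because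
the total integral is zero. -/
lemma exists_primitive_test {η : ℝ → ℝ} (hη : IsTestFunction (Ioo a b) η) (h0 : ∫ t, η t = 0) :
    ∃ θ, IsTestFunction (Ioo a b) θ ∧ deriv θ = η := by
  have hd : ∀ x, HasDerivAt (fun x => ∫ t in a..x, η t) (η x) x := fun x =>
    intervalIntegral.integral_hasDerivAt_right (hη.smooth.continuous.intervalIntegrable _ _)
      hη.smooth.continuous.stronglyMeasurable.stronglyMeasurableAtFilter
      hη.smooth.continuous.continuousAt
  have hderiv : deriv (fun x => ∫ t in a..x, η t) = η := funext fun x => (hd x).deriv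
  obtain ⟨a', b', ha', hb', hsub⟩ : ∃ a' b', a < a' ∧ b' < b ∧ tsupport η ⊆ Icc a' b' := by
    rcases (tsupport η).eq_empty_or_nonempty with h | h
    · exact ⟨a + 1, b - 1, by linarith, by linarith, by simp [h]⟩
    · obtain ⟨l, hl⟩ := hη.compact.exists_isLeast h
      obtain ⟨u, hu⟩ := hη.compact.exists_isGreatest h
      exact ⟨l, u, (hη.support hl.1).1, (hη.support hu.1).2, fun x hx => ⟨hl.2 hx, hu.2 hx⟩⟩
  have hzero : ∀ x, x ∉ Icc a' b' → η x = 0 := fun x hx =>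
    image_eq_zero_of_notMem_tsupport fun h => hx (hsub h)
  have hsupp : tsupport (fun x => ∫ t in a..x, η t) ⊆ Icc a' b' := by
    refine closure_minimal ?_ isClosed_Icc
    intro x hx
    by_contra hx'
    refine hx ?_
    rw [mem_Icc, not_and_or, not_le, not_le] at hx'
    rcases hx' with hx' | hx'
    · refine intervalIntegral.integral_zero_ae (ae_of_all _ fun t ht => hzero t fun h => ?_)
      have := (uIoc_subset_uIcc ht).2
      exact absurd (h.1.trans this) (not_le.2 (max_lt ha' hx'))
    · simp only
      rw [intervalIntegral.integral_eq_integral_of_support_subset, h0]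
      intro t ht
      have : t ∈ Icc a' b' := by by_contra h; exact ht (hzero t h)
      exact ⟨ha'.trans_le this.1, this.2.trans hx'.le⟩
  refine ⟨_, ⟨?_, ?_, hsupp.trans (Icc_subset_Ioo ha' hb')⟩, hderiv⟩
  · exact contDiff_infty_iff_deriv.2 ⟨fun x => (hd x).differentiableAt, by rw [hderiv]; exact hη.smooth⟩
  · exact HasCompactSupport.of_support_subset_isCompact isCompact_Icc
      ((subset_tsupport _).trans hsupp)

/-- The du Bois-Reymond argument. Any test function χ differs from a multiple of a fixed one of
positive integral by the derivative of a test function, so ∫ χ k is proportional to ∫ χ. Continuity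
turns equality almost everywhere into equality on the closed interval. -/
lemma eqOn_const_of_integral_deriv_mul (hab : a < b) {k : ℝ → ℝ} (hk : ContinuousOn k (Icc a b))
    (h : ∀ θ, IsTestFunction (Ioo a b) θ → ∫ t in a..b, deriv θ t * k t = 0) :
    ∃ c, ∀ t ∈ Icc a b, k t = c := by
  obtain ⟨χ₁, h1, h2, h3, h4, h5⟩ := exists_contDiff_tsupport_subset (n := ⊤)
    (isOpen_Ioo.mem_nhds (show (a + b) / 2 ∈ Ioo a b by constructor <;> linarith))
  have hpos : 0 < ∫ t, χ₁ t := h3.continuous.integral_pos_of_hasCompactSupport_nonneg_nonzero h2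
    (fun t => (h4 (mem_range_self t)).1) (x := (a + b) / 2) (by rw [h5]; norm_num)
  have hχ₁ : IsTestFunction (Ioo a b) χ₁ := ⟨h3, h2, h1⟩
  have hsub : Ioo a b ⊆ Ioc a b := Ioo_subset_Ioc_self
  have hint : ∀ {χ : ℝ → ℝ}, IsTestFunction (Ioo a b) χ →
      IntervalIntegrable (fun t => χ t * k t) volume a b := by
    intro χ hχ
    refine (hχ.smooth.continuous.continuousOn.mul ?_).intervalIntegrable
    rwa [uIcc_of_le hab.le]
  set c := (∫ t in a..b, χ₁ t * k t) / ∫ t, χ₁ t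
  refine ⟨c, ?_⟩
  have key : ∀ χ, IsTestFunction (Ioo a b) χ → ∫ t, χ t * (k t - c) = 0 := by
    intro χ hχ
    set m := (∫ t, χ t) / ∫ t, χ₁ t
    have hη : IsTestFunction (Ioo a b) (χ - fun t => m • χ₁ t) :=
      hχ.sub (hχ₁.smul_left contDiff_const)
    obtain ⟨θ, hθ, hθ'⟩ := exists_primitive_test hη (by
      simp only [Pi.sub_apply, smul_eq_mul]
      rw [integral_sub (hχ.smooth.continuous.integrable_of_hasCompactSupport hχ.compact)
        ((h3.continuous.integrable_of_hasCompactSupport h2).const_mul _), integral_const_mul]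
      simp only [m]
      field_simp
      ring)
    have h6 := h θ hθ
    rw [hθ'] at h6
    simp only [Pi.sub_apply, smul_eq_mul, sub_mul, mul_assoc] at h6
    rw [intervalIntegral.integral_sub (hint hχ) ((hint hχ₁).const_mul _),
      intervalIntegral.integral_const_mul] at h6
    rw [← intervalIntegral_eq_of_test hχ hsub]
    simp only [mul_sub]
    rw [intervalIntegral.integral_sub (hint hχ)
      ((hχ.smooth.continuous.intervalIntegrable _ _).mul_const _), intervalIntegral.integral_mul_const]
    have h7 := intervalIntegral_eq_of_test hχ hsub (fun _ => 1)
    simp only [mul_one] at h7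
    rw [h7]
    have : m * (∫ t in a..b, χ₁ t * k t) = (∫ t, χ t) * c := by
      simp only [m, c]; ring
    rw [← this]
    exact h6
  have hae := isOpen_Ioo.ae_eq_zero_of_integral_contDiff_smul_eq_zero (f := fun t => k t - c)
    (μ := volume) (((hk.mono Ioo_subset_Icc_self).sub continuousOn_const).locallyIntegrableOn
      measurableSet_Ioo)
    (fun g hg1 hg2 hg3 => key g ⟨hg1, hg2, hg3⟩)
  have := Measure.eqOn_Icc_of_ae_eq volume hab.ne (f := k) (g := fun _ => c) (by
    rw [← Measure.restrict_congr_set (μ := volume) (Ioo_ae_eq_Icc (a := a) (b := b))]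
    change ∀ᵐ x ∂_, _
    rw [ae_restrict_iff' measurableSet_Ioo]
    filter_upwards [hae] with t ht h
    simpa [sub_eq_zero] using ht h) hk continuousOn_const
  exact this

/-- A continuous function with integrable weak derivative is a primitive of it. -/
lemma sub_eq_integral_of_weakDeriv (hab : a < b) {g m : ℝ → ℝ} (hg : ContinuousOn g (Icc a b))
    (hm : IntervalIntegrable m volume a b)
    (h : ∀ θ, IsTestFunction (Ioo a b) θ → (∫ t in a..b, deriv θ t * g t) + ∫ t in a..b, θ t * m t = 0)
    {s t : ℝ} (hs : s ∈ Icc a b) (ht : t ∈ Icc a b) : g t - g s = ∫ r in s..t, m r := by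
  have hF : ContinuousOn (fun x => ∫ r in a..x, m r) (Icc a b) := by
    have := intervalIntegral.continuousOn_primitive_interval (a := a) (b := b) (f := m) (μ := volume)
      (by rw [uIcc_of_le hab.le, integrableOn_Icc_iff_integrableOn_Ioc]; exact hm.1)
    rwa [uIcc_of_le hab.le] at this
  have hAC : AbsolutelyContinuousOnInterval (fun x => ∫ r in a..x, m r) a b :=
    hm.absolutelyContinuousOnInterval_intervalIntegral left_mem_uIcc
  -- The difference of g and the primitive of m has weak derivative zero. Integration by parts for
  -- absolutely continuous functions suffices, since m is merely integrable.
  obtain ⟨c, hc⟩ := eqOn_const_of_integral_deriv_mul hab (hg.sub hF) (by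
    intro θ hθ
    have h1 := h θ hθ
    have hθab : θ a = 0 ∧ θ b = 0 := by
      constructor <;> refine image_eq_zero_of_notMem_tsupport fun hx => ?_
      · exact lt_irrefl _ (hθ.support hx).1
      · exact lt_irrefl _ (hθ.support hx).2
    have hθC : ContDiff ℝ 1 θ := hθ.smooth.of_le (by simp)
    have hθAC : AbsolutelyContinuousOnInterval θ a b := by
      have hi := (hθC.continuous_deriv le_rfl).intervalIntegrable (μ := volume) a b
      have := hi.absolutelyContinuousOnInterval_intervalIntegral (c := a) left_mem_uIcc
      have he : (fun x => ∫ r in a..x, deriv θ r) = θ := by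
        ext x
        rw [intervalIntegral.integral_deriv_eq_sub (fun y _ => hθC.differentiable (by simp) y)
          ((hθC.continuous_deriv le_rfl).intervalIntegrable _ _), hθab.1, sub_zero]
      rwa [he] at this
    have h2 := hθAC.integral_mul_deriv_eq_deriv_mul hAC
    rw [hθab.1, hθab.2, zero_mul, zero_mul, sub_zero, zero_sub] at h2
    have h3 : ∫ t in a..b, θ t * deriv (fun x => ∫ r in a..x, m r) t = ∫ t in a..b, θ t * m t := by
      refine intervalIntegral.integral_congr_ae ?_
      filter_upwards [hm.ae_hasDerivAt_integral] with x hx hx'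
      rw [(hx (uIoc_subset_uIcc hx') a left_mem_uIcc).deriv]
    rw [h3] at h2
    have hθ'c : ContinuousOn (deriv θ) (uIcc a b) := (hθC.continuous_deriv le_rfl).continuousOn
    rw [← uIcc_of_le hab.le] at hg hF
    simp only [Pi.sub_apply, mul_sub]
    refine (intervalIntegral.integral_sub (hθ'c.mul hg).intervalIntegrable
      (hθ'c.mul hF).intervalIntegrable).trans ?_
    simp only [Pi.mul_apply]
    linarith)
  have h1 := hc t ht
  have h2 := hc s hs
  simp only [Pi.sub_apply] at h1 h2
  rw [← intervalIntegral.integral_interval_sub_left (a := a)]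
  · linarith
  · exact hm.mono_set (by rw [uIcc_of_le hab.le, uIcc_of_le ht.1]; exact Icc_subset_Icc_right ht.2)
  · exact hm.mono_set (by rw [uIcc_of_le hab.le, uIcc_of_le hs.1]; exact Icc_subset_Icc_right hs.2)

end WeakDerivative

end SuitableNS

/-! ### The balance law with a fixed test field -/

namespace SuitableNS

/-- The measure of the cylinder `(a,b) × D`. -/
noncomputable abbrev cyl (D : Set E3) (a b : ℝ) : Measure (ℝ × E3) :=
  (volume.restrict (Ioo a b)).prod (volume.restrict D)

lemma cyl_eq (D : Set E3) (a b : ℝ) : cyl D a b = volume.restrict (Ioo a b ×ˢ D) :=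
  (volume_restrict_prod _).symm

variable {D : Set E3} {a b : ℝ}

lemma cyl_mono {a' b' : ℝ} (ha : a ≤ a') (hb : b' ≤ b) : cyl D a' b' ≤ cyl D a b := by
  rw [cyl_eq, cyl_eq]
  exact Measure.restrict_mono (prod_mono (Ioo_subset_Ioo ha hb) subset_rfl) le_rfl

lemma ae_cyl_mem (hD : IsSmoothBoundedDomain D) : ∀ᵐ p ∂cyl D a b, p ∈ Ioo a b ×ˢ D := by
  rw [cyl_eq]
  exact ae_restrict_mem (measurableSet_Ioo.prod hD.isOpen.measurableSet)

lemma memLp_cyl_smul {F : Type*} [NormedAddCommGroup F] [NormedSpace ℝ F]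
    (hD : IsSmoothBoundedDomain D) {χ : ℝ × E3 → ℝ} (hχ : Continuous χ) {f : ℝ × E3 → F}
    {p : ℝ≥0∞} (hf : MemLp f p (cyl D a b)) : MemLp (fun y => χ y • f y) p (cyl D a b) := by
  obtain ⟨C, h0, hC⟩ := exists_bound_of_continuous
    ((Metric.isBounded_Ioo a b).prod hD.bounded) hχ
  refine hf.of_le_mul (c := C) (hχ.aestronglyMeasurable.smul hf.1) ?_
  filter_upwards [ae_cyl_mem hD] with y hy
  rw [norm_smul]
  gcongr
  exact hC y hy

lemma IsTestFunction.memLp_cyl {F : Type*} [NormedAddCommGroup F] [NormedSpace ℝ F]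
    {Ψ : ℝ × E3 → F} {U : Set (ℝ × E3)} (h : IsTestFunction U Ψ) (p : ℝ≥0∞) :
    MemLp Ψ p (cyl D a b) := by
  have h1 : MemLp Ψ p (volume : Measure (ℝ × E3)) :=
    h.smooth.continuous.memLp_of_hasCompactSupport h.compact
  rw [cyl_eq]
  exact h1.restrict _

/-- With u in L³ and its gradient in L² the convective term lies in L^{6/5}. The dual exponent is 6,
exactly the Sobolev exponent available for fields in V. -/
lemma holderTriple_three_two : ENNReal.HolderTriple 3 2 (6 / 5) := ⟨by
  rw [← ENNReal.toReal_eq_toReal_iff' (by simp) (by simp), ENNReal.toReal_add (by simp) (by simp)]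
  norm_num⟩

lemma holderTriple_six : ENNReal.HolderTriple (6 / 5) 6 1 := ⟨by
  rw [← ENNReal.toReal_eq_toReal_iff' (by simp) (by simp), ENNReal.toReal_add (by simp) (by simp)]
  norm_num⟩

lemma holderTriple_pressure : ENNReal.HolderTriple (5 / 3) (5 / 2) 1 := ⟨by
  rw [← ENNReal.toReal_eq_toReal_iff' (by simp) (by simp), ENNReal.toReal_add (by simp) (by simp)]
  norm_num⟩

lemma memLp_apply' {α : Type*} {m : MeasurableSpace α} {U : α → E3} {p : ℝ≥0∞} {μ : Measure α}
    (hU : MemLp U p μ) (i : Fin 3) : MemLp (fun x => U x i) p μ :=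
  hU.of_le ((by fun_prop : Continuous fun y : E3 => y i).comp_aestronglyMeasurable hU.1)
    (Eventually.of_forall fun x => PiLp.norm_apply_le (U x) i)

lemma memLp_advect {α : Type*} {m : MeasurableSpace α} {μ : Measure α} {p q r : ℝ≥0∞}
    [p.HolderTriple q r] {u : α → E3} {G : Fin 3 → α → E3} (hu : MemLp u p μ)
    (hG : ∀ i, MemLp (G i) q μ) : MemLp (fun x => advect (u x) fun i => G i x) r μ :=
  memLp_finsetSum _ fun i _ => (hG i).smul (memLp_apply' hu i)

section Derivatives

variable {F : Type*} [NormedAddCommGroup F] [NormedSpace ℝ F] {φ : ℝ × E3 → F}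

lemma contDiff_timeDeriv (hφ : ContDiff ℝ ∞ φ) : ContDiff ℝ ∞ (timeDeriv φ) :=
  (hφ.fderiv_right (m := ∞) (by simp)).clm_apply contDiff_const

lemma contDiff_spaceDeriv (hφ : ContDiff ℝ ∞ φ) (b : E3) : ContDiff ℝ ∞ (spaceDeriv φ b) :=
  (hφ.fderiv_right (m := ∞) (by simp)).clm_apply contDiff_const

lemma IsTestFunction.timeDeriv {U : Set (ℝ × E3)} (h : IsTestFunction U φ) :
    IsTestFunction U (timeDeriv φ) := h.fderiv_apply (1, 0)

lemma IsTestFunction.spaceDeriv {U : Set (ℝ × E3)} (h : IsTestFunction U φ) (b : E3) :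
    IsTestFunction U (spaceDeriv φ b) := h.fderiv_apply (0, b)

lemma spaceDeriv_eq_sum (φ : ℝ × E3 → F) (y : E3) (p : ℝ × E3) :
    spaceDeriv φ y p = ∑ i, y i • spaceDeriv φ (basisVec i) p := by
  have := apply_eq_sum_basisVec ((fderiv ℝ φ p).comp (ContinuousLinearMap.inr ℝ ℝ E3)) y
  simpa [spaceDeriv] using this

end Derivatives

lemma IsTestFunction.divergence {Ψ : ℝ × E3 → E3} {U : Set (ℝ × E3)} (h : IsTestFunction U Ψ) :
    IsTestFunction U (divergence Ψ) := by
  have h1 : ∀ i, IsTestFunction U (fun p => (SuitableNS.spaceDeriv Ψ (basisVec i) p) i) := fun i =>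
    ⟨(EuclideanSpace.proj i : E3 →L[ℝ] ℝ).contDiff.comp (h.spaceDeriv (basisVec i)).smooth,
      (h.spaceDeriv (basisVec i)).compact.comp_left (g := fun y : E3 => y i) rfl,
      (closure_mono (Function.support_comp_subset (g := fun y : E3 => y i) rfl _)).trans
        (h.spaceDeriv (basisVec i)).support⟩
  have h2 : tsupport (SuitableNS.divergence Ψ) ⊆ tsupport Ψ := by
    refine closure_minimal ?_ (isClosed_tsupport _)
    intro p hp
    by_contra hn
    refine hp ?_
    have : fderiv ℝ Ψ p = 0 := image_eq_zero_of_notMem_tsupport fun hx =>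
      hn (tsupport_fderiv_subset ℝ hx)
    simp [SuitableNS.divergence, SuitableNS.spaceDeriv, this]
  exact ⟨ContDiff.sum fun i _ => (h1 i).smooth,
    HasCompactSupport.of_support_subset_isCompact h.compact ((subset_tsupport _).trans h2),
    h2.trans h.support⟩

/-- The equation `∂_t v + (u · ∇) u + ∇π = Δ v + h` on `(a,b) × D`, with the integrability that
gives a meaning to its terms; `G` and `H` are the gradients of `v` and `u`. -/
structure IsBalanced (D : Set E3) (a b : ℝ) (v : ℝ × E3 → E3) (G : Fin 3 → ℝ × E3 → E3)
    (h u : ℝ × E3 → E3) (H : Fin 3 → ℝ × E3 → E3) (π : ℝ × E3 → ℝ) : Prop where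
  flow : IsFlow D b v G
  memLp_force : MemLp h 2 (cyl D a b)
  memLp_three : MemLp u 3 (cyl D a b)
  memL2L4 : MemL2L4 (volume.restrict (Ioo a b)) (volume.restrict D) u
  memLp_grad : ∀ i, MemLp (H i) 2 (cyl D a b)
  equation : ∀ Ψ : ℝ × E3 → E3, IsTestFunction (Ioo a b ×ˢ D) Ψ →
    (∫ p, inner ℝ (v p) (timeDeriv Ψ p) ∂cyl D a b)
      - ∑ i, (∫ p, inner ℝ (G i p) (spaceDeriv Ψ (basisVec i) p) ∂cyl D a b)
      + (∫ p, inner ℝ (h p) (Ψ p) ∂cyl D a b)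
      - (∫ p, inner ℝ (advect (u p) fun i => H i p) (Ψ p) ∂cyl D a b)
      + ∫ p, π p * divergence Ψ p ∂cyl D a b = 0

/-- The factor of the test field in the balance law. -/
noncomputable def balanceZero (v : ℝ × E3 → E3) (G : Fin 3 → ℝ × E3 → E3) (h : ℝ × E3 → E3)
    (φ : ℝ × E3 → ℝ) (p : ℝ × E3) : E3 :=
  timeDeriv φ p • v p - ∑ i, spaceDeriv φ (basisVec i) p • G i p + φ p • h p

/-- The contribution of the pressure to the balance law. -/
noncomputable def balancePressure (π φ : ℝ × E3 → ℝ) (p : ℝ × E3) : E3 :=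
  ∑ i, (π p * spaceDeriv φ (basisVec i) p) • basisVec i

/-- The density of the rate of change of `∫ φ v · ψ`. -/
noncomputable def balanceDensity (v : ℝ × E3 → E3) (G : Fin 3 → ℝ × E3 → E3)
    (h u : ℝ × E3 → E3) (H : Fin 3 → ℝ × E3 → E3) (π φ : ℝ × E3 → ℝ) (ψ : E3 → E3)
    (Ψ : Fin 3 → E3 → E3) (p : ℝ × E3) : ℝ :=
  inner ℝ (balanceZero v G h φ p) (ψ p.2) - (∑ i, inner ℝ (φ p • G i p) (Ψ i p.2))
    - inner ℝ (φ p • advect (u p) fun i => H i p) (ψ p.2) + inner ℝ (balancePressure π φ p) (ψ p.2)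

variable {v h u : ℝ × E3 → E3} {G H : Fin 3 → ℝ × E3 → E3} {π π' φ : ℝ × E3 → ℝ}

lemma inner_balancePressure (π φ : ℝ × E3 → ℝ) (p : ℝ × E3) (y : E3) :
    inner ℝ (balancePressure π φ p) y = π p * spaceDeriv φ y p := by
  rw [spaceDeriv_eq_sum]
  simp only [balancePressure, sum_inner, inner_smul_left, Finset.mul_sum]
  refine Finset.sum_congr rfl fun i _ => ?_
  rw [show (basisVec i : E3) = EuclideanSpace.single i (1 : ℝ) from rfl,
    EuclideanSpace.inner_single_left]
  simp
  ring

section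

variable (hD : IsSmoothBoundedDomain D) (ha : 0 ≤ a) (hb : IsBalanced D a b v G h u H π)
  (hφ : ContDiff ℝ ∞ φ)

include hD ha hb in
lemma IsBalanced.memLp_flow : MemLp v 3 (cyl D a b) :=
  (hb.flow.memLp_three hD).mono_measure (cyl_mono ha le_rfl)

include ha hb in
lemma IsBalanced.memLp_flow_grad (i : Fin 3) : MemLp (G i) 2 (cyl D a b) :=
  (hb.flow.memLp_grad i).mono_measure (cyl_mono ha le_rfl)

include hb in
lemma IsBalanced.memLp_advect : MemLp (fun p => advect (u p) fun i => H i p) (6 / 5) (cyl D a b) :=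
  have := holderTriple_three_two
  SuitableNS.memLp_advect hb.memLp_three hb.memLp_grad

include hD ha hb hφ in
lemma IsBalanced.memLp_balanceZero : MemLp (balanceZero v G h φ) 2 (cyl D a b) := by
  have := hD.isFiniteMeasure
  refine MemLp.add (MemLp.sub ?_ (memLp_finsetSum _ fun i _ => ?_)) ?_
  · exact memLp_cyl_smul hD (contDiff_timeDeriv hφ).continuous
      ((hb.memLp_flow hD ha).mono_exponent (by norm_num))
  · exact memLp_cyl_smul hD (contDiff_spaceDeriv hφ _).continuous (hb.memLp_flow_grad ha i)
  · exact memLp_cyl_smul hD hφ.continuous hb.memLp_force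

include hD hφ in
lemma memLp_balancePressure (hπ : MemLp π (5 / 3) (cyl D a b)) :
    MemLp (balancePressure π φ) (5 / 3) (cyl D a b) := by
  refine memLp_finsetSum _ fun i _ => ?_
  have h1 := memLp_cyl_smul hD (contDiff_spaceDeriv hφ (basisVec i)).continuous hπ
  have h2 : MemLp (fun p => π p * spaceDeriv φ (basisVec i) p) (5 / 3) (cyl D a b) := by
    simpa only [smul_eq_mul, mul_comm] using h1
  exact h2.of_le (h2.1.smul_const _) (ae_of_all _ fun p => by rw [norm_smul, norm_basisVec, mul_one])

end

end SuitableNS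

namespace SuitableNS

variable {D : Set E3} {a b : ℝ} {v h u : ℝ × E3 → E3} {G H : Fin 3 → ℝ × E3 → E3}
  {π π' φ : ℝ × E3 → ℝ}

lemma integral_five {α ι : Type*} [Fintype ι] {m : MeasurableSpace α} {μ : Measure α}
    {f₁ f₃ f₄ f₅ : α → ℝ} {f₂ : ι → α → ℝ} (h₁ : Integrable f₁ μ) (h₂ : ∀ i, Integrable (f₂ i) μ)
    (h₃ : Integrable f₃ μ) (h₄ : Integrable f₄ μ) (h₅ : Integrable f₅ μ) :
    (∫ x, f₁ x ∂μ) - (∑ i, ∫ x, f₂ i x ∂μ) + (∫ x, f₃ x ∂μ) - (∫ x, f₄ x ∂μ) + (∫ x, f₅ x ∂μ) =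
      ∫ x, (f₁ x - (∑ i, f₂ i x) + f₃ x - f₄ x + f₅ x) ∂μ := by
  have hs := integrable_finsetSum Finset.univ fun i _ => h₂ i
  have h12 : Integrable (fun x => f₁ x - ∑ i, f₂ i x) μ := h₁.sub hs
  have h13 : Integrable (fun x => f₁ x - (∑ i, f₂ i x) + f₃ x) μ := h12.add h₃
  have h14 : Integrable (fun x => f₁ x - (∑ i, f₂ i x) + f₃ x - f₄ x) μ := h13.sub h₄
  rw [integral_add h14 h₅, integral_sub h13 h₄, integral_add h12 h₃, integral_sub h₁ hs,
    integral_finsetSum _ fun i _ => h₂ i]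

section Density

variable (hD : IsSmoothBoundedDomain D) (ha : 0 ≤ a) (hb : IsBalanced D a b v G h u H π)
  (hφ : ContDiff ℝ ∞ φ) (hπ' : MemLp π' (5 / 3) (cyl D a b))

include hD ha hb hφ hπ' in
-- The linear terms pair L² with L², the convective term L^{6/5} with L⁶, and the pressure L^{5/3}
-- with L^{5/2}, where the last space contains L⁶ on a finite measure space.
lemma IsBalanced.integrable_density {ψ : E3 → E3} {Ψ : Fin 3 → E3 → E3}
    (h2 : MemLp ψ 2 (volume.restrict D)) (h2' : ∀ i, MemLp (Ψ i) 2 (volume.restrict D))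
    (h6 : MemLp ψ 6 (volume.restrict D)) :
    Integrable (balanceDensity v G h u H π' φ ψ Ψ) (cyl D a b) := by
  have := hD.isFiniteMeasure
  have i1 := holderTriple_six
  have i2 := holderTriple_pressure
  refine (((integrable_inner_of_memLp (hb.memLp_balanceZero hD ha hφ) (h2.comp_snd _)).sub
    (integrable_finsetSum _ fun i _ => integrable_inner_of_memLp
      (memLp_cyl_smul hD hφ.continuous (hb.memLp_flow_grad ha i)) ((h2' i).comp_snd _))).sub ?_).add ?_
  · exact integrable_inner_of_memLp (memLp_cyl_smul hD hφ.continuous hb.memLp_advect) (h6.comp_snd _)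
  · refine integrable_inner_of_memLp (q := 5 / 2) (memLp_balancePressure hD hφ hπ') (MemLp.comp_snd ?_ _)
    exact h6.mono_exponent (by
      rw [← ENNReal.toReal_le_toReal (ENNReal.div_ne_top (by simp) (by simp)) (by simp)]; norm_num)

include hD ha hb hφ hπ' in
/-- The balance law for test functions. -/
lemma IsBalanced.balance_test (hab : a < b)
    (hππ' : ∀ p y, π p * spaceDeriv φ y p = π' p * spaceDeriv φ y p)
    {ψ : E3 → E3} (hψ : IsTestFunction D ψ) (hdiv : ∀ x, ∑ i, (fderiv ℝ ψ x (basisVec i)) i = 0)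
    {s t : ℝ} (hs : s ∈ Icc a b) (ht : t ∈ Icc a b) (hst : s ≤ t) :
    (∫ x in D, φ (t, x) * inner ℝ (v (t, x)) (ψ x)) - (∫ x in D, φ (s, x) * inner ℝ (v (s, x)) (ψ x)) =
      ∫ p, balanceDensity v G h u H π' φ ψ (fun i x => fderiv ℝ ψ x (basisVec i)) p ∂cyl D s t := by
  have hfin := hD.isFiniteMeasure
  have i1 := holderTriple_six
  have i2 := holderTriple_pressure
  set Ψ := fun (i : Fin 3) x => fderiv ℝ ψ x (basisVec i)
  have hM := hb.integrable_density hD ha hφ hπ' (hψ.memLp 2)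
    (fun i => (hψ.fderiv_apply (basisVec i)).memLp 2) (hψ.memLp 6)
  have hm : IntegrableOn (fun r => ∫ x in D, balanceDensity v G h u H π' φ ψ Ψ (r, x)) (Ioo a b) :=
    hM.integral_prod_left
  have hm' : IntervalIntegrable (fun r => ∫ x in D, balanceDensity v G h u H π' φ ψ Ψ (r, x))
      volume a b := by
    rw [intervalIntegrable_iff_integrableOn_Ioo_of_le hab.le]
    exact hm
  have hg : ContinuousOn (fun t => ∫ x in D, φ (t, x) * inner ℝ (v (t, x)) (ψ x)) (Icc a b) :=
    (hb.flow.continuousOn_smul hD hφ (hψ.memLp 2)).mono (Icc_subset_Icc_left ha)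
  -- The equation is tested with θ(t) φ ψ. This says that the density, integrated over D, is the
  -- weak time derivative of ∫ φ v·ψ.
  have key := sub_eq_integral_of_weakDeriv hab hg hm' (fun θ hθ => by
    have hθs : ContDiff ℝ ∞ (fun p : ℝ × E3 => θ p.1) := hθ.smooth.comp contDiff_fst
    have hψs : ContDiff ℝ ∞ (fun p : ℝ × E3 => ψ p.2) := hψ.smooth.comp contDiff_snd
    have hχ : IsTestFunction (Ioo a b ×ˢ D) (fun p : ℝ × E3 => θ p.1 • ψ p.2) := by
      have hsub : tsupport (fun p : ℝ × E3 => θ p.1 • ψ p.2) ⊆ tsupport θ ×ˢ tsupport ψ := by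
        refine closure_minimal (fun p hp => ⟨subset_tsupport _ ?_, subset_tsupport _ ?_⟩)
          ((isClosed_tsupport _).prod (isClosed_tsupport _))
        · exact left_ne_zero_of_smul hp
        · exact right_ne_zero_of_smul hp
      exact ⟨hθs.smul hψs, HasCompactSupport.of_support_subset_isCompact
        (hθ.compact.isCompact.prod hψ.compact.isCompact) ((subset_tsupport _).trans hsub),
        hsub.trans (prod_mono hθ.support hψ.support)⟩
    have hX := hχ.smul_left hφ
    set X : ℝ × E3 → E3 := fun p => φ p • θ p.1 • ψ p.2
    have hdX : ∀ p, HasFDerivAt X (φ p • (θ p.1 • (fderiv ℝ ψ p.2).comp (ContinuousLinearMap.snd ℝ ℝ E3)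
        + ((fderiv ℝ θ p.1).comp (ContinuousLinearMap.fst ℝ ℝ E3)).smulRight (ψ p.2)) +
        (fderiv ℝ φ p).smulRight (θ p.1 • ψ p.2)) p := by
      intro p
      exact ((hφ.differentiable (by simp)) p).hasFDerivAt.fun_smul
        (((hθ.hasFDerivAt p.1).comp p hasFDerivAt_fst).fun_smul
          ((hψ.hasFDerivAt p.2).comp p hasFDerivAt_snd))
    have hXt : ∀ p, timeDeriv X p = (deriv θ p.1 * φ p) • ψ p.2 + (θ p.1 * timeDeriv φ p) • ψ p.2 := by
      intro p
      rw [timeDeriv, (hdX p).fderiv]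
      simp [timeDeriv, smul_smul, mul_comm]
    have hXs : ∀ y p, spaceDeriv X y p = (θ p.1 * φ p) • fderiv ℝ ψ p.2 y +
        (θ p.1 * spaceDeriv φ y p) • ψ p.2 := by
      intro y p
      rw [spaceDeriv, (hdX p).fderiv]
      simp [spaceDeriv, smul_smul, mul_comm]
    -- Because ψ is solenoidal, the pressure is met only where ∇φ ≠ 0. It may be replaced by any π'
    -- with the same product against ∇φ, and by 0 if φ = 1.
    have hXd : ∀ p, divergence X p = θ p.1 * spaceDeriv φ (ψ p.2) p := by
      intro p
      rw [divergence, spaceDeriv_eq_sum φ (ψ p.2) p]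
      simp only [hXs, PiLp.add_apply, PiLp.smul_apply, smul_eq_mul, Finset.sum_add_distrib,
        ← Finset.mul_sum, hdiv, mul_zero, zero_add]
      rw [Finset.mul_sum]
      refine Finset.sum_congr rfl fun i _ => by ring
    have heq := hb.equation X hX
    have hpr : ∀ p, π p * divergence X p = inner ℝ (π' p) (divergence X p) := by
      intro p
      have := hππ' p (ψ p.2)
      simp only [hXd, RCLike.inner_apply, conj_trivial]
      linear_combination θ p.1 * this
    simp only [hpr] at heq
    have hv2 : MemLp v 2 (cyl D a b) := (hb.memLp_flow hD ha).mono_exponent (by norm_num)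
    have j1 := integrable_inner_of_memLp hv2 (hX.timeDeriv.memLp_cyl (D := D) (a := a) (b := b) 2)
    have j2 := fun i => integrable_inner_of_memLp (hb.memLp_flow_grad ha i)
      ((hX.spaceDeriv (basisVec i)).memLp_cyl (D := D) (a := a) (b := b) 2)
    have j3 := integrable_inner_of_memLp hb.memLp_force (hX.memLp_cyl (D := D) (a := a) (b := b) 2)
    have j4 := integrable_inner_of_memLp hb.memLp_advect (hX.memLp_cyl (D := D) (a := a) (b := b) 6)
    have j5 := integrable_inner_of_memLp hπ' (hX.divergence.memLp_cyl (D := D) (a := a) (b := b) (5 / 2))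
    rw [integral_five j1 j2 j3 j4 j5] at heq
    have hF : Integrable (fun p : ℝ × E3 => deriv θ p.1 * (φ p * inner ℝ (v p) (ψ p.2))) (cyl D a b) := by
      have c1 : Continuous fun p : ℝ × E3 => deriv θ p.1 * φ p :=
        ((hθ.smooth.continuous_deriv (by simp)).comp continuous_fst).mul hφ.continuous
      refine (integrable_inner_of_memLp (memLp_cyl_smul hD c1 hv2)
        ((hψ.memLp (D := D) 2).comp_snd (volume.restrict (Ioo a b)))).congr (ae_of_all _ fun p => ?_)
      simp only [inner_smul_left, conj_trivial]
      ring
    have hθM : Integrable (fun p : ℝ × E3 => θ p.1 * balanceDensity v G h u H π' φ ψ Ψ p) (cyl D a b) := by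
      obtain ⟨C, -, hC⟩ := exists_bound_of_continuous (Metric.isBounded_Ioo a b) hθ.smooth.continuous
      refine hM.bdd_mul (c := C) (hθ.smooth.continuous.comp continuous_fst).aestronglyMeasurable ?_
      filter_upwards [ae_cyl_mem hD] with p hp using hC p.1 hp.1
    have heq' : ∫ p, (deriv θ p.1 * (φ p * inner ℝ (v p) (ψ p.2)) +
        θ p.1 * balanceDensity v G h u H π' φ ψ Ψ p) ∂cyl D a b = 0 := by
      rw [← heq]
      refine integral_congr_ae (ae_of_all _ fun p => ?_)
      simp only [balanceDensity, hXt, hXs, inner_balancePressure, hXd, Ψ,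
        balanceZero, inner_add_left, inner_sub_left, inner_add_right, inner_smul_left, inner_smul_right,
        conj_trivial, sum_inner, X, RCLike.inner_apply, Finset.sum_add_distrib, mul_add, mul_sub,
        Finset.mul_sum]
      have : ∀ i, θ p.1 * (spaceDeriv φ (basisVec i) p * inner ℝ (G i p) (ψ p.2)) =
        θ p.1 * spaceDeriv φ (basisVec i) p * inner ℝ (G i p) (ψ p.2) := fun i => by ring
      simp only [this]
      have : ∀ i, θ p.1 * (φ p * inner ℝ (G i p) (fderiv ℝ ψ p.2 (basisVec i))) =
        θ p.1 * φ p * inner ℝ (G i p) (fderiv ℝ ψ p.2 (basisVec i)) := fun i => by ring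
      simp only [this]
      ring
    rw [integral_add hF hθM, integral_prod _ hF, integral_prod _ hθM] at heq'
    simp only [integral_const_mul] at heq'
    rw [intervalIntegral.integral_of_le hab.le, intervalIntegral.integral_of_le hab.le,
      integral_Ioc_eq_integral_Ioo, integral_Ioc_eq_integral_Ioo]
    exact heq') hs ht
  rw [key, intervalIntegral.integral_of_le hst, integral_Ioc_eq_integral_Ioo, integral_prod]
  exact hM.mono_measure (cyl_mono hs.1 ht.2)

end Density

end SuitableNS

namespace SuitableNS

variable {D : Set E3} {a b : ℝ} {v h u : ℝ × E3 → E3} {G H : Fin 3 → ℝ × E3 → E3}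
  {π π' φ : ℝ × E3 → ℝ}

lemma IsH10.memLp_six (hD : Bornology.IsBounded D) {v : E3 → E3} {G : Fin 3 → E3 → E3}
    (hv : IsH10 D v G) : MemLp v 6 (volume.restrict D) := by
  obtain ⟨C, hC⟩ := exists_sobolev hD 6 (by norm_num)
  refine ⟨hv.memLp.1, ((hC v G hv).1).trans_lt ?_⟩
  refine ENNReal.mul_lt_top (by simp) (ENNReal.sum_lt_top.2 fun i _ => (hv.memLp_grad i).2)

lemma H10Approx.tendsto_six (hD : Bornology.IsBounded D) {v : E3 → E3} {G : Fin 3 → E3 → E3}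
    (hv : IsH10 D v G) {φ : ℕ → E3 → E3} (h : H10Approx D v G φ) :
    Tendsto (fun n => eLpNorm (φ n - v) 6 (volume.restrict D)) atTop (𝓝 0) := by
  obtain ⟨C, hC⟩ := exists_sobolev hD 6 (by norm_num)
  simpa using (hC v G hv).2 φ h.test h.tendsto h.tendsto_grad

lemma tendsto_eLpNorm_comp_snd {α β F : Type*} {mα : MeasurableSpace α} {mβ : MeasurableSpace β}
    {μ : Measure α} {ν : Measure β} [IsFiniteMeasure μ] [SFinite ν] [NormedAddCommGroup F]
    {p : ℝ≥0∞} (hp : p ≠ 0) (hp' : p ≠ ⊤) {f : ℕ → β → F}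
    (hf : ∀ n, AEStronglyMeasurable (f n) ν) (h : Tendsto (fun n => eLpNorm (f n) p ν) atTop (𝓝 0)) :
    Tendsto (fun n => eLpNorm (fun x : α × β => f n x.2) p (μ.prod ν)) atTop (𝓝 0) := by
  have h1 : ∀ n, eLpNorm (fun x : α × β => f n x.2) p (μ.prod ν) =
      (μ univ) ^ (1 / p.toReal) * eLpNorm (f n) p ν := by
    intro n
    have hm : AEStronglyMeasurable (f n) (Measure.map Prod.snd (μ.prod ν)) := by
      rw [Measure.map_snd_prod]; exact (hf n).smul_measure _
    have := eLpNorm_map_measure (p := p) hm measurable_snd.aemeasurable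
    rw [Measure.map_snd_prod, eLpNorm_smul_measure_of_ne_top hp'] at this
    rw [smul_eq_mul, ENNReal.toReal_div, ENNReal.toReal_one] at this
    exact this.symm
  simp only [h1]
  have := ENNReal.Tendsto.const_mul (a := (μ univ) ^ (1 / p.toReal)) h
    (Or.inr (ENNReal.rpow_ne_top_of_nonneg (by positivity) (measure_ne_top _ _)))
  simpa using this

lemma tendsto_integral_inner_const {α F : Type*} {m : MeasurableSpace α} {μ : Measure α}
    [NormedAddCommGroup F] [InnerProductSpace ℝ F] {p q : ℝ≥0∞} (hq : 1 ≤ q) [p.HolderTriple q 1]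
    {f : α → F} {g : ℕ → α → F} {g₀ : α → F} (hf : MemLp f p μ)
    (hg : ∀ n, MemLp (g n) q μ) (hg₀ : MemLp g₀ q μ)
    (hgg : Tendsto (fun n => eLpNorm (g n - g₀) q μ) atTop (𝓝 0)) :
    Tendsto (fun n => ∫ x, inner ℝ (f x) (g n x) ∂μ) atTop (𝓝 (∫ x, inner ℝ (f x) (g₀ x) ∂μ)) :=
  tendsto_integral_inner hq (fun _ => hf) hg hf hg₀ (by simp) hgg

/-- The balance law for fields without divergence. -/
lemma IsBalanced.balance (hD : IsSmoothBoundedDomain D) (ha : 0 ≤ a)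
    (hb : IsBalanced D a b v G h u H π) (hφ : ContDiff ℝ ∞ φ) (hπ' : MemLp π' (5 / 3) (cyl D a b))
    (hab : a < b) (hππ' : ∀ p y, π p * spaceDeriv φ y p = π' p * spaceDeriv φ y p)
    {ψ : E3 → E3} {Ψ : Fin 3 → E3 → E3} (hψH : MemH D ψ) (hψ : IsH10 D ψ Ψ)
    {s t : ℝ} (hs : s ∈ Icc a b) (ht : t ∈ Icc a b) (hst : s ≤ t) :
    (∫ x in D, φ (t, x) * inner ℝ (v (t, x)) (ψ x)) - (∫ x in D, φ (s, x) * inner ℝ (v (s, x)) (ψ x)) =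
      ∫ p, balanceDensity v G h u H π' φ ψ Ψ p ∂cyl D s t := by
  have hfin := hD.isFiniteMeasure
  have i1 := holderTriple_six
  -- Convergence in H¹ handles the viscous and force terms. The convective and pressure terms use
  -- convergence in L⁶, for which the pressure contribution is lowered from L^{5/3} to L^{6/5}.
  obtain ⟨χ, hχ, hdiv⟩ := exists_solenoidal_approx hD hψH hψ
  have hχ6 := hχ.tendsto_six hD.bounded hψ
  have hψ6 := hψ.memLp_six hD.bounded
  have hmono := cyl_mono (D := D) hs.1 ht.2
  have hA := (hb.memLp_balanceZero hD ha hφ).mono_measure hmono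
  have hB := fun i => (memLp_cyl_smul hD hφ.continuous (hb.memLp_flow_grad ha i)).mono_measure hmono
  have hC := (memLp_cyl_smul hD hφ.continuous hb.memLp_advect).mono_measure hmono
  have hE : MemLp (balancePressure π' φ) (6 / 5) (cyl D s t) :=
    ((memLp_balancePressure hD hφ hπ').mono_measure hmono).mono_exponent (by
      rw [← ENNReal.toReal_le_toReal (ENNReal.div_ne_top (by simp) (by simp))
        (ENNReal.div_ne_top (by simp) (by simp))]; norm_num)
  have hsum : ∀ {ψ : E3 → E3} {Ψ : Fin 3 → E3 → E3} (h2 : MemLp ψ 2 (volume.restrict D))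
      (h2' : ∀ i, MemLp (Ψ i) 2 (volume.restrict D)) (h6 : MemLp ψ 6 (volume.restrict D)),
      ∫ p, balanceDensity v G h u H π' φ ψ Ψ p ∂cyl D s t =
        (∫ p, inner ℝ (balanceZero v G h φ p) (ψ p.2) ∂cyl D s t)
        - (∑ i, ∫ p, inner ℝ (φ p • G i p) (Ψ i p.2) ∂cyl D s t)
        + (∫ p, inner ℝ (balancePressure π' φ p) (ψ p.2) ∂cyl D s t)
        - (∫ p, inner ℝ (φ p • advect (u p) fun i => H i p) (ψ p.2) ∂cyl D s t) + ∫ _, (0 : ℝ) ∂cyl D s t := by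
    intro ψ Ψ h2 h2' h6
    rw [integral_five (integrable_inner_of_memLp hA (h2.comp_snd _))
      (fun i => integrable_inner_of_memLp (hB i) ((h2' i).comp_snd _))
      (integrable_inner_of_memLp hE (h6.comp_snd _))
      (integrable_inner_of_memLp hC (h6.comp_snd _)) (f₅ := fun _ => 0) (integrable_zero _ _ _)]
    refine integral_congr_ae (ae_of_all _ fun p => ?_)
    simp only [balanceDensity]
    ring
  have hl : ∀ r ∈ Icc a b, Tendsto (fun n => ∫ x in D, φ (r, x) * inner ℝ (v (r, x)) (χ n x)) atTop
      (𝓝 (∫ x in D, φ (r, x) * inner ℝ (v (r, x)) (ψ x))) := by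
    intro r hr
    have hm := memLp_continuous_smul hD (hφ.continuous.comp (by fun_prop : Continuous fun x => (r, x)))
      (hb.flow.memH r ⟨ha.trans hr.1, hr.2⟩).memLp
    have := tendsto_integral_inner_const (p := 2) (q := 2) (by norm_num) hm
      (fun n => (hχ.test n).memLp 2) hψ.memLp hχ.tendsto
    simpa only [inner_smul_left, conj_trivial, Function.comp_apply] using this
  have hr : Tendsto (fun n => ∫ p, balanceDensity v G h u H π' φ (χ n)
      (fun i x => fderiv ℝ (χ n) x (basisVec i)) p ∂cyl D s t) atTop
      (𝓝 (∫ p, balanceDensity v G h u H π' φ ψ Ψ p ∂cyl D s t)) := by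
    rw [hsum hψ.memLp hψ.memLp_grad hψ6]
    simp only [fun n => hsum ((hχ.test n).memLp 2)
      (fun i => ((hχ.test n).fderiv_apply (basisVec i)).memLp 2) ((hχ.test n).memLp 6)]
    have t2 := tendsto_eLpNorm_comp_snd (μ := volume.restrict (Ioo s t)) (by simp) (by simp)
      (fun n => ((hχ.test n).memLp 2).1.sub hψ.memLp.1) hχ.tendsto
    have t6 := tendsto_eLpNorm_comp_snd (μ := volume.restrict (Ioo s t)) (by simp) (by simp)
      (fun n => ((hχ.test n).memLp 6).1.sub hψ.memLp.1) hχ6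
    have tg := fun i => tendsto_eLpNorm_comp_snd (μ := volume.restrict (Ioo s t)) (by simp) (by simp)
      (fun n => (((hχ.test n).fderiv_apply (basisVec i)).memLp 2).1.sub (hψ.memLp_grad i).1)
      (hχ.tendsto_grad i)
    refine Tendsto.add (Tendsto.sub (Tendsto.add (Tendsto.sub ?_ (tendsto_finsetSum _ fun i _ => ?_))
      ?_) ?_) tendsto_const_nhds
    · exact tendsto_integral_inner_const (p := 2) (q := 2) (by norm_num) hA
        (fun n => ((hχ.test n).memLp 2).comp_snd _) (hψ.memLp.comp_snd _) t2
    · exact tendsto_integral_inner_const (p := 2) (q := 2) (by norm_num) (hB i)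
        (fun n => (((hχ.test n).fderiv_apply (basisVec i)).memLp 2).comp_snd _)
        ((hψ.memLp_grad i).comp_snd _) (tg i)
    · exact tendsto_integral_inner_const (by norm_num) hE
        (fun n => ((hχ.test n).memLp 6).comp_snd _) (hψ6.comp_snd _) t6
    · exact tendsto_integral_inner_const (by norm_num) hC
        (fun n => ((hχ.test n).memLp 6).comp_snd _) (hψ6.comp_snd _) t6
  refine tendsto_nhds_unique ((hl t ht).sub (hl s hs)) (hr.congr fun n => ?_)
  exact (hb.balance_test hD ha hφ hπ' hab hππ' (hχ.test n) (hdiv n) hs ht hst).symm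

end SuitableNS

/-! ### The product rule on the diagonal for functions of two times -/

namespace SuitableNS

/-- Functions `n` of two times for which `∫_a^b n(t, t - σ) dt` is continuous at `σ = 0`. -/
structure IsCross (a₀ a b : ℝ) (n : ℝ → ℝ → ℝ) : Prop where
  integrable : Integrable (fun p : ℝ × ℝ => n p.1 p.2)
    ((volume.restrict (Ioo a₀ b)).prod (volume.restrict (Ioo a₀ b)))
  shift : ∀ σ, 0 ≤ σ → σ < a - a₀ → IntegrableOn (fun t => n t (t - σ)) (Ioo a b)
  tendsto : Tendsto (fun σ => ∫ t in Ioo a b, n t (t - σ)) (𝓝[>] 0) (𝓝 (∫ t in Ioo a b, n t t))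

section Cross

variable {a₀ a b : ℝ} {n n₁ n₂ : ℝ → ℝ → ℝ}

lemma eventually_shift (ha : a₀ < a) : ∀ᶠ σ : ℝ in 𝓝[>] 0, 0 ≤ σ ∧ σ < a - a₀ := by
  filter_upwards [Ioo_mem_nhdsGT (sub_pos.2 ha)] with σ hσ using ⟨hσ.1.le, hσ.2⟩

lemma IsCross.diag (ha : a₀ < a) (h : IsCross a₀ a b n) : IntegrableOn (fun t => n t t) (Ioo a b) := by
  simpa using h.shift 0 le_rfl (sub_pos.2 ha)

lemma IsCross.add (ha : a₀ < a) (h₁ : IsCross a₀ a b n₁) (h₂ : IsCross a₀ a b n₂) :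
    IsCross a₀ a b (fun t r => n₁ t r + n₂ t r) := by
  refine ⟨h₁.integrable.add h₂.integrable, fun σ h h' => (h₁.shift σ h h').add (h₂.shift σ h h'), ?_⟩
  rw [integral_add (h₁.diag ha) (h₂.diag ha)]
  refine (h₁.tendsto.add h₂.tendsto).congr' ?_
  filter_upwards [eventually_shift ha] with σ hσ
  rw [integral_add (h₁.shift σ hσ.1 hσ.2) (h₂.shift σ hσ.1 hσ.2)]

lemma IsCross.neg (h₁ : IsCross a₀ a b n₁) : IsCross a₀ a b (fun t r => -n₁ t r) := by
  refine ⟨h₁.integrable.neg, fun σ h h' => (h₁.shift σ h h').neg, ?_⟩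
  simp only [integral_neg]
  exact h₁.tendsto.neg

lemma IsCross.sub (ha : a₀ < a) (h₁ : IsCross a₀ a b n₁) (h₂ : IsCross a₀ a b n₂) :
    IsCross a₀ a b (fun t r => n₁ t r - n₂ t r) := by
  simpa only [sub_eq_add_neg] using h₁.add ha h₂.neg

lemma isCross_zero : IsCross a₀ a b (fun _ _ => 0) :=
  ⟨integrable_zero _ _ _, fun _ _ _ => integrable_zero _ _ _, tendsto_const_nhds⟩

lemma isCross_sum {ι : Type*} (s : Finset ι) (ha : a₀ < a) {n : ι → ℝ → ℝ → ℝ}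
    (h : ∀ i, IsCross a₀ a b (n i)) : IsCross a₀ a b (fun t r => ∑ i ∈ s, n i t r) := by
  classical
  induction s using Finset.induction_on with
  | empty => simpa using isCross_zero
  | insert i s hi ih => simpa only [Finset.sum_insert hi] using (h i).add ha ih

lemma measurePreserving_shear :
    MeasurePreserving (fun p : ℝ × ℝ => (p.1, p.1 - p.2)) (volume.prod volume) (volume.prod volume) := by
  refine (MeasurePreserving.id (volume : Measure ℝ)).skew_product (by fun_prop) (ae_of_all _ fun t => ?_)
  exact Measure.map_sub_left_eq_self volume t

/-- The shear (t, r) ↦ (t, t - r) preserves measure. The margin between a₀ and a is the room for the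
shift: for t > a and σ < a - a₀ the time t - σ stays above a₀. -/
lemma IsCross.integrable_shear (h : IsCross a₀ a b n) :
    Integrable (fun p : ℝ × ℝ => n p.1 (p.1 - p.2))
      ((volume.restrict (Ioo a b)).prod (volume.restrict (Ioo 0 (a - a₀)))) := by
  have h1 := h.integrable
  rw [Measure.prod_restrict] at h1
  have h2 := (integrable_indicator_iff (measurableSet_Ioo.prod measurableSet_Ioo)).2 h1
  have h3 := (measurePreserving_shear.integrable_comp h2.1).2 h2
  rw [Measure.prod_restrict]
  refine (h3.integrableOn (s := Ioo a b ×ˢ Ioo 0 (a - a₀))).congr ?_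
  filter_upwards [ae_restrict_mem (measurableSet_Ioo.prod measurableSet_Ioo)] with p hp
  obtain ⟨⟨h4, h5⟩, h6, h7⟩ := hp
  rw [Function.comp_apply, indicator_of_mem]
  exact ⟨⟨by linarith, h5⟩, by simp only [mem_Ioo]; constructor <;> linarith⟩

/-- The increments of a function of two times along the diagonal, averaged over short shifts. -/
lemma integral_shift_eq (ha : a₀ < a) (hab : a < b) (h₁ : IsCross a₀ a b n₁) (h₂ : IsCross a₀ a b n₂)
    {g : ℝ → ℝ → ℝ}
    (hg₁ : ∀ᵐ r ∂volume.restrict (Ioo a₀ b), ∀ s ∈ Icc a₀ b, ∀ t ∈ Icc a₀ b, s ≤ t →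
      g t r - g s r = ∫ τ in Ioo s t, n₁ τ r)
    (hg₂ : ∀ᵐ t ∂volume.restrict (Ioo a₀ b), ∀ s ∈ Icc a₀ b, ∀ r ∈ Icc a₀ b, s ≤ r →
      g t r - g t s = ∫ τ in Ioo s r, n₂ t τ)
    (hg₀ : ContinuousOn (fun t => g t a₀) (Icc a₀ b)) (hga : ContinuousOn (g a) (Icc a₀ b))
    (hgb : ContinuousOn (g b) (Icc a₀ b)) {δ : ℝ} (hδ : 0 < δ) (hδ' : δ < a - a₀) :
    ∫ σ in 0..δ, (∫ t in Ioo a b, (n₁ t (t - σ) + n₂ t (t - σ))) =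
      ∫ σ in 0..δ, (g b (b - σ) - g a (a - σ)) := by
  have hsub : Ioo 0 δ ⊆ Ioo 0 (a - a₀) := Ioo_subset_Ioo_right hδ'.le
  have hδint : ∀ {n : ℝ → ℝ → ℝ}, IsCross a₀ a b n → Integrable (fun p : ℝ × ℝ => n p.1 (p.1 - p.2))
      ((volume.restrict (Ioo a b)).prod (volume.restrict (Ioo 0 δ))) := fun h =>
    h.integrable_shear.mono_measure (Measure.prod_mono le_rfl (Measure.restrict_mono hsub le_rfl))
  -- the strip `t - δ < r < t`
  have hstrip : ∀ {n : ℝ → ℝ → ℝ}, IsCross a₀ a b n →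
      ∫ σ in Ioo 0 δ, ∫ t in Ioo a b, n t (t - σ) = ∫ t in a..b, ∫ r in (t - δ)..t, n t r := by
    intro n h
    rw [integral_integral_swap (f := fun σ t => n t (t - σ)) (hδint h).swap,
      intervalIntegral.integral_of_le hab.le, integral_Ioc_eq_integral_Ioo]
    refine integral_congr_ae (ae_of_all _ fun t => ?_)
    have := intervalIntegral.integral_comp_sub_left (a := 0) (b := δ) (n t) t
    rw [sub_zero, intervalIntegral.integral_of_le hδ.le, integral_Ioc_eq_integral_Ioo] at this
    exact this
  -- values on lines parallel to the diagonal
  have hdiag : ∀ e, 0 ≤ e → e < a - a₀ → IntervalIntegrable (fun t => g t (t - e)) volume a b := by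
    intro e he he'
    rw [intervalIntegrable_iff_integrableOn_Ioo_of_le hab.le]
    have hm : MeasurableSet {p : ℝ × ℝ | p.2 < p.1 - e} :=
      measurableSet_lt measurable_snd (measurable_fst.sub_const e)
    have i1 := (h₂.integrable.indicator hm).integral_prod_left
    have i2 : IntegrableOn (fun t => g t a₀) (Ioo a b) :=
      (hg₀.integrableOn_Icc).mono_set ((Ioo_subset_Ioo_left ha.le).trans Ioo_subset_Icc_self)
    -- No joint measurability of g is assumed. On the shifted diagonal g equals g(t, a₀) plus an
    -- integral of n₂, and this is integrable by Fubini.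
    refine (i2.add (IntegrableOn.mono_set i1 (Ioo_subset_Ioo_left ha.le))).congr ?_
    filter_upwards [ae_restrict_mem measurableSet_Ioo,
      ae_restrict_of_ae_restrict_of_subset (Ioo_subset_Ioo_left ha.le) hg₂] with t ht hgt
    have h3 := hgt a₀ ⟨le_rfl, by linarith [ht.1, ht.2]⟩ (t - e)
      ⟨by linarith [ht.1], by linarith [ht.2]⟩ (by linarith [ht.1])
    have h4 : ∫ y in Ioo a₀ b, {p : ℝ × ℝ | p.2 < p.1 - e}.indicator (fun p => n₂ p.1 p.2) (t, y) =
        ∫ τ in Ioo a₀ (t - e), n₂ t τ := by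
      have : (fun y => {p : ℝ × ℝ | p.2 < p.1 - e}.indicator (fun p => n₂ p.1 p.2) (t, y)) =
          (Iio (t - e)).indicator (n₂ t) := by
        ext y; simp [indicator_apply]
      rw [this, setIntegral_indicator measurableSet_Iio]
      congr 2
      ext y
      simp only [mem_inter_iff, mem_Ioo, mem_Iio]
      constructor
      · rintro ⟨⟨h1, -⟩, h2⟩; exact ⟨h1, h2⟩
      · rintro ⟨h1, h2⟩; exact ⟨⟨h1, by linarith [ht.2]⟩, h2⟩
    rw [Pi.add_apply, h4, ← h3]
    ring
  have hd0 : IntervalIntegrable (fun t => g t t) volume a b := by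
    simpa using hdiag 0 le_rfl (sub_pos.2 ha)
  have hd1 := hdiag δ hδ.le hδ'
  -- At fixed t the section of the strip is (t - δ, t), over which n₂ integrates to an increment of
  -- g in the second time.
  have part₂ : ∫ t in a..b, ∫ r in (t - δ)..t, n₂ t r =
      (∫ t in a..b, g t t) - ∫ t in a..b, g t (t - δ) := by
    rw [← intervalIntegral.integral_sub hd0 hd1, intervalIntegral.integral_of_le hab.le,
      intervalIntegral.integral_of_le hab.le, integral_Ioc_eq_integral_Ioo,
      integral_Ioc_eq_integral_Ioo]
    refine integral_congr_ae ?_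
    filter_upwards [ae_restrict_mem measurableSet_Ioo,
      ae_restrict_of_ae_restrict_of_subset (Ioo_subset_Ioo_left ha.le) hg₂] with t ht hgt
    rw [hgt (t - δ) ⟨by linarith [ht.1], by linarith [ht.2]⟩ t ⟨by linarith [ht.1], ht.2.le⟩
      (by linarith), intervalIntegral.integral_of_le (by linarith), integral_Ioc_eq_integral_Ioo]
  have hp1 : IntervalIntegrable (fun r => g (min b (r + δ)) r) volume (a - δ) (b - δ) := by
    have := hd1.comp_add_right δ
    refine this.congr fun r hr => ?_
    rw [uIoc_of_le (by linarith)] at hr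
    simp only [add_sub_cancel_right]
    rw [min_eq_right (by linarith [hr.2])]
  have hp2 : IntervalIntegrable (fun r => g (min b (r + δ)) r) volume (b - δ) b := by
    have : IntervalIntegrable (g b) volume (b - δ) b := by
      refine (hgb.mono ?_).intervalIntegrable
      rw [uIcc_of_le (by linarith)]
      exact Icc_subset_Icc_left (by linarith)
    refine this.congr fun r hr => ?_
    rw [uIoc_of_le (by linarith)] at hr
    rw [min_eq_left (by linarith [hr.1])]
  have hq1 : IntervalIntegrable (fun r => g (max a r) r) volume (a - δ) a := by
    have : IntervalIntegrable (g a) volume (a - δ) a := by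
      refine (hga.mono ?_).intervalIntegrable
      rw [uIcc_of_le (by linarith)]
      exact Icc_subset_Icc (by linarith) hab.le
    refine this.congr fun r hr => ?_
    rw [uIoc_of_le (by linarith)] at hr
    rw [max_eq_left hr.2]
  have hq2 : IntervalIntegrable (fun r => g (max a r) r) volume a b := by
    refine hd0.congr fun r hr => ?_
    rw [uIoc_of_le hab.le] at hr
    rw [max_eq_right hr.1.le]
  -- For n₁ the order of integration is exchanged. At fixed r the section of the strip is the
  -- interval from max(a, r) to min(b, r + δ), over which n₁ integrates to an increment of g in the
  -- first time.
  have part₁ : ∫ t in a..b, ∫ r in (t - δ)..t, n₁ t r =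
      ∫ r in (a - δ)..b, (g (min b (r + δ)) r - g (max a r) r) := by
    set A : Set (ℝ × ℝ) := {p | a < p.1 ∧ p.2 < p.1 ∧ p.1 - δ < p.2}
    have hA : MeasurableSet A :=
      (measurableSet_lt measurable_const measurable_fst).inter
        ((measurableSet_lt measurable_snd measurable_fst).inter
          (measurableSet_lt (measurable_fst.sub_const δ) measurable_snd))
    have hswap := integral_integral_swap (f := fun t r => A.indicator (fun p => n₁ p.1 p.2) (t, r))
      (h₁.integrable.indicator hA)
    have hl : ∫ t in Ioo a₀ b, ∫ r in Ioo a₀ b, A.indicator (fun p => n₁ p.1 p.2) (t, r) =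
        ∫ t in a..b, ∫ r in (t - δ)..t, n₁ t r := by
      rw [intervalIntegral.integral_of_le hab.le, integral_Ioc_eq_integral_Ioo]
      have : Ioo a b = Ioo a₀ b ∩ Ioi a := by
        ext t; simp only [mem_Ioo, mem_inter_iff, mem_Ioi]
        constructor
        · rintro ⟨h1, h2⟩; exact ⟨⟨ha.trans h1, h2⟩, h1⟩
        · rintro ⟨⟨-, h2⟩, h1⟩; exact ⟨h1, h2⟩
      rw [this, ← setIntegral_indicator measurableSet_Ioi]
      refine setIntegral_congr_fun measurableSet_Ioo fun t ht => ?_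
      by_cases hta : a < t
      · simp only [indicator_of_mem (show t ∈ Ioi a from hta)]
        rw [intervalIntegral.integral_of_le (by linarith), integral_Ioc_eq_integral_Ioo]
        have h1 : (fun r => A.indicator (fun p => n₁ p.1 p.2) (t, r)) =
            (Ioo (t - δ) t).indicator (n₁ t) := by
          ext r
          by_cases hr : r ∈ Ioo (t - δ) t
          · rw [indicator_of_mem hr, indicator_of_mem]; exact ⟨hta, hr.2, hr.1⟩
          · rw [indicator_of_notMem hr, indicator_of_notMem]; exact fun h => hr ⟨h.2.2, h.2.1⟩
        rw [h1, setIntegral_indicator measurableSet_Ioo, inter_eq_right.2]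
        exact Ioo_subset_Ioo (by linarith) ht.2.le
      · simp only [indicator_of_notMem (show t ∉ Ioi a from hta)]
        refine integral_eq_zero_of_ae (ae_of_all _ fun r => ?_)
        exact indicator_of_notMem (fun h => hta h.1) _
    have hr : ∫ r in Ioo a₀ b, ∫ t in Ioo a₀ b, A.indicator (fun p => n₁ p.1 p.2) (t, r) =
        ∫ r in (a - δ)..b, (g (min b (r + δ)) r - g (max a r) r) := by
      rw [intervalIntegral.integral_of_le (by linarith), integral_Ioc_eq_integral_Ioo]
      have : Ioo (a - δ) b = Ioo a₀ b ∩ Ioi (a - δ) := by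
        ext t; simp only [mem_Ioo, mem_inter_iff, mem_Ioi]
        constructor
        · rintro ⟨h1, h2⟩; exact ⟨⟨by linarith, h2⟩, h1⟩
        · rintro ⟨⟨-, h2⟩, h1⟩; exact ⟨h1, h2⟩
      rw [this, ← setIntegral_indicator measurableSet_Ioi]
      refine setIntegral_congr_ae measurableSet_Ioo ?_
      filter_upwards [(ae_restrict_iff' measurableSet_Ioo).1 hg₁] with r hgr hr
      have h1 : (fun t => A.indicator (fun p => n₁ p.1 p.2) (t, r)) =
          (Ioo (max a r) (r + δ)).indicator (fun t => n₁ t r) := by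
        ext t
        by_cases ht : t ∈ Ioo (max a r) (r + δ)
        · rw [indicator_of_mem ht, indicator_of_mem]
          have := max_lt_iff.1 ht.1
          exact ⟨this.1, this.2, by linarith [ht.2]⟩
        · rw [indicator_of_notMem ht, indicator_of_notMem]
          exact fun h => ht ⟨max_lt h.1 h.2.1, by linarith [h.2.2]⟩
      rw [h1, setIntegral_indicator measurableSet_Ioo]
      have h2 : Ioo a₀ b ∩ Ioo (max a r) (r + δ) = Ioo (max a r) (min b (r + δ)) := by
        rw [Ioo_inter_Ioo, max_eq_right (ha.le.trans (le_max_left _ _))]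
      rw [h2]
      by_cases hra : a - δ < r
      · rw [indicator_of_mem (show r ∈ Ioi (a - δ) from hra)]
        have h3 : max a r ≤ min b (r + δ) :=
          max_le (le_min hab.le (by linarith)) (le_min hr.2.le (by linarith))
        exact (hgr hr _ ⟨ha.le.trans (le_max_left _ _), h3.trans (min_le_left _ _)⟩ _
          ⟨le_min (ha.trans hab).le (by linarith), min_le_left _ _⟩ h3).symm
      · rw [indicator_of_notMem (show r ∉ Ioi (a - δ) from hra), Ioo_eq_empty, setIntegral_empty]
        rw [not_lt]
        exact (min_le_right _ _).trans (le_trans (by linarith) (le_max_left _ _))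
    rw [← hl, hswap, hr]
  -- The integrals along the diagonal and along its shift by δ cancel those in the part with n₂.
  -- Only the two ends of the strip are left, with the first time equal to a or to b.
  have hsplit : ∫ r in (a - δ)..b, (g (min b (r + δ)) r - g (max a r) r) =
      ((∫ t in a..b, g t (t - δ)) + ∫ r in (b - δ)..b, g b r) -
        ((∫ r in (a - δ)..a, g a r) + ∫ t in a..b, g t t) := by
    rw [intervalIntegral.integral_sub (hp1.trans hp2) (hq1.trans hq2),
      ← intervalIntegral.integral_add_adjacent_intervals hp1 hp2,
      ← intervalIntegral.integral_add_adjacent_intervals hq1 hq2]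
    congr 2
    · have := intervalIntegral.integral_comp_add_right (a := a - δ) (b := b - δ)
        (fun t => g t (t - δ)) δ
      simp only [add_sub_cancel_right, sub_add_cancel] at this
      rw [← this]
      refine intervalIntegral.integral_congr fun r hr => ?_
      rw [uIcc_of_le (by linarith)] at hr
      rw [min_eq_right (by linarith [hr.2])]
    · refine intervalIntegral.integral_congr fun r hr => ?_
      rw [uIcc_of_le (by linarith)] at hr
      rw [min_eq_left (by linarith [hr.1])]
    · refine intervalIntegral.integral_congr fun r hr => ?_
      rw [uIcc_of_le (by linarith)] at hr
      rw [max_eq_left hr.2]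
    · refine intervalIntegral.integral_congr fun r hr => ?_
      rw [uIcc_of_le hab.le] at hr
      rw [max_eq_right hr.1]
  have hL : ∫ σ in 0..δ, (∫ t in Ioo a b, (n₁ t (t - σ) + n₂ t (t - σ))) =
      (∫ t in a..b, ∫ r in (t - δ)..t, n₁ t r) + ∫ t in a..b, ∫ r in (t - δ)..t, n₂ t r := by
    rw [← hstrip h₁, ← hstrip h₂, intervalIntegral.integral_of_le hδ.le, integral_Ioc_eq_integral_Ioo,
      ← integral_add (hδint h₁).integral_prod_right (hδint h₂).integral_prod_right]
    refine setIntegral_congr_fun measurableSet_Ioo fun σ hσ => ?_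
    exact integral_add (h₁.shift σ hσ.1.le (hσ.2.trans hδ')) (h₂.shift σ hσ.1.le (hσ.2.trans hδ'))
  have hcont : ∀ c, a ≤ c → c ≤ b → ContinuousOn (g c) (Icc a₀ b) →
      IntervalIntegrable (fun σ => g c (c - σ)) volume 0 δ := by
    intro c hc hcb h
    refine (h.comp (by fun_prop) fun σ hσ => ?_).intervalIntegrable
    rw [uIcc_of_le hδ.le] at hσ
    exact ⟨by linarith [hσ.2], by linarith [hσ.1]⟩
  have e1 := intervalIntegral.integral_comp_sub_left (a := 0) (b := δ) (g a) a
  have e2 := intervalIntegral.integral_comp_sub_left (a := 0) (b := δ) (g b) b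
  rw [sub_zero] at e1 e2
  rw [hL, part₁, part₂, hsplit, intervalIntegral.integral_sub (hcont b hab.le le_rfl hgb)
    (hcont a le_rfl hab.le hga), e1, e2]
  ring

/-- Formally this is d/dt g(t, t) = n₁ + n₂, but g is absolutely continuous in one time only for
almost every value of the other. The averaged identity over a strip of width δ avoids the diagonal,
and it is differentiated at δ = 0 from the right. On one side this uses continuity of the shifted
integrals of n₁ + n₂, on the other continuity of g(a, ·) and g(b, ·), so the conclusion holds at the
given endpoints and not merely at almost all of them. -/
theorem IsCross.sub_eq (ha : a₀ < a) (hab : a < b) (h₁ : IsCross a₀ a b n₁)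
    (h₂ : IsCross a₀ a b n₂) {g : ℝ → ℝ → ℝ}
    (hg₁ : ∀ᵐ r ∂volume.restrict (Ioo a₀ b), ∀ s ∈ Icc a₀ b, ∀ t ∈ Icc a₀ b, s ≤ t →
      g t r - g s r = ∫ τ in Ioo s t, n₁ τ r)
    (hg₂ : ∀ᵐ t ∂volume.restrict (Ioo a₀ b), ∀ s ∈ Icc a₀ b, ∀ r ∈ Icc a₀ b, s ≤ r →
      g t r - g t s = ∫ τ in Ioo s r, n₂ t τ)
    (hg₀ : ContinuousOn (fun t => g t a₀) (Icc a₀ b)) (hga : ContinuousOn (g a) (Icc a₀ b))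
    (hgb : ContinuousOn (g b) (Icc a₀ b)) :
    g b b - g a a = ∫ t in Ioo a b, (n₁ t t + n₂ t t) := by
  have hc := h₁.add ha h₂
  set J : ℝ → ℝ := fun σ => ∫ t in Ioo a b, (n₁ t (t - σ) + n₂ t (t - σ))
  have hJ : IntegrableOn J (Ioo 0 (a - a₀)) := hc.integrable_shear.integral_prod_right
  have d1 : HasDerivWithinAt (fun δ => ∫ σ in (0 : ℝ)..δ, J σ) (∫ t in Ioo a b, (n₁ t t + n₂ t t))
      (Ici 0) 0 := by
    refine intervalIntegral.integral_hasDerivWithinAt_of_tendsto_ae_right (t := Ioi 0) (by simp)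
      ⟨Ioo 0 (a - a₀), Ioo_mem_nhdsGT (sub_pos.2 ha), hJ.1⟩ ?_
    exact hc.tendsto.mono_left inf_le_left
  have hend : ∀ c ∈ Ioc a₀ b, a ≤ c → ContinuousOn (g c) (Icc a₀ b) →
      ContinuousOn (fun σ => g c (c - σ)) (Icc 0 (a - a₀)) := by
    intro c hc hac h
    refine h.comp (by fun_prop) fun σ hσ => ?_
    simp only [mem_Icc] at hσ ⊢
    constructor <;> linarith [hc.2, hσ.1, hσ.2]
  have hK : ContinuousOn (fun σ => g b (b - σ) - g a (a - σ)) (Icc 0 (a - a₀)) :=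
    (hend b ⟨ha.trans hab, le_rfl⟩ hab.le hgb).sub (hend a ⟨ha, hab.le⟩ le_rfl hga)
  have d2 : HasDerivWithinAt (fun δ => ∫ σ in (0 : ℝ)..δ, (g b (b - σ) - g a (a - σ)))
      (g b b - g a a) (Ici 0) 0 := by
    have h0 := (hK 0 ⟨le_rfl, (sub_pos.2 ha).le⟩).mono Ioo_subset_Icc_self
    refine intervalIntegral.integral_hasDerivWithinAt_of_tendsto_ae_right (t := Ioi 0) (by simp)
      ⟨Ioo 0 (a - a₀), Ioo_mem_nhdsGT (sub_pos.2 ha),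
        (hK.mono Ioo_subset_Icc_self).aestronglyMeasurable measurableSet_Ioo⟩ ?_
    have h1 := h0.tendsto
    simp only [sub_zero] at h1
    rw [nhdsWithin_Ioo_eq_nhdsGT (sub_pos.2 ha)] at h1
    exact h1.mono_left inf_le_left
  have hcongr : HasDerivWithinAt (fun δ => ∫ σ in (0 : ℝ)..δ, J σ) (g b b - g a a) (Ici 0) 0 := by
    refine d2.congr_of_eventuallyEq ?_ (by simp)
    have : Ico 0 (a - a₀) ∈ 𝓝[≥] (0 : ℝ) := Ico_mem_nhdsGE (sub_pos.2 ha)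
    filter_upwards [this] with δ hδ
    rcases hδ.1.eq_or_lt with h | h
    · simp [← h]
    · exact integral_shift_eq ha hab h₁ h₂ hg₁ hg₂ hg₀ hga hgb h hδ.2
  exact (uniqueDiffWithinAt_Ici 0).eq_deriv _ hcongr d1

end Cross

end SuitableNS

/-! ### Time shifts of space-time functions -/

namespace SuitableNS

variable {D : Set E3} {a₀ a b : ℝ}

section Lift

variable {β F : Type*} {mβ : MeasurableSpace β} {ν : Measure β} [IsFiniteMeasure ν]
  [NormedAddCommGroup F] {μ : Measure ℝ} [IsFiniteMeasure μ]

/-- Forgetting one of the two times multiplies the measure by a finite constant, so measurability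
and L^p membership pass to functions of two times and space. -/
lemma map_lift_fst : Measure.map (Prod.map Prod.fst id) ((μ.prod μ).prod ν) = μ univ • μ.prod ν := by
  rw [← Measure.map_prod_map _ _ measurable_fst measurable_id, Measure.map_fst_prod, Measure.map_id,
    Measure.prod_smul_left]

lemma map_lift_snd : Measure.map (Prod.map Prod.snd id) ((μ.prod μ).prod ν) = μ univ • μ.prod ν := by
  rw [← Measure.map_prod_map _ _ measurable_snd measurable_id, Measure.map_snd_prod, Measure.map_id,
    Measure.prod_smul_left]

lemma aestronglyMeasurable_lift_fst {A : ℝ × β → F} (hA : AEStronglyMeasurable A (μ.prod ν)) :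
    AEStronglyMeasurable (fun q : (ℝ × ℝ) × β => A (q.1.1, q.2)) ((μ.prod μ).prod ν) := by
  have h : AEStronglyMeasurable A (Measure.map (Prod.map Prod.fst id) ((μ.prod μ).prod ν)) := by
    rw [map_lift_fst]; exact hA.smul_measure _
  exact h.comp_measurable (measurable_fst.prodMap measurable_id)

lemma aestronglyMeasurable_lift_snd {A : ℝ × β → F} (hA : AEStronglyMeasurable A (μ.prod ν)) :
    AEStronglyMeasurable (fun q : (ℝ × ℝ) × β => A (q.1.2, q.2)) ((μ.prod μ).prod ν) := by
  have h : AEStronglyMeasurable A (Measure.map (Prod.map Prod.snd id) ((μ.prod μ).prod ν)) := by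
    rw [map_lift_snd]; exact hA.smul_measure _
  exact h.comp_measurable (measurable_snd.prodMap measurable_id)

lemma memLp_lift_fst {A : ℝ × β → F} {p : ℝ≥0∞} (hA : MemLp A p (μ.prod ν)) :
    MemLp (fun q : (ℝ × ℝ) × β => A (q.1.1, q.2)) p ((μ.prod μ).prod ν) := by
  have h : MemLp A p (Measure.map (Prod.map Prod.fst id) ((μ.prod μ).prod ν)) := by
    rw [map_lift_fst]; exact hA.smul_measure (measure_ne_top _ _)
  exact h.comp_of_map (measurable_fst.prodMap measurable_id).aemeasurable

lemma memLp_lift_snd {A : ℝ × β → F} {p : ℝ≥0∞} (hA : MemLp A p (μ.prod ν)) :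
    MemLp (fun q : (ℝ × ℝ) × β => A (q.1.2, q.2)) p ((μ.prod μ).prod ν) := by
  have h : MemLp A p (Measure.map (Prod.map Prod.snd id) ((μ.prod μ).prod ν)) := by
    rw [map_lift_snd]; exact hA.smul_measure (measure_ne_top _ _)
  exact h.comp_of_map (measurable_snd.prodMap measurable_id).aemeasurable

end Lift

section Shift

variable {F : Type*} [NormedAddCommGroup F]

lemma measurePreserving_timeShift (σ : ℝ) :
    MeasurePreserving (fun p : ℝ × E3 => (p.1 - σ, p.2)) volume volume := by
  rw [Measure.volume_eq_prod]
  exact (measurePreserving_sub_right volume σ).prod (MeasurePreserving.id _)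

lemma shift_mem {σ : ℝ} (hσ : 0 ≤ σ) (hσ' : σ < a - a₀) {t : ℝ} (ht : t ∈ Ioo a b) :
    t - σ ∈ Ioo a₀ b := mem_Ioo.2 ⟨by linarith [ht.1], by linarith [ht.2]⟩

lemma indicator_shift {σ : ℝ} (hσ : 0 ≤ σ) (hσ' : σ < a - a₀) (B : ℝ × E3 → F) {p : ℝ × E3}
    (hp : p ∈ Ioo a b ×ˢ D) : (Ioo a₀ b ×ˢ D).indicator B (p.1 - σ, p.2) = B (p.1 - σ, p.2) :=
  indicator_of_mem (mk_mem_prod (shift_mem hσ hσ' hp.1) hp.2) _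

/-- The extension by zero is shifted on all of space-time, where translation preserves measure. On
the smaller cylinder the shifted extension agrees with the shifted function. -/
lemma memLp_timeShift (hD : IsSmoothBoundedDomain D) {σ : ℝ} (hσ : 0 ≤ σ) (hσ' : σ < a - a₀)
    {B : ℝ × E3 → F} {q : ℝ≥0∞} (hB : MemLp B q (cyl D a₀ b)) :
    MemLp (fun p : ℝ × E3 => B (p.1 - σ, p.2)) q (cyl D a b) := by
  have hm := measurableSet_Ioo (a := a₀) (b := b) |>.prod hD.isOpen.measurableSet
  rw [cyl_eq] at hB
  have h1 := ((memLp_indicator_iff_restrict hm).2 hB).comp_measurePreserving (measurePreserving_timeShift σ)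
  refine (memLp_congr_ae ?_).1 (by rw [cyl_eq]; exact h1.restrict (Ioo a b ×ˢ D))
  filter_upwards [ae_cyl_mem hD] with p hp using indicator_shift hσ hσ' B hp

lemma ae_timeShift {σ : ℝ} (hσ : 0 ≤ σ) (hσ' : σ < a - a₀) {P : ℝ → Prop}
    (h : ∀ᵐ t ∂volume.restrict (Ioo a₀ b), P t) : ∀ᵐ t ∂volume.restrict (Ioo a b), P (t - σ) := by
  rw [ae_restrict_iff' measurableSet_Ioo] at h ⊢
  filter_upwards [(measurePreserving_sub_right (volume : Measure ℝ) σ).quasiMeasurePreserving.ae h]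
    with t ht h' using ht (shift_mem hσ hσ' (by simpa using h'))

/-- Strong continuity of translations in L^q for finite q, applied to the extension by zero and
restricted afterwards. -/
lemma tendsto_eLpNorm_timeShift (hD : IsSmoothBoundedDomain D) (ha : a₀ < a)
    {B : ℝ × E3 → F} {q : ℝ≥0∞} (hq : 1 ≤ q) (hq' : q ≠ ⊤) (hB : MemLp B q (cyl D a₀ b)) :
    Tendsto (fun σ => eLpNorm (fun p : ℝ × E3 => B (p.1 - σ, p.2) - B p) q (cyl D a b))
      (𝓝[>] 0) (𝓝 0) := by
  have : Fact (1 ≤ q) := ⟨hq⟩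
  have hm := measurableSet_Ioo (a := a₀) (b := b) |>.prod hD.isOpen.measurableSet
  rw [cyl_eq] at hB
  have h1 := (memLp_indicator_iff_restrict hm).2 hB
  set B' := (Ioo a₀ b ×ˢ D).indicator B
  let g : ℝ → C(ℝ × E3, ℝ × E3) := fun σ => ⟨fun p => (p.1 - σ, p.2), by fun_prop⟩
  have hg : Continuous g := ContinuousMap.continuous_of_continuous_uncurry _ (by
    simp only [Function.uncurry_def, g, ContinuousMap.coe_mk]; fun_prop)
  have hc := (continuous_const (y := h1.toLp B')).compMeasurePreservingLp hg
    (fun σ => measurePreserving_timeShift σ) hq'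
  have hc0 := (hc.tendsto 0).mono_left (nhdsWithin_le_nhds (s := Ioi 0))
  rw [tendsto_iff_edist_tendsto_0] at hc0
  refine tendsto_of_tendsto_of_tendsto_of_le_of_le' tendsto_const_nhds hc0
    (Eventually.of_forall fun _ => zero_le) ?_
  filter_upwards [eventually_shift ha] with σ hσ
  rw [Lp.edist_def]
  have e : ∀ σ, (Lp.compMeasurePreserving (g σ) (measurePreserving_timeShift σ) (h1.toLp B')) =ᵐ[volume]
      fun p => B' (p.1 - σ, p.2) := by
    intro σ
    exact (Lp.coeFn_compMeasurePreserving _ _).trans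
      ((measurePreserving_timeShift σ).quasiMeasurePreserving.ae_eq_comp h1.coeFn_toLp)
  rw [eLpNorm_congr_ae ((e σ).sub (e 0)), cyl_eq]
  refine le_trans (eLpNorm_mono_ae ?_) (eLpNorm_mono_measure _ Measure.restrict_le_self)
  rw [← cyl_eq]
  filter_upwards [ae_cyl_mem hD] with p hp
  have e1 : B' (p.1 - σ, p.2) = _ := indicator_shift hσ.1 hσ.2 B hp
  have e2 : B' (p.1 - 0, p.2) = _ := indicator_shift le_rfl (sub_pos.2 ha) B hp
  rw [Pi.sub_apply, e1, e2]
  simp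

end Shift

section Pairings

variable {F : Type*} [NormedAddCommGroup F] [InnerProductSpace ℝ F]

/-- Hölder and continuity of translations on the shifted factor B. Finiteness of q is essential for
B, while nothing like it is asked of p. -/
lemma isCross_of_memLp (hD : IsSmoothBoundedDomain D) (ha : a₀ < a)
    {p q : ℝ≥0∞} [p.HolderTriple q 1] (hq : 1 ≤ q) (hq' : q ≠ ⊤) {A B : ℝ × E3 → F}
    (hA : MemLp A p (cyl D a₀ b)) (hB : MemLp B q (cyl D a₀ b)) :
    IsCross a₀ a b (fun t r => ∫ x in D, inner ℝ (A (t, x)) (B (r, x))) := by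
  have hfin := hD.isFiniteMeasure
  have hA' : MemLp A p (cyl D a b) := hA.mono_measure (cyl_mono ha.le le_rfl)
  have hint : ∀ σ, 0 ≤ σ → σ < a - a₀ →
      Integrable (fun z : ℝ × E3 => inner ℝ (A z) (B (z.1 - σ, z.2))) (cyl D a b) := fun σ h h' =>
    integrable_inner_of_memLp hA' (memLp_timeShift hD h h' hB)
  refine ⟨(integrable_inner_of_memLp (memLp_lift_fst hA) (memLp_lift_snd hB)).integral_prod_left,
    fun σ h h' => (hint σ h h').integral_prod_left, ?_⟩
  have hJ : ∀ σ, 0 ≤ σ → σ < a - a₀ → ∫ t in Ioo a b, ∫ x in D, inner ℝ (A (t, x)) (B (t - σ, x)) =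
      ∫ z, inner ℝ (A z) (B (z.1 - σ, z.2)) ∂cyl D a b := fun σ h h' => (integral_prod _ (hint σ h h')).symm
  have h0 := hJ 0 le_rfl (sub_pos.2 ha)
  have hint0 := hint 0 le_rfl (sub_pos.2 ha)
  simp only [sub_zero] at h0 hint0
  rw [h0, tendsto_iff_norm_sub_tendsto_zero]
  have ht := (ENNReal.tendsto_toReal ENNReal.zero_ne_top).comp
    (tendsto_eLpNorm_timeShift (b := b) hD ha hq hq' hB)
  have ht' := ht.const_mul (eLpNorm A p (cyl D a b)).toReal
  simp only [Function.comp_apply, ENNReal.toReal_zero, mul_zero] at ht'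
  refine squeeze_zero' (Eventually.of_forall fun _ => norm_nonneg _) ?_ ht'
  filter_upwards [eventually_shift ha] with σ hσ
  rw [hJ σ hσ.1 hσ.2, ← integral_sub (hint σ hσ.1 hσ.2) hint0]
  simp only [← inner_sub_right]
  exact integral_inner_le_eLpNorm hA' ((memLp_timeShift hD hσ.1 hσ.2 hB).sub
    (hB.mono_measure (cyl_mono ha.le le_rfl)))

end Pairings

end SuitableNS

namespace SuitableNS

variable {D : Set E3} {a₀ a b : ℝ}

/-- An ε/3 argument: an approximation that is uniform in the shift, the shift zero included,
preserves continuity at zero. -/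
lemma IsCross.of_approx (ha : a₀ < a) {n : ℝ → ℝ → ℝ}
    (hint : Integrable (fun p : ℝ × ℝ => n p.1 p.2)
      ((volume.restrict (Ioo a₀ b)).prod (volume.restrict (Ioo a₀ b))))
    (hshift : ∀ σ, 0 ≤ σ → σ < a - a₀ → IntegrableOn (fun t => n t (t - σ)) (Ioo a b))
    (happ : ∀ ε > 0, ∃ m, IsCross a₀ a b m ∧ ∀ σ, 0 ≤ σ → σ < a - a₀ →
      |(∫ t in Ioo a b, n t (t - σ)) - ∫ t in Ioo a b, m t (t - σ)| ≤ ε) : IsCross a₀ a b n := by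
  refine ⟨hint, hshift, ?_⟩
  rw [Metric.tendsto_nhds]
  intro ε hε
  obtain ⟨m, hm, hclose⟩ := happ (ε / 3) (by positivity)
  filter_upwards [Metric.tendsto_nhds.1 hm.tendsto (ε / 3) (by positivity), eventually_shift ha]
    with σ h1 hσ
  have h2 := hclose σ hσ.1 hσ.2
  have h3 := hclose 0 le_rfl (sub_pos.2 ha)
  simp only [sub_zero] at h3
  rw [Real.dist_eq] at h1 ⊢
  rw [abs_le] at h2 h3
  rw [abs_lt] at h1 ⊢
  constructor <;> linarith [h1.1, h1.2, h2.1, h2.2, h3.1, h3.2]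

lemma holderTriple_four_two : ENNReal.HolderTriple 4 2 (4 / 3) := ⟨by
  rw [← ENNReal.toReal_eq_toReal_iff' (by simp) (by simp), ENNReal.toReal_add (by simp) (by simp)]
  norm_num⟩

lemma holderTriple_four : ENNReal.HolderTriple (4 / 3) 4 1 := ⟨by
  rw [← ENNReal.toReal_eq_toReal_iff' (by simp) (by simp), ENNReal.toReal_add (by simp) (by simp)]
  norm_num⟩

lemma enorm_integral_inner_smul_le {α F : Type*} {m : MeasurableSpace α} {μ : Measure α}
    [NormedAddCommGroup F] [InnerProductSpace ℝ F] {c : α → ℝ} {G B : α → F}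
    (hc : AEStronglyMeasurable c μ) (hG : AEStronglyMeasurable G μ) (hB : AEStronglyMeasurable B μ) :
    ‖∫ x, inner ℝ (c x • G x) (B x) ∂μ‖ₑ ≤ eLpNorm c 4 μ * eLpNorm G 2 μ * eLpNorm B 4 μ := by
  have i1 := holderTriple_four_two
  have i2 := holderTriple_four
  refine (enorm_integral_le_lintegral_enorm _).trans ?_
  rw [← eLpNorm_one_eq_lintegral_enorm]
  refine (eLpNorm_inner_le (p := 4 / 3) (q := 4) (hc.smul hG) hB).trans ?_
  gcongr
  exact eLpNorm_smul_le_mul_eLpNorm hG hc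

variable {F : Type*} [NormedAddCommGroup F] [InnerProductSpace ℝ F]

/-- The pairing of `c G`, with `c ∈ L²(L⁴)` and `G ∈ L²`, with a field in `L^∞(L⁴)`. -/
lemma isCross_of_memL2L4 (hD : IsSmoothBoundedDomain D) (ha : a₀ < a)
    {c : ℝ × E3 → ℝ} {G B : ℝ × E3 → F}
    (hc : MemL2L4 (volume.restrict (Ioo a₀ b)) (volume.restrict D) c) (hc2 : MemLp c 2 (cyl D a₀ b))
    (hG : MemLp G 2 (cyl D a₀ b)) (hB : MemLp B 2 (cyl D a₀ b)) {K : ℝ≥0}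
    (hK : ∀ᵐ t ∂volume.restrict (Ioo a₀ b), eLpNorm (fun x => B (t, x)) 4 (volume.restrict D) ≤ K) :
    IsCross a₀ a b (fun t r => ∫ x in D, inner ℝ (c (t, x) • G (t, x)) (B (r, x))) := by
  have hfin := hD.isFiniteMeasure
  set ν := volume.restrict D
  set M : ℝ≥0∞ := (∫⁻ t in Ioo a₀ b, eLpNorm (fun x => c (t, x)) 4 ν ^ 2) ^ (1 / 2 : ℝ) with hM
  have hMtop : M ≠ ⊤ := ENNReal.rpow_ne_top_of_nonneg (by norm_num) hc.lt_top.ne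
  have hslice : ∀ {G : ℝ × E3 → F}, MemLp G 2 (cyl D a₀ b) →
      ∫⁻ t in Ioo a₀ b, eLpNorm (fun x => c (t, x)) 4 ν * eLpNorm (fun x => G (t, x)) 2 ν ≤
        M * eLpNorm G 2 (cyl D a₀ b) := by
    intro G hG
    have h1 := ENNReal.lintegral_mul_le_Lp_mul_Lq (volume.restrict (Ioo a₀ b)) (p := 2) (q := 2)
      (by constructor <;> norm_num) (aemeasurable_eLpNorm_slice (p := 4) (by simp) (by simp) hc.meas)
      (aemeasurable_eLpNorm_slice (p := 2) (by simp) (by simp) hG.1)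
    have h2 := lintegral_eLpNorm_rpow (p := 2) (by simp) (by simp) hG.1
    simp only [ENNReal.toReal_ofNat] at h2
    rw [h2, ← ENNReal.rpow_mul] at h1
    norm_num at h1
    rw [hM]
    norm_num
    exact h1
  -- This bound is uniform in σ and linear in the L² norm of G, so G may be approximated without
  -- losing control of the shift.
  have hbound : ∀ {G : ℝ × E3 → F}, MemLp G 2 (cyl D a₀ b) → ∀ σ, 0 ≤ σ → σ < a - a₀ →
      ∫⁻ t in Ioo a b, ‖∫ x in D, inner ℝ (c (t, x) • G (t, x)) (B (t - σ, x))‖ₑ ≤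
        M * eLpNorm G 2 (cyl D a₀ b) * K := by
    intro G hG σ h h'
    have hsub : Ioo a b ⊆ Ioo a₀ b := Ioo_subset_Ioo_left ha.le
    calc _ ≤ ∫⁻ t in Ioo a b, eLpNorm (fun x => c (t, x)) 4 ν * eLpNorm (fun x => G (t, x)) 2 ν * K := by
          refine lintegral_mono_ae ?_
          filter_upwards [ae_restrict_of_ae_restrict_of_subset hsub hc.meas.prodMk_left,
            ae_restrict_of_ae_restrict_of_subset hsub hG.1.prodMk_left, ae_timeShift h h' hK,
            ae_timeShift h h' hB.1.prodMk_left] with t h1 h2 h3 h4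
          refine (enorm_integral_inner_smul_le h1 h2 h4).trans ?_
          gcongr
      _ ≤ ∫⁻ t in Ioo a₀ b, eLpNorm (fun x => c (t, x)) 4 ν * eLpNorm (fun x => G (t, x)) 2 ν * K :=
          lintegral_mono_set hsub
      _ ≤ _ := by
          rw [lintegral_mul_const' _ _ (by simp)]
          gcongr
          exact hslice hG
  have hshift : ∀ {G : ℝ × E3 → F}, MemLp G 2 (cyl D a₀ b) → ∀ σ, 0 ≤ σ → σ < a - a₀ →
      IntegrableOn (fun t => ∫ x in D, inner ℝ (c (t, x) • G (t, x)) (B (t - σ, x))) (Ioo a b) := by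
    intro G hG σ h h'
    refine ⟨?_, (hbound hG σ h h').trans_lt (ENNReal.mul_lt_top
      (ENNReal.mul_lt_top hMtop.lt_top hG.2) (by simp))⟩
    refine AEStronglyMeasurable.integral_prod_right' (μ := volume.restrict (Ioo a b))
      (f := fun z : ℝ × E3 => inner ℝ (c z • G z) (B (z.1 - σ, z.2))) ?_
    have hle := cyl_mono (D := D) (a := a₀) (a' := a) (b := b) ha.le le_rfl
    exact ((hc2.1.mono_measure hle).smul (hG.1.mono_measure hle)).inner (memLp_timeShift hD h h' hB).1
  -- Translations are not continuous in L^∞(L⁴), so B cannot be shifted directly. If G is replaced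
  -- by a bounded continuous G', then cG' lies in L² and the pairing with B is of the L² type
  -- already treated.
  refine IsCross.of_approx ha ?_ (hshift hG) ?_
  · have hmeas : AEStronglyMeasurable (fun p : ℝ × ℝ =>
        ∫ x in D, inner ℝ (c (p.1, x) • G (p.1, x)) (B (p.2, x)))
        ((volume.restrict (Ioo a₀ b)).prod (volume.restrict (Ioo a₀ b))) :=
      AEStronglyMeasurable.integral_prod_right'
        (f := fun q : (ℝ × ℝ) × E3 => inner ℝ (c (q.1.1, q.2) • G (q.1.1, q.2)) (B (q.1.2, q.2)))
        (((aestronglyMeasurable_lift_fst hc2.1).smul (aestronglyMeasurable_lift_fst hG.1)).inner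
          (aestronglyMeasurable_lift_snd hB.1))
    refine ⟨hmeas, ?_⟩
    calc _ ≤ ∫⁻ p : ℝ × ℝ, eLpNorm (fun x => c (p.1, x)) 4 ν * eLpNorm (fun x => G (p.1, x)) 2 ν * K
            ∂(volume.restrict (Ioo a₀ b)).prod (volume.restrict (Ioo a₀ b)) := by
          refine lintegral_mono_ae ?_
          filter_upwards [Measure.quasiMeasurePreserving_fst.ae hc.meas.prodMk_left,
            Measure.quasiMeasurePreserving_fst.ae hG.1.prodMk_left,
            Measure.quasiMeasurePreserving_snd.ae hK,
            Measure.quasiMeasurePreserving_snd.ae hB.1.prodMk_left] with p h1 h2 h3 h4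
          refine (enorm_integral_inner_smul_le h1 h2 h4).trans ?_
          gcongr
      _ = (∫⁻ t in Ioo a₀ b, eLpNorm (fun x => c (t, x)) 4 ν * eLpNorm (fun x => G (t, x)) 2 ν) * K *
            volume (Ioo a₀ b) := by
          have hm := ((aemeasurable_eLpNorm_slice (p := 4) (by simp) (by simp) hc.meas).mul
            (aemeasurable_eLpNorm_slice (p := 2) (by simp) (by simp) hG.1)).mul_const (K : ℝ≥0∞)
          refine (lintegral_prod (fun p : ℝ × ℝ => eLpNorm (fun x => c (p.1, x)) 4 ν *
            eLpNorm (fun x => G (p.1, x)) 2 ν * K) hm.comp_fst).trans ?_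
          simp only [lintegral_const, Measure.restrict_apply MeasurableSet.univ, univ_inter]
          rw [lintegral_mul_const' _ _ (by simp), lintegral_mul_const' _ _ (by simp)]
      _ < ⊤ := by
          refine ENNReal.mul_lt_top (ENNReal.mul_lt_top ((hslice hG).trans_lt
            (ENNReal.mul_lt_top hMtop.lt_top hG.2)) (by simp)) (by simp)
  · intro ε hε
    obtain ⟨η, hη, hη'⟩ : ∃ η : ℝ≥0∞, η ≠ 0 ∧ M * η * K ≤ ENNReal.ofReal ε := by
      -- The added 1 keeps the denominator nonzero when MK = 0.
      refine ⟨ENNReal.ofReal ε / (M * K + 1), ?_, ?_⟩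
      · exact ENNReal.div_ne_zero.2 ⟨by simpa using hε, by simp [ENNReal.mul_eq_top, hMtop]⟩
      · calc M * (ENNReal.ofReal ε / (M * K + 1)) * K = (ENNReal.ofReal ε / (M * K + 1)) * (M * K) := by ring
          _ ≤ (ENNReal.ofReal ε / (M * K + 1)) * (M * K + 1) := by gcongr; exact le_self_add
          _ = _ := ENNReal.div_mul_cancel (by simp) (by simp [ENNReal.mul_eq_top, hMtop])
    obtain ⟨G', h1, h2⟩ := hG.exists_boundedContinuous_eLpNorm_sub_le (by simp) hη
    refine ⟨fun t r => ∫ x in D, inner ℝ (c (t, x) • G' (t, x)) (B (r, x)), ?_, ?_⟩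
    · refine isCross_of_memLp hD ha (p := 2) (q := 2) (by norm_num) (by simp)
        (A := fun z => c z • G' z) ?_ hB
      refine hc2.of_le_mul (c := ‖G'‖) (hc2.1.smul h2.1) (ae_of_all _ fun z => ?_)
      rw [norm_smul, mul_comm]
      gcongr
      exact G'.norm_coe_le_norm z
    · intro σ h h'
      rw [← integral_sub (hshift hG σ h h') (hshift h2 σ h h'), ← Real.norm_eq_abs, ← toReal_enorm]
      refine ENNReal.toReal_le_of_le_ofReal hε.le (le_trans ?_ hη')
      refine (enorm_integral_le_lintegral_enorm _).trans ?_
      refine le_trans (le_of_eq ?_) ((hbound (hG.sub h2) σ h h').trans (by gcongr))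
      have hsub : Ioo a b ⊆ Ioo a₀ b := Ioo_subset_Ioo_left ha.le
      refine lintegral_congr_ae ?_
      filter_upwards [ae_restrict_of_ae_restrict_of_subset hsub hc.ae_lt_top,
        ae_restrict_of_ae_restrict_of_subset hsub (memLp_slice (by simp) (by simp) hG),
        ae_restrict_of_ae_restrict_of_subset hsub (memLp_slice (by simp) (by simp) h2),
        ae_timeShift h h' hK, ae_timeShift h h' hB.1.prodMk_left] with t j1 j2 j3 j4 j5
      have i1 := holderTriple_four_two
      have i2 := holderTriple_four
      have hB4 : MemLp (fun x => B (t - σ, x)) 4 ν := ⟨j5, j4.trans_lt (by simp)⟩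
      have e1 : MemLp (fun x => c (t, x) • G (t, x)) (4 / 3) ν := j2.smul j1
      have e2 : MemLp (fun x => c (t, x) • G' (t, x)) (4 / 3) ν := j3.smul j1
      rw [← integral_sub (integrable_inner_of_memLp e1 hB4) (integrable_inner_of_memLp e2 hB4)]
      simp only [← inner_sub_left, ← smul_sub, Pi.sub_apply]
      rfl

end SuitableNS

/-! ### The evolution of the pairing of v and w -/

namespace SuitableNS

section Generic

variable {α β F ι : Type*} {mα : MeasurableSpace α} {mβ : MeasurableSpace β} {μ : Measure α}
  {ν : Measure β} [SFinite μ] [SFinite ν]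

/-- Hölder in space with 1/4 + 1/2 + 1/4 = 1, then Cauchy–Schwarz in time for the first two factors.
This is where the L^∞(L⁴) bound on linear solutions makes the convective pairing integrable. -/
lemma integrable_inner_smul_of_memL2L4 [NormedAddCommGroup F] [InnerProductSpace ℝ F]
    {c : α × β → ℝ} {G B : α × β → F} (hc : MemL2L4 μ ν c) (hG : MemLp G 2 (μ.prod ν))
    (hB : AEStronglyMeasurable B (μ.prod ν)) {K : ℝ≥0}
    (hK : ∀ᵐ t ∂μ, eLpNorm (fun x => B (t, x)) 4 ν ≤ K) :
    Integrable (fun z => inner ℝ (c z • G z) (B z)) (μ.prod ν) := by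
  have hm : AEStronglyMeasurable (fun z => inner ℝ (c z • G z) (B z)) (μ.prod ν) :=
    (hc.meas.smul hG.1).inner hB
  refine ⟨hm, ?_⟩
  rw [HasFiniteIntegral, lintegral_prod _ hm.enorm]
  have i1 := holderTriple_four_two
  have i2 := holderTriple_four
  calc _ ≤ ∫⁻ t, (eLpNorm (fun x => c (t, x)) 4 ν * eLpNorm (fun x => G (t, x)) 2 ν) * K ∂μ := by
        refine lintegral_mono_ae ?_
        filter_upwards [hc.meas.prodMk_left, hG.1.prodMk_left, hB.prodMk_left, hK] with t h1 h2 h3 h4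
        rw [← eLpNorm_one_eq_lintegral_enorm]
        refine (eLpNorm_inner_le (p := 4 / 3) (q := 4) (h1.smul h2) h3).trans ?_
        gcongr
        exact eLpNorm_smul_le_mul_eLpNorm h2 h1
    _ < ⊤ := by
        rw [lintegral_mul_const' _ _ (by simp)]
        refine ENNReal.mul_lt_top (lt_of_le_of_lt (ENNReal.lintegral_mul_le_Lp_mul_Lq μ (p := 2) (q := 2)
          (by constructor <;> norm_num) (aemeasurable_eLpNorm_slice (p := 4) (by simp) (by simp) hc.meas)
          (aemeasurable_eLpNorm_slice (p := 2) (by simp) (by simp) hG.1)) ?_) (by simp)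
        have h2 := lintegral_eLpNorm_rpow (p := 2) (by simp) (by simp) hG.1
        simp only [ENNReal.toReal_ofNat] at h2
        rw [h2]
        refine ENNReal.mul_lt_top (ENNReal.rpow_lt_top_of_nonneg (by norm_num) ?_)
          (ENNReal.rpow_lt_top_of_nonneg (by norm_num)
            (ENNReal.rpow_ne_top_of_nonneg (by norm_num) hG.2.ne))
        simpa using hc.lt_top.ne

lemma integral_four [Fintype ι] {f₁ f₃ : α → ℝ} {f₂ f₄ : ι → α → ℝ}
    (h₁ : Integrable f₁ μ) (h₂ : ∀ i, Integrable (f₂ i) μ)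
    (h₃ : Integrable f₃ μ) (h₄ : ∀ i, Integrable (f₄ i) μ) :
    ∫ z, (f₁ z - (∑ i, f₂ i z) + f₃ z - ∑ i, f₄ i z) ∂μ =
      (∫ z, f₁ z ∂μ) - (∑ i, ∫ z, f₂ i z ∂μ) + (∫ z, f₃ z ∂μ) - ∑ i, ∫ z, f₄ i z ∂μ := by
  have := integral_five h₁ h₂ h₃ (integrable_finsetSum Finset.univ fun i _ => h₄ i)
    (f₅ := fun _ => 0) (integrable_zero _ _ _)
  rw [integral_finsetSum _ fun i _ => h₄ i, integral_zero, add_zero] at this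
  simpa using this.symm

lemma integral_four_prod [Fintype ι] {f₁ f₃ : α × β → ℝ} {f₂ f₄ : ι → α × β → ℝ}
    (h₁ : Integrable f₁ (μ.prod ν)) (h₂ : ∀ i, Integrable (f₂ i) (μ.prod ν))
    (h₃ : Integrable f₃ (μ.prod ν)) (h₄ : ∀ i, Integrable (f₄ i) (μ.prod ν)) :
    ∫ z, (f₁ z - (∑ i, f₂ i z) + f₃ z - ∑ i, f₄ i z) ∂μ.prod ν =
      ∫ t, ((∫ x, f₁ (t, x) ∂ν) - (∑ i, ∫ x, f₂ i (t, x) ∂ν) + (∫ x, f₃ (t, x) ∂ν) -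
        ∑ i, ∫ x, f₄ i (t, x) ∂ν) ∂μ := by
  rw [integral_four h₁ h₂ h₃ h₄, integral_four h₁.integral_prod_left
    (fun i => (h₂ i).integral_prod_left) h₃.integral_prod_left fun i => (h₄ i).integral_prod_left,
    integral_prod _ h₁, integral_prod _ h₃]
  simp only [integral_prod _ (h₂ _), integral_prod _ (h₄ _)]

lemma MemL2L4.apply {u : α × β → E3} (hu : MemL2L4 μ ν u) (i : Fin 3) :
    MemL2L4 μ ν (fun z => u z i) := by
  refine ⟨(by fun_prop : Continuous fun y : E3 => y i).comp_aestronglyMeasurable hu.meas,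
    lt_of_le_of_lt (lintegral_mono fun t => ?_) hu.lt_top⟩
  gcongr
  exact eLpNorm_mono fun x => PiLp.norm_apply_le _ i

end Generic

section Frozen

variable {φ : ℝ × E3 → ℝ}

/-- In the two-time pairing the weight belongs to the time r of w. As v moves in time t the weight
is constant in time, and its time derivative must vanish. -/
lemma contDiff_frozen (hφ : ContDiff ℝ ∞ φ) (r : ℝ) : ContDiff ℝ ∞ fun p : ℝ × E3 => φ (r, p.2) :=
  hφ.comp (contDiff_const.prodMk contDiff_snd)

lemma hasFDerivAt_frozen (hφ : ContDiff ℝ ∞ φ) (r : ℝ) (p : ℝ × E3) :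
    HasFDerivAt (fun p : ℝ × E3 => φ (r, p.2)) ((fderiv ℝ φ (r, p.2)).comp
      ((0 : ℝ × E3 →L[ℝ] ℝ).prod (ContinuousLinearMap.snd ℝ ℝ E3))) p :=
  ((hφ.differentiable (by simp)) (r, p.2)).hasFDerivAt.comp p
    ((hasFDerivAt_const r p).prodMk hasFDerivAt_snd)

lemma timeDeriv_frozen (hφ : ContDiff ℝ ∞ φ) (r : ℝ) (p : ℝ × E3) :
    timeDeriv (fun p : ℝ × E3 => φ (r, p.2)) p = 0 := by
  rw [timeDeriv, (hasFDerivAt_frozen hφ r p).fderiv]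
  exact (congrArg (fderiv ℝ φ (r, p.2)) (by simp)).trans (fderiv ℝ φ (r, p.2)).map_zero

lemma spaceDeriv_frozen (hφ : ContDiff ℝ ∞ φ) (r : ℝ) (y : E3) (p : ℝ × E3) :
    spaceDeriv (fun p : ℝ × E3 => φ (r, p.2)) y p = spaceDeriv φ y (r, p.2) := by
  rw [spaceDeriv, (hasFDerivAt_frozen hφ r p).fderiv]
  simp [spaceDeriv]

end Frozen

/-- The density of the rate of change of `∫ φ v · w`. -/
noncomputable def pairingDensity (v : ℝ × E3 → E3) (G : Fin 3 → ℝ × E3 → E3) (h u : ℝ × E3 → E3)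
    (H : Fin 3 → ℝ × E3 → E3) (π : ℝ × E3 → ℝ) (w : ℝ × E3 → E3) (W : Fin 3 → ℝ × E3 → E3)
    (k : ℝ × E3 → E3) (q φ : ℝ × E3 → ℝ) (p : ℝ × E3) : ℝ :=
  timeDeriv φ p * inner ℝ (v p) (w p)
    - (∑ i, spaceDeriv φ (basisVec i) p * (inner ℝ (G i p) (w p) + inner ℝ (v p) (W i p)))
    - 2 * (φ p * ∑ i, inner ℝ (G i p) (W i p))
    + φ p * (inner ℝ (h p) (w p) + inner ℝ (v p) (k p))
    - φ p * inner ℝ (advect (u p) fun i => H i p) (w p)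
    + π p * spaceDeriv φ (w p) p + q p * spaceDeriv φ (v p) p

variable {D : Set E3} {a₀ a b : ℝ} {v h u w k : ℝ × E3 → E3} {G H W : Fin 3 → ℝ × E3 → E3}
  {π π' q q' φ : ℝ × E3 → ℝ}

lemma advect_zero (y : E3) (G : Fin 3 → E3) (hy : y = 0) : advect y G = 0 := by
  simp [advect, hy]

lemma memLp_spaceDeriv (hD : IsSmoothBoundedDomain D) (hφ : ContDiff ℝ ∞ φ) {p : ℝ≥0∞}
    (hw : MemLp w p (cyl D a b)) : MemLp (fun z => spaceDeriv φ (w z) z) p (cyl D a b) := by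
  have : (fun z => spaceDeriv φ (w z) z) = fun z => ∑ i, spaceDeriv φ (basisVec i) z • w z i := by
    ext z
    rw [spaceDeriv_eq_sum]
    simp only [smul_eq_mul, mul_comm]
  rw [this]
  exact memLp_finsetSum _ fun i _ =>
    memLp_cyl_smul hD (contDiff_spaceDeriv hφ _).continuous (memLp_apply' hw i)

/-- The evolution of the pairing of a solution with a solution of the linear problem. -/
theorem IsBalanced.pairing (hD : IsSmoothBoundedDomain D) (h₀ : 0 ≤ a₀) (ha : a₀ < a) (hab : a < b)
    (hv : IsBalanced D a₀ b v G h u H π) (hw : IsBalanced D a₀ b w W k 0 0 q)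
    {K : ℝ≥0} (hK : ∀ᵐ t ∂volume.restrict (Ioo a₀ b), eLpNorm (fun x => w (t, x)) 4 (volume.restrict D) ≤ K)
    (hφ : ContDiff ℝ ∞ φ) (hπ' : MemLp π' (5 / 3) (cyl D a₀ b)) (hq' : MemLp q' (5 / 3) (cyl D a₀ b))
    (hππ' : ∀ t r x y, π (t, x) * spaceDeriv φ y (r, x) = π' (t, x) * spaceDeriv φ y (r, x))
    (hqq' : ∀ p y, q p * spaceDeriv φ y p = q' p * spaceDeriv φ y p) :
    Integrable (pairingDensity v G h u H π' w W k q' φ) (cyl D a b) ∧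
    (∫ x in D, φ (b, x) * inner ℝ (v (b, x)) (w (b, x)))
      - (∫ x in D, φ (a, x) * inner ℝ (v (a, x)) (w (a, x))) =
      ∫ p, pairingDensity v G h u H π' w W k q' φ p ∂cyl D a b := by
  have hfin := hD.isFiniteMeasure
  have i1 := holderTriple_six
  have i2 := holderTriple_pressure
  have i3 : ENNReal.HolderTriple (5 / 2) (5 / 3) 1 := i2.symm
  have h0b : a₀ < b := ha.trans hab
  have hv2 : MemLp v 2 (cyl D a₀ b) := (hv.memLp_flow hD h₀).mono_exponent (by norm_num)
  have hw2 : MemLp w 2 (cyl D a₀ b) := (hw.memLp_flow hD h₀).mono_exponent (by norm_num)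
  have h52 : (5 / 2 : ℝ≥0∞) ≤ 3 := by
    rw [← ENNReal.toReal_le_toReal (ENNReal.div_ne_top (by simp) (by simp)) (by simp)]; norm_num
  have h526 : (5 / 2 : ℝ≥0∞) ≤ 6 := h52.trans (by norm_num)
  have hv52 : MemLp v (5 / 2) (cyl D a₀ b) := (hv.memLp_flow hD h₀).mono_exponent h52
  have hw52 : MemLp w (5 / 2) (cyl D a₀ b) := (hw.memLp_flow hD h₀).mono_exponent h52
  -- the factors
  set B : Fin 3 → ℝ × E3 → E3 := fun i p => spaceDeriv φ (basisVec i) p • w p + φ p • W i p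
  have hB : ∀ i, MemLp (B i) 2 (cyl D a₀ b) := fun i =>
    (memLp_cyl_smul hD (contDiff_spaceDeriv hφ _).continuous hw2).add
      (memLp_cyl_smul hD hφ.continuous (hw.memLp_flow_grad h₀ i))
  set B₀ : ℝ × E3 → E3 := fun p => φ p • w p
  have hB₀ : MemLp B₀ 2 (cyl D a₀ b) := memLp_cyl_smul hD hφ.continuous hw2
  obtain ⟨M, hM0, hM⟩ := exists_bound_of_continuous ((Metric.isBounded_Ioo a₀ b).prod hD.bounded)
    hφ.continuous
  have hK₀ : ∀ᵐ t ∂volume.restrict (Ioo a₀ b),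
      eLpNorm (fun x => B₀ (t, x)) 4 (volume.restrict D) ≤ (M.toNNReal * K : ℝ≥0) := by
    filter_upwards [hK, ae_restrict_mem measurableSet_Ioo] with t ht ht'
    refine (eLpNorm_le_mul_eLpNorm_of_ae_le_mul (g := fun x => w (t, x)) (c := M) ?_ 4).trans ?_
    · filter_upwards [ae_restrict_mem hD.isOpen.measurableSet] with x hx
      rw [norm_smul]
      gcongr
      exact hM _ ⟨ht', hx⟩
    · rw [ENNReal.coe_mul]
      gcongr
      exact le_rfl
  set P : ℝ × E3 → ℝ := fun p => spaceDeriv φ (w p) p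
  have hP : MemLp P (5 / 2) (cyl D a₀ b) := memLp_spaceDeriv hD hφ hw52
  have hZ := hw.memLp_balanceZero hD h₀ hφ
  have hPq := memLp_balancePressure hD hφ hq'
  have hC : ∀ i, MemLp (fun p => φ p • W i p) 2 (cyl D a₀ b) := fun i =>
    memLp_cyl_smul hD hφ.continuous (hw.memLp_flow_grad h₀ i)
  have hu2 : ∀ i, MemLp (fun p => u p i) 2 (cyl D a₀ b) := fun i =>
    memLp_apply' (hv.memLp_three.mono_exponent (by norm_num)) i
  -- the derivatives in the two times
  set n₁ : ℝ → ℝ → ℝ := fun t r => (∫ x in D, inner ℝ (h (t, x)) (B₀ (r, x)))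
    - (∑ i, ∫ x in D, inner ℝ (G i (t, x)) (B i (r, x)))
    + (∫ x in D, inner ℝ (π' (t, x)) (P (r, x)))
    - ∑ i, ∫ x in D, inner ℝ (u (t, x) i • H i (t, x)) (B₀ (r, x))
  set n₂ : ℝ → ℝ → ℝ := fun t r => (∫ x in D, inner ℝ (v (t, x)) (balanceZero w W k φ (r, x)))
    - (∑ i, ∫ x in D, inner ℝ (G i (t, x)) (φ (r, x) • W i (r, x)))
    + (∫ x in D, inner ℝ (v (t, x)) (balancePressure q' φ (r, x)))
    - ∑ i : Fin 3, ∫ x in D, 0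
  have hq1 : (1 : ℝ≥0∞) ≤ 5 / 2 := by
    rw [← ENNReal.toReal_le_toReal (by simp) (ENNReal.div_ne_top (by simp) (by simp))]; norm_num
  have hq2 : (1 : ℝ≥0∞) ≤ 5 / 3 := by
    rw [← ENNReal.toReal_le_toReal (by simp) (ENNReal.div_ne_top (by simp) (by simp))]; norm_num
  have hn₁ : IsCross a₀ a b n₁ :=
    (((isCross_of_memLp hD ha (p := 2) (q := 2) (by norm_num) (by simp) hv.memLp_force hB₀).sub ha
      (isCross_sum _ ha fun i => isCross_of_memLp hD ha (p := 2) (q := 2) (by norm_num) (by simp)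
        (hv.memLp_flow_grad h₀ i) (hB i))).add ha
      (isCross_of_memLp hD ha hq1 (ENNReal.div_ne_top (by simp) (by simp)) hπ' hP)).sub ha
      (isCross_sum _ ha fun i => isCross_of_memL2L4 hD ha (hv.memL2L4.apply i) (hu2 i)
        (hv.memLp_grad i) hB₀ hK₀)
  have hn₂ : IsCross a₀ a b n₂ := by
    refine (((isCross_of_memLp hD ha (p := 2) (q := 2) (by norm_num) (by simp) hv2 hZ).sub ha
      (isCross_sum _ ha fun i => isCross_of_memLp hD ha (p := 2) (q := 2) (by norm_num) (by simp)
        (hv.memLp_flow_grad h₀ i) (hC i))).add ha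
      (isCross_of_memLp hD ha hq2 (ENNReal.div_ne_top (by simp) (by simp)) hv52 hPq)).sub ha ?_
    simpa using isCross_zero
  -- Since φ is evaluated at the second time, ∂ₜφ enters n₂ but not n₁. The pressure at time t meets
  -- the weight at time r, which is why the replacement of π by π' must be valid for two different
  -- times.
  set g : ℝ → ℝ → ℝ := fun t r => ∫ x in D, φ (r, x) * inner ℝ (v (t, x)) (w (r, x))
  have hwH : ∀ r ∈ Icc a₀ b, MemH D (fun x => w (r, x)) := fun r hr =>
    hw.flow.memH r ⟨h₀.trans hr.1, hr.2⟩
  have hvH : ∀ r ∈ Icc a₀ b, MemH D (fun x => v (r, x)) := fun r hr =>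
    hv.flow.memH r ⟨h₀.trans hr.1, hr.2⟩
  have hsub0 : Ioo a₀ b ⊆ Ioo 0 b := Ioo_subset_Ioo_left h₀
  -- For almost every r the field w(r) lies in V and is an admissible fixed test field in the
  -- balance law of v.
  have hg₁ : ∀ᵐ r ∂volume.restrict (Ioo a₀ b), ∀ s ∈ Icc a₀ b, ∀ t ∈ Icc a₀ b, s ≤ t →
      g t r - g s r = ∫ τ in Ioo s t, n₁ τ r := by
    filter_upwards [ae_restrict_of_ae_restrict_of_subset hsub0 hw.flow.h10,
      ae_restrict_mem measurableSet_Ioo] with r hr hr' s hs t ht hst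
    have hmono := cyl_mono (D := D) hs.1 ht.2
    have hw6 := hr.memLp_six hD.bounded
    have hbal := hv.balance hD h₀ (contDiff_frozen hφ r) hπ' h0b
      (fun p y => by rw [spaceDeriv_frozen hφ]; exact hππ' p.1 r p.2 y)
      (hwH r (Ioo_subset_Icc_self hr')) hr hs ht hst
    refine hbal.trans ?_
    have hcφ : Continuous fun x => φ (r, x) := hφ.continuous.comp (by fun_prop)
    have hB₀r : ∀ {p : ℝ≥0∞}, MemLp (fun x => w (r, x)) p (volume.restrict D) →
        MemLp (fun z : ℝ × E3 => B₀ (r, z.2)) p (cyl D s t) := fun h =>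
      (memLp_continuous_smul hD hcφ h).comp_snd _
    have hBr : ∀ i, MemLp (fun z : ℝ × E3 => B i (r, z.2)) 2 (cyl D s t) := fun i =>
      ((memLp_continuous_smul hD ((contDiff_spaceDeriv hφ (basisVec i)).continuous.comp
        (by fun_prop : Continuous fun x : E3 => (r, x))) hr.memLp).add
        (memLp_continuous_smul hD hcφ (hr.memLp_grad i))).comp_snd _
    have hPr : MemLp (fun z : ℝ × E3 => P (r, z.2)) (5 / 2) (cyl D s t) := by
      have h1 : MemLp (fun z : ℝ × E3 => w (r, z.2)) (5 / 2) (cyl D s t) :=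
        (hw6.mono_exponent h526).comp_snd _
      have h2 := memLp_spaceDeriv hD (contDiff_frozen hφ r) h1
      simpa only [spaceDeriv_frozen hφ] using h2
    have hsplit := integral_four_prod (μ := volume.restrict (Ioo s t)) (ν := volume.restrict D)
      (integrable_inner_of_memLp (hv.memLp_force.mono_measure hmono) (hB₀r hr.memLp))
      (fun i => integrable_inner_of_memLp ((hv.memLp_flow_grad h₀ i).mono_measure hmono) (hBr i))
      (integrable_inner_of_memLp (hπ'.mono_measure hmono) hPr)
      (fun i => integrable_inner_of_memLp (p := 6 / 5) (q := 6)
        (f := fun z => u z i • H i z) (g := fun z => B₀ (r, z.2)) (by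
          have := holderTriple_three_two
          exact ((hv.memLp_grad i).mono_measure hmono).smul
            ((memLp_apply' hv.memLp_three i).mono_measure hmono)) (hB₀r hw6))
    refine Eq.trans ?_ hsplit
    refine integral_congr_ae (ae_of_all _ fun z => ?_)
    simp only [balanceDensity, inner_balancePressure, balanceZero, timeDeriv_frozen hφ,
      spaceDeriv_frozen hφ, B₀, B, P, advect, inner_sub_left, inner_add_left, inner_add_right,
      inner_smul_left, inner_smul_right, sum_inner, conj_trivial, RCLike.inner_apply, Finset.mul_sum,
      Finset.smul_sum, Finset.sum_add_distrib, zero_mul]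
    have e : ∀ i, φ (r, z.2) * (u z i * inner ℝ (H i z) (w (r, z.2))) =
      u z i * (φ (r, z.2) * inner ℝ (H i z) (w (r, z.2))) := fun i => by ring
    simp only [e]
    ring
  -- The roles are exchanged: v(t) is the fixed test field in the linear equation of w, which has no
  -- convective term.
  have hg₂ : ∀ᵐ t ∂volume.restrict (Ioo a₀ b), ∀ s ∈ Icc a₀ b, ∀ r ∈ Icc a₀ b, s ≤ r →
      g t r - g t s = ∫ τ in Ioo s r, n₂ t τ := by
    filter_upwards [ae_restrict_of_ae_restrict_of_subset hsub0 hv.flow.h10,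
      ae_restrict_mem measurableSet_Ioo] with t ht ht' s hs r hr hsr
    have hmono := cyl_mono (D := D) hs.1 hr.2
    have hv6 := ht.memLp_six hD.bounded
    have hbal := hw.balance hD h₀ hφ hq' h0b hqq' (hvH t (Ioo_subset_Icc_self ht')) ht hs hr hsr
    have hsymm : ∀ r, g t r = ∫ x in D, φ (r, x) * inner ℝ (w (r, x)) (v (t, x)) := fun r => by
      simp only [g, real_inner_comm]
    rw [hsymm, hsymm]
    refine hbal.trans ?_
    have hsplit := integral_four_prod (μ := volume.restrict (Ioo s r)) (ν := volume.restrict D)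
      (f₁ := fun z => inner ℝ (v (t, z.2)) (balanceZero w W k φ z))
      (f₂ := fun i z => inner ℝ (G i (t, z.2)) (φ z • W i z))
      (f₃ := fun z => inner ℝ (v (t, z.2)) (balancePressure q' φ z))
      (f₄ := fun (i : Fin 3) z => 0)
      (integrable_inner_of_memLp (p := 2) (q := 2) (ht.memLp.comp_snd _) (hZ.mono_measure hmono))
      (fun i => integrable_inner_of_memLp (p := 2) (q := 2) ((ht.memLp_grad i).comp_snd _)
        ((hC i).mono_measure hmono))
      (integrable_inner_of_memLp (p := 5 / 2) (q := 5 / 3) ((hv6.mono_exponent h526).comp_snd _)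
        (hPq.mono_measure hmono))
      (fun i => integrable_zero _ _ _)
    refine Eq.trans ?_ hsplit
    refine integral_congr_ae (ae_of_all _ fun z => ?_)
    simp only [balanceDensity, Pi.zero_apply, advect_zero _ _ rfl, smul_zero, inner_zero_left,
      Finset.sum_const_zero, sub_zero]
    rw [real_inner_comm, real_inner_comm (v (t, z.2))]
    simp only [real_inner_comm]
  have hg₀ : ContinuousOn (fun t => g t a₀) (Icc a₀ b) :=
    (hv.flow.continuousOn_smul hD (contDiff_frozen hφ a₀) (hwH a₀ ⟨le_rfl, h0b.le⟩).memLp).mono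
      (Icc_subset_Icc_left h₀)
  have hgc : ∀ c ∈ Icc a₀ b, ContinuousOn (g c) (Icc a₀ b) := by
    intro c hc
    have := (hw.flow.continuousOn_smul hD hφ (hvH c hc).memLp).mono (Icc_subset_Icc_left h₀)
    simpa only [g, real_inner_comm] using this
  have key := IsCross.sub_eq ha hab hn₁ hn₂ hg₁ hg₂ hg₀ (hgc a ⟨ha.le, hab.le⟩) (hgc b ⟨h0b.le, le_rfl⟩)
  -- back to integrals over the cylinder
  have hmono := cyl_mono (D := D) (b := b) ha.le le_rfl
  have hsubI : Ioo a b ⊆ Ioo a₀ b := Ioo_subset_Ioo_left ha.le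
  have c1 := (integrable_inner_of_memLp hv.memLp_force hB₀).mono_measure hmono
  have c2 := fun i => (integrable_inner_of_memLp (hv.memLp_flow_grad h₀ i) (hB i)).mono_measure hmono
  have c3 := (integrable_inner_of_memLp hπ' hP).mono_measure hmono
  have c4 := fun i => (integrable_inner_smul_of_memL2L4 (hv.memL2L4.apply i) (hv.memLp_grad i)
    hB₀.1 hK₀).mono_measure hmono
  have c5 := (integrable_inner_of_memLp hv2 hZ).mono_measure hmono
  have c6 := fun i => (integrable_inner_of_memLp (hv.memLp_flow_grad h₀ i) (hC i)).mono_measure hmono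
  have c7 := (integrable_inner_of_memLp hv52 hPq).mono_measure hmono
  have e1 := integral_four_prod c1 c2 c3 c4
  have e2 := integral_four_prod c5 c6 c7 (f₄ := fun (i : Fin 3) _ => 0) fun i => integrable_zero _ _ _
  have s1 := ((c1.sub (integrable_finsetSum Finset.univ fun i _ => c2 i)).add c3).sub
    (integrable_finsetSum Finset.univ fun i _ => c4 i)
  have s2 := ((c5.sub (integrable_finsetSum Finset.univ fun i _ => c6 i)).add c7).sub
    (integrable_finsetSum Finset.univ fun (i : Fin 3) _ => integrable_zero (ℝ × E3) ℝ (cyl D a b))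
  -- On the diagonal the two densities add up. Each equation contributes one copy of φ ∇v·∇w, hence
  -- the factor 2 in the pairing density.
  have hpt : ∀ z, pairingDensity v G h u H π' w W k q' φ z =
      (inner ℝ (h z) (B₀ z) - (∑ i, inner ℝ (G i z) (B i z)) + inner ℝ (π' z) (P z)
        - ∑ i, inner ℝ (u z i • H i z) (B₀ z)) +
      (inner ℝ (v z) (balanceZero w W k φ z) - (∑ i, inner ℝ (G i z) (φ z • W i z))
        + inner ℝ (v z) (balancePressure q' φ z) - ∑ i : Fin 3, 0) := by
    intro z
    rw [real_inner_comm (balancePressure q' φ z), inner_balancePressure]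
    simp only [pairingDensity, balanceZero, B₀, B, P, advect, inner_sub_right, inner_add_left,
      inner_add_right, inner_smul_left, inner_smul_right, sum_inner, inner_sum, conj_trivial,
      RCLike.inner_apply, Finset.mul_sum, Finset.sum_add_distrib, mul_add, Finset.sum_const_zero]
    have e : ∀ i, φ z * (u z i * inner ℝ (H i z) (w z)) =
      u z i * (φ z * inner ℝ (H i z) (w z)) := fun i => by ring
    simp only [e]
    have e' : ∑ i, 2 * (φ z * inner ℝ (G i z) (W i z)) =
      ∑ i, φ z * inner ℝ (G i z) (W i z) + ∑ i, φ z * inner ℝ (G i z) (W i z) := by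
        rw [← Finset.mul_sum]; ring
    rw [e']
    ring
  refine ⟨(s1.add s2).congr (ae_of_all _ fun z => (hpt z).symm), ?_⟩
  · rw [show (∫ x in D, φ (b, x) * inner ℝ (v (b, x)) (w (b, x))) -
      (∫ x in D, φ (a, x) * inner ℝ (v (a, x)) (w (a, x))) = g b b - g a a from rfl, key]
    rw [integral_add (hn₁.diag ha) (hn₂.diag ha)]
    simp only [hpt]
    refine (congrArg₂ (· + ·) e1 e2).symm.trans ?_
    exact (integral_add s1 s2).symm

end SuitableNS

/-! ### Transport identities and the gradient form of the equations -/

namespace SuitableNS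

variable {D : Set E3} {a b : ℝ}

section Slices

variable {F : Type*} [NormedAddCommGroup F] [NormedSpace ℝ F] {Ψ : ℝ × E3 → F}

lemma hasFDerivAt_slice (hΨ : ContDiff ℝ ∞ Ψ) (t : ℝ) (x : E3) :
    HasFDerivAt (fun x => Ψ (t, x)) ((fderiv ℝ Ψ (t, x)).comp (ContinuousLinearMap.inr ℝ ℝ E3)) x :=
  ((hΨ.differentiable (by simp)) (t, x)).hasFDerivAt.comp x (hasFDerivAt_prodMk_right t x)

lemma fderiv_slice (hΨ : ContDiff ℝ ∞ Ψ) (t : ℝ) (x y : E3) :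
    fderiv ℝ (fun x => Ψ (t, x)) x y = spaceDeriv Ψ y (t, x) := by
  rw [(hasFDerivAt_slice hΨ t x).fderiv]; rfl

lemma IsTestFunction.slice (hΨ : IsTestFunction (Ioo a b ×ˢ D) Ψ) (t : ℝ) :
    IsTestFunction D (fun x => Ψ (t, x)) := by
  have hK : IsCompact (Prod.snd '' tsupport Ψ) := hΨ.compact.isCompact.image continuous_snd
  have hsub : tsupport (fun x => Ψ (t, x)) ⊆ Prod.snd '' tsupport Ψ := by
    refine closure_minimal (fun x hx => ⟨(t, x), subset_tsupport _ hx, rfl⟩) hK.isClosed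
  refine ⟨hΨ.smooth.comp (contDiff_const.prodMk contDiff_id),
    HasCompactSupport.of_support_subset_isCompact hK ((subset_tsupport _).trans hsub),
    hsub.trans ?_⟩
  rintro _ ⟨p, hp, rfl⟩
  exact (hΨ.support hp).2

end Slices

lemma advect_basisVec (i : Fin 3) (G : Fin 3 → E3) : advect (basisVec i) G = G i := by
  simp [advect, basisVec]

/-- Integration by parts along a field without divergence, on a space-time cylinder. -/
lemma integral_transport (hD : IsSmoothBoundedDomain D) {u c d : ℝ × E3 → E3}
    {C E : Fin 3 → ℝ × E3 → E3} {φ : ℝ × E3 → ℝ} (hφ : ContDiff ℝ ∞ φ)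
    (hu : ∀ᵐ t ∂volume.restrict (Ioo a b), MemLp (fun x => u (t, x)) 4 (volume.restrict D) ∧
      ∀ θ : E3 → ℝ, IsTestFunction D θ → ∫ x in D, fderiv ℝ θ x (u (t, x)) = 0)
    (hc : ∀ᵐ t ∂volume.restrict (Ioo a b), IsH10 D (fun x => c (t, x)) (fun i x => C i (t, x)))
    (hd : ∀ᵐ t ∂volume.restrict (Ioo a b), IsH10 D (fun x => d (t, x)) (fun i x => E i (t, x)))
    (h₁ : Integrable (fun p => φ p * (inner ℝ (advect (u p) fun i => C i p) (d p) +
      inner ℝ (c p) (advect (u p) fun i => E i p))) (cyl D a b))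
    (h₂ : Integrable (fun p => spaceDeriv φ (u p) p * inner ℝ (c p) (d p)) (cyl D a b)) :
    ∫ p, (φ p * (inner ℝ (advect (u p) fun i => C i p) (d p) +
      inner ℝ (c p) (advect (u p) fun i => E i p)) + spaceDeriv φ (u p) p * inner ℝ (c p) (d p))
      ∂cyl D a b = 0 := by
  rw [integral_add h₁ h₂, integral_prod _ h₁, integral_prod _ h₂,
    ← integral_add h₁.integral_prod_left h₂.integral_prod_left]
  refine integral_eq_zero_of_ae ?_
  filter_upwards [hu, hc, hd] with t h3 h4 h5
  have := integral_advect_add_advect hD h3.1 h3.2 h4 h5 (χ := fun x => φ (t, x))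
    (hφ.comp (contDiff_const.prodMk contDiff_id))
  simp only [fderiv_slice hφ] at this
  simp only [Pi.zero_apply, this, neg_add_cancel]

lemma MemH.div_test {v : E3 → E3} (hv : MemH D v) (θ : E3 → ℝ) (hθ : IsTestFunction D θ) :
    ∫ x in D, fderiv ℝ θ x (v x) = 0 := hv.weak θ (hθ.mono (subset_univ _))

/-- The equation in divergence form implies the equation in gradient form. -/
lemma IsBalanced.of_weak (hD : IsSmoothBoundedDomain D) (ha : 0 ≤ a) {v h u : ℝ × E3 → E3}
    {G H : Fin 3 → ℝ × E3 → E3} {π : ℝ × E3 → ℝ} (hv : IsFlow D b v G)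
    (hh : MemLp h 2 (cyl D a b)) (hu : IsFlow D b u H)
    (heq : ∀ Ψ : ℝ × E3 → E3, IsTestFunction (Ioo a b ×ˢ D) Ψ →
      -(∫ p, inner ℝ (v p) (timeDeriv Ψ p) ∂cyl D a b)
        - (∫ p, inner ℝ (u p) (spaceDeriv Ψ (u p) p) ∂cyl D a b)
        - (∫ p, π p * divergence Ψ p ∂cyl D a b)
      = (∫ p, inner ℝ (v p) (laplace Ψ p) ∂cyl D a b) + ∫ p, inner ℝ (h p) (Ψ p) ∂cyl D a b) :
    IsBalanced D a b v G h u H π := by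
  have hfin := hD.isFiniteMeasure
  have hle := cyl_mono (D := D) (b := b) ha le_rfl
  have hsub : Ioo a b ⊆ Ioo 0 b := Ioo_subset_Ioo_left ha
  have hv3 := (hv.memLp_three hD).mono_measure hle
  have hu3 := (hu.memLp_three hD).mono_measure hle
  have hv2 : MemLp v 2 (cyl D a b) := hv3.mono_exponent (by norm_num)
  have hu2 : MemLp u 2 (cyl D a b) := hu3.mono_exponent (by norm_num)
  have hu4 : MemL2L4 (volume.restrict (Ioo a b)) (volume.restrict D) u :=
    ⟨hu2.1, (lintegral_mono_set hsub).trans_lt (hu.memL2L4 hD).lt_top⟩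
  have hH : ∀ i, MemLp (H i) 2 (cyl D a b) := fun i => (hu.memLp_grad i).mono_measure hle
  have hG : ∀ i, MemLp (G i) 2 (cyl D a b) := fun i => (hv.memLp_grad i).mono_measure hle
  have i0 := holderTriple_three_two
  have i1 := holderTriple_six
  have hvH := ae_restrict_of_ae_restrict_of_subset hsub hv.h10
  have huH := ae_restrict_of_ae_restrict_of_subset hsub hu.h10
  refine ⟨hv, hh, hu3, hu4, hH, fun Ψ hΨ => ?_⟩
  -- With the constant weight, the transport identity along a coordinate vector is integration by
  -- parts in the viscous term, and along u in the convective term.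
  have hone : ContDiff ℝ ∞ (fun _ : ℝ × E3 => (1 : ℝ)) := contDiff_const
  have hone' : ∀ y p, spaceDeriv (fun _ : ℝ × E3 => (1 : ℝ)) y p = 0 := fun y p => by
    simp [spaceDeriv]
  have hvisc : ∀ i, ∫ p, inner ℝ (v p) (spaceDeriv (spaceDeriv Ψ (basisVec i)) (basisVec i) p)
      ∂cyl D a b = -∫ p, inner ℝ (G i p) (spaceDeriv Ψ (basisVec i) p) ∂cyl D a b := by
    intro i
    have j1 := integrable_inner_of_memLp (hG i)
      ((hΨ.spaceDeriv (basisVec i)).memLp_cyl (D := D) (a := a) (b := b) 2)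
    have j2 := integrable_inner_of_memLp hv2
      (((hΨ.spaceDeriv (basisVec i)).spaceDeriv (basisVec i)).memLp_cyl (D := D) (a := a) (b := b) 2)
    have hs := (hΨ.spaceDeriv (basisVec i)).smooth
    have := integral_transport hD (a := a) (b := b) (u := fun _ => basisVec i) (c := v) (C := G)
      (d := spaceDeriv Ψ (basisVec i))
      (E := fun j p => spaceDeriv (spaceDeriv Ψ (basisVec i)) (basisVec j) p) hone
      (ae_of_all _ fun t => ⟨memLp_const _, fun θ hθ => integral_fderiv_test hθ _⟩) hvH
      (ae_of_all _ fun t => by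
        have := ((hΨ.spaceDeriv (basisVec i)).slice t).isH10 (D := D)
        simpa only [fderiv_slice hs] using this)
      (by simp only [advect_basisVec, one_mul]; exact j1.add j2) (by simp [hone'])
    simp only [advect_basisVec, one_mul, hone', zero_mul, add_zero] at this
    rw [integral_add j1 j2] at this
    linarith
  have hlap : ∫ p, inner ℝ (v p) (laplace Ψ p) ∂cyl D a b =
      -∑ i, ∫ p, inner ℝ (G i p) (spaceDeriv Ψ (basisVec i) p) ∂cyl D a b := by
    simp only [laplace, inner_sum]
    rw [integral_finsetSum _ fun i _ => integrable_inner_of_memLp hv2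
      (((hΨ.spaceDeriv (basisVec i)).spaceDeriv (basisVec i)).memLp_cyl (D := D) (a := a) (b := b) 2),
      ← Finset.sum_neg_distrib]
    exact Finset.sum_congr rfl fun i _ => hvisc i
  have hconv : ∫ p, inner ℝ (u p) (spaceDeriv Ψ (u p) p) ∂cyl D a b =
      -∫ p, inner ℝ (advect (u p) fun i => H i p) (Ψ p) ∂cyl D a b := by
    have j1 := integrable_inner_of_memLp (SuitableNS.memLp_advect (r := 6 / 5) hu3 hH)
      (hΨ.memLp_cyl (D := D) (a := a) (b := b) 6)
    have j2 : Integrable (fun p => inner ℝ (u p) (spaceDeriv Ψ (u p) p)) (cyl D a b) := by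
      refine integrable_inner_of_memLp (p := 2) (q := 2) hu2 ?_
      simp only [fun p => spaceDeriv_eq_sum Ψ (u p) p]
      refine memLp_finsetSum _ fun i _ => ?_
      have h6 : MemLp (spaceDeriv Ψ (basisVec i)) 6 (cyl D a b) :=
        (hΨ.spaceDeriv (basisVec i)).memLp_cyl 6
      have : ENNReal.HolderTriple 3 6 2 := ⟨by
        rw [← ENNReal.toReal_eq_toReal_iff' (by simp) (by simp), ENNReal.toReal_add (by simp) (by simp)]
        norm_num⟩
      exact h6.smul (memLp_apply' hu3 i)
    have := integral_transport hD (a := a) (b := b) (u := u) (c := u) (C := H) (d := Ψ)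
      (E := fun j p => spaceDeriv Ψ (basisVec j) p) hone
      (by
        filter_upwards [huH, ae_restrict_mem measurableSet_Ioo] with t h1 h2
        exact ⟨h1.memLp_four hD.bounded, (hu.memH t ⟨ha.trans h2.1.le, h2.2.le⟩).div_test⟩) huH
      (ae_of_all _ fun t => by
        have := (hΨ.slice t).isH10 (D := D)
        simpa only [fderiv_slice hΨ.smooth] using this)
      (by
        simp only [advect, one_mul, ← spaceDeriv_eq_sum] at j1 ⊢
        exact j1.add j2) (by simp [hone'])
    have e : ∀ p, advect (u p) (fun j => spaceDeriv Ψ (basisVec j) p) = spaceDeriv Ψ (u p) p :=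
      fun p => (spaceDeriv_eq_sum Ψ (u p) p).symm
    simp only [one_mul, hone', zero_mul, add_zero, e] at this
    rw [integral_add j1 j2] at this
    linarith
  have := heq Ψ hΨ
  rw [hlap, hconv] at this
  linarith

end SuitableNS

/-! ### The energy density and its pointwise change -/

namespace SuitableNS

variable {D : Set E3} {a₀ a b : ℝ}

lemma integrable_cyl_mul (hD : IsSmoothBoundedDomain D) {χ : ℝ × E3 → ℝ} (hχ : Continuous χ)
    {f : ℝ × E3 → ℝ} (hf : Integrable f (cyl D a b)) : Integrable (fun p => χ p * f p) (cyl D a b) := by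
  rw [← memLp_one_iff_integrable] at hf ⊢
  exact memLp_cyl_smul hD hχ hf

lemma integrable_mul_inner_of_memLp_three {α F : Type*} {m : MeasurableSpace α} {μ : Measure α}
    [NormedAddCommGroup F] [InnerProductSpace ℝ F] {c d : α → F} {s : α → ℝ} (hc : MemLp c 3 μ)
    (hd : MemLp d 3 μ) (hs : MemLp s 3 μ) : Integrable (fun x => s x * inner ℝ (c x) (d x)) μ := by
  have i1 : ENNReal.HolderTriple 3 3 (3 / 2) := ⟨by
    rw [← ENNReal.toReal_eq_toReal_iff' (by simp) (by simp), ENNReal.toReal_add (by simp) (by simp)]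
    norm_num⟩
  have i2 : ENNReal.HolderTriple 3 (3 / 2) 1 := ⟨by
    rw [← ENNReal.toReal_eq_toReal_iff' (by simp) (by simp), ENNReal.toReal_add (by simp) (by simp)]
    norm_num⟩
  have h1 : MemLp (fun x => s x • d x) (3 / 2) μ := hd.smul hs
  simpa only [inner_smul_right] using integrable_inner_of_memLp hc h1

lemma integrable_inner_advect {u z : ℝ × E3 → E3} {G : Fin 3 → ℝ × E3 → E3}
    (hu : MemL2L4 (volume.restrict (Ioo a b)) (volume.restrict D) u) (hG : ∀ i, MemLp (G i) 2 (cyl D a b))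
    (hz : AEStronglyMeasurable z (cyl D a b)) {K : ℝ≥0}
    (hK : ∀ᵐ t ∂volume.restrict (Ioo a b), eLpNorm (fun x => z (t, x)) 4 (volume.restrict D) ≤ K) :
    Integrable (fun p => inner ℝ (z p) (advect (u p) fun i => G i p)) (cyl D a b) := by
  have := integrable_finsetSum Finset.univ fun i _ =>
    integrable_inner_smul_of_memL2L4 (hu.apply i) (hG i) hz hK
  refine this.congr (ae_of_all _ fun p => ?_)
  simp only [advect, inner_sum, real_inner_comm]

/-- The density of the local energy balance. -/
noncomputable def localDensity (v : ℝ × E3 → E3) (G : Fin 3 → ℝ × E3 → E3) (h z : ℝ × E3 → E3)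
    (π φ : ℝ × E3 → ℝ) (p : ℝ × E3) : ℝ :=
  2 * (gradSq (fun i => G i p) * φ p) - ‖v p‖ ^ 2 * (timeDeriv φ p + laplace φ p)
    - 2 * (π p * spaceDeriv φ (v p) p)
    - (‖v p‖ ^ 2 + 2 * inner ℝ (v p) (z p)) * spaceDeriv φ (v p + z p) p
    - 2 * (φ p * inner ℝ (z p) (advect (v p + z p) fun i => G i p))
    - 2 * (φ p * inner ℝ (h p) (v p))

/-- The integrability that gives a meaning to the local energy balance. -/
structure EnergyData (D : Set E3) (a b : ℝ) (v : ℝ × E3 → E3) (G : Fin 3 → ℝ × E3 → E3)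
    (h z : ℝ × E3 → E3) (π : ℝ × E3 → ℝ) : Prop where
  three : MemLp v 3 (cyl D a b)
  l2l4 : MemL2L4 (volume.restrict (Ioo a b)) (volume.restrict D) v
  grad : ∀ i, MemLp (G i) 2 (cyl D a b)
  force : MemLp h 2 (cyl D a b)
  three' : MemLp z 3 (cyl D a b)
  four : ∃ K : ℝ≥0, ∀ᵐ t ∂volume.restrict (Ioo a b), eLpNorm (fun x => z (t, x)) 4 (volume.restrict D) ≤ K
  pressure : MemLp π (5 / 3) (cyl D a b)

variable {v h z w k : ℝ × E3 → E3} {G Z W : Fin 3 → ℝ × E3 → E3} {π π' q q' φ : ℝ × E3 → ℝ}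

lemma contDiff_laplace (hφ : ContDiff ℝ ∞ φ) : ContDiff ℝ ∞ (laplace φ) :=
  ContDiff.sum fun _ _ => contDiff_spaceDeriv (contDiff_spaceDeriv hφ _) _

section Terms

variable (hD : IsSmoothBoundedDomain D) (hφ : ContDiff ℝ ∞ φ) (e : EnergyData D a b v G h z π)
include hD hφ e

lemma EnergyData.integrable_gradSq : Integrable (fun p => gradSq (fun i => G i p) * φ p) (cyl D a b) := by
  have h1 := integrable_finsetSum Finset.univ fun i _ => integrable_inner_of_memLp (e.grad i) (e.grad i)
  refine (integrable_cyl_mul hD hφ.continuous h1).congr (ae_of_all _ fun p => ?_)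
  simp only [gradSq, real_inner_self_eq_norm_sq, mul_comm]

lemma EnergyData.integrable_sq :
    Integrable (fun p => ‖v p‖ ^ 2 * (timeDeriv φ p + laplace φ p)) (cyl D a b) := by
  have := hD.isFiniteMeasure
  have hv2 : MemLp v 2 (cyl D a b) := e.three.mono_exponent (by norm_num)
  refine (integrable_cyl_mul hD ((contDiff_timeDeriv hφ).continuous.add
    (contDiff_laplace hφ).continuous) (integrable_inner_of_memLp hv2 hv2)).congr (ae_of_all _ fun p => ?_)
  simp only [real_inner_self_eq_norm_sq, Pi.add_apply]
  exact mul_comm _ _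

lemma EnergyData.integrable_pressure :
    Integrable (fun p => π p * spaceDeriv φ (v p) p) (cyl D a b) := by
  have := hD.isFiniteMeasure
  have i2 := holderTriple_pressure
  have h1 : MemLp v (5 / 2) (cyl D a b) := e.three.mono_exponent (by
    rw [← ENNReal.toReal_le_toReal (ENNReal.div_ne_top (by simp) (by simp)) (by simp)]; norm_num)
  have := integrable_inner_of_memLp e.pressure (memLp_spaceDeriv hD hφ h1)
  refine this.congr (ae_of_all _ fun p => ?_)
  simp [mul_comm]

lemma EnergyData.integrable_cubic : Integrable (fun p =>
    (‖v p‖ ^ 2 + 2 * inner ℝ (v p) (z p)) * spaceDeriv φ (v p + z p) p) (cyl D a b) := by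
  have hs : MemLp (fun p => spaceDeriv φ (v p + z p) p) 3 (cyl D a b) :=
    memLp_spaceDeriv hD hφ (w := fun p => v p + z p) (e.three.add e.three')
  refine ((integrable_mul_inner_of_memLp_three e.three e.three hs).add
    ((integrable_mul_inner_of_memLp_three e.three e.three' hs).const_mul 2)).congr
    (ae_of_all _ fun p => ?_)
  simp only [Pi.add_apply, real_inner_self_eq_norm_sq]
  ring

lemma EnergyData.integrable_advect : Integrable (fun p =>
    φ p * inner ℝ (z p) (advect (v p + z p) fun i => G i p)) (cyl D a b) := by
  have := hD.isFiniteMeasure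
  obtain ⟨K, hK⟩ := e.four
  exact integrable_cyl_mul hD hφ.continuous
    (integrable_inner_advect (e.l2l4.add (memL2L4_of_bound e.three'.1 hK)) e.grad e.three'.1 hK)

lemma EnergyData.integrable_force : Integrable (fun p => φ p * inner ℝ (h p) (v p)) (cyl D a b) := by
  have := hD.isFiniteMeasure
  exact integrable_cyl_mul hD hφ.continuous
    (integrable_inner_of_memLp e.force (e.three.mono_exponent (by norm_num) : MemLp v 2 (cyl D a b)))

lemma EnergyData.integrable_density : Integrable (localDensity v G h z π φ) (cyl D a b) :=
  ((((((e.integrable_gradSq hD hφ).const_mul 2).sub (e.integrable_sq hD hφ)).sub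
    ((e.integrable_pressure hD hφ).const_mul 2)).sub (e.integrable_cubic hD hφ)).sub
    ((e.integrable_advect hD hφ).const_mul 2)).sub ((e.integrable_force hD hφ).const_mul 2)

lemma EnergyData.integral_density : ∫ p, localDensity v G h z π φ p ∂cyl D a b =
    2 * (∫ p, gradSq (fun i => G i p) * φ p ∂cyl D a b)
    - (∫ p, ‖v p‖ ^ 2 * (timeDeriv φ p + laplace φ p) ∂cyl D a b)
    - 2 * (∫ p, π p * spaceDeriv φ (v p) p ∂cyl D a b)
    - (∫ p, (‖v p‖ ^ 2 + 2 * inner ℝ (v p) (z p)) * spaceDeriv φ (v p + z p) p ∂cyl D a b)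
    - 2 * (∫ p, φ p * inner ℝ (z p) (advect (v p + z p) fun i => G i p) ∂cyl D a b)
    - 2 * ∫ p, φ p * inner ℝ (h p) (v p) ∂cyl D a b := by
  have h1 := (e.integrable_gradSq hD hφ).const_mul 2
  have h2 := e.integrable_sq hD hφ
  have h3 := (e.integrable_pressure hD hφ).const_mul 2
  have h4 := e.integrable_cubic hD hφ
  have h5 := (e.integrable_advect hD hφ).const_mul 2
  have h6 := (e.integrable_force hD hφ).const_mul 2
  rw [← integral_const_mul, ← integral_const_mul, ← integral_const_mul, ← integral_const_mul]
  refine (integral_sub ((((h1.sub h2).sub h3).sub h4).sub h5) h6).trans (congrArg (· - _) ?_)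
  refine (integral_sub (((h1.sub h2).sub h3).sub h4) h5).trans (congrArg (· - _) ?_)
  refine (integral_sub ((h1.sub h2).sub h3) h4).trans (congrArg (· - _) ?_)
  refine (integral_sub (h1.sub h2) h3).trans (congrArg (· - _) ?_)
  exact integral_sub h1 h2

end Terms

lemma advect_add (y : E3) (G W : Fin 3 → E3) :
    advect y (fun i => G i + W i) = advect y G + advect y W := by
  simp [advect, smul_add, Finset.sum_add_distrib]

/-- The change of the local energy balance under a change of the linear part, pointwise. -/
lemma localDensity_add (p : ℝ × E3) :
    localDensity (fun p => v p + w p) (fun i p => G i p + W i p) (fun p => h p + k p)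
      (fun p => z p - w p) (fun p => π p + q p) φ p - localDensity v G h z π φ p
      + 2 * pairingDensity v G h (fun p => v p + z p) (fun i p => G i p + Z i p) π w W k q φ p
      + pairingDensity w W k 0 0 q w W k q φ p =
    -(∑ i, (2 * (spaceDeriv φ (basisVec i) p * (inner ℝ (G i p) (w p) + inner ℝ (v p) (W i p)) +
          spaceDeriv (spaceDeriv φ (basisVec i)) (basisVec i) p * inner ℝ (v p) (w p)) +
        (spaceDeriv φ (basisVec i) p * (inner ℝ (W i p) (w p) + inner ℝ (w p) (W i p)) +
          spaceDeriv (spaceDeriv φ (basisVec i)) (basisVec i) p * inner ℝ (w p) (w p))))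
    - 2 * (φ p * (inner ℝ (advect (v p + z p) fun i => Z i p) (w p) +
        inner ℝ (z p) (advect (v p + z p) fun i => W i p)) +
        spaceDeriv φ (v p + z p) p * inner ℝ (z p) (w p))
    + (φ p * (inner ℝ (advect (v p + z p) fun i => W i p) (w p) +
        inner ℝ (w p) (advect (v p + z p) fun i => W i p)) +
        spaceDeriv φ (v p + z p) p * inner ℝ (w p) (w p)) := by
  -- The advecting velocity is the same before and after the change. This is what lets the cubic
  -- terms combine with the convective term of the pairing into transport expressions along one
  -- field.
  have e1 : v p + w p + (z p - w p) = v p + z p := by abel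
  have e2 : ∀ x y : E3, spaceDeriv φ (x + y) p = spaceDeriv φ x p + spaceDeriv φ y p := by
    intro x y
    rw [spaceDeriv, spaceDeriv, spaceDeriv, ← map_add]; simp
  simp only [localDensity, pairingDensity, e1, gradSq, laplace, Pi.zero_apply, advect_zero _ _ rfl,
    advect_add, inner_zero_left, ← real_inner_self_eq_norm_sq, inner_add_left, inner_add_right,
    inner_sub_left, inner_sub_right, Fin.sum_univ_three]
  rw [e2 (v p) (w p)]
  have c1 := real_inner_comm (v p) (w p)
  have c2 := real_inner_comm (z p) (w p)
  have c3 := real_inner_comm (advect (v p + z p) fun i => W i p) (w p)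
  have c4 := real_inner_comm (advect (v p + z p) fun i => G i p) (w p)
  have c6 := real_inner_comm (k p) (w p)
  have c7 := real_inner_comm (k p) (v p)
  have c8 := fun i => real_inner_comm (G i p) (W i p)
  have c9 := fun i => real_inner_comm (W i p) (w p)
  simp only [c1, c2, c3, c4, c6, c7, c8, c9]
  ring

end SuitableNS

/-! ### Equality of the two energy balances -/

namespace SuitableNS

variable {D : Set E3} {a₀ a b : ℝ}
  {v h z w k : ℝ × E3 → E3} {G Z W : Fin 3 → ℝ × E3 → E3} {π π' q q' φ : ℝ × E3 → ℝ}

/-- The second-order version of the transport identity. -/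
lemma integral_transport_laplace (hD : IsSmoothBoundedDomain D) (ha : 0 ≤ a) (hφ : ContDiff ℝ ∞ φ)
    (hv : IsFlow D b v G) (hw : IsFlow D b w W) (i : Fin 3) :
    Integrable (fun p => spaceDeriv φ (basisVec i) p * (inner ℝ (G i p) (w p) + inner ℝ (v p) (W i p)) +
      spaceDeriv (spaceDeriv φ (basisVec i)) (basisVec i) p * inner ℝ (v p) (w p)) (cyl D a b) ∧
    ∫ p, (spaceDeriv φ (basisVec i) p * (inner ℝ (G i p) (w p) + inner ℝ (v p) (W i p)) +
      spaceDeriv (spaceDeriv φ (basisVec i)) (basisVec i) p * inner ℝ (v p) (w p)) ∂cyl D a b = 0 := by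
  have hfin := hD.isFiniteMeasure
  have hle := cyl_mono (D := D) (b := b) ha le_rfl
  have hsub : Ioo a b ⊆ Ioo 0 b := Ioo_subset_Ioo_left ha
  have hv2 : MemLp v 2 (cyl D a b) := (hv.memLp_of_le_three hD (by norm_num)).mono_measure hle
  have hw2 : MemLp w 2 (cyl D a b) := (hw.memLp_of_le_three hD (by norm_num)).mono_measure hle
  have hs := contDiff_spaceDeriv hφ (basisVec i)
  have j1 : Integrable (fun p => spaceDeriv φ (basisVec i) p *
      (inner ℝ (G i p) (w p) + inner ℝ (v p) (W i p))) (cyl D a b) :=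
    integrable_cyl_mul hD hs.continuous
      ((integrable_inner_of_memLp ((hv.memLp_grad i).mono_measure hle) hw2).add
        (integrable_inner_of_memLp hv2 ((hw.memLp_grad i).mono_measure hle)))
  have j2 : Integrable (fun p => spaceDeriv (spaceDeriv φ (basisVec i)) (basisVec i) p *
      inner ℝ (v p) (w p)) (cyl D a b) :=
    integrable_cyl_mul hD (contDiff_spaceDeriv hs _).continuous (integrable_inner_of_memLp hv2 hw2)
  refine ⟨j1.add j2, ?_⟩
  have := integral_transport hD (a := a) (b := b) (u := fun _ => basisVec i) (c := v) (C := G)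
    (d := w) (E := W) hs
    (ae_of_all _ fun t => ⟨memLp_const _, fun θ hθ => integral_fderiv_test hθ _⟩)
    (ae_restrict_of_ae_restrict_of_subset hsub hv.h10)
    (ae_restrict_of_ae_restrict_of_subset hsub hw.h10)
    (by simpa only [advect_basisVec] using j1) j2
  simpa only [advect_basisVec] using this

/-- The transported fields must be bounded in L⁴, uniformly in time, for the integrand to be
integrable. It is therefore used only for pairs formed from z and w and never for v, whose square
satisfies no such identity here. -/
lemma integral_transport_flow (hD : IsSmoothBoundedDomain D) (ha : 0 ≤ a) (hφ : ContDiff ℝ ∞ φ)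
    {u : ℝ × E3 → E3} {U : Fin 3 → ℝ × E3 → E3} (hu : IsFlow D b u U)
    (hv : IsFlow D b v G) (hw : IsFlow D b w W) {K₁ K₂ : ℝ≥0}
    (hK₁ : ∀ᵐ t ∂volume.restrict (Ioo a b), eLpNorm (fun x => v (t, x)) 4 (volume.restrict D) ≤ K₁)
    (hK₂ : ∀ᵐ t ∂volume.restrict (Ioo a b), eLpNorm (fun x => w (t, x)) 4 (volume.restrict D) ≤ K₂) :
    Integrable (fun p => φ p * (inner ℝ (advect (u p) fun i => G i p) (w p) +
      inner ℝ (v p) (advect (u p) fun i => W i p)) +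
      spaceDeriv φ (u p) p * inner ℝ (v p) (w p)) (cyl D a b) ∧
    ∫ p, (φ p * (inner ℝ (advect (u p) fun i => G i p) (w p) +
      inner ℝ (v p) (advect (u p) fun i => W i p)) +
      spaceDeriv φ (u p) p * inner ℝ (v p) (w p)) ∂cyl D a b = 0 := by
  have hle := cyl_mono (D := D) (b := b) ha le_rfl
  have hsub : Ioo a b ⊆ Ioo 0 b := Ioo_subset_Ioo_left ha
  have hu3 := (hu.memLp_three hD).mono_measure hle
  have hv3 := (hv.memLp_three hD).mono_measure hle
  have hw3 := (hw.memLp_three hD).mono_measure hle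
  have hu4 : MemL2L4 (volume.restrict (Ioo a b)) (volume.restrict D) u :=
    ⟨hu3.1, (lintegral_mono_set hsub).trans_lt (hu.memL2L4 hD).lt_top⟩
  have j1 : Integrable (fun p => φ p * (inner ℝ (advect (u p) fun i => G i p) (w p) +
      inner ℝ (v p) (advect (u p) fun i => W i p))) (cyl D a b) := by
    have h1 := integrable_inner_advect hu4 (fun i => (hv.memLp_grad i).mono_measure hle) hw3.1 hK₂
    have h2 := integrable_inner_advect hu4 (fun i => (hw.memLp_grad i).mono_measure hle) hv3.1 hK₁
    have h1' : Integrable (fun p => inner ℝ (advect (u p) fun i => G i p) (w p)) (cyl D a b) :=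
      h1.congr (ae_of_all _ fun p => real_inner_comm _ _)
    exact integrable_cyl_mul hD hφ.continuous (h1'.add h2)
  have j2 := integrable_mul_inner_of_memLp_three hv3 hw3 (memLp_spaceDeriv hD hφ hu3)
  refine ⟨j1.add j2, integral_transport hD hφ ?_ (ae_restrict_of_ae_restrict_of_subset hsub hv.h10)
    (ae_restrict_of_ae_restrict_of_subset hsub hw.h10) j1 j2⟩
  filter_upwards [ae_restrict_of_ae_restrict_of_subset hsub hu.h10, ae_restrict_mem measurableSet_Ioo]
    with t h1 h2
  exact ⟨h1.memLp_four hD.bounded, (hu.memH t ⟨ha.trans h2.1.le, h2.2.le⟩).div_test⟩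

lemma IsH10.add {v w : E3 → E3} {G W : Fin 3 → E3 → E3} (hv : IsH10 D v G) (hw : IsH10 D w W) :
    IsH10 D (fun x => v x + w x) (fun i x => G i x + W i x) := by
  obtain ⟨φ, hφ⟩ := hv.exists_approx
  obtain ⟨ψ, hψ⟩ := hw.exists_approx
  have hlim : ∀ {f g : ℕ → E3 → E3}, (∀ n, AEStronglyMeasurable (f n) (volume.restrict D)) →
      (∀ n, AEStronglyMeasurable (g n) (volume.restrict D)) →
      Tendsto (fun n => eLpNorm (f n) 2 (volume.restrict D)) atTop (𝓝 0) →
      Tendsto (fun n => eLpNorm (g n) 2 (volume.restrict D)) atTop (𝓝 0) →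
      Tendsto (fun n => eLpNorm (f n + g n) 2 (volume.restrict D)) atTop (𝓝 0) := by
    intro f g hf hg h1 h2
    refine tendsto_of_tendsto_of_tendsto_of_le_of_le tendsto_const_nhds (by simpa using h1.add h2)
      (fun _ => zero_le) fun n => eLpNorm_add_le (hf n) (hg n) (by norm_num)
  refine ⟨hv.memLp.add hw.memLp, fun i => (hv.memLp_grad i).add (hw.memLp_grad i),
    fun n x => φ n x + ψ n x, fun n => ?_, ?_, fun i => ?_⟩
  · exact ⟨(hφ.test n).smooth.add (hψ.test n).smooth, (hφ.test n).compact.add (hψ.test n).compact,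
      (tsupport_add _ _).trans (union_subset (hφ.test n).support (hψ.test n).support)⟩
  · refine (hlim (fun n => ((hφ.test n).memLp 2).1.sub hv.memLp.1)
      (fun n => ((hψ.test n).memLp 2).1.sub hw.memLp.1) hφ.tendsto hψ.tendsto).congr fun n => ?_
    congr 1
    ext x : 1
    simp only [Pi.add_apply, Pi.sub_apply]
    abel
  · refine (hlim (fun n => (((hφ.test n).fderiv_apply (basisVec i)).memLp 2).1.sub (hv.memLp_grad i).1)
      (fun n => (((hψ.test n).fderiv_apply (basisVec i)).memLp 2).1.sub (hw.memLp_grad i).1)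
      (hφ.tendsto_grad i) (hψ.tendsto_grad i)).congr fun n => ?_
    congr 1
    ext x : 1
    have : fderiv ℝ (fun x => φ n x + ψ n x) x = fderiv ℝ (φ n) x + fderiv ℝ (ψ n) x :=
      (((hφ.test n).hasFDerivAt x).add ((hψ.test n).hasFDerivAt x)).fderiv
    change (fderiv ℝ (φ n) x (basisVec i) - G i x) + (fderiv ℝ (ψ n) x (basisVec i) - W i x) = _
    rw [this, add_apply]
    abel

lemma IsFlow.add (hv : IsFlow D b v G) (hw : IsFlow D b w W) :
    IsFlow D b (fun p => v p + w p) (fun i p => G i p + W i p) := by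
  obtain ⟨C, hC⟩ := hv.bound
  obtain ⟨C', hC'⟩ := hw.bound
  refine ⟨fun t ht => (hv.memH t ht).add (hw.memH t ht), fun ψ hψ => ?_, hv.meas.add hw.meas,
    ⟨C + C', fun t ht => ?_⟩, fun i => (hv.memLp_grad i).add (hw.memLp_grad i), ?_⟩
  · refine ((hv.cont ψ hψ).add (hw.cont ψ hψ)).congr fun t ht => ?_
    simp only [inner_add_left]
    exact integral_add (integrable_inner_of_memLp (hv.memH t ht).memLp hψ)
      (integrable_inner_of_memLp (hw.memH t ht).memLp hψ)
  · rw [ENNReal.coe_add]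
    exact (eLpNorm_add_le (hv.memH t ht).memLp.1 (hw.memH t ht).memLp.1 (by norm_num)).trans
      (add_le_add (hC t ht) (hC' t ht))
  · filter_upwards [hv.h10, hw.h10] with t h1 h2 using h1.add h2

lemma IsBalanced.energyData (hD : IsSmoothBoundedDomain D) (h₀ : 0 ≤ a₀) (ha : a₀ ≤ a)
    {u : ℝ × E3 → E3} {H : Fin 3 → ℝ × E3 → E3} (hv : IsBalanced D a₀ b v G h u H π)
    (hz : IsFlow D b z Z) {K : ℝ≥0}
    (hK : ∀ᵐ t ∂volume.restrict (Ioo a₀ b), eLpNorm (fun x => z (t, x)) 4 (volume.restrict D) ≤ K)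
    (hπ' : MemLp π' (5 / 3) (cyl D a₀ b)) : EnergyData D a b v G h z π' := by
  have hle := cyl_mono (D := D) (b := b) ha le_rfl
  have hle' := cyl_mono (D := D) (b := b) (h₀.trans ha) le_rfl
  refine ⟨(hv.memLp_flow hD h₀).mono_measure hle, ⟨(hv.flow.memLp_three hD).1.mono_measure hle',
    (lintegral_mono_set (Ioo_subset_Ioo_left (h₀.trans ha))).trans_lt (hv.flow.memL2L4 hD).lt_top⟩,
    fun i => (hv.flow.memLp_grad i).mono_measure hle', hv.memLp_force.mono_measure hle,
    (hz.memLp_three hD).mono_measure hle',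
    ⟨K, ae_restrict_of_ae_restrict_of_subset (Ioo_subset_Ioo_left ha) hK⟩, hπ'.mono_measure hle⟩

lemma EnergyData.change (e : EnergyData D a b v G h z π) (e' : EnergyData D a b w W k w q) :
    EnergyData D a b (fun p => v p + w p) (fun i p => G i p + W i p) (fun p => h p + k p)
      (fun p => z p - w p) (fun p => π p + q p) := by
  obtain ⟨K, hK⟩ := e.four
  obtain ⟨K', hK'⟩ := e'.four
  refine ⟨e.three.add e'.three, e.l2l4.add e'.l2l4, fun i => (e.grad i).add (e'.grad i),
    e.force.add e'.force, e.three'.sub e'.three, ⟨K + K', ?_⟩, e.pressure.add e'.pressure⟩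
  filter_upwards [hK, hK', e.three'.1.prodMk_left, e'.three.1.prodMk_left] with t h1 h2 h3 h4
  rw [ENNReal.coe_add]
  exact (eLpNorm_sub_le h3 h4 (by norm_num)).trans (add_le_add h1 h2)

/-- The energy balance does not depend on the solution of the linear problem. -/
theorem IsBalanced.energy_change (hD : IsSmoothBoundedDomain D) (h₀ : 0 ≤ a₀) (ha : a₀ < a) (hab : a < b)
    (hv : IsBalanced D a₀ b v G h (fun p => v p + z p) (fun i p => G i p + Z i p) π)
    (hz : IsFlow D b z Z) (hw : IsBalanced D a₀ b w W k 0 0 q) {K K' : ℝ≥0}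
    (hK : ∀ᵐ t ∂volume.restrict (Ioo a₀ b), eLpNorm (fun x => z (t, x)) 4 (volume.restrict D) ≤ K)
    (hK' : ∀ᵐ t ∂volume.restrict (Ioo a₀ b), eLpNorm (fun x => w (t, x)) 4 (volume.restrict D) ≤ K')
    (hφ : ContDiff ℝ ∞ φ) (hπ' : MemLp π' (5 / 3) (cyl D a₀ b)) (hq' : MemLp q' (5 / 3) (cyl D a₀ b))
    (hππ' : ∀ t r x y, π (t, x) * spaceDeriv φ y (r, x) = π' (t, x) * spaceDeriv φ y (r, x))
    (hqq' : ∀ t r x y, q (t, x) * spaceDeriv φ y (r, x) = q' (t, x) * spaceDeriv φ y (r, x)) :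
    (∫ p, localDensity (fun p => v p + w p) (fun i p => G i p + W i p) (fun p => h p + k p)
        (fun p => z p - w p) (fun p => π' p + q' p) φ p ∂cyl D a b)
      + ((∫ x in D, φ (b, x) * ‖v (b, x) + w (b, x)‖ ^ 2) - ∫ x in D, φ (a, x) * ‖v (a, x) + w (a, x)‖ ^ 2) =
    (∫ p, localDensity v G h z π' φ p ∂cyl D a b)
      + ((∫ x in D, φ (b, x) * ‖v (b, x)‖ ^ 2) - ∫ x in D, φ (a, x) * ‖v (a, x)‖ ^ 2) := by
  have h0a := h₀.trans ha.le
  have hsub : Ioo a b ⊆ Ioo a₀ b := Ioo_subset_Ioo_left ha.le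
  have e := hv.energyData hD h₀ ha.le hz hK hπ'
  have e' := hw.energyData hD h₀ ha.le hw.flow hK' hq'
  have e₁ := e.change e'
  -- The evolution of the mixed term and, in the next line, of the weighted square of w: together
  -- they account for the difference of |v + w|² and |v|².
  obtain ⟨p1, p2⟩ := hv.pairing hD h₀ ha hab hw hK' hφ hπ' hq' hππ' (fun p y => hqq' p.1 p.1 p.2 y)
  obtain ⟨p3, p4⟩ := hw.pairing hD h₀ ha hab hw hK' hφ hq' hq' hqq' (fun p y => hqq' p.1 p.1 p.2 y)
  have t1 := integral_transport_laplace hD h0a hφ hv.flow hw.flow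
  have t2 := integral_transport_laplace hD h0a hφ hw.flow hw.flow
  have kz := ae_restrict_of_ae_restrict_of_subset hsub hK
  have kw := ae_restrict_of_ae_restrict_of_subset hsub hK'
  have hu := hv.flow.add hz
  obtain ⟨t3, t4⟩ := integral_transport_flow hD h0a hφ hu hz hw.flow kz kw
  obtain ⟨t5, t6⟩ := integral_transport_flow hD h0a hφ hu hw.flow hw.flow kw kw
  have d1 := e₁.integrable_density hD hφ
  have d0 := e.integrable_density hD hφ
  have hsum := integrable_finsetSum Finset.univ fun i _ => ((t1 i).1.const_mul 2).add (t2 i).1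
  have hL := integral_add ((d1.sub d0).add (p1.const_mul 2)) p3
  have hR := integral_add (hsum.neg.sub (t3.const_mul 2)) t5
  -- By the pointwise identity the integrand is a sum of total transport expressions, along
  -- coordinate vectors and along u, and each of them has integral zero.
  have hLR : ∫ p, (((localDensity (fun p => v p + w p) (fun i p => G i p + W i p) (fun p => h p + k p)
        (fun p => z p - w p) (fun p => π' p + q' p) φ - localDensity v G h z π' φ) + fun p =>
        2 * pairingDensity v G h (fun p => v p + z p) (fun i p => G i p + Z i p) π' w W k q' φ p) p
        + pairingDensity w W k 0 0 q' w W k q' φ p) ∂cyl D a b = 0 := by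
    refine (integral_congr_ae (ae_of_all _ fun p => localDensity_add (Z := Z) p)).trans ?_
    refine Eq.trans ?_ (hR.trans ?_)
    · refine integral_congr_ae (ae_of_all _ fun p => ?_)
      simp only [Pi.sub_apply, Pi.neg_apply, Pi.add_apply]
    · rw [t6, integral_sub' hsum.neg (t3.const_mul 2), integral_const_mul, t4, integral_neg',
        integral_finsetSum _ fun i _ => ((t1 i).1.const_mul 2).add (t2 i).1]
      have : ∀ i, ∫ p, ((fun p => 2 * (spaceDeriv φ (basisVec i) p *
          (inner ℝ (G i p) (w p) + inner ℝ (v p) (W i p)) +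
          spaceDeriv (spaceDeriv φ (basisVec i)) (basisVec i) p * inner ℝ (v p) (w p))) +
          fun p => spaceDeriv φ (basisVec i) p *
          (inner ℝ (W i p) (w p) + inner ℝ (w p) (W i p)) +
          spaceDeriv (spaceDeriv φ (basisVec i)) (basisVec i) p * inner ℝ (w p) (w p)) p
          ∂cyl D a b = 0 := by
        intro i
        rw [integral_add' ((t1 i).1.const_mul 2) (t2 i).1, integral_const_mul, (t1 i).2, (t2 i).2]
        simp
      rw [Finset.sum_eq_zero fun i _ => this i]
      simp
  have hL' := integral_add' (d1.sub d0) (p1.const_mul 2)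
  rw [integral_sub' d1 d0, integral_const_mul] at hL'
  rw [hLR, hL', ← p2, ← p4] at hL
  have hexp : ∀ t ∈ Icc a b, ∫ x in D, φ (t, x) * ‖v (t, x) + w (t, x)‖ ^ 2 =
      (∫ x in D, φ (t, x) * ‖v (t, x)‖ ^ 2) + 2 * (∫ x in D, φ (t, x) * inner ℝ (v (t, x)) (w (t, x))) +
        ∫ x in D, φ (t, x) * inner ℝ (w (t, x)) (w (t, x)) := by
    intro t ht
    have ht' : t ∈ Icc 0 b := ⟨h0a.trans ht.1, ht.2⟩
    have hc : Continuous fun x => φ (t, x) := hφ.continuous.comp (by fun_prop)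
    have hi : ∀ {c d : E3 → E3}, MemLp c 2 (volume.restrict D) → MemLp d 2 (volume.restrict D) →
        Integrable (fun x => φ (t, x) * inner ℝ (c x) (d x)) (volume.restrict D) := by
      intro c d hc' hd
      simpa only [inner_smul_left, conj_trivial] using
        integrable_inner_of_memLp (p := 2) (q := 2) (memLp_continuous_smul hD hc hc') hd
    have mv := (hv.flow.memH t ht').memLp
    have mw := (hw.flow.memH t ht').memLp
    rw [← integral_const_mul]
    have hvv := hi mv mv
    simp only [real_inner_self_eq_norm_sq] at hvv
    have i1 := integral_add hvv ((hi mv mw).const_mul 2)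
    have i2 := integral_add (hvv.add ((hi mv mw).const_mul 2)) (hi mw mw)
    rw [← i1]
    refine Eq.trans ?_ i2
    refine integral_congr_ae (ae_of_all _ fun x => ?_)
    simp only [Pi.add_apply, norm_add_sq_real, real_inner_self_eq_norm_sq]
    ring
  rw [hexp a ⟨le_rfl, hab.le⟩, hexp b ⟨hab.le, le_rfl⟩]
  linarith

end SuitableNS

/-! ### Restriction to bounded cylinders, local pressures, operations in the energy space -/

namespace SuitableNS

variable {D : Set E3} {a b : ℝ} {T : EReal}

section Test

variable {F : Type*} [NormedAddCommGroup F] [NormedSpace ℝ F] {U : Set (ℝ × E3)} {Ψ : ℝ × E3 → F}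

lemma IsTestFunction.eq_zero (h : IsTestFunction U Ψ) {p : ℝ × E3} (hp : p ∉ U) : Ψ p = 0 :=
  image_eq_zero_of_notMem_tsupport fun hx => hp (h.support hx)

lemma IsTestFunction.laplace (h : IsTestFunction U Ψ) : IsTestFunction U (laplace Ψ) := by
  have h' : IsTestFunction (tsupport Ψ) Ψ := ⟨h.smooth, h.compact, subset_rfl⟩
  have h2 : tsupport (SuitableNS.laplace Ψ) ⊆ tsupport Ψ := by
    refine closure_minimal ?_ (isClosed_tsupport _)
    intro p hp
    by_contra hn
    exact hp (Finset.sum_eq_zero fun i _ => ((h'.spaceDeriv _).spaceDeriv _).eq_zero hn)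
  exact ⟨ContDiff.sum fun i _ => contDiff_spaceDeriv (contDiff_spaceDeriv h.smooth _) _,
    HasCompactSupport.of_support_subset_isCompact h.compact ((subset_tsupport _).trans h2),
    h2.trans h.support⟩

end Test

lemma isOpen_openTimes (T : EReal) : IsOpen (openTimes T) :=
  (isOpen_lt continuous_const continuous_id).inter
    (isOpen_lt continuous_coe_real_ereal continuous_const)

lemma isOpen_spaceTime (hD : IsSmoothBoundedDomain D) (T : EReal) : IsOpen (spaceTime D T) :=
  (isOpen_openTimes T).prod hD.isOpen

lemma Ioo_prod_subset_spaceTime (ha : 0 ≤ a) (hb : (b : EReal) ≤ T) : Ioo a b ×ˢ D ⊆ spaceTime D T :=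
  prod_mono (fun _ ht => ⟨ha.trans_lt ht.1, (EReal.coe_lt_coe_iff.2 ht.2).trans_le hb⟩) subset_rfl

lemma cyl_le_spaceTime (ha : 0 ≤ a) (hb : (b : EReal) ≤ T) :
    cyl D a b ≤ volume.restrict (spaceTime D T) := by
  rw [cyl_eq]
  exact Measure.restrict_mono (Ioo_prod_subset_spaceTime ha hb) le_rfl

lemma integral_spaceTime_eq (hD : IsSmoothBoundedDomain D) (ha : 0 ≤ a) (hb : (b : EReal) ≤ T)
    {F : ℝ × E3 → ℝ} (hF : ∀ p ∉ Ioo a b ×ˢ D, F p = 0) :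
    ∫ p in spaceTime D T, F p = ∫ p, F p ∂cyl D a b := by
  rw [cyl_eq]
  exact setIntegral_eq_of_subset_of_forall_sdiff_eq_zero (isOpen_spaceTime hD T).measurableSet
    (Ioo_prod_subset_spaceTime ha hb) fun p hp => hF p hp.2

/-- A compact part of the space-time cylinder stays away from its initial and final times. -/
lemma exists_Ioo_prod (hT : 0 < T) {K : Set (ℝ × E3)} (hK : IsCompact K) (hKT : K ⊆ spaceTime D T) :
    ∃ a b : ℝ, 0 < a ∧ a < b ∧ (b : EReal) < T ∧ K ⊆ Ioo a b ×ˢ D := by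
  rcases K.eq_empty_or_nonempty with rfl | hne
  · obtain ⟨b, h0, h1⟩ := EReal.lt_iff_exists_real_btwn.1 hT
    have h0' : 0 < b := by exact_mod_cast h0
    exact ⟨b / 2, b, by positivity, by linarith, h1, by simp⟩
  · obtain ⟨m, hm, hm'⟩ := hK.exists_isMinOn hne (f := Prod.fst) continuous_fst.continuousOn
    obtain ⟨M, hM, hM'⟩ := hK.exists_isMaxOn hne (f := Prod.fst) continuous_fst.continuousOn
    obtain ⟨b, h0, h1⟩ := EReal.lt_iff_exists_real_btwn.1 (hKT hM).1.2
    have h0' : M.1 < b := by exact_mod_cast h0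
    have hm0 : 0 < m.1 := (hKT hm).1.1
    have hmM : m.1 ≤ M.1 := hM' hm
    refine ⟨m.1 / 2, b, by positivity, by linarith, h1, fun p hp => ⟨⟨?_, ?_⟩, (hKT hp).2⟩⟩
    · have : m.1 ≤ p.1 := hm' hp
      linarith
    · exact lt_of_le_of_lt (hM' hp : p.1 ≤ M.1) h0'

lemma IsTestFunction.exists_Ioo_prod {F : Type*} [NormedAddCommGroup F] [NormedSpace ℝ F]
    {Ψ : ℝ × E3 → F} (hT : 0 < T) (h : IsTestFunction (spaceTime D T) Ψ) :
    ∃ a b : ℝ, 0 < a ∧ a < b ∧ (b : EReal) < T ∧ IsTestFunction (Ioo a b ×ˢ D) Ψ := by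
  obtain ⟨a, b, h1, h2, h3, h4⟩ := SuitableNS.exists_Ioo_prod hT h.compact h.support
  exact ⟨a, b, h1, h2, h3, h.smooth, h.compact, h4⟩

/-! ### Locally integrable pressures -/

lemma InL53loc.integrable_mul {q θ : ℝ × E3 → ℝ} (hq : InL53loc D T q)
    (hθ : IsTestFunction (spaceTime D T) θ) : Integrable (fun p => q p * θ p) := by
  have i2 := holderTriple_pressure
  have h1 := hq _ hθ.compact hθ.support
  have h2 : MemLp θ (5 / 2) (volume.restrict (tsupport θ)) :=
    (hθ.smooth.continuous.memLp_of_hasCompactSupport hθ.compact).restrict _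
  have h3 : IntegrableOn (fun p => q p * θ p) (tsupport θ) :=
    (integrable_inner_of_memLp h1 h2).congr (ae_of_all _ fun p => by simp [mul_comm])
  refine (integrableOn_iff_integrable_of_support_subset fun p hp => ?_).1 h3
  by_contra hn
  exact hp (by simp [image_eq_zero_of_notMem_tsupport hn])

lemma InL53loc.add {q r : ℝ × E3 → ℝ} (hq : InL53loc D T q) (hr : InL53loc D T r) :
    InL53loc D T (q + r) := fun K h1 h2 => (hq K h1 h2).add (hr K h1 h2)

lemma InL53loc.sub {q r : ℝ × E3 → ℝ} (hq : InL53loc D T q) (hr : InL53loc D T r) :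
    InL53loc D T (q - r) := fun K h1 h2 => (hq K h1 h2).sub (hr K h1 h2)

/-- A pressure may be cut off in space where a test function does not see it. -/
lemma InL53loc.exists_cutoff {q φ : ℝ × E3 → ℝ} (hq : InL53loc D T q)
    (hφ : IsTestFunction (spaceTime D T) φ) (ha : 0 < a) (hb : (b : EReal) < T) :
    ∃ q' : ℝ × E3 → ℝ, MemLp q' (5 / 3) (cyl D a b) ∧
      ∀ t r x y, q (t, x) * spaceDeriv φ y (r, x) = q' (t, x) * spaceDeriv φ y (r, x) := by
  -- The cutoff is the indicator of the spatial projection of the support. It does not depend on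
  -- time, so it serves for a pressure and a test function taken at different times.
  set K := Prod.snd '' tsupport φ with hKdef
  have hK : IsCompact K := hφ.compact.image continuous_snd
  have hKD : K ⊆ D := by
    rintro _ ⟨p, hp, rfl⟩
    exact (hφ.support hp).2
  have hφ' : IsTestFunction (tsupport φ) φ := ⟨hφ.smooth, hφ.compact, subset_rfl⟩
  have hKm : MeasurableSet (univ ×ˢ K : Set (ℝ × E3)) := MeasurableSet.univ.prod hK.measurableSet
  refine ⟨(univ ×ˢ K).indicator q, ?_, fun t r x y => ?_⟩
  · rw [cyl_eq, memLp_indicator_iff_restrict hKm, Measure.restrict_restrict hKm]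
    have hsub : Icc a b ×ˢ K ⊆ spaceTime D T := fun p hp =>
      ⟨⟨ha.trans_le hp.1.1, (EReal.coe_le_coe_iff.2 hp.1.2).trans_lt hb⟩, hKD hp.2⟩
    have hsub' : univ ×ˢ K ∩ Ioo a b ×ˢ D ⊆ Icc a b ×ˢ K := fun p hp =>
      ⟨Ioo_subset_Icc_self hp.2.1, hp.1.2⟩
    exact (hq _ (isCompact_Icc.prod hK) hsub).mono_measure (Measure.restrict_mono hsub' le_rfl)
  · by_cases hx : x ∈ K
    · rw [indicator_of_mem (show (t, x) ∈ univ ×ˢ K from ⟨mem_univ _, hx⟩)]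
    · rw [(hφ'.spaceDeriv y).eq_zero (p := (r, x)) fun h => hx ⟨_, h, rfl⟩]
      simp

/-! ### Sums and differences in the energy space -/

lemma IsH10.neg {v : E3 → E3} {G : Fin 3 → E3 → E3} (hv : IsH10 D v G) : IsH10 D (-v) (-G) := by
  obtain ⟨φ, hφ, h1, h2⟩ := hv.approx
  refine ⟨hv.memLp.neg, fun i => (hv.memLp_grad i).neg, fun n => -φ n, fun n => ?_, ?_, fun i => ?_⟩
  · exact ⟨(hφ n).smooth.neg, (hφ n).compact.neg,
      by rw [tsupport, Function.support_neg]; exact (hφ n).support⟩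
  · refine h1.congr fun n => ?_
    rw [← eLpNorm_neg]
    congr 1
    exact neg_sub' _ _
  · refine (h2 i).congr fun n => ?_
    rw [← eLpNorm_neg]
    congr 1
    ext x : 1
    rw [fderiv_neg]
    simp only [Pi.neg_apply, neg_apply]
    abel

lemma MemV.add {v w : E3 → E3} {G W : Fin 3 → E3 → E3} (hv : MemV D v G) (hw : MemV D w W) :
    MemV D (v + w) (G + W) := by
  refine ⟨hv.h10.add hw.h10, ?_⟩
  filter_upwards [hv.div_free, hw.div_free] with x h1 h2
  simp only [Pi.add_apply, PiLp.add_apply, Finset.sum_add_distrib, h1, h2, add_zero]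

lemma MemV.neg {v : E3 → E3} {G : Fin 3 → E3 → E3} (hv : MemV D v G) : MemV D (-v) (-G) := by
  refine ⟨hv.h10.neg, ?_⟩
  filter_upwards [hv.div_free] with x h1
  simp only [Pi.neg_apply, PiLp.neg_apply, Finset.sum_neg_distrib, h1, neg_zero]

variable {v w : ℝ × E3 → E3} {G W : Fin 3 → ℝ × E3 → E3}

lemma InEnergyClass.add (hv : InEnergyClass D T v G) (hw : InEnergyClass D T w W) :
    InEnergyClass D T (v + w) (G + W) := by
  obtain ⟨C, hC⟩ := hv.bound
  obtain ⟨C', hC'⟩ := hw.bound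
  refine ⟨hv.meas.add hw.meas, ⟨C + C', ?_⟩, fun i => (hv.grad_memLp i).add (hw.grad_memLp i), ?_⟩
  · filter_upwards [hC, hC'] with t h1 h2
    refine ⟨h1.1.add h2.1, ?_⟩
    rw [ENNReal.coe_add]
    exact (eLpNorm_add_le h1.1.memLp.1 h2.1.memLp.1 (by norm_num)).trans (add_le_add h1.2 h2.2)
  · filter_upwards [hv.memV, hw.memV] with t h1 h2 using h1.add h2

lemma InEnergyClass.neg (hv : InEnergyClass D T v G) : InEnergyClass D T (-v) (-G) := by
  obtain ⟨C, hC⟩ := hv.bound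
  refine ⟨hv.meas.neg, ⟨C, ?_⟩, fun i => (hv.grad_memLp i).neg, ?_⟩
  · filter_upwards [hC] with t h1
    exact ⟨h1.1.neg, (eLpNorm_neg (fun x => v (t, x)) _ _).trans_le h1.2⟩
  · filter_upwards [hv.memV] with t h1 using h1.neg

lemma InEnergyClass.sub (hv : InEnergyClass D T v G) (hw : InEnergyClass D T w W) :
    InEnergyClass D T (v - w) (G - W) := by
  rw [sub_eq_add_neg, sub_eq_add_neg]
  exact hv.add hw.neg

lemma WeaklyContinuous.add (hv : WeaklyContinuous D T v) (hw : WeaklyContinuous D T w) :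
    WeaklyContinuous D T (v + w) := by
  refine ⟨fun t ht => (hv.memH t ht).add (hw.memH t ht), fun ψ hψ =>
    ((hv.cont ψ hψ).add (hw.cont ψ hψ)).congr fun t ht => ?_⟩
  simp only [Pi.add_apply, inner_add_left]
  exact integral_add (integrable_inner_of_memLp (hv.memH t ht).memLp hψ.memLp)
    (integrable_inner_of_memLp (hw.memH t ht).memLp hψ.memLp)

lemma WeaklyContinuous.neg (hv : WeaklyContinuous D T v) : WeaklyContinuous D T (-v) := by
  refine ⟨fun t ht => (hv.memH t ht).neg, fun ψ hψ => (hv.cont ψ hψ).neg.congr fun t ht => ?_⟩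
  simp only [Pi.neg_apply, inner_neg_left, integral_neg]

lemma WeaklyContinuous.sub (hv : WeaklyContinuous D T v) (hw : WeaklyContinuous D T w) :
    WeaklyContinuous D T (v - w) := by
  rw [sub_eq_add_neg]
  exact hv.add hw.neg

lemma InLinftyL4.sub (hv : InLinftyL4 D T v) (hw : InLinftyL4 D T w)
    (hvm : AEStronglyMeasurable v (volume.restrict (spaceTime D T)))
    (hwm : AEStronglyMeasurable w (volume.restrict (spaceTime D T))) : InLinftyL4 D T (v - w) := by
  obtain ⟨C, hC⟩ := hv
  obtain ⟨C', hC'⟩ := hw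
  rw [spaceTime, volume_restrict_prod] at hvm hwm
  refine ⟨C + C', ?_⟩
  filter_upwards [hC, hC', hvm.prodMk_left, hwm.prodMk_left] with t h1 h2 h3 h4
  rw [ENNReal.coe_add]
  exact (eLpNorm_sub_le h3 h4 (by norm_num)).trans (add_le_add h1 h2)

end SuitableNS

/-! ### Differences of solutions of the linear problem -/

namespace SuitableNS

variable {D : Set E3} {a b : ℝ} {T : EReal} {f fa fb g h k z z₁ v w : ℝ × E3 → E3}
  {v₀ w₀ za zb : E3 → E3} {Q Q₁ q π : ℝ × E3 → ℝ} {G Z W : Fin 3 → ℝ × E3 → E3}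

lemma isH10_zero : IsH10 D 0 0 :=
  ⟨MemLp.zero, fun _ => MemLp.zero, fun _ => 0, fun _ =>
    ⟨contDiff_const, HasCompactSupport.zero, by simp [tsupport]⟩, by simp, fun i => by simp⟩

lemma IsFlow.zero : IsFlow D b 0 0 :=
  ⟨fun _ _ => memH_zero, fun ψ _ => by simpa using continuousOn_const,
    aestronglyMeasurable_zero, ⟨0, fun t _ => by simp⟩, fun _ => MemLp.zero,
    ae_of_all _ fun _ => isH10_zero⟩

lemma IsStokesSolution.isFlow (hz : IsStokesSolution D T f g za z Q)
    (hZ : ∀ S : ℝ, 0 < S → (S : EReal) ≤ T → InEnergyClass D S z Z) (hb : 0 < b)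
    (hbT : (b : EReal) ≤ T) : IsFlow D b z Z := (hZ b hb hbT).isFlow hb hbT hz.weakCont

lemma IsStokesSolution.exists_bound (hz : IsStokesSolution D T f g za z Q) (ha : 0 ≤ a) (hb : 0 < b)
    (hbT : (b : EReal) ≤ T) : ∃ K : ℝ≥0, ∀ᵐ t ∂volume.restrict (Ioo a b),
      eLpNorm (fun x => z (t, x)) 4 (volume.restrict D) ≤ K := by
  obtain ⟨K, hK⟩ := hz.bound4 b hb hbT
  rw [openTimes_coe] at hK
  exact ⟨K, ae_restrict_of_ae_restrict_of_subset (Ioo_subset_Ioo_left ha) hK⟩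

lemma IsStokesSolution.memLp_two (hD : IsSmoothBoundedDomain D) (hz : IsStokesSolution D T f g za z Q)
    (ha : 0 ≤ a) (hb : 0 < b) (hbT : (b : EReal) ≤ T) : MemLp z 2 (cyl D a b) := by
  obtain ⟨Z, hZ⟩ := hz.energy
  exact ((hz.isFlow hZ hb hbT).memLp_of_le_three hD (by norm_num)).mono_measure (cyl_mono ha le_rfl)

lemma IsStokesSolution.equation_cyl (hD : IsSmoothBoundedDomain D) (ha : 0 ≤ a)
    (hbT : (b : EReal) ≤ T) (hz : IsStokesSolution D T f g za z Q) {Ψ : ℝ × E3 → E3}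
    (hΨ : IsTestFunction (Ioo a b ×ˢ D) Ψ) :
    -(∫ p, inner ℝ (z p) (timeDeriv Ψ p) ∂cyl D a b) - ∫ p, Q p * divergence Ψ p ∂cyl D a b
      = (∫ p, inner ℝ (z p) (laplace Ψ p) ∂cyl D a b) + (∫ p, inner ℝ (f p) (Ψ p) ∂cyl D a b)
        - ∫ p, inner ℝ (g p) (timeDeriv Ψ p) ∂cyl D a b := by
  have := hz.equation Ψ (hΨ.mono (Ioo_prod_subset_spaceTime ha hbT))
  rwa [integral_spaceTime_eq hD ha hbT fun p hp => by simp [hΨ.timeDeriv.eq_zero hp],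
    integral_spaceTime_eq hD ha hbT fun p hp => by simp [hΨ.divergence.eq_zero hp],
    integral_spaceTime_eq hD ha hbT fun p hp => by simp [hΨ.laplace.eq_zero hp],
    integral_spaceTime_eq hD ha hbT fun p hp => by simp [hΨ.eq_zero hp],
    integral_spaceTime_eq hD ha hbT fun p hp => by simp [hΨ.timeDeriv.eq_zero hp]] at this

/-- The difference of two solutions of the linear problem solves the linear problem with the
difference of the data. -/
lemma IsStokesSolution.sub (hD : IsSmoothBoundedDomain D) (hT : 0 < T) (hfa : InL2H D T fa)
    (hfb : InL2H D T fb) (hz : IsStokesSolution D T fa g za z Q)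
    (hz₁ : IsStokesSolution D T fb g zb z₁ Q₁) :
    IsStokesSolution D T (fa - fb) 0 (za - zb) (z - z₁) (Q - Q₁) := by
  obtain ⟨Z, hZ⟩ := hz.energy
  obtain ⟨Z₁, hZ₁⟩ := hz₁.energy
  refine ⟨hz.weakCont.sub hz₁.weakCont, ?_, ⟨Z - Z₁, fun S h1 h2 => (hZ S h1 h2).sub (hZ₁ S h1 h2)⟩,
    fun S h1 h2 => (hz.bound4 S h1 h2).sub (hz₁.bound4 S h1 h2) (hZ S h1 h2).meas (hZ₁ S h1 h2).meas,
    hz.pressure.sub hz₁.pressure, fun Ψ hΨT => ?_⟩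
  · filter_upwards [hz.initial, hz₁.initial] with x h1 h2
    simp [h1, h2]
  · obtain ⟨a, b, ha, hab, hbT, hΨ⟩ := hΨT.exists_Ioo_prod hT
    have hb := ha.trans hab
    have e1 := hz.equation_cyl hD ha.le hbT.le hΨ
    have e2 := hz₁.equation_cyl hD ha.le hbT.le hΨ
    rw [integral_spaceTime_eq hD ha.le hbT.le fun p hp => by simp [hΨ.timeDeriv.eq_zero hp],
      integral_spaceTime_eq hD ha.le hbT.le fun p hp => by simp [hΨ.divergence.eq_zero hp],
      integral_spaceTime_eq hD ha.le hbT.le fun p hp => by simp [hΨ.laplace.eq_zero hp],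
      integral_spaceTime_eq hD ha.le hbT.le fun p hp => by simp [hΨ.eq_zero hp]]
    simp only [Pi.sub_apply, Pi.zero_apply, inner_sub_left, inner_zero_left, sub_mul, integral_zero]
    have m1 := hz.memLp_two hD ha.le hb hbT.le
    have m2 := hz₁.memLp_two hD ha.le hb hbT.le
    have q1 : ∀ {q : ℝ × E3 → ℝ}, InL53loc D T q → Integrable (fun p => q p * divergence Ψ p)
        (cyl D a b) := fun hq => by
      rw [cyl_eq]
      exact (hq.integrable_mul hΨT.divergence).restrict
    have n1 := hΨ.timeDeriv.memLp_cyl (D := D) (a := a) (b := b) 2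
    have n2 := hΨ.laplace.memLp_cyl (D := D) (a := a) (b := b) 2
    have n3 := hΨ.memLp_cyl (D := D) (a := a) (b := b) 2
    have c := cyl_le_spaceTime (D := D) ha.le hbT.le
    rw [integral_sub (integrable_inner_of_memLp m1 n1) (integrable_inner_of_memLp m2 n1),
      integral_sub (integrable_inner_of_memLp m1 n2) (integrable_inner_of_memLp m2 n2),
      integral_sub (q1 hz.pressure) (q1 hz₁.pressure),
      integral_sub (integrable_inner_of_memLp (hfa.memLp.mono_measure c) n3)
        (integrable_inner_of_memLp (hfb.memLp.mono_measure c) n3)]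
    -- The term with ∂ₜΨ tested against g is the same in both equations and cancels without being
    -- evaluated.
    linarith

/-- The linear equation without singular force is the case u = 0 of the balanced equation, so linear
and nonlinear solutions share one pairing theorem. -/
lemma IsStokesSolution.isBalanced (hD : IsSmoothBoundedDomain D) (ha : 0 ≤ a) (hb : 0 < b)
    (hbT : (b : EReal) ≤ T) (hk : MemLp k 2 (volume.restrict (spaceTime D T)))
    (hw : IsStokesSolution D T k 0 w₀ w q)
    (hW : ∀ S : ℝ, 0 < S → (S : EReal) ≤ T → InEnergyClass D S w W) :
    IsBalanced D a b w W k 0 0 q := by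
  refine IsBalanced.of_weak hD ha (hw.isFlow hW hb hbT) (hk.mono_measure (cyl_le_spaceTime ha hbT))
    IsFlow.zero fun Ψ hΨ => ?_
  have := hw.equation_cyl hD ha hbT hΨ
  simp only [Pi.zero_apply, inner_zero_left, integral_zero, sub_zero] at this ⊢
  exact this

end SuitableNS

/-! ### The energy estimate for the linear problem, up to infinite time -/

namespace SuitableNS

variable {D : Set E3} {a₀ a b : ℝ} {k w : ℝ × E3 → E3} {w₀ : E3 → E3} {q : ℝ × E3 → ℝ}
  {W : Fin 3 → ℝ × E3 → E3} {T : EReal}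

/-- The Poincaré inequality. -/
lemma exists_poincare (hD : IsSmoothBoundedDomain D) : ∃ C : ℝ, 0 < C ∧ ∀ (v : E3 → E3)
    (G : Fin 3 → E3 → E3), IsH10 D v G →
      ∫ x in D, ‖v x‖ ^ 2 ≤ C * ∫ x in D, gradSq fun i => G i x := by
  obtain ⟨C, hC⟩ := exists_sobolev hD.bounded 2 (by norm_num)
  -- The 3 comes from squaring a sum of three norms, and the added 1 makes the constant positive so
  -- that its inverse can be used below.
  refine ⟨3 * (C : ℝ) ^ 2 + 1, by positivity, fun v G hv => ?_⟩
  have h1 := (hC v G hv).1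
  have hfin : ∀ i, eLpNorm (G i) 2 (volume.restrict D) ≠ ⊤ := fun i => (hv.memLp_grad i).2.ne
  have h2 : (eLpNorm v 2 (volume.restrict D)).toReal ≤
      C * ∑ i, (eLpNorm (G i) 2 (volume.restrict D)).toReal := by
    have := ENNReal.toReal_mono (ENNReal.mul_ne_top (by simp) (ENNReal.sum_ne_top.2 fun i _ => hfin i)) h1
    rwa [ENNReal.toReal_mul, ENNReal.toReal_sum fun i _ => hfin i] at this
  have h3 : ∫ x in D, gradSq (fun i => G i x) = ∑ i, (eLpNorm (G i) 2 (volume.restrict D)).toReal ^ 2 := by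
    simp only [gradSq]
    rw [integral_finsetSum _ fun i _ => (memLp_two_iff_integrable_sq_norm (hv.memLp_grad i).1).1
      (hv.memLp_grad i)]
    exact Finset.sum_congr rfl fun i _ => integral_norm_sq_eq (hv.memLp_grad i)
  rw [integral_norm_sq_eq hv.memLp, h3]
  set s := fun i => (eLpNorm (G i) 2 (volume.restrict D)).toReal
  have h4 : (∑ i, s i) ^ 2 ≤ 3 * ∑ i, s i ^ 2 := by
    simpa using sq_sum_le_card_mul_sum_sq (s := Finset.univ) (f := s)
  have h5 : 0 ≤ ∑ i, s i ^ 2 := Finset.sum_nonneg fun i _ => sq_nonneg _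
  calc (eLpNorm v 2 (volume.restrict D)).toReal ^ 2 ≤ (C * ∑ i, s i) ^ 2 := by gcongr
    _ = C ^ 2 * (∑ i, s i) ^ 2 := by ring
    _ ≤ C ^ 2 * (3 * ∑ i, s i ^ 2) := by gcongr
    _ ≤ _ := by nlinarith

lemma gradSq_nonneg (G : Fin 3 → E3) : 0 ≤ gradSq G := Finset.sum_nonneg fun _ _ => by positivity

lemma integrable_gradSq {α : Type*} {m : MeasurableSpace α} {μ : Measure α} {G : Fin 3 → α → E3}
    (hG : ∀ i, MemLp (G i) 2 μ) : Integrable (fun x => gradSq fun i => G i x) μ :=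
  integrable_finsetSum _ fun i _ => (memLp_two_iff_integrable_sq_norm (hG i).1).1 (hG i)

/-- The energy estimate for the linear problem. -/
lemma exists_energy_le (hD : IsSmoothBoundedDomain D) : ∃ C : ℝ, 0 < C ∧
    ∀ (a₀ a b : ℝ) (w k : ℝ × E3 → E3) (W : Fin 3 → ℝ × E3 → E3) (q : ℝ × E3 → ℝ) (K : ℝ≥0),
      0 ≤ a₀ → a₀ < a → a < b → IsBalanced D a₀ b w W k 0 0 q →
      (∀ᵐ t ∂volume.restrict (Ioo a₀ b), eLpNorm (fun x => w (t, x)) 4 (volume.restrict D) ≤ K) →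
      (∫ x in D, ‖w (b, x)‖ ^ 2) + (∫ p, gradSq (fun i => W i p) ∂cyl D a b) ≤
        (∫ x in D, ‖w (a, x)‖ ^ 2) + C * ∫ p, ‖k p‖ ^ 2 ∂cyl D a b := by
  obtain ⟨C, hC, hP⟩ := exists_poincare hD
  refine ⟨C, hC, fun a₀ a b w k W q K h₀ ha hab hw hK => ?_⟩
  have hfin := hD.isFiniteMeasure
  have hone : ∀ y p, spaceDeriv (fun _ : ℝ × E3 => (1 : ℝ)) y p = 0 := fun y p => by simp [spaceDeriv]
  -- The solution is paired with itself with weight 1. The gradient of the weight vanishes, so the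
  -- pressure may be replaced by zero.
  obtain ⟨-, h1⟩ := hw.pairing hD h₀ ha hab hw hK (φ := fun _ => 1) contDiff_const
    (π' := 0) (q' := 0) MemLp.zero MemLp.zero (by simp [hone]) (by simp [hone])
  have hle := cyl_mono (D := D) (b := b) (h₀.trans ha.le) le_rfl
  have hW : ∀ i, MemLp (W i) 2 (cyl D a b) := fun i => (hw.flow.memLp_grad i).mono_measure hle
  have mw : MemLp w 2 (cyl D a b) :=
    (hw.flow.memLp_of_le_three hD (by norm_num)).mono_measure hle
  have mk : MemLp k 2 (cyl D a b) := hw.memLp_force.mono_measure (cyl_mono ha.le le_rfl)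
  have iw := (memLp_two_iff_integrable_sq_norm mw.1).1 mw
  have ik := (memLp_two_iff_integrable_sq_norm mk.1).1 mk
  have iW := integrable_gradSq hW
  have ikw := integrable_inner_of_memLp (p := 2) (q := 2) mk mw
  have h2 : (∫ x in D, ‖w (b, x)‖ ^ 2) - (∫ x in D, ‖w (a, x)‖ ^ 2) =
      -(2 * ∫ p, gradSq (fun i => W i p) ∂cyl D a b) + 2 * ∫ p, inner ℝ (k p) (w p) ∂cyl D a b := by
    simp only [one_mul, real_inner_self_eq_norm_sq] at h1
    rw [h1, ← integral_const_mul, ← integral_const_mul, ← integral_neg]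
    refine Eq.trans ?_ (integral_add (iW.const_mul 2).neg (ikw.const_mul 2))
    refine integral_congr_ae (ae_of_all _ fun p => ?_)
    simp only [pairingDensity, hone, gradSq, real_inner_self_eq_norm_sq, Pi.zero_apply,
      advect_zero _ _ rfl, inner_zero_left, real_inner_comm (w p) (k p), timeDeriv]
    simp
    ring
  have h3 : ∫ p, ‖w p‖ ^ 2 ∂cyl D a b ≤ C * ∫ p, gradSq (fun i => W i p) ∂cyl D a b := by
    rw [integral_prod (f := fun p => ‖w p‖ ^ 2) iw,
      integral_prod (f := fun p => gradSq fun i => W i p) iW, ← integral_const_mul]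
    refine integral_mono_ae iw.integral_prod_left (iW.integral_prod_left.const_mul C) ?_
    filter_upwards [ae_restrict_of_ae_restrict_of_subset
      (Ioo_subset_Ioo_left (h₀.trans ha.le)) hw.flow.h10] with t ht using hP _ _ ht
  -- Young's inequality is weighted by the Poincaré constant, so that the term in w costs exactly
  -- one of the two copies of the dissipation.
  have h4 : 2 * ∫ p, inner ℝ (k p) (w p) ∂cyl D a b ≤
      C⁻¹ * (∫ p, ‖w p‖ ^ 2 ∂cyl D a b) + C * ∫ p, ‖k p‖ ^ 2 ∂cyl D a b := by
    rw [← integral_const_mul, ← integral_const_mul, ← integral_const_mul,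
      ← integral_add (iw.const_mul _) (ik.const_mul _)]
    refine integral_mono (ikw.const_mul 2) ((iw.const_mul _).add (ik.const_mul _)) fun p => ?_
    have e1 := real_inner_le_norm (k p) (w p)
    have e2 : C⁻¹ * ‖w p‖ ^ 2 + C * ‖k p‖ ^ 2 - 2 * (‖k p‖ * ‖w p‖) =
        C⁻¹ * (‖w p‖ - C * ‖k p‖) ^ 2 := by
      field_simp
      ring
    have e3 : 0 ≤ C⁻¹ * (‖w p‖ - C * ‖k p‖) ^ 2 := by positivity
    simp only
    linarith
  have h5 : C⁻¹ * (∫ p, ‖w p‖ ^ 2 ∂cyl D a b) ≤ ∫ p, gradSq (fun i => W i p) ∂cyl D a b := by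
    rw [inv_mul_le_iff₀ hC]
    exact h3
  linarith

/-- A solution of the linear problem without a singular force lies in the energy space up to `T`. -/
lemma IsStokesSolution.inEnergyClass_top (hD : IsSmoothBoundedDomain D)
    (hk : MemLp k 2 (volume.restrict (spaceTime D ⊤))) (hw : IsStokesSolution D ⊤ k 0 w₀ w q)
    (hW : ∀ S : ℝ, 0 < S → (S : EReal) ≤ ⊤ → InEnergyClass D S w W) : InEnergyClass D ⊤ w W := by
  obtain ⟨C, hC, hE⟩ := exists_energy_le hD
  have hO : openTimes ⊤ = ⋃ n : ℕ, Ioo (0 : ℝ) (n + 1) := by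
    ext t
    simp only [openTimes, mem_ofPred_eq, mem_iUnion, mem_Ioo]
    refine ⟨fun h => ?_, fun ⟨n, h⟩ => ⟨h.1, EReal.coe_lt_top _⟩⟩
    obtain ⟨n, hn⟩ := exists_nat_gt t
    exact ⟨n, h.1, by linarith⟩
  have hS : spaceTime D ⊤ = ⋃ n : ℕ, Ioo (0 : ℝ) (n + 1) ×ˢ D := by
    rw [spaceTime, hO, iUnion_prod_const]
  have hWn : ∀ n : ℕ, InEnergyClass D ((n + 1 : ℝ) : EReal) w W := fun n =>
    hW (n + 1) (by positivity) le_top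
  obtain ⟨B, hB⟩ := (hw.isFlow hW one_pos le_top).bound
  have hsq : ∀ t, 0 ≤ t → ∫ x in D, ‖w (t, x)‖ ^ 2 =
      (eLpNorm (fun x => w (t, x)) 2 (volume.restrict D)).toReal ^ 2 := fun t ht =>
    integral_norm_sq_eq (hw.weakCont.memH t ⟨ht, le_top⟩).memLp
  have ik := (memLp_two_iff_integrable_sq_norm hk.1).1 hk
  -- Starting at a time a ≤ 1, where the L² norm is at most B, the right-hand side depends neither
  -- on a nor on b. The choice a = 1 bounds the norm at later times, and the limit a → 0, b → ∞
  -- makes the gradient square integrable up to infinity.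
  have key : ∀ a b : ℝ, 0 < a → a ≤ 1 → a < b →
      (∫ x in D, ‖w (b, x)‖ ^ 2) + (∫ p, gradSq (fun i => W i p) ∂cyl D a b) ≤
        (B : ℝ) ^ 2 + C * ∫ p in spaceTime D ⊤, ‖k p‖ ^ 2 := by
    intro a b ha ha1 hab
    have hb := ha.trans hab
    obtain ⟨K, hK⟩ := hw.exists_bound (a := a / 2) (by positivity) hb le_top
    refine (hE (a / 2) a b w k W q K (by positivity) (by linarith) hab
      (hw.isBalanced hD (by positivity) hb le_top hk hW) hK).trans ?_
    have e1 : ∫ x in D, ‖w (a, x)‖ ^ 2 ≤ (B : ℝ) ^ 2 := by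
      rw [hsq a ha.le]
      gcongr
      exact ENNReal.toReal_le_coe_of_le_coe (hB a ⟨ha.le, ha1⟩)
    have e2 : ∫ p, ‖k p‖ ^ 2 ∂cyl D a b ≤ ∫ p in spaceTime D ⊤, ‖k p‖ ^ 2 :=
      integral_mono_measure (cyl_le_spaceTime ha.le le_top) (ae_of_all _ fun p => by positivity) ik
    gcongr
  set M := (B : ℝ) ^ 2 + C * ∫ p in spaceTime D ⊤, ‖k p‖ ^ 2 with hM
  have hmeas : ∀ {f : ℝ × E3 → E3}, (∀ n : ℕ, AEStronglyMeasurable f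
      (volume.restrict (spaceTime D ((n + 1 : ℝ) : EReal)))) →
      AEStronglyMeasurable f (volume.restrict (spaceTime D ⊤)) := by
    intro f hf
    rw [hS, aestronglyMeasurable_iUnion_iff]
    intro n
    simpa only [spaceTime_coe] using hf n
  have hWm : ∀ i, AEStronglyMeasurable (W i) (volume.restrict (spaceTime D ⊤)) := fun i =>
    hmeas fun n => ((hWn n).grad_memLp i).1
  refine ⟨hmeas fun n => (hWn n).meas, ⟨B + Real.toNNReal (√M), ?_⟩, ?_, ?_⟩
  · filter_upwards [ae_restrict_mem (isOpen_openTimes ⊤).measurableSet] with t ht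
    have ht0 : 0 < t := ht.1
    refine ⟨hw.weakCont.memH t ⟨ht0.le, le_top⟩, ?_⟩
    rw [ENNReal.coe_add]
    rcases le_or_gt t 1 with h1 | h1
    · exact (hB t ⟨ht0.le, h1⟩).trans le_self_add
    · refine le_trans ?_ le_add_self
      have e := key 1 t one_pos le_rfl h1
      have e2 : 0 ≤ ∫ p, gradSq (fun i => W i p) ∂cyl D 1 t := integral_nonneg fun p => gradSq_nonneg _
      rw [hsq t ht0.le] at e
      have e3 : (eLpNorm (fun x => w (t, x)) 2 (volume.restrict D)).toReal ≤ √M :=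
        Real.le_sqrt_of_sq_le (by linarith)
      exact (ENNReal.le_ofReal_iff_toReal_le (hw.weakCont.memH t ⟨ht0.le, le_top⟩).memLp.2.ne
        (Real.sqrt_nonneg _)).2 e3
  · have hcov : AECover (volume.restrict (spaceTime D ⊤)) atTop
        (fun n : ℕ => Ioo (1 / ((n : ℝ) + 2)) ((n : ℝ) + 2) ×ˢ D) := by
      have hlim : Tendsto (fun n : ℕ => (n : ℝ) + 2) atTop atTop :=
        tendsto_atTop_add_const_right _ _ tendsto_natCast_atTop_atTop
      refine ⟨?_, fun n => measurableSet_Ioo.prod hD.isOpen.measurableSet⟩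
      filter_upwards [ae_restrict_mem (isOpen_spaceTime hD ⊤).measurableSet] with p hp
      have h0 : 0 < p.1 := hp.1.1
      filter_upwards [hlim.eventually_gt_atTop p.1, hlim.eventually_gt_atTop (1 / p.1)] with n h1 h2
      refine ⟨⟨?_, h1⟩, hp.2⟩
      rw [one_div_lt (by positivity) h0]
      exact h2
    have hres : ∀ n : ℕ, (volume.restrict (spaceTime D ⊤)).restrict
        (Ioo (1 / ((n : ℝ) + 2)) ((n : ℝ) + 2) ×ˢ D) = cyl D (1 / ((n : ℝ) + 2)) ((n : ℝ) + 2) := by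
      intro n
      rw [cyl_eq, Measure.restrict_restrict (measurableSet_Ioo.prod hD.isOpen.measurableSet),
        inter_eq_left.2 (Ioo_prod_subset_spaceTime (by positivity) le_top)]
    have hint : Integrable (fun p => gradSq fun i => W i p) (volume.restrict (spaceTime D ⊤)) := by
      refine hcov.integrable_of_integral_bounded_of_nonneg_ae M (fun n => ?_)
        (ae_of_all _ fun p => gradSq_nonneg _) (Eventually.of_forall fun n => ?_)
      · rw [IntegrableOn, hres]
        exact integrable_gradSq fun i => ((hw.isFlow hW (b := n + 2) (by positivity) le_top).memLp_grad
          i).mono_measure (cyl_mono (by positivity) le_rfl)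
      · rw [hres]
        have h2 : (1 : ℝ) / (n + 2) < 1 := by
          rw [div_lt_one (by positivity)]
          have : (0 : ℝ) ≤ n := n.cast_nonneg
          linarith
        have h3 : (1 : ℝ) < n + 2 := by
          have : (0 : ℝ) ≤ n := n.cast_nonneg
          linarith
        have e := key _ _ (by positivity) h2.le (h2.trans h3)
        have e2 : 0 ≤ ∫ x in D, ‖w ((n : ℝ) + 2, x)‖ ^ 2 := integral_nonneg fun x => by positivity
        linarith
    intro i
    refine (memLp_two_iff_integrable_sq_norm (hWm i)).2 (hint.mono' ((hWm i).norm.pow 2)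
      (ae_of_all _ fun p => ?_))
    rw [Real.norm_of_nonneg (by positivity)]
    exact Finset.single_le_sum (f := fun i => ‖W i p‖ ^ 2) (fun _ _ => by positivity)
      (Finset.mem_univ i)
  · rw [hO, ae_restrict_iUnion_iff]
    intro n
    simpa only [openTimes_coe] using (hWn n).memV

lemma IsStokesSolution.inEnergyClass (hD : IsSmoothBoundedDomain D) (hT : 0 < T)
    (hk : MemLp k 2 (volume.restrict (spaceTime D T))) (hw : IsStokesSolution D T k 0 w₀ w q)
    (hW : ∀ S : ℝ, 0 < S → (S : EReal) ≤ T → InEnergyClass D S w W) : InEnergyClass D T w W := by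
  induction T with
  | bot => exact absurd hT (by simp)
  | coe S => exact hW S (by exact_mod_cast hT) le_rfl
  | top => exact hw.inEnergyClass_top hD hk hW

end SuitableNS

/-! ### Changing the linear solution in weak solutions and in energy inequalities -/

namespace SuitableNS

variable {D : Set E3} {a b : ℝ} {T : EReal} {f fa fb g h k z z₁ v w : ℝ × E3 → E3}
  {u₀ v₀ w₀ za zb : E3 → E3} {Q Q₁ q π π' φ : ℝ × E3 → ℝ} {G Z W : Fin 3 → ℝ × E3 → E3}

lemma IsModifiedWeakSolution.equation_cyl (hD : IsSmoothBoundedDomain D) (ha : 0 ≤ a)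
    (hbT : (b : EReal) ≤ T) (hv : IsModifiedWeakSolution D T h v₀ z v G π) {Ψ : ℝ × E3 → E3}
    (hΨ : IsTestFunction (Ioo a b ×ˢ D) Ψ) :
    -(∫ p, inner ℝ (v p) (timeDeriv Ψ p) ∂cyl D a b)
        - (∫ p, inner ℝ (v p + z p) (spaceDeriv Ψ (v p + z p) p) ∂cyl D a b)
        - ∫ p, π p * divergence Ψ p ∂cyl D a b
      = (∫ p, inner ℝ (v p) (laplace Ψ p) ∂cyl D a b) + ∫ p, inner ℝ (h p) (Ψ p) ∂cyl D a b := by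
  have := hv.equation Ψ (hΨ.mono (Ioo_prod_subset_spaceTime ha hbT))
  rwa [integral_spaceTime_eq hD ha hbT fun p hp => by simp [hΨ.timeDeriv.eq_zero hp],
    integral_spaceTime_eq hD ha hbT fun p hp => by simp [(hΨ.spaceDeriv _).eq_zero hp],
    integral_spaceTime_eq hD ha hbT fun p hp => by simp [hΨ.divergence.eq_zero hp],
    integral_spaceTime_eq hD ha hbT fun p hp => by simp [hΨ.laplace.eq_zero hp],
    integral_spaceTime_eq hD ha hbT fun p hp => by simp [hΨ.eq_zero hp]] at this

lemma IsModifiedWeakSolution.isBalanced (hD : IsSmoothBoundedDomain D) (ha : 0 ≤ a) (hb : 0 < b)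
    (hbT : (b : EReal) ≤ T) (hh : MemLp h 2 (volume.restrict (spaceTime D T)))
    (hz : IsFlow D b z Z) (hv : IsModifiedWeakSolution D T h v₀ z v G π) :
    IsBalanced D a b v G h (fun p => v p + z p) (fun i p => G i p + Z i p) π :=
  have hf := (hv.energy.mono hbT).isFlow hb hbT hv.weakCont
  IsBalanced.of_weak hD ha hf (hh.mono_measure (cyl_le_spaceTime ha hbT)) (hf.add hz)
    fun _ hΨ => hv.equation_cyl hD ha hbT hΨ

/-- Changing the solution of the linear problem turns modified weak solutions into such. -/
lemma IsModifiedWeakSolution.change (hD : IsSmoothBoundedDomain D) (hT : 0 < T)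
    (hh : MemLp h 2 (volume.restrict (spaceTime D T)))
    (hk : MemLp k 2 (volume.restrict (spaceTime D T)))
    (hw : IsStokesSolution D T k 0 w₀ w q)
    (hW : ∀ S : ℝ, 0 < S → (S : EReal) ≤ T → InEnergyClass D S w W)
    (hv : IsModifiedWeakSolution D T h v₀ z v G π) :
    IsModifiedWeakSolution D T (h + k) (v₀ + w₀) (z - w) (v + w) (G + W) (π + q) := by
  refine ⟨hv.weakCont.add hw.weakCont, ?_, hv.energy.add (hw.inEnergyClass hD hT hk hW),
    hv.pressure.add hw.pressure, fun Ψ hΨT => ?_⟩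
  · filter_upwards [hv.initial, hw.initial] with x h1 h2
    simp [h1, h2]
  · obtain ⟨a, b, ha, hab, hbT, hΨ⟩ := hΨT.exists_Ioo_prod hT
    have hb := ha.trans hab
    have e1 := hv.equation_cyl hD ha.le hbT.le hΨ
    have e2 := hw.equation_cyl hD ha.le hbT.le hΨ
    have eu : ∀ p, (v + w) p + (z - w) p = v p + z p := fun p => by
      simp only [Pi.add_apply, Pi.sub_apply]
      abel
    simp only [eu]
    rw [integral_spaceTime_eq hD ha.le hbT.le fun p hp => by simp [hΨ.timeDeriv.eq_zero hp],
      integral_spaceTime_eq hD ha.le hbT.le fun p hp => by simp [(hΨ.spaceDeriv _).eq_zero hp],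
      integral_spaceTime_eq hD ha.le hbT.le fun p hp => by simp [hΨ.divergence.eq_zero hp],
      integral_spaceTime_eq hD ha.le hbT.le fun p hp => by simp [hΨ.laplace.eq_zero hp],
      integral_spaceTime_eq hD ha.le hbT.le fun p hp => by simp [hΨ.eq_zero hp]]
    simp only [Pi.zero_apply, inner_zero_left, integral_zero] at e2
    -- The nonlinear term contains only u and is common to both equations. Hiding it keeps the
    -- additive expansion from touching it.
    generalize ∫ p, inner ℝ (v p + z p) (spaceDeriv Ψ (v p + z p) p) ∂cyl D a b = I at e1 ⊢
    simp only [Pi.add_apply, inner_add_left, add_mul]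
    have m1 : MemLp v 2 (cyl D a b) :=
      (((hv.energy.mono hbT.le).isFlow hb hbT.le hv.weakCont).memLp_of_le_three hD
        (by norm_num)).mono_measure (cyl_mono ha.le le_rfl)
    have m2 := hw.memLp_two hD ha.le hb hbT.le
    have q1 : ∀ {q : ℝ × E3 → ℝ}, InL53loc D T q → Integrable (fun p => q p * divergence Ψ p)
        (cyl D a b) := fun hq => by
      rw [cyl_eq]
      exact (hq.integrable_mul hΨT.divergence).restrict
    have n1 := hΨ.timeDeriv.memLp_cyl (D := D) (a := a) (b := b) 2
    have n2 := hΨ.laplace.memLp_cyl (D := D) (a := a) (b := b) 2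
    have n3 := hΨ.memLp_cyl (D := D) (a := a) (b := b) 2
    have c := cyl_le_spaceTime (D := D) ha.le hbT.le
    rw [integral_add (integrable_inner_of_memLp m1 n1) (integrable_inner_of_memLp m2 n1),
      integral_add (integrable_inner_of_memLp m1 n2) (integrable_inner_of_memLp m2 n2),
      integral_add (q1 hv.pressure) (q1 hw.pressure),
      integral_add (integrable_inner_of_memLp (hh.mono_measure c) n3)
        (integrable_inner_of_memLp (hk.mono_measure c) n3)]
    linarith

lemma EnergyData.integral_density_one (hD : IsSmoothBoundedDomain D)
    (e : EnergyData D a b v G h z π) : ∫ p, localDensity v G h z π (fun _ => 1) p ∂cyl D a b =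
      2 * (∫ p, gradSq (fun i => G i p) ∂cyl D a b)
      - 2 * (∫ p, inner ℝ (z p) (advect (v p + z p) fun i => G i p) ∂cyl D a b)
      - 2 * ∫ p, inner ℝ (h p) (v p) ∂cyl D a b := by
  have h1 : ∀ y p, spaceDeriv (fun _ : ℝ × E3 => (1 : ℝ)) y p = 0 := fun y p => by simp [spaceDeriv]
  have h2 : ∀ p, timeDeriv (fun _ : ℝ × E3 => (1 : ℝ)) p = 0 := fun p => by simp [timeDeriv]
  have h3 : ∀ p, laplace (fun _ : ℝ × E3 => (1 : ℝ)) p = 0 := fun p => by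
    refine Finset.sum_eq_zero fun i _ => ?_
    have : spaceDeriv (fun _ : ℝ × E3 => (1 : ℝ)) (basisVec i) = fun _ => 0 := funext fun p => h1 _ p
    rw [this]
    simp [spaceDeriv]
  rw [e.integral_density hD contDiff_const]
  simp only [h1, h2, h3, mul_one, one_mul, mul_zero, add_zero, integral_zero, sub_zero]

/-- The local energy inequality in terms of the density. -/
lemma EnergyData.localEnergy_iff (hD : IsSmoothBoundedDomain D) (ha : 0 ≤ a) (hbT : (b : EReal) ≤ T)
    (hφ : IsTestFunction (Ioo a b ×ˢ D) φ) (e : EnergyData D a b v G h z π')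
    (hππ' : ∀ p y, π p * spaceDeriv φ y p = π' p * spaceDeriv φ y p) :
    2 * (∫ p in spaceTime D T, gradSq (fun i => G i p) * φ p)
      ≤ (∫ p in spaceTime D T, ‖v p‖ ^ 2 * (timeDeriv φ p + laplace φ p))
        + 2 * (∫ p in spaceTime D T, π p * spaceDeriv φ (v p) p)
        + (∫ p in spaceTime D T,
            (‖v p‖ ^ 2 + 2 * inner ℝ (v p) (z p)) * spaceDeriv φ (v p + z p) p)
        + 2 * (∫ p in spaceTime D T,
            φ p * inner ℝ (z p) (advect (v p + z p) (fun i => G i p)))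
        + 2 * (∫ p in spaceTime D T, φ p * inner ℝ (h p) (v p)) ↔
      ∫ p, localDensity v G h z π' φ p ∂cyl D a b ≤ 0 := by
  simp only [hππ']
  rw [e.integral_density hD hφ.smooth,
    integral_spaceTime_eq hD ha hbT fun p hp => by simp [hφ.eq_zero hp],
    integral_spaceTime_eq hD ha hbT fun p hp => by simp [hφ.timeDeriv.eq_zero hp, hφ.laplace.eq_zero hp],
    integral_spaceTime_eq hD ha hbT fun p hp => by simp [(hφ.spaceDeriv _).eq_zero hp],
    integral_spaceTime_eq hD ha hbT fun p hp => by simp [(hφ.spaceDeriv _).eq_zero hp],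
    integral_spaceTime_eq hD ha hbT fun p hp => by simp [hφ.eq_zero hp],
    integral_spaceTime_eq hD ha hbT fun p hp => by simp [hφ.eq_zero hp]]
  constructor <;> intro h <;> linarith

section Change

variable (hD : IsSmoothBoundedDomain D) (hh : MemLp h 2 (volume.restrict (spaceTime D T)))
    (hk : MemLp k 2 (volume.restrict (spaceTime D T)))
    (hz : IsStokesSolution D T f g za z Q) (hw : IsStokesSolution D T k 0 w₀ w q)
    (hW : ∀ S : ℝ, 0 < S → (S : EReal) ≤ T → InEnergyClass D S w W)
    (hv : IsModifiedWeakSolution D T h v₀ z v G π)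
include hD hh hk hz hw hW hv

/-- The equality of energy balances with weight 1 between s and t. The pairing needs some room
before the initial time, which is why the equations are considered from s/2 on. -/
lemma EnergyInequality.change (hE : EnergyInequality D T h z v G) :
    EnergyInequality D T (h + k) (z - w) (v + w) (G + W) := by
  intro t ht
  filter_upwards [hE t ht, ae_restrict_mem measurableSet_Ioo] with s hs hst
  have hs0 : 0 < s := hst.1
  have ht0 := hs0.trans hst.2
  have h₀ : 0 ≤ s / 2 := by positivity
  have hss : s / 2 < s := by linarith
  obtain ⟨Z, hZ⟩ := hz.energy
  have fz := hz.isFlow hZ ht0 ht.2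
  obtain ⟨K, hK⟩ := hz.exists_bound h₀ ht0 ht.2
  obtain ⟨K', hK'⟩ := hw.exists_bound h₀ ht0 ht.2
  have bv := hv.isBalanced hD h₀ ht0 ht.2 hh fz
  have bw := hw.isBalanced hD h₀ ht0 ht.2 hk hW
  have hone : ∀ y p, spaceDeriv (fun _ : ℝ × E3 => (1 : ℝ)) y p = 0 := fun y p => by simp [spaceDeriv]
  have e := bv.energyData hD h₀ hss.le fz hK (π' := 0) MemLp.zero
  have e' := bw.energyData hD h₀ hss.le bw.flow hK' (π' := 0) MemLp.zero
  -- A weight with zero gradient does not see the pressures, so zero replaces them and no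
  -- integrability up to the boundary of D is needed.
  have key := bv.energy_change hD h₀ hss hst.2 fz bw hK hK' (φ := fun _ => 1) contDiff_const
    (π' := 0) (q' := 0) MemLp.zero MemLp.zero (by simp [hone]) (by simp [hone])
  rw [e.integral_density_one hD, (e.change e').integral_density_one hD] at key
  simp only [one_mul] at key
  simp only [← cyl_eq] at hs ⊢
  simp only [Pi.add_apply, Pi.sub_apply]
  linarith

/-- The test function vanishes at the ends of a time interval containing its support, so the
equality of energy balances reduces to equality of the integrated densities. Starting from a/2 > 0
leaves room for the shift and stays where the cut-off pressures are integrable. -/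
lemma LocalEnergyInequality.change (hT : 0 < T) (hE : LocalEnergyInequality D T h z v G π) :
    LocalEnergyInequality D T (h + k) (z - w) (v + w) (G + W) (π + q) := by
  intro φ hφT hφ0
  obtain ⟨a, b, ha, hab, hbT, hφ⟩ := hφT.exists_Ioo_prod hT
  have hb := ha.trans hab
  have h₀ : 0 < a / 2 := by positivity
  have haa : a / 2 < a := by linarith
  obtain ⟨Z, hZ⟩ := hz.energy
  have fz := hz.isFlow hZ hb hbT.le
  obtain ⟨K, hK⟩ := hz.exists_bound h₀.le hb hbT.le
  obtain ⟨K', hK'⟩ := hw.exists_bound h₀.le hb hbT.le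
  obtain ⟨π', hπ', hππ'⟩ := hv.pressure.exists_cutoff hφT h₀ hbT
  obtain ⟨q', hq', hqq'⟩ := hw.pressure.exists_cutoff hφT h₀ hbT
  have bv := hv.isBalanced hD h₀.le hb hbT.le hh fz
  have bw := hw.isBalanced hD h₀.le hb hbT.le hk hW
  have e := bv.energyData hD h₀.le haa.le fz hK hπ'
  have e' := bw.energyData hD h₀.le haa.le bw.flow hK' hq'
  have key := bv.energy_change hD h₀.le haa hab fz bw hK hK' hφ.smooth hπ' hq' hππ' hqq'
  have hφb : ∀ x, φ (b, x) = 0 := fun x => hφ.eq_zero fun h => lt_irrefl b h.1.2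
  have hφa : ∀ x, φ (a, x) = 0 := fun x => hφ.eq_zero fun h => lt_irrefl a h.1.1
  simp only [hφa, hφb, zero_mul, integral_zero, sub_zero, add_zero] at key
  have h1 := (e.localEnergy_iff hD ha.le hbT.le hφ fun p y => hππ' p.1 p.1 p.2 y).1 (hE φ hφT hφ0)
  rw [← key] at h1
  refine ((e.change e').localEnergy_iff (π := π + q) hD ha.le hbT.le hφ fun p y => ?_).2 h1
  rw [Pi.add_apply, add_mul, add_mul, hππ' p.1 p.1 p.2 y, hqq' p.1 p.1 p.2 y]

end Change

/-- The velocity of a weak solution can be rewritten relative to any other solution of the linear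
problem, with both energy inequalities preserved. -/
theorem exists_change (hD : IsSmoothBoundedDomain D) (hT : 0 < T) (hf : InL2H D T f)
    (hfa : InL2H D T fa) (hfb : InL2H D T fb) (hz : IsStokesSolution D T fa g za z Q)
    (hz₁ : IsStokesSolution D T fb g zb z₁ Q₁) :
    ∃ W : Fin 3 → ℝ × E3 → E3, ∀ (u : ℝ × E3 → E3) (P : ℝ × E3 → ℝ) (G : Fin 3 → ℝ × E3 → E3),
      IsModifiedWeakSolution D T (f - fa) (u₀ - za) z (u - z) G (P - Q) →
      IsModifiedWeakSolution D T (f - fb) (u₀ - zb) z₁ (u - z₁) (G + W) (P - Q₁) ∧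
      (EnergyInequality D T (f - fa) z (u - z) G →
        EnergyInequality D T (f - fb) z₁ (u - z₁) (G + W)) ∧
      (LocalEnergyInequality D T (f - fa) z (u - z) G (P - Q) →
        LocalEnergyInequality D T (f - fb) z₁ (u - z₁) (G + W) (P - Q₁)) := by
  have hw := hz.sub hD hT hfa hfb hz₁
  obtain ⟨W, hW⟩ := hw.energy
  have hh := hf.memLp.sub hfa.memLp
  have hk := hfa.memLp.sub hfb.memLp
  refine ⟨W, fun u P G hv => ?_⟩
  have e1 : f - fb = (f - fa) + (fa - fb) := by abel
  have e2 : u₀ - zb = (u₀ - za) + (za - zb) := by abel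
  have e3 : u - z₁ = (u - z) + (z - z₁) := by abel
  have e4 : P - Q₁ = (P - Q) + (Q - Q₁) := by abel
  have e5 : z₁ = z - (z - z₁) := by abel
  rw [e1, e2, e3, e4]
  have h1 := hv.change hD hT hh hk hw hW
  have h2 := fun hE => EnergyInequality.change hD hh hk hz hw hW hv hE
  have h3 := fun hE => LocalEnergyInequality.change hD hh hk hz hw hW hv hT hE
  rw [← e5] at h1 h2 h3
  exact ⟨h1, h2, h3⟩

theorem IsSuitable.change (hD : IsSmoothBoundedDomain D) (hT : 0 < T) (hf : InL2H D T f)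
    (hfa : InL2H D T fa) (hfb : InL2H D T fb) (hz : IsStokesSolution D T fa g za z Q)
    (hz₁ : IsStokesSolution D T fb g zb z₁ Q₁) {u : ℝ × E3 → E3} {P : ℝ × E3 → ℝ}
    (h : IsSuitable D T (f - fa) (u₀ - za) z Q u P) :
    IsSuitable D T (f - fb) (u₀ - zb) z₁ Q₁ u P := by
  obtain ⟨W, hW⟩ := exists_change (u₀ := u₀) hD hT hf hfa hfb hz hz₁
  obtain ⟨G, h1, h2, h3⟩ := h
  obtain ⟨k1, k2, k3⟩ := hW u P G h1
  exact ⟨G + W, k1, k2 h2, k3 h3⟩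

theorem IsLocallySuitable.change (hD : IsSmoothBoundedDomain D) (hT : 0 < T) (hf : InL2H D T f)
    (hfa : InL2H D T fa) (hfb : InL2H D T fb) (hz : IsStokesSolution D T fa g za z Q)
    (hz₁ : IsStokesSolution D T fb g zb z₁ Q₁) {u : ℝ × E3 → E3} {P : ℝ × E3 → ℝ}
    (h : IsLocallySuitable D T (f - fa) (u₀ - za) z Q u P) :
    IsLocallySuitable D T (f - fb) (u₀ - zb) z₁ Q₁ u P := by
  obtain ⟨W, hW⟩ := exists_change (u₀ := u₀) hD hT hf hfa hfb hz hz₁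
  obtain ⟨G, h1, h3⟩ := h
  obtain ⟨k1, -, k3⟩ := hW u P G h1
  exact ⟨G + W, k1, k3 h3⟩

/-! ### The trivial solution of the linear problem -/

lemma InEnergyClass.zero : InEnergyClass D T 0 0 :=
  ⟨aestronglyMeasurable_zero, ⟨0, ae_of_all _ fun t => ⟨memH_zero, by simp⟩⟩, fun _ => MemLp.zero,
    ae_of_all _ fun t => ⟨isH10_zero, ae_of_all _ fun x => by simp⟩⟩

lemma InL2H.zero : InL2H D T 0 := ⟨MemLp.zero, ae_of_all _ fun _ => memH_zero⟩

/-- This is the reference solution for the comparison with Caffarelli, Kohn and Nirenberg: relative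
to it v = u and π = P, and the whole force is carried by h. -/
lemma isStokesSolution_zero : IsStokesSolution D T 0 0 0 0 0 := by
  refine ⟨⟨fun t _ => memH_zero, fun ψ _ => by simpa using continuousOn_const⟩, ae_of_all _ fun _ => rfl,
    ⟨0, fun _ _ _ => InEnergyClass.zero⟩, fun _ _ _ => ⟨0, ae_of_all _ fun t => by simp⟩,
    fun _ _ _ => MemLp.zero, fun Ψ _ => by simp⟩

/-- With z = 0 the definitions agree term by term, except that the flux of |u|² + 2P stands under
one integral on one side and under two on the other. Splitting it requires integrability of both
parts, and this comes from the weak solution together with a cut-off pressure. -/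
lemma isModifiedWeakSolution_zero_iff (hD : IsSmoothBoundedDomain D) (hT : 0 < T) (hf : InL2H D T f)
    {u : ℝ × E3 → E3} {P : ℝ × E3 → ℝ} :
    IsModifiedWeakSolution D T f u₀ 0 u G P ∧ LocalEnergyInequality D T f 0 u G P ↔
      IsCKNSuitable D T f u₀ u G P := by
  have key : IsModifiedWeakSolution D T f u₀ 0 u G P → ∀ φ : ℝ × E3 → ℝ,
      IsTestFunction (spaceTime D T) φ →
      ∫ p in spaceTime D T, (‖u p‖ ^ 2 + 2 * P p) * spaceDeriv φ (u p) p =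
        (∫ p in spaceTime D T, ‖u p‖ ^ 2 * spaceDeriv φ (u p) p) +
          2 * ∫ p in spaceTime D T, P p * spaceDeriv φ (u p) p := by
    intro hv φ hφT
    obtain ⟨a, b, ha, hab, hbT, hφ⟩ := hφT.exists_Ioo_prod hT
    have hb := ha.trans hab
    obtain ⟨P', hP', hPP'⟩ := hv.pressure.exists_cutoff hφT ha hbT
    have e := (hv.isBalanced hD ha.le hb hbT.le hf.memLp IsFlow.zero).energyData hD ha.le le_rfl
      IsFlow.zero (K := 0) (ae_of_all _ fun t => by simp) hP'
    have i1 := e.integrable_cubic hD hφ.smooth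
    have i2 := (e.integrable_pressure hD hφ.smooth).const_mul 2
    simp only [Pi.zero_apply, inner_zero_right, mul_zero, add_zero] at i1
    have hPP : ∀ p y, P p * spaceDeriv φ y p = P' p * spaceDeriv φ y p :=
      fun p y => hPP' p.1 p.1 p.2 y
    simp only [add_mul, mul_assoc, hPP]
    rw [integral_spaceTime_eq hD ha.le hbT.le fun p hp => by simp [(hφ.spaceDeriv _).eq_zero hp],
      integral_spaceTime_eq hD ha.le hbT.le fun p hp => by simp [(hφ.spaceDeriv _).eq_zero hp],
      integral_spaceTime_eq hD ha.le hbT.le fun p hp => by simp [(hφ.spaceDeriv _).eq_zero hp],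
      integral_add i1 i2, integral_const_mul]
  have hcomm : ∀ φ : ℝ × E3 → ℝ, ∫ p in spaceTime D T, inner ℝ (u p) (f p) * φ p =
      ∫ p in spaceTime D T, φ p * inner ℝ (f p) (u p) := fun φ =>
    integral_congr_ae (ae_of_all _ fun p => by
      simp only
      rw [real_inner_comm, mul_comm])
  constructor
  · rintro ⟨hv, hE⟩
    refine ⟨hv.weakCont, hv.initial, hv.energy, hv.pressure, fun Ψ hΨ => ?_, fun φ hφ h0 => ?_⟩
    · simpa only [Pi.zero_apply, add_zero] using hv.equation Ψ hΨ
    · have := hE φ hφ h0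
      simp only [Pi.zero_apply, inner_zero_left, inner_zero_right, mul_zero, add_zero,
        integral_zero] at this
      rw [key hv φ hφ, hcomm]
      linarith
  · intro h
    have hv : IsModifiedWeakSolution D T f u₀ 0 u G P :=
      ⟨h.weakCont, h.initial, h.energy, h.pressure, fun Ψ hΨ => by
        simpa only [Pi.zero_apply, add_zero] using h.equation Ψ hΨ⟩
    refine ⟨hv, fun φ hφ h0 => ?_⟩
    have := h.localEnergy φ hφ h0
    rw [key hv φ hφ, hcomm] at this
    simp only [Pi.zero_apply, inner_zero_left, inner_zero_right, mul_zero, add_zero, integral_zero]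
    linarith

lemma energyInequality_zero_iff {u : ℝ × E3 → E3} :
    EnergyInequality D T f 0 u G ↔ LerayEnergyInequality D T f u G := by
  simp only [EnergyInequality, LerayEnergyInequality, Pi.zero_apply, inner_zero_left, integral_zero,
    mul_zero, add_zero]

lemma isSuitable_zero_iff (hD : IsSmoothBoundedDomain D) (hT : 0 < T) (hf : InL2H D T f)
    {u : ℝ × E3 → E3} {P : ℝ × E3 → ℝ} : IsSuitable D T f u₀ 0 0 u P ↔
      ∃ G, IsCKNSuitable D T f u₀ u G P ∧ LerayEnergyInequality D T f u G := by
  simp only [IsSuitable, sub_zero, ← isModifiedWeakSolution_zero_iff hD hT hf, energyInequality_zero_iff]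
  exact exists_congr fun G => by tauto

lemma isLocallySuitable_zero_iff (hD : IsSmoothBoundedDomain D) (hT : 0 < T) (hf : InL2H D T f)
    {u : ℝ × E3 → E3} {P : ℝ × E3 → ℝ} : IsLocallySuitable D T f u₀ 0 0 u P ↔
      ∃ G, IsCKNSuitable D T f u₀ u G P := by
  simp only [IsLocallySuitable, sub_zero, ← isModifiedWeakSolution_zero_iff hD hT hf]

end SuitableNS

theorem mainTheorem4 (D : Set E3) (hD : IsSmoothBoundedDomain D) (T : EReal) (hT : 0 < T)
    (f g : ℝ × E3 → E3) (hf : InL2H D T f)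
    (hg : LocallyIntegrableOn g (spaceTime D T)) (u₀ : E3 → E3) :
    -- two solutions of the linear problem with the full force `f + ∂_t g` and zero initial value
    (∀ (z z₁ : ℝ × E3 → E3) (Q Q₁ : ℝ × E3 → ℝ),
      IsStokesSolution D T f g 0 z Q → IsStokesSolution D T f g 0 z₁ Q₁ →
      ∀ (u : ℝ × E3 → E3) (P : ℝ × E3 → ℝ),
        IsSuitable D T 0 u₀ z Q u P ↔ IsSuitable D T 0 u₀ z₁ Q₁ u P) ∧
    -- two linear problems with different smooth forces and initial values
    (∀ (fa fb : ℝ × E3 → E3) (za zb : E3 → E3) (z z₁ : ℝ × E3 → E3) (Q Q₁ : ℝ × E3 → ℝ),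
      InL2H D T fa → InL2H D T fb →
      IsStokesSolution D T fa g za z Q → IsStokesSolution D T fb g zb z₁ Q₁ →
      ∀ (u : ℝ × E3 → E3) (P : ℝ × E3 → ℝ),
        IsSuitable D T (f - fa) (u₀ - za) z Q u P ↔
          IsSuitable D T (f - fb) (u₀ - zb) z₁ Q₁ u P) ∧
    -- the case `g = 0`: agreement with Caffarelli, Kohn and Nirenberg
    (∀ (z : ℝ × E3 → E3) (Q : ℝ × E3 → ℝ), IsStokesSolution D T f 0 0 z Q →
      ∀ (u : ℝ × E3 → E3) (P : ℝ × E3 → ℝ),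
        (IsSuitable D T 0 u₀ z Q u P ↔
          ∃ G, IsCKNSuitable D T f u₀ u G P ∧ LerayEnergyInequality D T f u G) ∧
        (IsLocallySuitable D T 0 u₀ z Q u P ↔ ∃ G, IsCKNSuitable D T f u₀ u G P)) := by
  have hb : ∀ (fa fb g : ℝ × E3 → E3) (za zb : E3 → E3) (z z₁ : ℝ × E3 → E3) (Q Q₁ : ℝ × E3 → ℝ),
      InL2H D T fa → InL2H D T fb →
      IsStokesSolution D T fa g za z Q → IsStokesSolution D T fb g zb z₁ Q₁ →
      ∀ (u : ℝ × E3 → E3) (P : ℝ × E3 → ℝ),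
        IsSuitable D T (f - fa) (u₀ - za) z Q u P ↔
          IsSuitable D T (f - fb) (u₀ - zb) z₁ Q₁ u P :=
    fun _ _ _ _ _ _ _ _ _ ha hb hz hz₁ _ _ =>
      ⟨fun h => h.change hD hT hf ha hb hz hz₁, fun h => h.change hD hT hf hb ha hz₁ hz⟩
  refine ⟨fun z z₁ Q Q₁ hz hz₁ u P => ?_, fun fa fb za zb z z₁ Q Q₁ => hb fa fb g za zb z z₁ Q Q₁,
    fun z Q hz u P => ⟨?_, ?_⟩⟩
  · simpa only [sub_self, sub_zero] using hb f f g 0 0 z z₁ Q Q₁ hf hf hz hz₁ u P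
  -- The solution with the full force f is compared with the zero solution, so h changes from 0 to
  -- f.
  · rw [← isSuitable_zero_iff hD hT hf]
    simpa only [sub_self, sub_zero] using
      hb f 0 0 0 0 z 0 Q 0 hf InL2H.zero hz isStokesSolution_zero u P
  · rw [← isLocallySuitable_zero_iff hD hT hf]
    have key : IsLocallySuitable D T (f - f) (u₀ - 0) z Q u P ↔
        IsLocallySuitable D T (f - 0) (u₀ - 0) 0 0 u P :=
      ⟨fun h => h.change hD hT hf hf InL2H.zero hz isStokesSolution_zero,
        fun h => h.change hD hT hf InL2H.zero hf isStokesSolution_zero hz⟩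
    simpa only [sub_self, sub_zero] using key
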